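/- **Setting.** All transfer matrices are $l\times l$ and real rational; $\mathbb{R}\mathcal{H}_\infty$ is the class of those that are proper and have no pole in $\mathrm{Re}\,s\ge 0$. A square $A\in\mathbb{R}\mathcal{H}_\infty$ is *minimum phase* (outer) if $\det A(s)\neq0$ for $\mathrm{Re}\,s>0$; $A\in\mathbb{R}\mathcal{H}_\infty$ is *inner* (*allpass* if square) if $A(j\omega)^HA(j\omega)=I$ for all real $\omega$; the *minimum phase part* of $A$ is a minimum phase $A_0$ with $A=BA_0$, $B$ allpass. The zeros of an invertible transfer matrix are the poles of its inverse. Let $P=P_o/s^{n}$ with an integer $n\ge1$, where $P$ is invertible and $P_o$ is proper and has no zero at $s=0$. Let $F=\phi I\in\mathbb{R}\mathcal{H}_\infty$ (with $\phi$ scalar) and $H\in\mathbb{R}\mathcal{H}_\infty$. Let $0\le\epsilon\le1$; if $\epsilon\neq0$, let $H$ be strictly proper. Let $w$ and $n$ be uncorrelated zero-mean white Gaussian noises with $l$ independent channels of spectral densities $\sigma_i^2$ and $\gamma_i^2$; put $U=\mathrm{diag}(\sigma_i)$, $V=\mathrm{diag}(\gamma_i)$. The reference is the Brownian motion $r(t)=\int_0^t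 w$. The closed loop, started at rest at time $0$, is $u=K_1r+K_2y$, $u_c=Fu+Hn$, $y=Pu_c$. The controller $[K_1\ K_2]$ is stabilizing if, with $u=K_1r+K_2(y+d_2)$ and $y=PF(u+d_1)$, all transfer matrices from $(r,d_1,d_2)$ to $(u,y)$ exist and lie in $\mathbb{R}\mathcal{H}_\infty$. Its cost is $$J=\lim_{t\to\infty}E\big[(1-\epsilon)\|r(t)-y(t)\|^2+\epsilon\|u_c(t)\|^2\big]\in[0,\infty]$$ (for $\epsilon=0$ the term in $u_c$ is absent), and $J^*$ is the infimum of $J$ over all stabilizing controllers. Let $PF=NM^{-1}=\tilde M^{-1}\tilde N$ and $P=N_0M^{-1}$ with all factors in $\mathbb{R}\mathcal{H}_\infty$, and let $X,Y,\tilde X,\tilde Y\in\mathbb{R}\mathcal{H}_\infty$ satisfy $$\begin{bmatrix}\tilde X&-\tilde Y\\-\tilde N&\tilde M\end{bmatrix}\begin{bmatrix}M&Y\\N&X\end{bmatrix}=I .$$ **Zeros.** Assume that the zeros of $P$ in $\mathrm{Re}\,s>0$ are simple, that those of $\phi$ are simple, and that no zero of $\phi$ in $\mathrm{Re}\,s>0$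 is a zero of $P$. List the zeros of $PF$ in $\mathrm{Re}\,s>0$ as $z_1,\dots,z_m$: each zero of $P$ once and each zero of $\phi$ exactly $l$ times, equal ones in consecutive positions. (If $l=1$, or if $\phi$ has no such zeros, the $z_i$ are distinct.) **Factorizations.** Let $\eta_i,\omega_i\in\mathbb{C}^l$ be unit vectors, and let $N_m$, $C$ be minimum phase, such that $$N=L_1L_2\cdots L_m N_m,\qquad \tilde NHV=C\,D_m\cdots D_2D_1,$$ $$L_i(s)=I+\Big(\tfrac{\bar z_i}{z_i}\tfrac{z_i-s}{\bar z_i+s}-1\Big)\eta_i\eta_i^H,\qquad D_i(s)=I+\Big(\tfrac{s-z_i}{s+\bar z_i}-1\Big)\omega_i\omega_i^H .$$ (The second factorization requires that $H$ be invertible without zeros in $\mathrm{Re}\,s>0$ and that all $\gamma_i\ne0$.) Let $C_{FM}$, $N_{om}$, $M_m$ be minimum phase parts of $FM$, $N_0$, $M$, and let $$\begin{bmatrix}\sqrt{1-\epsilon}\,N_m\\ \sqrt{\epsilon}\,C_{FM}\end{bmatrix}=\Theta_i\Theta_o,\qquad \begin{bmatrix}\sqrt{1-\epsilon}\,N_{om}\\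 \sqrt{\epsilon}\,M_m\end{bmatrix}=\Delta_i\Delta_o$$ be inner-outer factorizations. Put $$f(s)=\mathrm{tr}\{(1-\epsilon)U^TN_m(s)\Theta_o^{-1}(s)\Theta_o^{-T}(0)N_m^T(0)U\}$$ and, if $\epsilon<1$, suppose that $f(s)=\Big(\prod_{k=1}^{N_s}\frac{\bar s_k(s_k-s)}{s_k(\bar s_k+s)}\Big)f_m(s)$ with $\mathrm{Re}\,s_k>0$ and $f_m$ rational without poles or zeros in $\mathrm{Re}\,s>0$. Put $O(z_i)=\Delta_o(z_i)\tilde X(z_i)H(z_i)$ and, for increasing products over $k$, $$D_i^l=\prod_{k<i,\ z_k\ne z_i}D_k^{-1}(z_i),\qquad D_i^r=\prod_{k>i,\ z_k\neq z_i}D_k^{-1}(z_i).$$ **Theorem.** (a) The stabilizing controllers are exactly $[K_1\ K_2]=(\tilde X-R\tilde N)^{-1}[Q\ \ \tilde Y-R\tilde M]$ with $Q,R\in\mathbb{R}\mathcal{H}_\infty$ and $\tilde X-R\tilde N$ invertible. (b) If $\epsilon<1$, then $f,f_m\in\mathbb{R}\mathcal{H}_\infty$, $f(0)=f_m(0)=\sum_i\sigma_i^2$,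 and $\omega^{-2}\log|f(j\omega)/f(0)|$ is integrable on $(0,\infty)$. (c) $J^*$ is finite and $$\begin{aligned}J^*={}&2(1-\epsilon)\Bigg[\sum_{i=1}^{m}\frac{\mathrm{Re}\,z_i}{|z_i|^2}\sum_{j=1}^l\sigma_j^2\cos^2\angle(\eta_i,e_j)+\Big(\sum_{i=1}^l\sigma_i^2\Big)\Big(\sum_{k=1}^{N_s}\frac{\mathrm{Re}\,s_k}{|s_k|^2}-\frac1\pi\int_0^\infty\frac{\log|f(j\omega)/f(0)|}{\omega^2}\,d\omega\Big)\Bigg]\\&+\sum_{i,j=1}^{m}\frac{4\,\mathrm{Re}(z_i)\,\mathrm{Re}(z_j)}{\bar z_i+z_j}\;\omega_j^HD_j^r(D_i^r)^H\omega_i\;\;\omega_i^H(D_i^l)^HV^HO(z_i)^HO(z_j)VD_j^l\omega_j ,\end{aligned}$$ where $\cos\angle(u,v)=|u^Hv|/(\|u\|\|v\|)$ and $e_j$ is the $j$-th unit vector; for $\epsilon=1$ the first line is $0$. (d) If all $M(z_i)$ are invertible, the double sum is unchanged when $O(z_i)$ is replaced by $\Delta_o(z_i)M^{-1}(z_i)H(z_i)$.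 -/

import Mathlib

open Matrix MeasureTheory ProbabilityTheory Filter Topology

noncomputable section

namespace Tracking

/-! ### Real rational transfer matrices -/

/-- Matrices of real rational functions of the Laplace variable `s = RatFunc.X`. -/
abbrev RMat (m n : Type*) := Matrix m n (RatFunc ℝ)

/-- Value of a real rational function at a complex point (meaningful off its poles). -/
def ev (g : RatFunc ℝ) (s : ℂ) : ℂ := RatFunc.eval (algebraMap ℝ ℂ) s g

/-- Entrywise value of a transfer matrix at a complex point. -/
def evM {m n : Type*} (A : RMat m n) (s : ℂ) : Matrix m n ℂ := A.map fun g => ev g s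

/-- Value of a transfer matrix at `s = 0`, as a real matrix. -/
def atZero {m n : Type*} (A : RMat m n) : Matrix m n ℝ :=
  A.map fun g => RatFunc.eval (RingHom.id ℝ) 0 g

/-- A constant real matrix as a transfer matrix. -/
def constM {m n : Type*} (A : Matrix m n ℝ) : RMat m n := A.map fun x => RatFunc.C x

/-- `s` is a pole of `g`. -/
def IsPole (g : RatFunc ℝ) (s : ℂ) : Prop := Polynomial.aeval s g.denom = 0

def Proper (g : RatFunc ℝ) : Prop := g.num.degree ≤ g.denom.degree

def StrictlyProper (g : RatFunc ℝ) : Prop := g.num.degree < g.denom.degree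

/-- Stable and proper: no pole in the closed right half plane and none at infinity. -/
def Stable (g : RatFunc ℝ) : Prop := Proper g ∧ ∀ s : ℂ, 0 ≤ s.re → ¬ IsPole g s

/-- The class `RH∞` of stable proper real rational transfer matrices. -/
def RHinf {m n : Type*} (A : RMat m n) : Prop := ∀ i j, Stable (A i j)

/-- Zeros of an invertible square transfer matrix are the poles of its inverse (the
transmission zeros); at a point that is not a pole of `A` this means that `A` is singular there. -/
def IsZeroOf {m : Type*} [Fintype m] [DecidableEq m] (A : RMat m m) (s : ℂ) : Prop :=
  ∃ i j, IsPole (A⁻¹ i j) s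

/-- Minimum phase (outer) square element of `RH∞`: no zero in the open right half plane. -/
def MinPhase {m : Type*} [Fintype m] [DecidableEq m] (A : RMat m m) : Prop :=
  RHinf A ∧ ∀ s : ℂ, 0 < s.re → (evM A s).det ≠ 0

/-- Inner: in `RH∞` and with orthonormal columns on the imaginary axis. For a square matrix this
is an allpass factor. -/
def IsInner {m n : Type*} [Fintype m] [DecidableEq n] (A : RMat m n) : Prop :=
  RHinf A ∧ ∀ ω : ℝ, (evM A (ω * Complex.I))ᴴ * evM A (ω * Complex.I) = 1

/-- `A₀` is the minimum phase part of `A`: `A = B * A₀` with `B` allpass. -/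
def IsMinPhasePart {m : Type*} [Fintype m] [DecidableEq m] (A₀ A : RMat m m) : Prop :=
  MinPhase A₀ ∧ ∃ B : RMat m m, IsInner B ∧ A = B * A₀

/-- `G₀` is the outer factor in an inner-outer factorization of the stacked matrix
`[√(1-ε) A ; √ε B]`. -/
def IsOuterFactor {m : Type*} [Fintype m] [DecidableEq m] (ε : ℝ) (A B G₀ : RMat m m) : Prop :=
  MinPhase G₀ ∧ ∃ Gi : RMat (m ⊕ m) m, IsInner Gi ∧
    fromRows (RatFunc.C (√(1 - ε)) • A) (RatFunc.C (√ε) • B) = Gi * G₀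

variable {l : ℕ}

/-! ### Elementary allpass factors -/

/-- `[η U] diag(b, I) [η U]ᴴ` for a unit vector `η` completed by `U` to a unitary matrix; it equals
`I + (b - 1) η ηᴴ` for every such `U`. -/
def rankOne (b : ℂ) (η : EuclideanSpace ℂ (Fin l)) : Matrix (Fin l) (Fin l) ℂ :=
  1 + (b - 1) • vecMulVec (fun i => η i) (fun i => star (η i))

/-- Elementary allpass factor with zero `z`, normalized to be `I` at `s = 0`. -/
def elemL (z : ℂ) (η : EuclideanSpace ℂ (Fin l)) (s : ℂ) : Matrix (Fin l) (Fin l) ℂ :=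
  rankOne (star z / z * ((z - s) / (star z + s))) η

/-- Elementary allpass factor with zero `z`, normalized to be `I` at infinity. -/
def elemD (z : ℂ) (η : EuclideanSpace ℂ (Fin l)) (s : ℂ) : Matrix (Fin l) (Fin l) ℂ :=
  rankOne ((s - z) / (s + star z)) η

variable {m : ℕ}

/-- `L(s) = L₁(s) L₂(s) ⋯ Lₘ(s)`. -/
def prodL (z : Fin m → ℂ) (η : Fin m → EuclideanSpace ℂ (Fin l)) (s : ℂ) :
    Matrix (Fin l) (Fin l) ℂ :=
  (List.ofFn fun i => elemL (z i) (η i) s).prod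

/-- `D(s) = Dₘ(s) ⋯ D₂(s) D₁(s)`, so that `D⁻¹ = D₁⁻¹ D₂⁻¹ ⋯ Dₘ⁻¹`. -/
def prodD (z : Fin m → ℂ) (w : Fin m → EuclideanSpace ℂ (Fin l)) (s : ℂ) :
    Matrix (Fin l) (Fin l) ℂ :=
  (List.ofFn fun i => elemD (z i) (w i) s).reverse.prod

/-- `Dᵢˡ(zᵢ) = ∏_{k < i} Dₖ⁻¹(zᵢ)` in increasing order, over the `k` with `zₖ ≠ zᵢ`. -/
def Dl (z : Fin m → ℂ) (w : Fin m → EuclideanSpace ℂ (Fin l)) (i : Fin m) :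
    Matrix (Fin l) (Fin l) ℂ :=
  open Classical in
  (List.ofFn fun k => if k < i ∧ z k ≠ z i then (elemD (z k) (w k) (z i))⁻¹ else 1).prod

/-- `Dᵢʳ(zᵢ) = ∏_{k > i} Dₖ⁻¹(zᵢ)` in increasing order, over the `k` with `zₖ ≠ zᵢ`. -/
def Dr (z : Fin m → ℂ) (w : Fin m → EuclideanSpace ℂ (Fin l)) (i : Fin m) :
    Matrix (Fin l) (Fin l) ℂ :=
  open Classical in
  (List.ofFn fun k => if i < k ∧ z k ≠ z i then (elemD (z k) (w k) (z i))⁻¹ else 1).prod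

/-- `uᴴ A v`. -/
def sesq (u : EuclideanSpace ℂ (Fin l)) (A : Matrix (Fin l) (Fin l) ℂ)
    (v : EuclideanSpace ℂ (Fin l)) : ℂ :=
  (fun i => star (u i)) ⬝ᵥ (A *ᵥ fun i => v i)

/-- Cosine of the angle between (the complex lines spanned by) two vectors. -/
def cosAngle (u v : EuclideanSpace ℂ (Fin l)) : ℝ := ‖inner ℂ u v‖ / (‖u‖ * ‖v‖)

/-! ### The three parts of the closed form -/

/-- `∑ᵢ Re zᵢ / |zᵢ|² ∑ⱼ σⱼ² cos² ∠(ηᵢ, eⱼ)`. -/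
def zeroTerm (σ : Fin l → ℝ) (z : Fin m → ℂ) (η : Fin m → EuclideanSpace ℂ (Fin l)) : ℝ :=
  ∑ i, (z i).re / ‖z i‖ ^ 2 *
    ∑ j, σ j ^ 2 * cosAngle (η i) (EuclideanSpace.single j (1 : ℂ)) ^ 2

/-- `f(s) = tr { (1-ε) Uᵀ N_m(s) Θ_o(s)⁻¹ Θ_o(0)⁻ᵀ N_m(0)ᵀ U }`, where `U = diag(σ)`. -/
def fFun (ε : ℝ) (σ : Fin l → ℝ) (Nm Θo : RMat (Fin l) (Fin l)) : RatFunc ℝ :=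
  Matrix.trace (RatFunc.C (1 - ε) • (constM (diagonal σ)ᵀ * Nm * Θo⁻¹ *
    constM (((atZero Θo)⁻¹)ᵀ * (atZero Nm)ᵀ * diagonal σ)))

/-- The integrand `log |f(jω) / f(0)| / ω²`. -/
def logIntegrand (f : RatFunc ℝ) (ω : ℝ) : ℝ :=
  Real.log ‖ev f (ω * Complex.I) / ev f 0‖ / ω ^ 2

/-- `∑ₖ Re sₖ / |sₖ|² - (1/π) ∫₀^∞ log |f(jω) / f(0)| / ω² dω`. -/
def logTerm {Ns : ℕ} (f : RatFunc ℝ) (s : Fin Ns → ℂ) : ℝ :=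
  ∑ k, (s k).re / ‖s k‖ ^ 2 - 1 / Real.pi * ∫ ω in Set.Ioi (0 : ℝ), logIntegrand f ω

/-- The double sum over the zeros, for given matrices `O i = O(zᵢ)`. -/
def noiseTerm (γ : Fin l → ℝ) (z : Fin m → ℂ) (w : Fin m → EuclideanSpace ℂ (Fin l))
    (O : Fin m → Matrix (Fin l) (Fin l) ℂ) : ℂ :=
  let V : Matrix (Fin l) (Fin l) ℂ := diagonal fun i => (γ i : ℂ)
  ∑ i, ∑ j, (4 * (z i).re * (z j).re : ℂ) / (star (z i) + z j) *
    sesq (w j) (Dr z w j * (Dr z w i)ᴴ) (w i) *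
    sesq (w i) ((Dl z w i)ᴴ * Vᴴ * (O i)ᴴ * O j * V * Dl z w j) (w j)

/-! ### Closed loop: `u = K₁ r + K₂ y`, `u_c = F u + H n`, `y = P u_c` -/

/-- Internal stability of the two-parameter loop around `G = P F`: with `u = K₁ r + K₂ (y + d₂)`
and `y = G (u + d₁)`, all transfer matrices from `(r, d₁, d₂)` to `(u, y)` are in `RH∞`
(the one from `d₁` to `u` is `(I - K₂ G)⁻¹ - I`). -/
def Stabilizes (G K₁ K₂ : RMat (Fin l) (Fin l)) : Prop :=
  IsUnit (1 - K₂ * G).det ∧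
  RHinf (1 - K₂ * G)⁻¹ ∧ RHinf ((1 - K₂ * G)⁻¹ * K₁) ∧ RHinf ((1 - K₂ * G)⁻¹ * K₂) ∧
  RHinf (G * (1 - K₂ * G)⁻¹) ∧ RHinf (G * (1 - K₂ * G)⁻¹ * K₁) ∧
  RHinf (G * (1 - K₂ * G)⁻¹ * K₂)

/-- The parametrized family of controllers
`[K₁ K₂] = (X̃ - R Ñ)⁻¹ [Q, Ỹ - R M̃]` with `Q, R ∈ RH∞`. -/
def IsYoula (Xt Yt Nt Mt K₁ K₂ : RMat (Fin l) (Fin l)) : Prop :=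
  ∃ Q R : RMat (Fin l) (Fin l), RHinf Q ∧ RHinf R ∧ IsUnit (Xt - R * Nt).det ∧
    K₁ = (Xt - R * Nt)⁻¹ * Q ∧ K₂ = (Xt - R * Nt)⁻¹ * (Yt - R * Mt)

/-! ### White noise and responses of linear systems -/

variable {Ω : Type*} [MeasurableSpace Ω]

/-- `L²` functions of time. -/
abbrev TimeL2 := Lp ℝ 2 (volume : Measure ℝ)

/-- A family of linear maps from test functions to random variables, `W i φ = ∫ φ(t) wᵢ(t) dt`. -/
abbrev Noise (l : ℕ) (μ : Measure Ω) := Fin l → TimeL2 →ₗ[ℝ] Lp ℝ 2 μ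

/-- `W` is an `l`-channel zero-mean white Gaussian noise with independent channels, channel `i`
having spectral density `σᵢ²`: each `∑ᵢ ∫ φᵢ wᵢ` is a centered Gaussian variable with variance
`∑ᵢ σᵢ² ‖φᵢ‖²`. -/
def IsWhiteNoise {μ : Measure Ω} (σ : Fin l → ℝ) (W : Noise l μ) : Prop :=
  ∀ φ : Fin l → TimeL2,
    μ.map (∑ i, W i (φ i) : Lp ℝ 2 μ) = gaussianReal 0 (∑ i, σ i ^ 2 * ‖φ i‖ ^ 2).toNNReal

/-- The two noises are uncorrelated. -/
def Uncorrelated {μ : Measure Ω} (W N : Noise l μ) : Prop :=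
  ∀ i j φ ψ, ∫ x, W i φ x * N j ψ x ∂μ = 0

/-- The class of a square integrable function (and `0` for any other function). -/
def toL2 (g : ℝ → ℝ) : TimeL2 :=
  open Classical in if h : MemLp g 2 volume then h.toLp g else 0

/-- `τ ↦ g(t - τ)` on `[0, t]`, and `0` elsewhere. -/
def window (g : ℝ → ℝ) (t : ℝ) : ℝ → ℝ := (Set.Icc 0 t).indicator fun τ => g (t - τ)

/-- `g` is the impulse response of the causal system with transfer function `G`: it is locally
square integrable on `[0, ∞)` and its Laplace transform is `G` on the open right half plane. -/
def IsImpulseResponse (G : RatFunc ℝ) (g : ℝ → ℝ) : Prop :=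
  (∀ t : ℝ, MemLp g 2 (volume.restrict (Set.Icc 0 t))) ∧
  ∀ s : ℂ, 0 < s.re →
    IntegrableOn (fun t : ℝ => Complex.exp (-s * t) * (g t : ℂ)) (Set.Ioi 0) ∧
    ∫ t in Set.Ioi (0 : ℝ), Complex.exp (-s * t) * (g t : ℂ) = ev G s

/-- The reference `r(t) = ∫₀ᵗ w`, a Brownian motion. -/
def reference {μ : Measure Ω} (W : Noise l μ) (t : ℝ) (i : Fin l) : Lp ℝ 2 μ :=
  W i (toL2 (window (fun _ => 1) t))

/-- `y = T_r r + T_n n` for the reference `r = w / s`, started at rest at time `0`: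
`y(t) = ∫₀ᵗ a(t - τ) w(τ) dτ + ∫₀ᵗ b(t - τ) n(τ) dτ` with impulse responses `a` of `T_r / s`
and `b` of `T_n`. -/
def IsResponse {μ : Measure Ω} (W N : Noise l μ) (Tr Tn : RMat (Fin l) (Fin l))
    (y : ℝ → Fin l → Lp ℝ 2 μ) : Prop :=
  ∃ a b : Fin l → Fin l → ℝ → ℝ,
    (∀ i j, IsImpulseResponse (Tr i j / RatFunc.X) (a i j)) ∧
    (∀ i j, IsImpulseResponse (Tn i j) (b i j)) ∧
    ∀ t, 0 ≤ t → ∀ i,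
      y t i = ∑ j, W j (toL2 (window (a i j) t)) + ∑ j, N j (toL2 (window (b i j) t))

/-- `J` is the (finite, steady state) value of
`E[(1-ε) ‖r(t) - y(t)‖² + ε ‖u_c(t)‖²]` for the controller `[K₁ K₂]`. For `ε = 0` the plant
input `u_c` does not enter and need not have finite power. -/
def HasCost {μ : Measure Ω} (ε : ℝ) (W N : Noise l μ) (P F H K₁ K₂ : RMat (Fin l) (Fin l))
    (J : ℝ) : Prop :=
  ∃ y uc : ℝ → Fin l → Lp ℝ 2 μ,
    IsResponse W N ((1 - P * F * K₂)⁻¹ * P * F * K₁) ((1 - P * F * K₂)⁻¹ * P * H) y ∧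
    (ε ≠ 0 → IsResponse W N ((1 - F * K₂ * P)⁻¹ * F * K₁) ((1 - F * K₂ * P)⁻¹ * H) uc) ∧
    Tendsto (fun t => ∫ x, ((1 - ε) * ∑ i, (reference W t i x - y t i x) ^ 2
      + ε * ∑ i, (uc t i x) ^ 2) ∂μ) atTop (𝓝 J)

/-- The finite values of the cost over all stabilizing two-parameter controllers. -/
def costSet {μ : Measure Ω} (ε : ℝ) (W N : Noise l μ) (P F H : RMat (Fin l) (Fin l)) : Set ℝ :=
  {J | ∃ K₁ K₂, Stabilizes (P * F) K₁ K₂ ∧ HasCost ε W N P F H K₁ K₂ J}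

end Tracking

end

open Tracking

open Matrix MeasureTheory ProbabilityTheory Filter Topology

noncomputable section

namespace Tracking

section

/-! ### Evaluation of real rational functions -/

/-! The parametrization of the stabilizing controllers makes the closed loop affine: the reference
acts through `N Q` and `F M Q`, the channel noise through `N₀ (Xt - R Nt) H` and `M (Xt - R Nt) H`,
with `Q` and `R` free and independent (`CoprimeLoop.stabilizes_iff`, `CoprimeLoop.closedLoop`,
`CoprimeLoop.isUnit_det`). White noise turns mean squares into energies of impulse responses, and
Plancherel's theorem turns `2πJ` into the integral over the imaginary axis of a tracking density
depending on `Q` only plus a noise density depending on `R` only. Two inequalities suffice: every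
attained cost dominates the frequency-domain cost (`HasCost.freqCost_le`), and a finite
frequency-domain cost is attained or improved under mild conditions at `0` and at infinity
(`exists_hasCost`). Then `CoprimeLoop.isGLB_costSet` adds two separate infima.

Tracking, for `ε < 1`. Put `Ψ = (1-ε) Nm Θ⁻¹`, a multiple of the upper block of the inner factor.
The integrators of the plant give `M(0) = 0`, so `Ψ(0) Ψ(0)ᴴ = (1-ε) I`, and completion of squares
(`tracking_identity`) writes `ω²` times the density as `|(Ψ(0)ᴴ - Θ Q) U|² - 2 Re k`, where `k = tr
U ((1-ε) N - Ψ(0) Θ) Q U` is stable and vanishes at `0`. By Cauchy's theorem `∫ Re k / ω² = π k'(0)`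
(`half_residue`). Finite cost forces `N(0) Q(0) U = U`, and then `k'(0)` no longer depends on `Q`.
With `N = L Nm` it splits into the derivative of `L` at `0`, which is the sum over the `zᵢ`, and the
derivative of `f` at `0`, which a Bode-type formula expresses through the `sₖ` and the integral of
`log |f|` (`tendsto_slope_logTerm`). The remaining square can be made arbitrarily small, because the
outer `Θ` has stable approximate inverses that are exact at the origin
(`exists_approx_inverse_of_zero`).

Noise. The outer factor `Δ` merges the two rows into `|Δ (Xt - R Nt) H V|²`. Multiplication by
`D⁻¹`, unitary on the axis, gives `T D⁻¹ - Δ R C` with `T = Δ Xt H V`. The poles of `D⁻¹` in the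
right half plane are simple: a repeated zero is a zero of `φ`, there `D` vanishes as a matrix
although at most `l` factors vanish, and this forces orthogonal directions (`prodD_kernel`,
`prodDinv_eq`). So `T D⁻¹` is a Hardy function plus simple fractions `2 Re zᵢ / (s - zᵢ)` with
matrix coefficients. `R` cannot change these coefficients, since `D(zᵢ) Dᵢˡ ωᵢ = 0`; the two parts
are orthogonal in `L²`; and `Δ R C` can approach the Hardy part because `Δ` and `C` are outer. The
infimum is therefore the energy of the fractions, and `integral_kernel` evaluates it as the double
sum. Replacing `Xt` by `M⁻¹` is harmless because `M Xt = I + Y Nt` and `Nt H V Dᵢˡ ωᵢ = 0` at `zᵢ`.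
-/

lemma ev_eq_div (g : RatFunc ℝ) (s : ℂ) :
    ev g s = Polynomial.aeval s g.num / Polynomial.aeval s g.denom := rfl

lemma not_isPole_C (c : ℝ) (s : ℂ) : ¬ IsPole (RatFunc.C c) s := by
  simp [IsPole]

lemma not_isPole_X (s : ℂ) : ¬ IsPole RatFunc.X s := by
  simp [IsPole]

lemma not_isPole_zero (s : ℂ) : ¬ IsPole 0 s := by
  simp [IsPole]

lemma not_isPole_one (s : ℂ) : ¬ IsPole 1 s := by
  simp [IsPole]

lemma not_isPole_of_denom_dvd {g : RatFunc ℝ} {q : Polynomial ℝ} {s : ℂ} (h : g.denom ∣ q)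
    (hq : Polynomial.aeval s q ≠ 0) : ¬ IsPole g s := by
  obtain ⟨r, rfl⟩ := h
  intro hp
  apply hq
  rw [map_mul, show Polynomial.aeval s g.denom = 0 from hp, zero_mul]

lemma not_isPole_add {g h : RatFunc ℝ} {s : ℂ} (hg : ¬ IsPole g s) (hh : ¬ IsPole h s) :
    ¬ IsPole (g + h) s :=
  not_isPole_of_denom_dvd (RatFunc.denom_add_dvd g h) (by
    rw [map_mul]; exact mul_ne_zero hg hh)

lemma not_isPole_mul {g h : RatFunc ℝ} {s : ℂ} (hg : ¬ IsPole g s) (hh : ¬ IsPole h s) :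
    ¬ IsPole (g * h) s :=
  not_isPole_of_denom_dvd (RatFunc.denom_mul_dvd g h) (by
    rw [map_mul]; exact mul_ne_zero hg hh)

lemma not_isPole_neg {g : RatFunc ℝ} {s : ℂ} (hg : ¬ IsPole g s) : ¬ IsPole (-g) s := by
  have h : -g = RatFunc.C (-1) * g := by simp
  rw [h]
  exact not_isPole_mul (not_isPole_C _ _) hg

lemma not_isPole_sub {g h : RatFunc ℝ} {s : ℂ} (hg : ¬ IsPole g s) (hh : ¬ IsPole h s) :
    ¬ IsPole (g - h) s := by
  rw [sub_eq_add_neg]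
  exact not_isPole_add hg (not_isPole_neg hh)

lemma not_isPole_sum {ι : Type*} (t : Finset ι) {g : ι → RatFunc ℝ} {s : ℂ}
    (hg : ∀ i ∈ t, ¬ IsPole (g i) s) : ¬ IsPole (∑ i ∈ t, g i) s := by
  classical
  induction t using Finset.induction_on with
  | empty => simpa using not_isPole_zero s
  | insert a t ha ih =>
    rw [Finset.sum_insert ha]
    exact not_isPole_add (hg a (by simp)) (ih fun i hi => hg i (by simp [hi]))

lemma ev_add {g h : RatFunc ℝ} {s : ℂ} (hg : ¬ IsPole g s) (hh : ¬ IsPole h s) :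
    ev (g + h) s = ev g s + ev h s := RatFunc.eval_add _ _ hg hh

lemma ev_mul {g h : RatFunc ℝ} {s : ℂ} (hg : ¬ IsPole g s) (hh : ¬ IsPole h s) :
    ev (g * h) s = ev g s * ev h s := RatFunc.eval_mul _ _ hg hh

@[simp] lemma ev_C (c : ℝ) (s : ℂ) : ev (RatFunc.C c) s = c := by simp [ev]

@[simp] lemma ev_X (s : ℂ) : ev RatFunc.X s = s := by simp [ev]

@[simp] lemma ev_zero (s : ℂ) : ev 0 s = 0 := by simp [ev]

@[simp] lemma ev_one (s : ℂ) : ev 1 s = 1 := by simp [ev]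

lemma ev_neg {g : RatFunc ℝ} {s : ℂ} (hg : ¬ IsPole g s) : ev (-g) s = -ev g s := by
  have h : -g = RatFunc.C (-1) * g := by simp
  rw [h, ev_mul (not_isPole_C _ _) hg, ev_C]
  simp

lemma ev_sub {g h : RatFunc ℝ} {s : ℂ} (hg : ¬ IsPole g s) (hh : ¬ IsPole h s) :
    ev (g - h) s = ev g s - ev h s := by
  rw [sub_eq_add_neg, ev_add hg (not_isPole_neg hh), ev_neg hh, sub_eq_add_neg]

lemma ev_sum {ι : Type*} (t : Finset ι) {g : ι → RatFunc ℝ} {s : ℂ}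
    (hg : ∀ i ∈ t, ¬ IsPole (g i) s) : ev (∑ i ∈ t, g i) s = ∑ i ∈ t, ev (g i) s := by
  classical
  induction t using Finset.induction_on with
  | empty => simp
  | insert a t ha ih =>
    rw [Finset.sum_insert ha, Finset.sum_insert ha, ev_add (hg a (by simp)),
      ih fun i hi => hg i (by simp [hi])]
    exact not_isPole_sum t fun i hi => hg i (by simp [hi])

lemma not_isPole_div_poly (p : Polynomial ℝ) {q : Polynomial ℝ} {s : ℂ}
    (hq : Polynomial.aeval s q ≠ 0) :
    ¬ IsPole (algebraMap _ (RatFunc ℝ) p / algebraMap _ (RatFunc ℝ) q) s :=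
  not_isPole_of_denom_dvd (RatFunc.denom_div_dvd p q) hq

lemma not_isPole_poly (p : Polynomial ℝ) (s : ℂ) : ¬ IsPole (algebraMap _ (RatFunc ℝ) p) s := by
  simp [IsPole]

@[simp] lemma ev_poly (p : Polynomial ℝ) (s : ℂ) :
    ev (algebraMap _ (RatFunc ℝ) p) s = Polynomial.aeval s p := by
  simp [ev_eq_div]

lemma ev_div_poly (p : Polynomial ℝ) {q : Polynomial ℝ} {s : ℂ}
    (hq : Polynomial.aeval s q ≠ 0) :
    ev (algebraMap _ (RatFunc ℝ) p / algebraMap _ (RatFunc ℝ) q) s =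
      Polynomial.aeval s p / Polynomial.aeval s q := by
  have hq0 : q ≠ 0 := by rintro rfl; simp at hq
  have h : algebraMap _ (RatFunc ℝ) p =
      algebraMap _ (RatFunc ℝ) p / algebraMap _ (RatFunc ℝ) q * algebraMap _ (RatFunc ℝ) q := by
    rw [div_mul_cancel₀]
    simpa using hq0
  have h2 := congrArg (fun g => ev g s) h
  simp only [ev_mul (not_isPole_div_poly p hq) (not_isPole_poly q s), ev_poly] at h2
  rw [h2, mul_div_cancel_right₀ _ hq]

lemma num_ne_zero_of_isPole {g : RatFunc ℝ} {s : ℂ} (hg : IsPole g s) :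
    Polynomial.aeval s g.num ≠ 0 := by
  intro h
  obtain ⟨a, b, hab⟩ := RatFunc.isCoprime_num_denom g
  have h2 := congrArg (Polynomial.aeval s) hab
  simp [h, show Polynomial.aeval s g.denom = 0 from hg] at h2

lemma ev_conj (g : RatFunc ℝ) (s : ℂ) : ev g (star s) = star (ev g s) := by
  have h : ∀ p : Polynomial ℝ, Polynomial.aeval (star s) p = star (Polynomial.aeval s p) := by
    intro p
    exact Polynomial.aeval_conj p s
  rw [ev_eq_div, ev_eq_div, h, h, star_div₀]

lemma ev_zero_eq_ofReal (g : RatFunc ℝ) :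
    ev g 0 = ((RatFunc.eval (RingHom.id ℝ) 0 g : ℝ) : ℂ) := by
  have h : ∀ p : Polynomial ℝ, Polynomial.aeval (0 : ℂ) p =
      ((Polynomial.eval₂ (RingHom.id ℝ) 0 p : ℝ) : ℂ) := by
    intro p
    rw [Polynomial.eval₂_id]
    simpa using (Polynomial.aeval_algebraMap_apply_eq_algebraMap_eval (A := ℂ) (0 : ℝ) p)
  rw [ev_eq_div, h, h, RatFunc.eval]
  push_cast
  rfl

/-! ### Identities off finite sets -/

/-- Transfer matrices may be multiplied and inverted pointwise only off finitely many poles. The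
cofinite filter records these exceptions; it passes to almost every frequency (`ae_of_cofinite`) and
to one-sided limits along real shifts. -/
lemma eventually_aeval_ne_zero {q : Polynomial ℝ} (hq : q ≠ 0) :
    ∀ᶠ s : ℂ in cofinite, Polynomial.aeval s q ≠ 0 := by
  have h : (q.map (algebraMap ℝ ℂ)) ≠ 0 := by
    simpa [Polynomial.map_eq_zero] using hq
  filter_upwards [Polynomial.eventually_cofinite_not_isRoot h] with s hs
  rwa [Polynomial.IsRoot, Polynomial.eval_map_algebraMap] at hs

lemma eventually_not_isPole (g : RatFunc ℝ) : ∀ᶠ s : ℂ in cofinite, ¬ IsPole g s :=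
  eventually_aeval_ne_zero g.denom_ne_zero

lemma eventually_ev_ne_zero {g : RatFunc ℝ} (hg : g ≠ 0) :
    ∀ᶠ s : ℂ in cofinite, ev g s ≠ 0 := by
  filter_upwards [eventually_not_isPole g,
    eventually_aeval_ne_zero (RatFunc.num_ne_zero hg)] with s h1 h2
  rw [ev_eq_div]
  exact div_ne_zero h2 h1

lemma tendsto_add_real_cofinite (s : ℂ) :
    Tendsto (fun t : ℝ => s + (t : ℂ)) cofinite cofinite :=
  Function.Injective.tendsto_cofinite fun a b h => by simpa using h

lemma tendsto_mul_I_cofinite :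
    Tendsto (fun t : ℝ => (t : ℂ) * Complex.I) cofinite cofinite :=
  Function.Injective.tendsto_cofinite fun a b h => by simpa using h

lemma nhdsGT_le_cofinite (x : ℝ) : 𝓝[>] x ≤ cofinite :=
  (nhdsWithin_mono x fun _ hy => ne_of_gt hy).trans (nhdsNE_le_cofinite x)

lemma ae_of_cofinite {p : ℂ → Prop} (h : ∀ᶠ s in cofinite, p s) :
    ∀ᵐ ω : ℝ, p (ω * Complex.I) := by
  have h2 := tendsto_mul_I_cofinite.eventually h
  rw [eventually_cofinite] at h2
  exact measure_mono_null (fun _ hx => hx) (h2.measure_zero volume)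

lemma atTop_le_cofinite_real : (atTop : Filter ℝ) ≤ cofinite := by
  rw [le_cofinite_iff_eventually_ne]
  intro x
  exact (eventually_gt_atTop x).mono fun y hy => ne_of_gt hy

/-! ### Boundedness and stability -/

/-- Otherwise `q` would be negligible against `p` at infinity, which contradicts the bound at large
positive real points. -/
lemma degree_le_of_bound {p q : Polynomial ℝ} {C : ℝ}
    (h : ∀ᶠ s : ℂ in cofinite, 0 < s.re →
      ‖Polynomial.aeval s p‖ ≤ C * ‖Polynomial.aeval s q‖) : p.degree ≤ q.degree := by
  by_contra! hlt
  have hlt' : (q.map (algebraMap ℝ ℂ)).degree < (p.map (algebraMap ℝ ℂ)).degree := by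
    simpa [Polynomial.degree_map] using hlt
  have hp0 : p ≠ 0 := by rintro rfl; simp at hlt
  have ho := Polynomial.isLittleO_cobounded_of_degree_lt hlt'
  have hC : (0 : ℝ) < 1 / (2 * (|C| + 1)) := by positivity
  have ho2 := ho.bound hC
  have ht : Tendsto (fun t : ℝ => (t : ℂ)) atTop (Bornology.cobounded ℂ) := by
    rw [← tendsto_norm_atTop_iff_cobounded]
    refine tendsto_abs_atTop_atTop.congr fun x => ?_
    simp
  have ht2 : Tendsto (fun t : ℝ => (t : ℂ)) atTop cofinite := by
    have := (tendsto_add_real_cofinite 0).comp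
      (show Tendsto id atTop cofinite from atTop_le_cofinite_real)
    simpa [Function.comp_def] using this
  obtain ⟨t, h1, h2, h3, h4⟩ := ((ht.eventually ho2).and ((ht2.eventually h).and
    ((ht2.eventually (eventually_aeval_ne_zero hp0)).and (eventually_gt_atTop (0 : ℝ))))).exists
  have h5 := h2 (by simpa using h4)
  simp only [Polynomial.eval_map_algebraMap] at h1
  have h6 : 0 < ‖Polynomial.aeval (t : ℂ) p‖ := norm_pos_iff.2 h3
  have h7 : C * ‖Polynomial.aeval (t : ℂ) q‖ ≤
      |C| * (1 / (2 * (|C| + 1)) * ‖Polynomial.aeval (t : ℂ) p‖) := by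
    refine (mul_le_mul_of_nonneg_right (le_abs_self C) (norm_nonneg _)).trans ?_
    exact mul_le_mul_of_nonneg_left h1 (abs_nonneg C)
  have h8 : |C| * (1 / (2 * (|C| + 1))) ≤ 1 / 2 := by
    rw [mul_one_div, div_le_div_iff₀ (by positivity) (by norm_num)]
    linarith
  have h9 : |C| * (1 / (2 * (|C| + 1)) * ‖Polynomial.aeval (t : ℂ) p‖) ≤
      1 / 2 * ‖Polynomial.aeval (t : ℂ) p‖ := by
    rw [← mul_assoc]
    exact mul_le_mul_of_nonneg_right h8 h6.le
  linarith

/-- A rational function that is bounded on the open right half plane, up to finitely many points,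
is stable and proper. -/
lemma stable_of_bound {g : RatFunc ℝ} {C : ℝ}
    (h : ∀ᶠ s : ℂ in cofinite, 0 < s.re → ‖ev g s‖ ≤ C) : Stable g := by
  have hb : ∀ᶠ s : ℂ in cofinite, 0 < s.re →
      ‖Polynomial.aeval s g.num‖ ≤ C * ‖Polynomial.aeval s g.denom‖ := by
    filter_upwards [h, eventually_not_isPole g] with s h1 h2 h3
    have h4 := h1 h3
    rwa [ev_eq_div, norm_div, div_le_iff₀ (norm_pos_iff.2 h2)] at h4
  -- At a pole the denominator vanishes. The cleared bound, passed to the limit along `s + t` with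
  -- `t ↓ 0`, makes the numerator vanish too, against coprimality. The shift to the right also
  -- covers poles on the imaginary axis.
  refine ⟨degree_le_of_bound hb, fun s hs hp => num_ne_zero_of_isPole hp ?_⟩
  have ht : Tendsto (fun t : ℝ => s + (t : ℂ)) (𝓝[>] 0) (𝓝 s) := by
    have h1 : Continuous (fun t : ℝ => s + (t : ℂ)) := by fun_prop
    have := h1.tendsto 0
    simp only [Complex.ofReal_zero, add_zero] at this
    exact this.mono_left nhdsWithin_le_nhds
  have hb2 := ((tendsto_add_real_cofinite s).mono_left (nhdsGT_le_cofinite 0)).eventually hb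
  have hc : ∀ p : Polynomial ℝ, Tendsto (fun t : ℝ => ‖Polynomial.aeval (s + (t : ℂ)) p‖)
      (𝓝[>] 0) (𝓝 ‖Polynomial.aeval s p‖) := fun p =>
    ((p.continuous_aeval.tendsto s).comp ht).norm
  have hle := le_of_tendsto_of_tendsto (hc g.num) ((hc g.denom).const_mul C) (by
    filter_upwards [hb2, self_mem_nhdsWithin] with t h1 h2
    refine h1 ?_
    have : (0 : ℝ) < t := h2
    simp only [Complex.add_re, Complex.ofReal_re]
    linarith)
  rw [show Polynomial.aeval s g.denom = 0 from hp, norm_zero, mul_zero] at hle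
  exact norm_le_zero_iff.1 hle

lemma strictlyProper_of_bound {g : RatFunc ℝ} {C : ℝ}
    (h : ∀ᶠ s : ℂ in cofinite, 0 < s.re → ‖s * ev g s‖ ≤ C) : StrictlyProper g := by
  have hb : ∀ᶠ s : ℂ in cofinite, 0 < s.re →
      ‖Polynomial.aeval s (Polynomial.X * g.num)‖ ≤ C * ‖Polynomial.aeval s g.denom‖ := by
    filter_upwards [h, eventually_not_isPole g] with s h1 h2 h3
    have h4 := h1 h3
    rw [ev_eq_div, ← mul_div_assoc, norm_div, div_le_iff₀ (norm_pos_iff.2 h2)] at h4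
    simpa using h4
  have h1 := degree_le_of_bound hb
  unfold StrictlyProper
  by_cases hn : g.num = 0
  · rw [hn, Polynomial.degree_zero, bot_lt_iff_ne_bot, Ne, Polynomial.degree_eq_bot]
    exact g.denom_ne_zero
  · rw [Polynomial.degree_mul, Polynomial.degree_X] at h1
    refine lt_of_lt_of_le ?_ h1
    rw [Polynomial.degree_eq_natDegree hn]
    norm_cast
    omega

/-- The comparison of degrees controls the quotient outside a large disc; the part of the half plane
inside the disc is compact and free of zeros of `q`. -/
lemma exists_bound_div {p q : Polynomial ℝ} (hd : p.degree ≤ q.degree)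
    (hq : ∀ s : ℂ, 0 ≤ s.re → Polynomial.aeval s q ≠ 0) :
    ∃ C : ℝ, 0 < C ∧ ∀ s : ℂ, 0 ≤ s.re → ‖Polynomial.aeval s p / Polynomial.aeval s q‖ ≤ C := by
  have hd' : (p.map (algebraMap ℝ ℂ)).degree ≤ (q.map (algebraMap ℝ ℂ)).degree := by
    simpa [Polynomial.degree_map] using hd
  obtain ⟨c, hc, ho⟩ := (Polynomial.isBigO_cobounded_of_degree_le hd').exists_pos
  have ho2 := ho.bound
  simp only [Polynomial.eval_map_algebraMap] at ho2
  obtain ⟨r, hr⟩ := (Filter.hasBasis_cobounded_norm (E := ℂ)).eventually_iff.1 ho2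
  have hK : IsCompact (Metric.closedBall (0 : ℂ) r ∩ {s : ℂ | 0 ≤ s.re}) :=
    (isCompact_closedBall 0 r).inter_right (isClosed_le continuous_const Complex.continuous_re)
  have hcont : ContinuousOn (fun s : ℂ => Polynomial.aeval s p / Polynomial.aeval s q)
      (Metric.closedBall (0 : ℂ) r ∩ {s : ℂ | 0 ≤ s.re}) :=
    p.continuous_aeval.continuousOn.div q.continuous_aeval.continuousOn fun s hs => hq s hs.2
  obtain ⟨c', hc'⟩ := hK.exists_bound_of_continuousOn hcont
  refine ⟨max c c', lt_max_of_lt_left hc, fun s hs => ?_⟩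
  by_cases h : ‖s‖ ≤ r
  · exact (hc' s ⟨by simpa using h, hs⟩).trans (le_max_right _ _)
  · refine le_trans ?_ (le_max_left _ _)
    rw [norm_div, div_le_iff₀ (norm_pos_iff.2 (hq s hs))]
    exact hr.2 (le_of_not_ge h)

lemma Stable.exists_bound {g : RatFunc ℝ} (hg : Stable g) :
    ∃ C : ℝ, 0 < C ∧ ∀ s : ℂ, 0 ≤ s.re → ‖ev g s‖ ≤ C :=
  exists_bound_div hg.1 hg.2

lemma Stable.exists_bound_of_strictlyProper {g : RatFunc ℝ} (hg : Stable g)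
    (hs : StrictlyProper g) :
    ∃ C : ℝ, 0 < C ∧ ∀ s : ℂ, 0 ≤ s.re → ‖ev g s‖ ≤ C / (1 + ‖s‖) := by
  obtain ⟨c, hc, h1⟩ := hg.exists_bound
  have hd : (Polynomial.X * g.num).degree ≤ g.denom.degree := by
    by_cases hn : g.num = 0
    · simp [hn]
    · unfold StrictlyProper at hs
      rw [Polynomial.degree_mul, Polynomial.degree_X]
      rw [Polynomial.degree_eq_natDegree hn, Polynomial.degree_eq_natDegree g.denom_ne_zero] at *
      norm_cast at *
      omega
  obtain ⟨c', hc', h2⟩ := exists_bound_div hd hg.2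
  refine ⟨c + c', by positivity, fun s hs => ?_⟩
  rw [le_div_iff₀ (by positivity), mul_add, mul_one]
  have h3 := h2 s hs
  rw [map_mul, Polynomial.aeval_X, mul_div_assoc, norm_mul, mul_comm, ← ev_eq_div] at h3
  exact add_le_add (h1 s hs) h3

lemma Stable.not_isPole {g : RatFunc ℝ} (hg : Stable g) {s : ℂ} (hs : 0 ≤ s.re) :
    ¬ IsPole g s := hg.2 s hs

lemma Stable.add {g h : RatFunc ℝ} (hg : Stable g) (hh : Stable h) : Stable (g + h) := by
  obtain ⟨c, -, h1⟩ := hg.exists_bound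
  obtain ⟨d, -, h2⟩ := hh.exists_bound
  refine stable_of_bound (C := c + d) (Eventually.of_forall fun s hs => ?_)
  rw [ev_add (hg.2 s hs.le) (hh.2 s hs.le)]
  exact (norm_add_le _ _).trans (add_le_add (h1 s hs.le) (h2 s hs.le))

lemma Stable.mul {g h : RatFunc ℝ} (hg : Stable g) (hh : Stable h) : Stable (g * h) := by
  obtain ⟨c, hc, h1⟩ := hg.exists_bound
  obtain ⟨d, -, h2⟩ := hh.exists_bound
  refine stable_of_bound (C := c * d) (Eventually.of_forall fun s hs => ?_)
  rw [ev_mul (hg.2 s hs.le) (hh.2 s hs.le), norm_mul]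
  exact mul_le_mul (h1 s hs.le) (h2 s hs.le) (norm_nonneg _) hc.le

lemma stable_C (c : ℝ) : Stable (RatFunc.C c) :=
  stable_of_bound (C := ‖(c : ℂ)‖) (Eventually.of_forall fun s _ => by rw [ev_C])

lemma stable_zero : Stable 0 := by simpa using stable_C 0

lemma stable_one : Stable 1 := by simpa using stable_C 1

lemma Stable.neg {g : RatFunc ℝ} (hg : Stable g) : Stable (-g) := by
  have h : -g = RatFunc.C (-1) * g := by simp
  rw [h]
  exact (stable_C _).mul hg

lemma Stable.sub {g h : RatFunc ℝ} (hg : Stable g) (hh : Stable h) : Stable (g - h) := by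
  rw [sub_eq_add_neg]
  exact hg.add hh.neg

lemma stable_sum {ι : Type*} (t : Finset ι) {g : ι → RatFunc ℝ} (hg : ∀ i ∈ t, Stable (g i)) :
    Stable (∑ i ∈ t, g i) := by
  classical
  induction t using Finset.induction_on with
  | empty => simpa using stable_zero
  | insert a t ha ih =>
    rw [Finset.sum_insert ha]
    exact (hg a (by simp)).add (ih fun i hi => hg i (by simp [hi]))

lemma stable_prod {ι : Type*} (t : Finset ι) {g : ι → RatFunc ℝ} (hg : ∀ i ∈ t, Stable (g i)) :
    Stable (∏ i ∈ t, g i) := by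
  classical
  induction t using Finset.induction_on with
  | empty => simpa using stable_one
  | insert a t ha ih =>
    rw [Finset.prod_insert ha]
    exact (hg a (by simp)).mul (ih fun i hi => hg i (by simp [hi]))

lemma stable_div_poly {p q : Polynomial ℝ} (hd : p.degree ≤ q.degree)
    (hq : ∀ s : ℂ, 0 ≤ s.re → Polynomial.aeval s q ≠ 0) :
    Stable (algebraMap _ (RatFunc ℝ) p / algebraMap _ (RatFunc ℝ) q) := by
  obtain ⟨c, -, h⟩ := exists_bound_div hd hq
  refine stable_of_bound (C := c) (Eventually.of_forall fun s hs => ?_)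
  rw [ev_div_poly p (hq s hs.le)]
  exact h s hs.le

lemma differentiableAt_ev {g : RatFunc ℝ} {s : ℂ} (hg : ¬ IsPole g s) :
    DifferentiableAt ℂ (ev g) s := by
  have h : ev g = fun s => Polynomial.aeval s g.num / Polynomial.aeval s g.denom := rfl
  rw [h]
  exact (g.num.differentiable_aeval s).div (g.denom.differentiable_aeval s) hg

end

section

/-! ### Evaluation of transfer matrices -/

/-- No entry of `A` has a pole at `s`. -/
def NoPole {m n : Type*} (A : RMat m n) (s : ℂ) : Prop := ∀ i j, ¬ IsPole (A i j) s

section Matrices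

variable {m n p : Type*} {s : ℂ}

lemma RHinf.noPole {A : RMat m n} (hA : RHinf A) (hs : 0 ≤ s.re) : NoPole A s :=
  fun i j => (hA i j).2 s hs

lemma eventually_noPole [Finite m] [Finite n] (A : RMat m n) :
    ∀ᶠ s : ℂ in cofinite, NoPole A s := by
  unfold NoPole
  simp only [eventually_all]
  exact fun i j => eventually_not_isPole (A i j)

lemma NoPole.mul [Fintype n] {A : RMat m n} {B : RMat n p} (hA : NoPole A s) (hB : NoPole B s) :
    NoPole (A * B) s := fun i j => by
  rw [Matrix.mul_apply]
  exact not_isPole_sum _ fun k _ => not_isPole_mul (hA i k) (hB k j)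

lemma NoPole.sub {A B : RMat m n} (hA : NoPole A s) (hB : NoPole B s) : NoPole (A - B) s :=
  fun i j => not_isPole_sub (hA i j) (hB i j)

lemma noPole_constM (A : Matrix m n ℝ) : NoPole (constM A) s := fun _ _ => not_isPole_C _ _

lemma evM_mul [Fintype n] {A : RMat m n} {B : RMat n p} (hA : NoPole A s) (hB : NoPole B s) :
    evM (A * B) s = evM A s * evM B s := by
  ext i j
  simp only [evM, Matrix.map_apply, Matrix.mul_apply]
  rw [ev_sum _ fun k _ => not_isPole_mul (hA i k) (hB k j)]
  exact Finset.sum_congr rfl fun k _ => ev_mul (hA i k) (hB k j)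

lemma evM_add {A B : RMat m n} (hA : NoPole A s) (hB : NoPole B s) :
    evM (A + B) s = evM A s + evM B s := by
  ext i j
  exact ev_add (hA i j) (hB i j)

lemma evM_sub {A B : RMat m n} (hA : NoPole A s) (hB : NoPole B s) :
    evM (A - B) s = evM A s - evM B s := by
  ext i j
  exact ev_sub (hA i j) (hB i j)

lemma evM_smul {g : RatFunc ℝ} {A : RMat m n} (hg : ¬ IsPole g s) (hA : NoPole A s) :
    evM (g • A) s = ev g s • evM A s := by
  ext i j
  exact ev_mul hg (hA i j)

@[simp] lemma evM_constM (A : Matrix m n ℝ) (s : ℂ) :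
    evM (constM A) s = A.map fun x => (x : ℂ) := by
  ext i j
  simp [evM, constM]

@[simp] lemma evM_one [DecidableEq m] (s : ℂ) : evM (1 : RMat m m) s = 1 := by
  ext i j
  by_cases h : i = j <;> simp [evM, Matrix.one_apply, h]

@[simp] lemma evM_zero (s : ℂ) : evM (0 : RMat m n) s = 0 := by
  ext i j
  simp [evM]

lemma evM_apply (A : RMat m n) (s : ℂ) (i : m) (j : n) : evM A s i j = ev (A i j) s := rfl

lemma evM_conj (A : RMat m n) (s : ℂ) : evM A (star s) = (evM A s).map star := by
  ext i j
  exact ev_conj _ _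

lemma evM_at_zero (A : RMat m n) : evM A 0 = (atZero A).map fun x => (x : ℂ) := by
  ext i j
  exact ev_zero_eq_ofReal _

lemma ev_prod {ι : Type*} (t : Finset ι) {g : ι → RatFunc ℝ}
    (hg : ∀ i ∈ t, ¬ IsPole (g i) s) :
    ¬ IsPole (∏ i ∈ t, g i) s ∧ ev (∏ i ∈ t, g i) s = ∏ i ∈ t, ev (g i) s := by
  classical
  induction t using Finset.induction_on with
  | empty => simpa using not_isPole_one s
  | insert a t ha ih =>
    have h := ih fun i hi => hg i (by simp [hi])
    rw [Finset.prod_insert ha, Finset.prod_insert ha, ev_mul (hg a (by simp)) h.1, h.2]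
    exact ⟨not_isPole_mul (hg a (by simp)) h.1, rfl⟩

variable [Fintype m] [DecidableEq m]

lemma ev_det_and {A : RMat m m} (hA : NoPole A s) :
    ¬ IsPole A.det s ∧ ev A.det s = (evM A s).det := by
  have h1 : ∀ σ : Equiv.Perm m, ¬ IsPole (((Equiv.Perm.sign σ : ℤ) : RatFunc ℝ) *
      ∏ i, A (σ i) i) s ∧ ev (((Equiv.Perm.sign σ : ℤ) : RatFunc ℝ) * ∏ i, A (σ i) i) s =
      ((Equiv.Perm.sign σ : ℤ) : ℂ) * ∏ i, evM A s (σ i) i := by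
    intro σ
    have h2 : ((Equiv.Perm.sign σ : ℤ) : RatFunc ℝ) =
        RatFunc.C ((Equiv.Perm.sign σ : ℤ) : ℝ) := by simp
    obtain ⟨h3, h4⟩ := ev_prod Finset.univ (s := s) (g := fun i => A (σ i) i) fun i _ => hA _ _
    rw [h2, ev_mul (not_isPole_C _ _) h3, h4, ev_C]
    exact ⟨not_isPole_mul (not_isPole_C _ _) h3, by simp [evM_apply]⟩
  rw [Matrix.det_apply', Matrix.det_apply', ev_sum _ fun σ _ => (h1 σ).1]
  exact ⟨not_isPole_sum _ fun σ _ => (h1 σ).1, Finset.sum_congr rfl fun σ _ => (h1 σ).2⟩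

lemma ev_det {A : RMat m m} (hA : NoPole A s) : ev A.det s = (evM A s).det := (ev_det_and hA).2

lemma eventually_evM_inv {A : RMat m m} (hA : A.det ≠ 0) :
    ∀ᶠ s : ℂ in cofinite, (evM A s).det ≠ 0 ∧ evM A⁻¹ s = (evM A s)⁻¹ := by
  filter_upwards [eventually_noPole A, eventually_noPole A⁻¹, eventually_ev_ne_zero hA]
    with s h1 h2 h3
  rw [ev_det h1] at h3
  refine ⟨h3, (Matrix.inv_eq_right_inv ?_).symm⟩
  rw [← evM_mul h1 h2, Matrix.mul_nonsing_inv _ (Ne.isUnit hA), evM_one]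

end Matrices

section RHinf

variable {m n p : Type*}

lemma RHinf.mul [Fintype n] {A : RMat m n} {B : RMat n p} (hA : RHinf A) (hB : RHinf B) :
    RHinf (A * B) := fun i j => by
  rw [Matrix.mul_apply]
  exact stable_sum _ fun k _ => (hA i k).mul (hB k j)

lemma RHinf.add {A B : RMat m n} (hA : RHinf A) (hB : RHinf B) : RHinf (A + B) :=
  fun i j => (hA i j).add (hB i j)

lemma RHinf.sub {A B : RMat m n} (hA : RHinf A) (hB : RHinf B) : RHinf (A - B) :=
  fun i j => (hA i j).sub (hB i j)

lemma RHinf.neg {A : RMat m n} (hA : RHinf A) : RHinf (-A) := fun i j => (hA i j).neg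

lemma RHinf.smul {g : RatFunc ℝ} {A : RMat m n} (hg : Stable g) (hA : RHinf A) :
    RHinf (g • A) := fun i j => hg.mul (hA i j)

lemma rHinf_constM (A : Matrix m n ℝ) : RHinf (constM A) := fun _ _ => stable_C _

lemma rHinf_zero : RHinf (0 : RMat m n) := fun _ _ => stable_zero

variable [DecidableEq m]

lemma rHinf_one : RHinf (1 : RMat m m) := fun i j => by
  by_cases h : i = j <;> simp [Matrix.one_apply, h, stable_one, stable_zero]

variable [Fintype m]

lemma RHinf.det {A : RMat m m} (hA : RHinf A) : Stable A.det := by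
  rw [Matrix.det_apply']
  refine stable_sum _ fun σ _ => Stable.mul ?_ (stable_prod _ fun i _ => hA _ _)
  have h2 : ((Equiv.Perm.sign σ : ℤ) : RatFunc ℝ) =
      RatFunc.C ((Equiv.Perm.sign σ : ℤ) : ℝ) := by simp
  rw [h2]
  exact stable_C _

lemma RHinf.adjugate {A : RMat m m} (hA : RHinf A) : RHinf A.adjugate := fun i j => by
  rw [Matrix.adjugate_apply]
  refine RHinf.det fun a b => ?_
  by_cases h : a = j
  · subst h
    by_cases hb : b = i
    · subst hb; simp [stable_one]
    · simp [hb, stable_zero]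
  · simp [Matrix.updateRow_ne h, hA a b]

lemma MinPhase.det_ne_zero {A : RMat m m} (hA : MinPhase A) : A.det ≠ 0 := by
  intro h
  have h1 := hA.2 1 (by simp)
  rw [← ev_det (hA.1.noPole (by simp)), h, ev_zero] at h1
  exact h1 rfl

end RHinf

end

section

/-! ### Square integrable analytic functions on the right half plane -/

/-- Functions that are analytic on the open right half plane, continuous up to the imaginary axis
and decay like `1 / |s|`. -/
structure IsH2 (f : ℂ → ℂ) : Prop where
  cont : ContinuousOn f {s | 0 ≤ s.re}
  diff : DifferentiableOn ℂ f {s | 0 < s.re}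
  bound : ∃ C : ℝ, ∀ s : ℂ, 0 ≤ s.re → ‖f s‖ ≤ C / (1 + ‖s‖)

lemma continuous_axis {f : ℂ → ℂ} (hf : ContinuousOn f {s | 0 ≤ s.re}) :
    Continuous fun ω : ℝ => f (ω * Complex.I) := by
  have h : Continuous fun ω : ℝ => (ω : ℂ) * Complex.I := by fun_prop
  exact hf.comp_continuous h fun ω => by simp

lemma norm_axis (ω : ℝ) : ‖(ω : ℂ) * Complex.I‖ = |ω| := by simp

lemma inv_one_add_abs_sq_le (ω : ℝ) : 1 / (1 + |ω|) ^ 2 ≤ (1 + ω ^ 2)⁻¹ := by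
  rw [one_div]
  apply inv_anti₀ (by positivity)
  nlinarith [abs_nonneg ω, sq_abs ω]

lemma integrable_axis_of_bound {f : ℂ → ℂ} (hf : ContinuousOn f {s | 0 ≤ s.re}) {C : ℝ}
    (hC : ∀ s : ℂ, 0 ≤ s.re → ‖f s‖ ≤ C / (1 + ‖s‖) ^ 2) :
    Integrable fun ω : ℝ => f (ω * Complex.I) := by
  have hC0 : 0 ≤ C := by
    have := (norm_nonneg _).trans (hC 0 (by simp))
    simpa using this
  refine (integrable_inv_one_add_sq.const_mul C).mono'
    (continuous_axis hf).aestronglyMeasurable (Eventually.of_forall fun ω => ?_)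
  refine (hC _ (by simp)).trans ?_
  rw [norm_axis, div_eq_mul_one_div]
  exact mul_le_mul_of_nonneg_left (inv_one_add_abs_sq_le ω) hC0

/-- Cauchy's theorem on the right half plane. -/
lemma integral_axis_eq_zero {f : ℂ → ℂ} (hf : ContinuousOn f {s | 0 ≤ s.re})
    (hd : DifferentiableOn ℂ f {s | 0 < s.re}) {C : ℝ}
    (hC : ∀ s : ℂ, 0 ≤ s.re → ‖f s‖ ≤ C / (1 + ‖s‖) ^ 2) :
    ∫ ω : ℝ, f (ω * Complex.I) = 0 := by
  have hint := integrable_axis_of_bound hf hC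
  have hC0 : 0 ≤ C := by
    have := (norm_nonneg _).trans (hC 0 (by simp))
    simpa using this
  have hlim := intervalIntegral_tendsto_integral hint tendsto_neg_atTop_atBot tendsto_id
  refine tendsto_nhds_unique hlim ?_
  rw [tendsto_zero_iff_norm_tendsto_zero]
  -- Cauchy's theorem is applied to the rectangle `[0, T] × [-T, T]`. Its three sides off the axis
  -- have total length `4T`, and the integrand there is at most `C / T²`.
  have hT : Tendsto (fun T : ℝ => 4 * C / T) atTop (𝓝 0) := tendsto_const_nhds.div_atTop tendsto_id
  refine squeeze_zero' (Eventually.of_forall fun _ => norm_nonneg _) ?_ hT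
  filter_upwards [eventually_gt_atTop (0 : ℝ)] with T hT
  have key := Complex.integral_boundary_rect_eq_zero_of_continuousOn_of_differentiableOn f
    (⟨0, -T⟩ : ℂ) (⟨T, T⟩ : ℂ) (hf.mono ?_) (hd.mono ?_)
  rotate_left
  · intro s hs
    rw [Complex.mem_reProdIm, Set.uIcc_of_le hT.le] at hs
    exact hs.1.1
  · intro s hs
    rw [Complex.mem_reProdIm, min_eq_left hT.le] at hs
    exact hs.1.1
  have hb : ∀ s : ℂ, 0 ≤ s.re → T ≤ ‖s‖ → ‖f s‖ ≤ C / T ^ 2 := fun s hs hTs =>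
    (hC s hs).trans (div_le_div_of_nonneg_left hC0 (by positivity)
      (pow_le_pow_left₀ hT.le (by linarith) 2))
  have h1 : ‖∫ x : ℝ in (0)..T, f (x + ((-T : ℝ) : ℂ) * Complex.I)‖ ≤ C / T ^ 2 * |T - 0| := by
    refine intervalIntegral.norm_integral_le_of_norm_le_const fun x hx => ?_
    rw [Set.uIoc_of_le hT.le] at hx
    refine hb _ (by simpa using hx.1.le) ?_
    refine le_trans ?_ (Complex.abs_im_le_norm _)
    simp [abs_of_pos hT]
  have h2 : ‖∫ x : ℝ in (0)..T, f (x + (T : ℂ) * Complex.I)‖ ≤ C / T ^ 2 * |T - 0| := by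
    refine intervalIntegral.norm_integral_le_of_norm_le_const fun x hx => ?_
    rw [Set.uIoc_of_le hT.le] at hx
    refine hb _ (by simpa using hx.1.le) ?_
    refine le_trans ?_ (Complex.abs_im_le_norm _)
    simp [abs_of_pos hT]
  have h3 : ‖∫ y : ℝ in (-T)..T, f ((T : ℂ) + y * Complex.I)‖ ≤ C / T ^ 2 * |T - -T| := by
    refine intervalIntegral.norm_integral_le_of_norm_le_const fun x _ => ?_
    refine hb _ (by simpa using hT.le) ?_
    refine le_trans ?_ (Complex.abs_re_le_norm _)
    simp [abs_of_pos hT]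
  simp only [Complex.ofReal_zero, zero_add, smul_eq_mul] at key
  have h4 : Complex.I * ∫ y : ℝ in (-T)..T, f (y * Complex.I) =
      (∫ x : ℝ in (0)..T, f (x + ((-T : ℝ) : ℂ) * Complex.I)) -
      (∫ x : ℝ in (0)..T, f (x + (T : ℂ) * Complex.I)) +
      Complex.I * ∫ y : ℝ in (-T)..T, f ((T : ℂ) + y * Complex.I) := by
    linear_combination -key
  have h5 := congrArg norm h4
  rw [norm_mul, Complex.norm_I, one_mul] at h5
  simp only [id]
  rw [h5]
  refine (norm_add_le _ _).trans ((add_le_add (norm_sub_le _ _) le_rfl).trans ?_)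
  rw [norm_mul, Complex.norm_I, one_mul]
  refine (add_le_add (add_le_add h1 h2) h3).trans (le_of_eq ?_)
  rw [sub_zero, sub_neg_eq_add, abs_of_pos hT, abs_of_pos (by linarith)]
  field_simp
  ring

namespace IsH2

lemma exists_bound {f : ℂ → ℂ} (hf : IsH2 f) :
    ∃ C : ℝ, 0 ≤ C ∧ ∀ s : ℂ, 0 ≤ s.re → ‖f s‖ ≤ C / (1 + ‖s‖) := by
  obtain ⟨C, hC⟩ := hf.bound
  refine ⟨C, ?_, hC⟩
  have := (norm_nonneg _).trans (hC 0 (by simp))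
  simpa using this

lemma zero : IsH2 fun _ => 0 :=
  ⟨continuousOn_const, differentiableOn_const _, 0, fun s _ => by simp⟩

lemma add {f g : ℂ → ℂ} (hf : IsH2 f) (hg : IsH2 g) : IsH2 fun s => f s + g s := by
  obtain ⟨c, hc⟩ := hf.bound
  obtain ⟨d, hd⟩ := hg.bound
  refine ⟨hf.cont.add hg.cont, hf.diff.add hg.diff, c + d, fun s hs => ?_⟩
  rw [add_div]
  exact (norm_add_le _ _).trans (add_le_add (hc s hs) (hd s hs))

lemma const_mul {f : ℂ → ℂ} (hf : IsH2 f) (a : ℂ) : IsH2 fun s => a * f s := by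
  obtain ⟨c, hc⟩ := hf.bound
  refine ⟨continuousOn_const.mul hf.cont, hf.diff.const_mul a, ‖a‖ * c, fun s hs => ?_⟩
  rw [norm_mul, mul_div_assoc]
  exact mul_le_mul_of_nonneg_left (hc s hs) (norm_nonneg _)

lemma mul_const {f : ℂ → ℂ} (hf : IsH2 f) (a : ℂ) : IsH2 fun s => f s * a := by
  simpa only [mul_comm] using hf.const_mul a

lemma sub {f g : ℂ → ℂ} (hf : IsH2 f) (hg : IsH2 g) : IsH2 fun s => f s - g s := by
  simpa [sub_eq_add_neg] using hf.add (hg.const_mul (-1))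

lemma sum {ι : Type*} (t : Finset ι) {f : ι → ℂ → ℂ} (hf : ∀ i ∈ t, IsH2 (f i)) :
    IsH2 fun s => ∑ i ∈ t, f i s := by
  classical
  induction t using Finset.induction_on with
  | empty => simpa using zero
  | insert a t ha ih =>
    simp only [Finset.sum_insert ha]
    exact (hf a (by simp)).add (ih fun i hi => hf i (by simp [hi]))

lemma continuous_axis {f : ℂ → ℂ} (hf : IsH2 f) : Continuous fun ω : ℝ => f (ω * Complex.I) :=
  Tracking.continuous_axis hf.cont

/-- The product of two functions in the Hardy class integrates to zero along the axis. -/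
lemma integral_mul {f g : ℂ → ℂ} (hf : IsH2 f) (hg : IsH2 g) :
    Integrable (fun ω : ℝ => f (ω * Complex.I) * g (ω * Complex.I)) ∧
    ∫ ω : ℝ, f (ω * Complex.I) * g (ω * Complex.I) = 0 := by
  obtain ⟨c, hc0, hc⟩ := hf.exists_bound
  obtain ⟨d, hd0, hd⟩ := hg.exists_bound
  have hb : ∀ s : ℂ, 0 ≤ s.re → ‖f s * g s‖ ≤ c * d / (1 + ‖s‖) ^ 2 := fun s hs => by
    rw [norm_mul]
    refine (mul_le_mul (hc s hs) (hd s hs) (norm_nonneg _) (by positivity)).trans (le_of_eq ?_)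
    field_simp
  exact ⟨integrable_axis_of_bound (f := fun s => f s * g s) (hf.cont.mul hg.cont) hb,
    integral_axis_eq_zero (f := fun s => f s * g s) (hf.cont.mul hg.cont)
      (hf.diff.mul hg.diff) hb⟩

lemma norm_sq_axis_le {f : ℂ → ℂ} (hf : IsH2 f) :
    ∃ C : ℝ, 0 ≤ C ∧ ∀ ω : ℝ, ‖f (ω * Complex.I)‖ ^ 2 ≤ C * (1 + ω ^ 2)⁻¹ := by
  obtain ⟨c, hc0, hc⟩ := hf.exists_bound
  refine ⟨c ^ 2, by positivity, fun ω => ?_⟩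
  have h := hc (ω * Complex.I) (by simp)
  rw [norm_axis] at h
  calc ‖f (ω * Complex.I)‖ ^ 2 ≤ (c / (1 + |ω|)) ^ 2 := pow_le_pow_left₀ (norm_nonneg _) h 2
    _ = c ^ 2 * (1 / (1 + |ω|) ^ 2) := by field_simp
    _ ≤ _ := mul_le_mul_of_nonneg_left (inv_one_add_abs_sq_le ω) (by positivity)

lemma integrable_norm_sq {f : ℂ → ℂ} (hf : IsH2 f) :
    Integrable fun ω : ℝ => ‖f (ω * Complex.I)‖ ^ 2 := by
  obtain ⟨c, hc0, hc⟩ := hf.norm_sq_axis_le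
  refine (integrable_inv_one_add_sq.const_mul c).mono'
    (hf.continuous_axis.norm.pow 2).aestronglyMeasurable (Eventually.of_forall fun ω => ?_)
  rw [Real.norm_of_nonneg (by positivity)]
  exact hc ω

lemma inv_add {a : ℂ} (ha : 0 < a.re) : IsH2 fun s => 1 / (a + s) := by
  have hre : ∀ s : ℂ, 0 ≤ s.re → a.re ≤ ‖a + s‖ := fun s hs =>
    le_trans (by simpa using hs) ((le_abs_self _).trans (Complex.abs_re_le_norm (a + s)))
  have hne : ∀ s : ℂ, 0 ≤ s.re → a + s ≠ 0 := fun s hs h => by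
    have := hre s hs
    rw [h, norm_zero] at this
    linarith
  refine ⟨?_, ?_, (1 + ‖a‖) / a.re + 1, fun s hs => ?_⟩
  · exact continuousOn_const.div (by fun_prop) fun s hs => hne s hs
  · exact (differentiableOn_const _).div (by fun_prop) fun s hs => hne s (le_of_lt hs)
  · have h1 := hre s hs
    have h2 : ‖s‖ ≤ ‖a + s‖ + ‖a‖ := by
      have := norm_sub_le (a + s) a
      simpa using this
    have h3 : 0 < ‖a + s‖ := lt_of_lt_of_le ha h1
    rw [norm_div, norm_one, div_le_div_iff₀ h3 (by positivity), one_mul, add_mul, one_mul,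
      div_mul_eq_mul_div]
    have h4 : 1 + ‖a‖ ≤ (1 + ‖a‖) * ‖a + s‖ / a.re := by
      rw [le_div_iff₀ ha]
      exact mul_le_mul_of_nonneg_left h1 (by positivity)
    linarith

lemma of_stable {g : RatFunc ℝ} (hg : Stable g) (hs : StrictlyProper g) : IsH2 (ev g) := by
  obtain ⟨C, -, hC⟩ := hg.exists_bound_of_strictlyProper hs
  exact ⟨fun s h => (differentiableAt_ev (hg.2 s h)).continuousAt.continuousWithinAt,
    fun s h => (differentiableAt_ev (hg.2 s (le_of_lt h))).differentiableWithinAt, C, hC⟩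

/-- The difference quotient at `z` is what remains of `f(s) / (s - z)` once the pole is split off,
so this lemma supplies the Hardy part of `T D⁻¹`. Near `z` compactness bounds it; away from `z` the
factor `1 / (s - z)` gives the decay. -/
lemma dslope {f : ℂ → ℂ} (hf : IsH2 f) {z : ℂ} (hz : 0 < z.re) : IsH2 (dslope f z) := by
  have ho : IsOpen {s : ℂ | 0 < s.re} := isOpen_lt continuous_const Complex.continuous_re
  have hn : {s : ℂ | 0 < s.re} ∈ 𝓝 z := ho.mem_nhds hz
  have hn' : {s : ℂ | 0 ≤ s.re} ∈ 𝓝 z := mem_of_superset hn fun s (hs : 0 < s.re) => show 0 ≤ s.re from hs.le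
  have hcont : ContinuousOn (_root_.dslope f z) {s | 0 ≤ s.re} :=
    (continuousOn_dslope hn').2 ⟨hf.cont, (hf.diff.differentiableAt hn)⟩
  refine ⟨hcont, (Complex.differentiableOn_dslope hn).2 hf.diff, ?_⟩
  obtain ⟨C, hC0, hC⟩ := hf.exists_bound
  obtain ⟨c, hc⟩ := ((isCompact_closedBall z z.re).inter_right
    (isClosed_le continuous_const Complex.continuous_re :
      IsClosed {s : ℂ | 0 ≤ s.re})).exists_bound_of_continuousOn
    (hcont.mono Set.inter_subset_right)
  have hc0 : 0 ≤ c := (norm_nonneg _).trans (hc z ⟨by simp [hz.le], hz.le⟩)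
  refine ⟨c * (1 + ‖z‖ + z.re) + 2 * C * ((1 + ‖z‖) / z.re + 1), fun s hs => ?_⟩
  rw [le_div_iff₀ (by positivity)]
  have hsn : ‖s‖ ≤ ‖z‖ + ‖s - z‖ := by
    have := norm_add_le z (s - z)
    simpa using this
  by_cases h : ‖s - z‖ ≤ z.re
  · have h1 := hc s ⟨by simpa [dist_eq_norm] using h, hs⟩
    have h2 : ‖_root_.dslope f z s‖ * (1 + ‖s‖) ≤ c * (1 + ‖z‖ + z.re) :=
      mul_le_mul h1 (by linarith) (by positivity) hc0
    have h3 : 0 ≤ 2 * C * ((1 + ‖z‖) / z.re + 1) := by positivity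
    linarith
  · push Not at h
    have hne : s ≠ z := by rintro rfl; simp at h; linarith
    have hp : 0 < ‖s - z‖ := hz.trans h
    have hCb : ∀ s : ℂ, 0 ≤ s.re → ‖f s‖ ≤ C := fun s hs =>
      (hC s hs).trans (div_le_self hC0 (by linarith [norm_nonneg s]))
    have h1 : ‖_root_.dslope f z s‖ * ‖s - z‖ ≤ 2 * C := by
      rw [dslope_of_ne _ hne, slope_def_field, norm_div, div_mul_cancel₀ _ hp.ne']
      refine (norm_sub_le _ _).trans ?_
      linarith [hCb s hs, hCb z hz.le]
    have h2 : 1 + ‖s‖ ≤ ((1 + ‖z‖) / z.re + 1) * ‖s - z‖ := by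
      have : 1 + ‖z‖ ≤ (1 + ‖z‖) / z.re * ‖s - z‖ := by
        rw [div_mul_eq_mul_div, le_div_iff₀ hz]
        exact mul_le_mul_of_nonneg_left h.le (by positivity)
      linarith
    have h3 : ‖_root_.dslope f z s‖ * (1 + ‖s‖) ≤ 2 * C * ((1 + ‖z‖) / z.re + 1) := by
      calc _ ≤ ‖_root_.dslope f z s‖ * (((1 + ‖z‖) / z.re + 1) * ‖s - z‖) :=
            mul_le_mul_of_nonneg_left h2 (norm_nonneg _)
        _ = (‖_root_.dslope f z s‖ * ‖s - z‖) * ((1 + ‖z‖) / z.re + 1) := by ring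
        _ ≤ _ := mul_le_mul_of_nonneg_right h1 (by positivity)
    have h4 : 0 ≤ c * (1 + ‖z‖ + z.re) := by positivity
    linarith

end IsH2

lemma integral_inv_normSq_sub {b : ℂ} (hb : 0 < b.re) :
    ∫ ω : ℝ, (‖b - ω * Complex.I‖ ^ 2)⁻¹ = Real.pi / b.re := by
  have h : ∀ ω : ℝ, (‖b - ω * Complex.I‖ ^ 2)⁻¹ =
      (b.re ^ 2)⁻¹ * (1 + ((ω - b.im) / b.re) ^ 2)⁻¹ := by
    intro ω
    rw [← Complex.normSq_eq_norm_sq, Complex.normSq_apply, ← mul_inv]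
    congr 1
    simp
    field_simp
    ring
  simp_rw [h]
  rw [integral_const_mul, integral_sub_right_eq_self
    (fun x : ℝ => (1 + (x / b.re) ^ 2)⁻¹) b.im,
    Measure.integral_comp_div (fun x : ℝ => (1 + x ^ 2)⁻¹) b.re, integral_univ_inv_one_add_sq,
    abs_of_pos hb, smul_eq_mul]
  field_simp

/-- The inner product of two antistable first order kernels. -/
lemma integral_kernel {a b : ℂ} (ha : 0 < a.re) (hb : 0 < b.re) :
    Integrable (fun ω : ℝ => 1 / ((a + ω * Complex.I) * (b - ω * Complex.I))) ∧
    ∫ ω : ℝ, 1 / ((a + ω * Complex.I) * (b - ω * Complex.I)) = 2 * Real.pi / (a + b) := by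
  have hb' : 0 < (star b).re := by simpa using hb
  have hab : a + b ≠ 0 := fun h => by
    have := congrArg Complex.re h
    simp at this
    linarith
  have hne : ∀ (c : ℂ) (_ : 0 < c.re) (ω : ℝ), c + ω * Complex.I ≠ 0 := fun c hc ω h => by
    have := congrArg Complex.re h
    simp at this
    linarith
  have hne' : ∀ ω : ℝ, b - ω * Complex.I ≠ 0 := fun ω h => by
    have := congrArg Complex.re h
    simp at this
    linarith
  obtain ⟨hi1, hz1⟩ := (IsH2.inv_add ha).integral_mul (IsH2.inv_add hb')
  have hsq : ∀ ω : ℝ, (star b + ω * Complex.I) * (b - ω * Complex.I) =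
      ((‖b - ω * Complex.I‖ ^ 2 : ℝ) : ℂ) := by
    intro ω
    rw [← Complex.normSq_eq_norm_sq, ← Complex.mul_conj, mul_comm]
    simp
  -- The integral of a function that is not integrable is `0` by convention, so its nonzero value
  -- already proves integrability.
  have hi2 : Integrable fun ω : ℝ => (‖b - ω * Complex.I‖ ^ 2)⁻¹ := by
    by_contra h
    have h1 := integral_inv_normSq_sub hb
    rw [integral_undef h] at h1
    have := div_pos Real.pi_pos hb
    linarith
  -- Partial fractions relative to `star b + iω`: the kernel is a multiple of the Poisson kernel `1
  -- / |b - iω|²` plus a product of two Hardy functions, and the latter integrates to zero.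
  have heq : ∀ ω : ℝ, 1 / ((a + ω * Complex.I) * (b - ω * Complex.I)) =
      (2 * b.re / (a + b)) * (((‖b - ω * Complex.I‖ ^ 2)⁻¹ : ℝ) : ℂ) -
      ((a - star b) / (a + b)) * (1 / (a + ω * Complex.I) * (1 / (star b + ω * Complex.I))) := by
    intro ω
    have h1 := hne a ha ω
    have h2 := hne _ hb' ω
    have h3 := hne' ω
    rw [Complex.ofReal_inv, ← hsq]
    have h4 : (2 * b.re : ℂ) = b + star b := by
      simpa using (Complex.add_conj b).symm
    rw [h4]
    field_simp
    ring
  simp_rw [heq]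
  have hi3 : Integrable fun ω : ℝ =>
      (2 * b.re / (a + b) : ℂ) * (((‖b - ω * Complex.I‖ ^ 2)⁻¹ : ℝ) : ℂ) :=
    hi2.ofReal.const_mul _
  have hi4 := hi1.const_mul ((a - star b) / (a + b))
  refine ⟨hi3.sub hi4, ?_⟩
  rw [integral_sub hi3 hi4, integral_const_mul, integral_const_mul, hz1, mul_zero, sub_zero,
    integral_complex_ofReal, integral_inv_normSq_sub hb]
  have hbr : (b.re : ℂ) ≠ 0 := by exact_mod_cast hb.ne'
  push_cast
  field_simp

/-! ### Division by the Laplace variable and the half residue at the origin -/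

lemma Stable.div_X {k : RatFunc ℝ} (hk : Stable k) (h0 : ev k 0 = 0) :
    Stable (k / RatFunc.X) ∧ StrictlyProper (k / RatFunc.X) ∧
      ∀ s : ℂ, 0 ≤ s.re → s * ev (k / RatFunc.X) s = ev k s := by
  have hp0 : ¬ IsPole k 0 := hk.2 0 (by simp)
  have hn : Polynomial.X ∣ k.num := by
    rw [Polynomial.X_dvd_iff, Polynomial.coeff_zero_eq_eval_zero]
    rw [ev_eq_div, div_eq_zero_iff] at h0
    have h1 := h0.resolve_right hp0
    have h2 := Polynomial.aeval_algebraMap_apply_eq_algebraMap_eval (A := ℂ) (0 : ℝ) k.num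
    rw [map_zero, h1] at h2
    simpa using h2.symm
  obtain ⟨p, hp⟩ := hn
  have hk2 : k / RatFunc.X = algebraMap _ (RatFunc ℝ) p / algebraMap _ (RatFunc ℝ) k.denom := by
    have h1 := RatFunc.num_div_denom k
    rw [hp, map_mul, RatFunc.algebraMap_X] at h1
    have hX := RatFunc.X_ne_zero (K := ℝ)
    rw [div_eq_iff hX]
    conv_lhs => rw [← h1]
    ring
  have hd : p.degree ≤ k.denom.degree := by
    refine le_trans ?_ hk.1
    rw [hp, Polynomial.degree_mul, Polynomial.degree_X]
    exact le_add_of_nonneg_left (by simp)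
  have hst : Stable (k / RatFunc.X) := by
    rw [hk2]
    exact stable_div_poly hd hk.2
  have hmul : ∀ s : ℂ, 0 ≤ s.re → s * ev (k / RatFunc.X) s = ev k s := by
    intro s hs
    have h1 : k = RatFunc.X * (k / RatFunc.X) := by
      rw [mul_div_cancel₀]
      exact RatFunc.X_ne_zero
    conv_rhs => rw [h1, ev_mul (not_isPole_X s) (hst.2 s hs), ev_X]
  refine ⟨hst, ?_, hmul⟩
  obtain ⟨C, -, hC⟩ := hk.exists_bound
  refine strictlyProper_of_bound (C := C) (Eventually.of_forall fun s hs => ?_)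
  rw [hmul s hs.le]
  exact hC s hs.le

lemma Stable.exists_bound_div_X {g : RatFunc ℝ} (hg : Stable g) (hs : StrictlyProper g)
    (h0 : ev g 0 = 0) :
    ∃ C : ℝ, ∀ s : ℂ, 0 ≤ s.re → ‖ev (g / RatFunc.X) s‖ ≤ C / (1 + ‖s‖) ^ 2 := by
  obtain ⟨h1, -, h3⟩ := hg.div_X h0
  obtain ⟨c, hc0, hc⟩ := hg.exists_bound_of_strictlyProper hs
  obtain ⟨d, hd0, hd⟩ := h1.exists_bound
  refine ⟨4 * d + 2 * c, fun s hs => ?_⟩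
  rw [le_div_iff₀ (by positivity)]
  have hd' := hd s hs
  by_cases h : ‖s‖ ≤ 1
  · have h2 : (1 + ‖s‖) ^ 2 ≤ 4 := by nlinarith [norm_nonneg s]
    have := mul_le_mul hd' h2 (by positivity) hd0.le
    linarith
  · push Not at h
    have h4 := hc s hs
    rw [← h3 s hs, le_div_iff₀ (by positivity), norm_mul] at h4
    have h5 : ‖ev (g / RatFunc.X) s‖ * (1 + ‖s‖) ^ 2 ≤
        2 * (‖s‖ * ‖ev (g / RatFunc.X) s‖ * (1 + ‖s‖)) := by
      have : 0 ≤ ‖ev (g / RatFunc.X) s‖ * (1 + ‖s‖) := by positivity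
      nlinarith
    linarith

/-- Write `k = s h` and subtract `h(0) / (1 + s)` from `h`. What is left is divisible by `s`, with a
quotient that decays quadratically and contributes nothing by Cauchy's theorem. The subtracted term
contributes `h(0) ∫ 1 / (1 + ω²) = π h(0)`, and `h(0)` is real because the coefficients are. -/
lemma half_residue {k : RatFunc ℝ} (hk : Stable k) (h0 : ev k 0 = 0) :
    Integrable (fun ω : ℝ => (ev k (ω * Complex.I)).re / ω ^ 2) ∧
    ∫ ω : ℝ, (ev k (ω * Complex.I)).re / ω ^ 2 = Real.pi * (ev (k / RatFunc.X) 0).re := by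
  obtain ⟨hh, hhs, hmul⟩ := hk.div_X h0
  set h := k / RatFunc.X with hh_def
  set h₀ : ℝ := RatFunc.eval (RingHom.id ℝ) 0 h with hh0
  have hev0 : ev h 0 = h₀ := ev_zero_eq_ofReal h
  set e : RatFunc ℝ := algebraMap (Polynomial ℝ) (RatFunc ℝ) 1 /
    algebraMap (Polynomial ℝ) (RatFunc ℝ) (1 + Polynomial.X) with he
  have hne : ∀ s : ℂ, 0 ≤ s.re → Polynomial.aeval s (1 + Polynomial.X : Polynomial ℝ) ≠ 0 := by
    intro s hs h1
    have := congrArg Complex.re h1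
    simp at this
    linarith
  have hdeg : (1 + Polynomial.X : Polynomial ℝ).degree = 1 := by
    rw [add_comm]; exact Polynomial.degree_X_add_C 1
  have hes : Stable e := stable_div_poly (by rw [hdeg]; simp) hne
  have hee : ∀ s : ℂ, 0 ≤ s.re → ev e s = 1 / (1 + s) := fun s hs => by
    rw [he, ev_div_poly _ (hne s hs)]
    simp
  have hesp : StrictlyProper e := by
    refine strictlyProper_of_bound (C := 1) (Eventually.of_forall fun s hs => ?_)
    rw [hee s hs.le, mul_one_div, norm_div]
    refine div_le_one_of_le₀ ?_ (norm_nonneg _)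
    rw [Complex.norm_def, Complex.norm_def]
    apply Real.sqrt_le_sqrt
    simp only [Complex.normSq_apply, Complex.add_re, Complex.one_re, Complex.add_im,
      Complex.one_im]
    nlinarith
  set q : RatFunc ℝ := h - RatFunc.C h₀ * e with hq
  have hqs : Stable q := hh.sub ((stable_C _).mul hes)
  have hqe : ∀ s : ℂ, 0 ≤ s.re → ev q s = ev h s - h₀ / (1 + s) := fun s hs => by
    rw [hq, ev_sub (hh.2 s hs) (((stable_C _).mul hes).2 s hs),
      ev_mul (not_isPole_C _ _) (hes.2 s hs), ev_C, hee s hs, mul_one_div]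
  have hq0 : ev q 0 = 0 := by rw [hqe 0 (by simp), hev0]; simp
  have hqsp : StrictlyProper q := by
    have h1 := (IsH2.of_stable hh hhs).sub ((IsH2.of_stable hes hesp).const_mul h₀)
    obtain ⟨C, hC0, hC⟩ := h1.exists_bound
    refine strictlyProper_of_bound (C := C) (Eventually.of_forall fun s hs => ?_)
    have h2 := hC s hs.le
    rw [hee s hs.le, mul_one_div, ← hqe s hs.le, le_div_iff₀ (by positivity)] at h2
    rw [norm_mul]
    nlinarith [norm_nonneg (ev q s)]
  obtain ⟨hps, -, hpmul⟩ := hqs.div_X hq0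
  obtain ⟨C, hC⟩ := hqs.exists_bound_div_X hqsp hq0
  have hcont : ContinuousOn (ev (q / RatFunc.X)) {s | 0 ≤ s.re} := fun s hs =>
    (differentiableAt_ev (hps.2 s hs)).continuousAt.continuousWithinAt
  have hdiff : DifferentiableOn ℂ (ev (q / RatFunc.X)) {s | 0 < s.re} := fun s hs =>
    (differentiableAt_ev (hps.2 s (le_of_lt hs))).differentiableWithinAt
  have hint := integrable_axis_of_bound hcont hC
  have hzero := integral_axis_eq_zero hcont hdiff hC
  have hae : (fun ω : ℝ => (ev k (ω * Complex.I)).re / ω ^ 2) =ᵐ[volume]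
      fun ω : ℝ => h₀ * (1 + ω ^ 2)⁻¹ - (ev (q / RatFunc.X) (ω * Complex.I)).re := by
    filter_upwards [Measure.ae_ne volume (0 : ℝ)] with ω hω
    have hs : 0 ≤ ((ω : ℂ) * Complex.I).re := by simp
    have h1 : (1 + (ω : ℂ) * Complex.I) ≠ 0 := by
      have := hne _ hs
      simpa using this
    have hωI : (ω : ℂ) * Complex.I ≠ 0 := by simp [hω]
    have h2 : ev k (ω * Complex.I) = -(ω : ℂ) ^ 2 * ev (q / RatFunc.X) (ω * Complex.I) +
        (ω : ℂ) * Complex.I * (h₀ / (1 + ω * Complex.I)) := by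
      rw [← hmul _ hs]
      have h3 := hpmul _ hs
      rw [hqe _ hs] at h3
      have h4 : ev h (ω * Complex.I) = ω * Complex.I * ev (q / RatFunc.X) (ω * Complex.I) +
        h₀ / (1 + ω * Complex.I) := by rw [h3]; ring
      rw [h4]
      linear_combination (ω : ℂ) ^ 2 * ev (q / RatFunc.X) (ω * Complex.I) * Complex.I_sq
    have h5 : (ω : ℂ) * Complex.I * (h₀ / (1 + ω * Complex.I)) =
        ((h₀ * ω ^ 2 / (1 + ω ^ 2) : ℝ) : ℂ) + ((h₀ * ω / (1 + ω ^ 2) : ℝ) : ℂ) * Complex.I := by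
      have h6 : (1 + (ω : ℂ) ^ 2) ≠ 0 := by
        norm_cast; positivity
      push_cast
      field_simp
      linear_combination (-(ω : ℂ) ^ 2 * h₀) * Complex.I_sq
    rw [h2, h5]
    have h7 : (-(ω : ℂ) ^ 2 * ev (q / RatFunc.X) (ω * Complex.I)).re =
        -ω ^ 2 * (ev (q / RatFunc.X) (ω * Complex.I)).re := by
      rw [show (-(ω : ℂ) ^ 2) = ((-ω ^ 2 : ℝ) : ℂ) by push_cast; ring, Complex.re_ofReal_mul]
    simp only [Complex.add_re, h7, Complex.ofReal_re, Complex.re_ofReal_mul, Complex.I_re,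
      mul_zero, add_zero]
    have : 1 + ω ^ 2 ≠ 0 := by positivity
    field_simp
    ring
  have hi1 : Integrable fun ω : ℝ => h₀ * (1 + ω ^ 2)⁻¹ := integrable_inv_one_add_sq.const_mul h₀
  have hre : ∫ ω : ℝ, (ev (q / RatFunc.X) (ω * Complex.I)).re = 0 := by
    have := integral_re hint
    rw [hzero] at this
    simpa using this
  have hi2 : Integrable fun ω : ℝ => (ev (q / RatFunc.X) (ω * Complex.I)).re := hint.re
  refine ⟨(hi1.sub hi2).congr hae.symm, ?_⟩
  rw [integral_congr_ae hae, integral_sub hi1 hi2, hre, integral_const_mul,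
    integral_univ_inv_one_add_sq, hev0, sub_zero, Complex.ofReal_re, mul_comm]

end

section

/-! ### Logarithmic integrals of minimum phase polynomials -/

lemma abs_log_norm_one_add_le {u : ℂ} (hu : ‖u‖ ≤ 1 / 2) :
    |Real.log ‖1 + u‖| ≤ 3 / 2 * ‖u‖ := by
  rw [← Complex.log_re]
  exact (Complex.abs_re_le_norm _).trans (Complex.norm_log_one_add_half_le_self hu)

/-- Near `0` the logarithm is of order `x²`, so the integrand is bounded. On a compact middle range
the logarithm of the modulus of an analytic function is integrable even across its zeros. At
infinity the logarithm grows more slowly than `√x`, which leaves `x^(-3/2)`. -/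
lemma integrableOn_log_quadratic (c : ℂ) :
    IntegrableOn (fun x : ℝ => Real.log ‖1 + c ^ 2 * x ^ 2‖ / x ^ 2) (Set.Ioi 0) := by
  by_cases hc : c = 0
  · simp [hc]
  have hcp : 0 < ‖c‖ := norm_pos_iff.2 hc
  have hmeas : Measurable fun x : ℝ => Real.log ‖1 + c ^ 2 * (x : ℂ) ^ 2‖ / x ^ 2 := by
    fun_prop
  set δ : ℝ := 1 / (2 * ‖c‖) with hδ
  have hδ0 : 0 < δ := by positivity
  set X : ℝ := max (2 / ‖c‖) (max 1 δ) with hX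
  have hX1 : 1 ≤ X := (le_max_left _ _).trans (le_max_right _ _)
  have hXδ : δ ≤ X := (le_max_right _ _).trans (le_max_right _ _)
  have hXc : 2 / ‖c‖ ≤ X := le_max_left _ _
  have h1 : IntegrableOn (fun x : ℝ => Real.log ‖1 + c ^ 2 * x ^ 2‖ / x ^ 2) (Set.Ioc 0 δ) := by
    refine Measure.integrableOn_of_bounded (M := 3 / 2 * ‖c‖ ^ 2) (by simp)
      hmeas.aestronglyMeasurable ?_
    filter_upwards [ae_restrict_mem measurableSet_Ioc] with x hx
    have hx2 : ‖c ^ 2 * (x : ℂ) ^ 2‖ = ‖c‖ ^ 2 * x ^ 2 := by simp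
    have hle : ‖c ^ 2 * (x : ℂ) ^ 2‖ ≤ 1 / 2 := by
      rw [hx2]
      have h3 : ‖c‖ * x ≤ 1 / 2 := by
        have := mul_le_mul_of_nonneg_left hx.2 hcp.le
        rw [hδ] at this
        refine this.trans (le_of_eq ?_)
        field_simp
      have h4 : 0 ≤ ‖c‖ * x := mul_nonneg hcp.le hx.1.le
      nlinarith
    have h5 := abs_log_norm_one_add_le hle
    have hxp : 0 < x ^ 2 := pow_pos hx.1 2
    rw [Real.norm_eq_abs, abs_div, abs_of_pos hxp, div_le_iff₀ hxp]
    rw [hx2] at h5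
    linarith
  have h2 : IntegrableOn (fun x : ℝ => Real.log ‖1 + c ^ 2 * x ^ 2‖ / x ^ 2) (Set.Ioc δ X) := by
    have hm : MeromorphicOn (fun x : ℝ => 1 + c ^ 2 * (x : ℂ) ^ 2) (Set.uIcc δ X) := by
      intro x _
      have : AnalyticAt ℝ (fun x : ℝ => (x : ℂ)) x := Complex.ofRealCLM.analyticAt x
      exact (analyticAt_const.add (analyticAt_const.mul (this.pow 2))).meromorphicAt
    have h3 := hm.intervalIntegrable_log_norm
    have h4 := h3.mul_continuousOn (g := fun x : ℝ => (x ^ 2)⁻¹) (by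
      refine ContinuousOn.inv₀ (by fun_prop) fun x hx => ?_
      rw [Set.uIcc_of_le hXδ] at hx
      exact (pow_pos (hδ0.trans_le hx.1) 2).ne')
    rw [intervalIntegrable_iff_integrableOn_Ioc_of_le hXδ] at h4
    exact h4
  have h3 : IntegrableOn (fun x : ℝ => Real.log ‖1 + c ^ 2 * x ^ 2‖ / x ^ 2) (Set.Ioi X) := by
    have hi : IntegrableOn (fun x : ℝ => (Real.log (1 + ‖c‖ ^ 2) + 4) * x ^ (-(3 / 2) : ℝ))
        (Set.Ioi X) :=
      (integrableOn_Ioi_rpow_of_lt (by norm_num) (by linarith)).const_mul _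
    refine Integrable.mono' hi hmeas.aestronglyMeasurable ?_
    filter_upwards [ae_restrict_mem measurableSet_Ioi] with x hx
    have hxX : X < x := hx
    have hx1 : 1 ≤ x := hX1.trans hxX.le
    have hx0 : 0 < x := by linarith
    have hcx : 2 ≤ ‖c‖ * x := by
      have := hXc.trans hxX.le
      rwa [div_le_iff₀ hcp, mul_comm] at this
    have hx2 : ‖c ^ 2 * (x : ℂ) ^ 2‖ = ‖c‖ ^ 2 * x ^ 2 := by simp
    have hge : 1 ≤ ‖1 + c ^ 2 * (x : ℂ) ^ 2‖ := by
      have := norm_sub_norm_le (c ^ 2 * (x : ℂ) ^ 2) (-1)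
      rw [hx2, norm_neg, norm_one, sub_neg_eq_add, add_comm (c ^ 2 * (x : ℂ) ^ 2)] at this
      nlinarith
    have hlog0 : 0 ≤ Real.log ‖1 + c ^ 2 * (x : ℂ) ^ 2‖ := Real.log_nonneg hge
    have hle : ‖1 + c ^ 2 * (x : ℂ) ^ 2‖ ≤ (1 + ‖c‖ ^ 2) * x ^ 2 := by
      refine (norm_add_le _ _).trans ?_
      rw [hx2, norm_one]
      nlinarith
    have hlog1 : Real.log ‖1 + c ^ 2 * (x : ℂ) ^ 2‖ ≤ Real.log (1 + ‖c‖ ^ 2) + 2 * Real.log x := by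
      refine (Real.log_le_log (by linarith) hle).trans (le_of_eq ?_)
      rw [Real.log_mul (by positivity) (by positivity), Real.log_pow]
      norm_num
    have hlog2 : Real.log x ≤ 2 * x ^ (1 / 2 : ℝ) := by
      have := Real.log_le_rpow_div hx0.le (show (0 : ℝ) < 1 / 2 by norm_num)
      linarith
    have hxh : 1 ≤ x ^ (1 / 2 : ℝ) := Real.one_le_rpow hx1 (by norm_num)
    have hl : 0 ≤ Real.log (1 + ‖c‖ ^ 2) := Real.log_nonneg (by nlinarith)
    rw [Real.norm_of_nonneg (by positivity), div_le_iff₀ (by positivity), mul_assoc,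
      ← Real.rpow_natCast x 2, ← Real.rpow_add hx0]
    norm_num
    nlinarith
  have hu : Set.Ioi (0 : ℝ) = Set.Ioc 0 δ ∪ (Set.Ioc δ X ∪ Set.Ioi X) := by
    rw [Set.Ioc_union_Ioi_eq_Ioi hXδ, Set.Ioc_union_Ioi_eq_Ioi hδ0.le]
  rw [hu]
  exact h1.union (h2.union h3)

lemma tendsto_log_div_atTop : Tendsto (fun x : ℝ => Real.log x / x) atTop (𝓝 0) := by
  simpa using Real.isLittleO_log_id_atTop.tendsto_div_nhds_zero

/-- With `a = i c` the quadratic factors as `(1 + a x)(1 - a x)`, and both factors stay in the slit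
plane because `Im a = Re c > 0`. Integration by parts yields the antiderivative `Φ`, which vanishes
at `0`; at infinity `log a - log (-a) = π i` makes its limit `Re (π c)`. -/
lemma integral_log_quadratic_of_pos {c : ℂ} (hc : 0 < c.re) :
    ∫ x in Set.Ioi (0 : ℝ), Real.log ‖1 + c ^ 2 * x ^ 2‖ / x ^ 2 = Real.pi * c.re := by
  set a : ℂ := Complex.I * c with ha
  have haim : 0 < a.im := by simpa [ha] using hc
  have hslit : ∀ b : ℂ, b.im ≠ 0 → ∀ x : ℝ, 1 + b * x ∈ Complex.slitPlane := by
    intro b hb x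
    by_cases hx : x = 0
    · simp [hx]
    · refine Or.inr ?_
      simp [hb, hx]
  have ham : (-a).im ≠ 0 := by simpa using haim.ne'
  have hderiv : ∀ b : ℂ, b.im ≠ 0 → ∀ x : ℝ,
      HasDerivAt (fun x : ℝ => Complex.log (1 + b * x)) (b / (1 + b * x)) x := by
    intro b hb x
    have h1 : HasDerivAt (fun x : ℝ => 1 + b * (x : ℂ)) b x := by
      simpa using ((Complex.ofRealCLM.hasDerivAt (x := x)).const_mul b).const_add 1
    simpa using h1.clog_real (hslit b hb x)
  set Φ : ℝ → ℝ := fun x => -(Complex.log (1 + a * x) + Complex.log (1 + (-a) * x)).re / x +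
    (-a * (Complex.log (1 + a * x) - Complex.log (1 + (-a) * x))).re with hΦ
  have hfac : ∀ x : ℝ, Real.log ‖1 + c ^ 2 * (x : ℂ) ^ 2‖ =
      (Complex.log (1 + a * x) + Complex.log (1 + (-a) * x)).re := by
    intro x
    have h1 : 1 + c ^ 2 * (x : ℂ) ^ 2 = (1 + a * x) * (1 + (-a) * x) := by
      rw [ha]
      linear_combination (c ^ 2 * (x : ℂ) ^ 2) * Complex.I_sq
    rw [h1, norm_mul, Real.log_mul, Complex.add_re, Complex.log_re, Complex.log_re]
    · exact norm_ne_zero_iff.2 (Complex.slitPlane_ne_zero (hslit a haim.ne' x))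
    · exact norm_ne_zero_iff.2 (Complex.slitPlane_ne_zero (hslit _ ham x))
  have hΦd : ∀ x ∈ Set.Ioi (0 : ℝ),
      HasDerivAt Φ (Real.log ‖1 + c ^ 2 * (x : ℂ) ^ 2‖ / x ^ 2) x := by
    intro x hx
    have hx0 : x ≠ 0 := ne_of_gt hx
    have hM := hderiv a haim.ne' x
    have hP := hderiv (-a) ham x
    have hre : ∀ {f : ℝ → ℂ} {f' : ℂ} {x : ℝ}, HasDerivAt f f' x →
        HasDerivAt (fun x => (f x).re) f'.re x := fun h =>
      Complex.reCLM.hasFDerivAt.comp_hasDerivAt _ h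
    have h1 := ((hre (hM.add hP)).neg.div (hasDerivAt_id x) hx0).add
      (hre ((hM.sub hP).const_mul (-a)))
    refine h1.congr_deriv ?_
    rw [hfac]
    simp only [id, mul_one, Pi.add_apply, Pi.neg_apply]
    have hxc : (x : ℂ) ≠ 0 := by exact_mod_cast hx0
    have hn1 := Complex.slitPlane_ne_zero (hslit a haim.ne' x)
    have hn2 := Complex.slitPlane_ne_zero (hslit _ ham x)
    have h2 : -a * (a / (1 + a * x) - -a / (1 + -a * x)) =
        ((x⁻¹ : ℝ) : ℂ) * (a / (1 + a * x) + -a / (1 + -a * x)) := by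
      rw [div_sub_div _ _ hn1 hn2, div_add_div _ _ hn1 hn2, mul_div_assoc', mul_div_assoc']
      congr 1
      push_cast
      field_simp
      ring
    rw [h2, Complex.re_ofReal_mul]
    field_simp
    ring
  have hΦ0 : Φ 0 = 0 := by simp [hΦ]
  have hcont : ContinuousWithinAt Φ (Set.Ici 0) 0 := by
    rw [← continuousWithinAt_Ioi_iff_Ici]
    unfold ContinuousWithinAt
    rw [hΦ0]
    have hs : ∀ b : ℂ, b.im ≠ 0 → Tendsto (fun x : ℝ => Complex.log (1 + b * x) / x) (𝓝[>] 0)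
        (𝓝 b) := by
      intro b hb
      have := (hderiv b hb 0).tendsto_slope_zero_right
      simp only [zero_add, Complex.ofReal_zero, mul_zero, add_zero, Complex.log_one, sub_zero,
        div_one] at this
      refine this.congr fun x => ?_
      rw [Complex.real_smul]
      push_cast
      rw [div_eq_inv_mul]
    have hl : ∀ b : ℂ, b.im ≠ 0 → Tendsto (fun x : ℝ => Complex.log (1 + b * x)) (𝓝[>] 0)
        (𝓝 0) := by
      intro b hb
      have := (hderiv b hb 0).continuousAt.tendsto
      simp only [Complex.ofReal_zero, mul_zero, add_zero, Complex.log_one] at this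
      exact this.mono_left nhdsWithin_le_nhds
    have h1 := ((hs a haim.ne').add (hs _ ham)).neg
    have h2 := (((hl a haim.ne').sub (hl _ ham)).const_mul (-a))
    have h3 := (Complex.continuous_re.tendsto _).comp (h1.add h2)
    simp only [add_neg_cancel, sub_zero, mul_zero, neg_zero, add_zero, Complex.zero_re] at h3
    refine h3.congr fun x => ?_
    simp only [Function.comp_apply, hΦ, Complex.add_re]
    congr 1
    rw [← add_div, Complex.neg_re, Complex.div_ofReal_re, neg_div, Complex.add_re]
  have hlim : Tendsto Φ atTop (𝓝 (Real.pi * c.re)) := by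
    have hL : ∀ b : ℂ, b.im ≠ 0 → Tendsto (fun x : ℝ => Complex.log (((1 / x : ℝ) : ℂ) + b))
        atTop (𝓝 (Complex.log b)) := by
      intro b hb
      have h1 : Tendsto (fun x : ℝ => ((1 / x : ℝ) : ℂ) + b) atTop (𝓝 b) := by
        have : Tendsto (fun x : ℝ => 1 / x) atTop (𝓝 0) := by
          simpa using tendsto_inv_atTop_zero (𝕜 := ℝ)
        simpa using ((Complex.continuous_ofReal.tendsto 0).comp this).add_const b
      exact h1.clog (Or.inr hb)
    have heq : ∀ b : ℂ, b.im ≠ 0 → ∀ x : ℝ, 0 < x → Complex.log (1 + b * x) =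
        Real.log x + Complex.log (((1 / x : ℝ) : ℂ) + b) := by
      intro b hb x hx
      rw [← Complex.log_ofReal_mul hx]
      · congr 1
        have : (x : ℂ) ≠ 0 := by exact_mod_cast hx.ne'
        push_cast
        field_simp
      · intro h
        have := congrArg Complex.im h
        rw [Complex.add_im, Complex.ofReal_im, zero_add] at this
        exact hb this
    have hsub : Complex.log a - Complex.log (-a) = Real.pi * Complex.I := by
      rw [Complex.log, Complex.log, norm_neg, Complex.arg_neg_eq_arg_sub_pi_of_im_pos haim]
      push_cast
      ring
    have h1 : Tendsto (fun x : ℝ => -(2 * (Real.log x / x) +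
        (Complex.log (((1 / x : ℝ) : ℂ) + a) + Complex.log (((1 / x : ℝ) : ℂ) + -a)).re *
        x⁻¹) + (-a * (Complex.log (((1 / x : ℝ) : ℂ) + a) -
          Complex.log (((1 / x : ℝ) : ℂ) + -a))).re) atTop
        (𝓝 (-(2 * 0 + (Complex.log a + Complex.log (-a)).re * 0) +
          (-a * (Complex.log a - Complex.log (-a))).re)) := by
      refine Tendsto.add (((tendsto_log_div_atTop.const_mul 2).add (Tendsto.mul ?_
        tendsto_inv_atTop_zero)).neg) ?_
      · exact (Complex.continuous_re.tendsto _).comp ((hL a haim.ne').add (hL _ ham))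
      · exact (Complex.continuous_re.tendsto _).comp
          (((hL a haim.ne').sub (hL _ ham)).const_mul (-a))
    have h2 : -(2 * 0 + (Complex.log a + Complex.log (-a)).re * 0) +
          (-a * (Complex.log a - Complex.log (-a))).re = Real.pi * c.re := by
      rw [hsub, ha]
      simp
      ring
    rw [h2] at h1
    refine h1.congr' ?_
    filter_upwards [eventually_gt_atTop (0 : ℝ)] with x hx
    simp only [hΦ]
    rw [heq a haim.ne' x hx, heq _ ham x hx]
    congr 1
    · simp only [Complex.add_re, Complex.ofReal_re]
      field_simp
      ring
    · congr 2
      ring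
  rw [integral_Ioi_of_hasDerivAt_of_tendsto hcont hΦd (integrableOn_log_quadratic c) hlim, hΦ0,
    sub_zero]

/-- The borderline case of a root on the imaginary axis, where the integrand has a logarithmic
singularity at `1 / b`. The antiderivative tends to `0` at both ends and is continuous across the
singularity, so the two boundary values at `1 / b` cancel. -/
lemma integral_log_quadratic_axis {b : ℝ} (hb : 0 < b) :
    ∫ x in Set.Ioi (0 : ℝ), Real.log |1 - b ^ 2 * x ^ 2| / x ^ 2 = 0 := by
  have hint : IntegrableOn (fun x : ℝ => Real.log |1 - b ^ 2 * x ^ 2| / x ^ 2) (Set.Ioi 0) := by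
    refine (integrableOn_log_quadratic (Complex.I * b)).congr_fun (fun x _ => ?_) measurableSet_Ioi
    have : 1 + (Complex.I * b) ^ 2 * (x : ℂ) ^ 2 = ((1 - b ^ 2 * x ^ 2 : ℝ) : ℂ) := by
      push_cast
      linear_combination ((b : ℂ) ^ 2 * x ^ 2) * Complex.I_sq
    simp only
    rw [this, Complex.norm_real, Real.norm_eq_abs]
  set Φ : ℝ → ℝ := fun x => -(1 / x + b) * Real.log (1 + b * x) +
    (b - 1 / x) * Real.log (1 - b * x) with hΦ
  have hΦd : ∀ x : ℝ, 0 < x → x ≠ 1 / b →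
      HasDerivAt Φ (Real.log |1 - b ^ 2 * x ^ 2| / x ^ 2) x := by
    intro x hx hxb
    have hn1 : 1 + b * x ≠ 0 := by positivity
    have hn2 : 1 - b * x ≠ 0 := by
      intro h
      apply hxb
      field_simp
      linarith
    have hM : HasDerivAt (fun x : ℝ => Real.log (1 + b * x)) (b / (1 + b * x)) x := by
      have : HasDerivAt (fun x : ℝ => 1 + b * x) b x := by
        simpa using ((hasDerivAt_id x).const_mul b).const_add 1
      exact this.log hn1
    have hP : HasDerivAt (fun x : ℝ => Real.log (1 - b * x)) (-b / (1 - b * x)) x := by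
      have : HasDerivAt (fun x : ℝ => 1 - b * x) (-b) x := by
        simpa using ((hasDerivAt_id x).const_mul b).const_sub 1
      exact this.log hn2
    have hinv : HasDerivAt (fun x : ℝ => 1 / x) (-(x ^ 2)⁻¹) x := by
      simpa using hasDerivAt_inv hx.ne'
    have h1 := ((hinv.add_const b).neg.mul hM).add ((hinv.const_sub b).mul hP)
    refine h1.congr_deriv ?_
    have h2 : 1 - b ^ 2 * x ^ 2 = (1 + b * x) * (1 - b * x) := by ring
    rw [Real.log_abs, h2, Real.log_mul hn1 hn2]
    have h3 : -(1 / x + b) * (b / (1 + b * x)) = -b / x := by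
      rw [mul_div_assoc', div_eq_div_iff hn1 hx.ne']
      field_simp
    have h4 : (b - 1 / x) * (-b / (1 - b * x)) = b / x := by
      rw [mul_div_assoc', div_eq_div_iff hn2 hx.ne']
      field_simp
      ring
    simp only [Pi.neg_apply]
    rw [h3, h4]
    field_simp
    ring
  -- The term `(1 - b x) log (1 - b x)` tends to `0`. Since `Real.log 0 = 0`, the limit is also the
  -- value of `Φ` at `1 / b`.
  have hlb : Tendsto Φ (𝓝[≠] (1 / b)) (𝓝 (-(1 / (1 / b) + b) * Real.log (1 + b * (1 / b)))) := by
    have h1 : Tendsto (fun x : ℝ => -(1 / x + b) * Real.log (1 + b * x) -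
        (1 / x) * ((1 - b * x) * Real.log (1 - b * x))) (𝓝 (1 / b))
        (𝓝 (-(1 / (1 / b) + b) * Real.log (1 + b * (1 / b)) -
          (1 / (1 / b)) * ((1 - b * (1 / b)) * Real.log (1 - b * (1 / b))))) := by
      have hbn : (1 / b) ≠ 0 := by positivity
      have hinv : Tendsto (fun x : ℝ => 1 / x) (𝓝 (1 / b)) (𝓝 (1 / (1 / b))) := by
        simpa using (continuousAt_inv₀ hbn).tendsto
      refine Tendsto.sub (Tendsto.mul (hinv.add_const b).neg ?_) (hinv.mul ?_)
      · have : ContinuousAt (fun x : ℝ => Real.log (1 + b * x)) (1 / b) :=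
          ContinuousAt.log (by fun_prop) (by positivity)
        exact this.tendsto
      · have : Continuous fun x : ℝ => (1 - b * x) * Real.log (1 - b * x) :=
          Real.continuous_mul_log.comp (by fun_prop)
        exact this.tendsto _
    have h2 : (1 - b * (1 / b)) = 0 := by field_simp; ring
    rw [h2, zero_mul, mul_zero, sub_zero] at h1
    refine (h1.mono_left nhdsWithin_le_nhds).congr' ?_
    have h3 : ∀ᶠ x in 𝓝 (1 / b), x ≠ 0 := isOpen_ne.mem_nhds (by positivity : (1 / b) ≠ 0)
    filter_upwards [nhdsWithin_le_nhds h3] with x hx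
    simp only [hΦ]
    field_simp
    ring
  have h0 : Tendsto Φ (𝓝[>] 0) (𝓝 0) := by
    have hs : ∀ d : ℝ, Tendsto (fun x : ℝ => Real.log (1 + d * x) / x) (𝓝[>] 0) (𝓝 d) ∧
        Tendsto (fun x : ℝ => Real.log (1 + d * x)) (𝓝[>] 0) (𝓝 0) := by
      intro d
      have h1 : HasDerivAt (fun x : ℝ => Real.log (1 + d * x)) d 0 := by
        have : HasDerivAt (fun x : ℝ => 1 + d * x) d 0 := by
          simpa using ((hasDerivAt_id (0 : ℝ)).const_mul d).const_add 1
        simpa using this.log (by simp)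
      constructor
      · have := h1.tendsto_slope_zero_right
        simp only [zero_add, mul_zero, add_zero, Real.log_one, sub_zero] at this
        refine this.congr fun x => ?_
        rw [smul_eq_mul, div_eq_inv_mul]
      · have := h1.continuousAt.tendsto
        simp only [mul_zero, add_zero, Real.log_one] at this
        exact this.mono_left nhdsWithin_le_nhds
    have h1 := ((hs b).1.neg.sub ((hs b).2.const_mul b)).add
      (((hs (-b)).2.const_mul b).sub (hs (-b)).1)
    simp only [mul_zero, sub_zero, zero_sub, neg_neg, neg_add_cancel] at h1
    refine h1.congr fun x => ?_
    simp only [hΦ, neg_mul, ← sub_eq_add_neg]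
    ring
  have hinf : Tendsto Φ atTop (𝓝 0) := by
    have hL : ∀ d : ℝ, d ≠ 0 → Tendsto (fun x : ℝ => Real.log (1 / x + d))
        atTop (𝓝 (Real.log d)) := by
      intro d hd
      have h1 : Tendsto (fun x : ℝ => 1 / x + d) atTop (𝓝 d) := by
        have : Tendsto (fun x : ℝ => 1 / x) atTop (𝓝 0) := by
          simpa using tendsto_inv_atTop_zero (𝕜 := ℝ)
        simpa using this.add_const d
      exact h1.log hd
    have h1 := (((tendsto_log_div_atTop.const_mul 2).add
      (((hL b hb.ne').add (hL (-b) (neg_ne_zero.2 hb.ne'))).mul tendsto_inv_atTop_zero)).neg).add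
      (((hL (-b) (neg_ne_zero.2 hb.ne')).sub (hL b hb.ne')).const_mul b)
    simp only [Real.log_neg_eq_log, sub_self, mul_zero, add_zero, neg_zero] at h1
    refine h1.congr' ?_
    filter_upwards [eventually_gt_atTop (1 / b)] with x hx
    have hx0 : 0 < x := lt_trans (by positivity) hx
    have hbx : 1 < b * x := by
      rwa [div_lt_iff₀ hb, mul_comm] at hx
    have h2 : 1 + b * x = x * (1 / x + b) := by field_simp
    have h3 : 1 - b * x = x * (1 / x + -b) := by field_simp; ring
    have h4 : (1 / x + -b) ≠ 0 := by
      intro h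
      rw [h, mul_zero] at h3
      linarith
    simp only [hΦ]
    rw [h2, h3, Real.log_mul hx0.ne' (by positivity), Real.log_mul hx0.ne' h4]
    field_simp
    ring
  have hpos : 0 < 1 / b := by positivity
  have hu : Set.Ioi (0 : ℝ) = Set.Ioc 0 (1 / b) ∪ Set.Ioi (1 / b) :=
    (Set.Ioc_union_Ioi_eq_Ioi hpos.le).symm
  rw [hu, setIntegral_union Set.Ioc_disjoint_Ioi_same measurableSet_Ioi
    (hint.mono_set Set.Ioc_subset_Ioi_self)
    (hint.mono_set (Set.Ioi_subset_Ioi hpos.le)), ← intervalIntegral.integral_of_le hpos.le]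
  rw [intervalIntegral.integral_eq_sub_of_hasDerivAt_of_tendsto hpos
    (fun x hx => hΦd x hx.1 hx.2.ne)
    ((intervalIntegrable_iff_integrableOn_Ioc_of_le hpos.le).2
      (hint.mono_set Set.Ioc_subset_Ioi_self)) h0
    (hlb.mono_left (nhdsWithin_mono _ fun x (hx : x < 1 / b) => hx.ne))]
  rw [integral_Ioi_of_hasDerivAt_of_tendsto (f := Φ) ?_
    (fun x hx => hΦd x (hpos.trans hx) (ne_of_gt hx))
    (hint.mono_set (Set.Ioi_subset_Ioi hpos.le)) hinf]
  · have h2 : (1 - b * (1 / b)) = 0 := by field_simp; ring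
    simp only [hΦ]
    rw [h2, Real.log_zero]
    ring
  · rw [← continuousWithinAt_Ioi_iff_Ici]
    have h2 : (1 - b * (1 / b)) = 0 := by field_simp; ring
    have h3 : Φ (1 / b) = -(1 / (1 / b) + b) * Real.log (1 + b * (1 / b)) := by
      simp only [hΦ]
      rw [h2, Real.log_zero, mul_zero, add_zero]
    unfold ContinuousWithinAt
    rw [h3]
    exact hlb.mono_left (nhdsWithin_mono _ fun x (hx : 1 / b < x) => hx.ne')

lemma integral_log_quadratic {c : ℂ} (hc : c.re ≤ 0) (hc0 : c ≠ 0) :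
    ∫ x in Set.Ioi (0 : ℝ), Real.log ‖1 + c ^ 2 * x ^ 2‖ / x ^ 2 = -Real.pi * c.re := by
  rcases hc.lt_or_eq with h | h
  · have := integral_log_quadratic_of_pos (c := -c) (by simpa using h)
    simp only [neg_sq, Complex.neg_re] at this
    rw [this]
    ring
  · have hi : 0 < |c.im| := by
      rw [abs_pos]
      intro h2
      exact hc0 (Complex.ext h h2)
    have h3 := integral_log_quadratic_axis hi
    refine Eq.trans (setIntegral_congr_fun measurableSet_Ioi fun x _ => ?_)
      (h3.trans (by rw [h, mul_zero]))
    have h4 : c = c.im * Complex.I := by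
      apply Complex.ext <;> simp [h]
    have h5 : 1 + c ^ 2 * (x : ℂ) ^ 2 = ((1 - |c.im| ^ 2 * x ^ 2 : ℝ) : ℂ) := by
      rw [h4, sq_abs]
      push_cast
      simp
      linear_combination ((c.im : ℂ) ^ 2 * x ^ 2) * Complex.I_sq
    rw [h5, Complex.norm_real, Real.norm_eq_abs]

/-- The sum on the right is the logarithmic derivative at `0` of the polynomial with roots `R`; a
root `r` contributes through the quadratic with `c = r⁻¹`. -/
lemma log_quadratic_multiset (R : Multiset ℂ) (hR : ∀ r ∈ R, r ≠ 0 ∧ r.re ≤ 0) :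
    IntegrableOn (fun x : ℝ => (R.map fun r => Real.log ‖1 + r⁻¹ ^ 2 * (x : ℂ) ^ 2‖).sum / x ^ 2)
      (Set.Ioi 0) ∧
    ∫ x in Set.Ioi (0 : ℝ), (R.map fun r => Real.log ‖1 + r⁻¹ ^ 2 * (x : ℂ) ^ 2‖).sum / x ^ 2 =
      Real.pi * (R.map fun r => 1 / (0 - r)).sum.re := by
  induction R using Multiset.induction_on with
  | empty => simp
  | cons r R ih =>
    obtain ⟨h1, h2⟩ := ih fun r hr => hR r (by simp [hr])
    have hr := hR r (by simp)
    simp only [Multiset.map_cons, Multiset.sum_cons, add_div]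
    refine ⟨(integrableOn_log_quadratic _).add h1, ?_⟩
    rw [integral_add (integrableOn_log_quadratic _) h1, h2, integral_log_quadratic ?_
      (inv_ne_zero hr.1)]
    · simp only [zero_sub, Complex.add_re, one_div, inv_neg, Complex.neg_re]
      ring
    · rw [Complex.inv_re]
      exact div_nonpos_of_nonpos_of_nonneg hr.2 (Complex.normSq_nonneg _)

/-- Bode type integral of a real polynomial without zeros in the open right half plane. -/
lemma log_integral_poly {q : Polynomial ℝ} (h0 : q.eval 0 ≠ 0)
    (hq : ∀ s : ℂ, 0 < s.re → Polynomial.aeval s q ≠ 0) :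
    IntegrableOn (fun ω : ℝ => Real.log ‖Polynomial.aeval ((ω : ℂ) * Complex.I) q /
      Polynomial.aeval (0 : ℂ) q‖ / ω ^ 2) (Set.Ioi 0) ∧
    ∫ ω in Set.Ioi (0 : ℝ), Real.log ‖Polynomial.aeval ((ω : ℂ) * Complex.I) q /
      Polynomial.aeval (0 : ℂ) q‖ / ω ^ 2 =
      Real.pi / 2 * (q.derivative.eval 0 / q.eval 0) := by
  have hq0 : q ≠ 0 := by rintro rfl; simp at h0
  set p := q.map (algebraMap ℝ ℂ) with hp
  have hev : ∀ s : ℂ, Polynomial.aeval s q = p.eval s := fun s => by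
    rw [hp, Polynomial.eval_map_algebraMap]
  have hp0 : p ≠ 0 := by simpa [hp, Polynomial.map_eq_zero] using hq0
  have hreal : ∀ q : Polynomial ℝ, (q.map (algebraMap ℝ ℂ)).eval 0 = ((q.eval 0 : ℝ) : ℂ) := by
    intro q
    have := Polynomial.eval_map_algebraMap (R := ℝ) (B := ℂ) q 0
    rw [this]
    simpa using (Polynomial.aeval_algebraMap_apply_eq_algebraMap_eval (A := ℂ) (0 : ℝ) q)
  have hpe0 : p.eval 0 ≠ 0 := by
    rw [hp, hreal]
    exact_mod_cast h0
  have hsp := IsAlgClosed.splits p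
  have hroots : ∀ r ∈ p.roots, r ≠ 0 ∧ r.re ≤ 0 := by
    intro r hr
    have hr2 : p.eval r = 0 := (Polynomial.mem_roots hp0).1 hr
    refine ⟨by rintro rfl; exact hpe0 hr2, ?_⟩
    by_contra! h
    exact hq r h (by rw [hev, hr2])
  obtain ⟨h1, h2⟩ := log_quadratic_multiset p.roots hroots
  -- For real coefficients `|q(iω)|² = q(iω) q(-iω)`, and each root then enters through `1 + ω² /
  -- r²`. The square accounts for the factor `1 / 2`; the frequencies with `q(iω) = 0` are
  -- discarded.
  have hae : ∀ᵐ ω : ℝ, Real.log ‖Polynomial.aeval ((ω : ℂ) * Complex.I) q /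
      Polynomial.aeval (0 : ℂ) q‖ / ω ^ 2 = 1 / 2 *
      ((p.roots.map fun r => Real.log ‖1 + r⁻¹ ^ 2 * (ω : ℂ) ^ 2‖).sum / ω ^ 2) := by
    filter_upwards [ae_of_cofinite (eventually_aeval_ne_zero hq0)] with ω hω
    have hc : p.eval (-((ω : ℂ) * Complex.I)) = star (p.eval ((ω : ℂ) * Complex.I)) := by
      have h3 : -((ω : ℂ) * Complex.I) = (starRingEnd ℂ) ((ω : ℂ) * Complex.I) := by simp
      rw [h3, ← hev, ← hev, Polynomial.aeval_conj]
      rfl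
    have hprod : p.eval ((ω : ℂ) * Complex.I) * p.eval (-((ω : ℂ) * Complex.I)) =
        p.eval 0 ^ 2 * (p.roots.map fun r => 1 + r⁻¹ ^ 2 * (ω : ℂ) ^ 2).prod := by
      have e1 : ∀ R : Multiset ℂ, (∀ r ∈ R, r ≠ 0) →
          (R.map fun r => (ω : ℂ) * Complex.I - r).prod *
            (R.map fun r => -((ω : ℂ) * Complex.I) - r).prod =
          (R.map fun r => 0 - r).prod ^ 2 *
            (R.map fun r => 1 + r⁻¹ ^ 2 * (ω : ℂ) ^ 2).prod := by
        intro R hR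
        induction R using Multiset.induction_on with
        | empty => simp
        | cons r R ih =>
          have ih' := ih fun r hr => hR r (by simp [hr])
          have hr := hR r (by simp)
          have e2 : ((ω : ℂ) * Complex.I - r) * (-((ω : ℂ) * Complex.I) - r) =
              (0 - r) ^ 2 * (1 + r⁻¹ ^ 2 * (ω : ℂ) ^ 2) := by
            field_simp
            linear_combination (-(ω : ℂ) ^ 2 * r ^ 2) * Complex.I_sq
          simp only [Multiset.map_cons, Multiset.prod_cons]
          rw [mul_mul_mul_comm, ih', e2]
          ring
      rw [hsp.eval_eq_prod_roots, hsp.eval_eq_prod_roots (-_), hsp.eval_eq_prod_roots 0]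
      have e3 := e1 p.roots fun r hr => (hroots r hr).1
      linear_combination p.leadingCoeff ^ 2 * e3
    rw [hev] at hω
    have hne : ∀ r ∈ p.roots, 1 + r⁻¹ ^ 2 * (ω : ℂ) ^ 2 ≠ 0 := by
      intro r hr h
      have h4 : (p.roots.map fun r => 1 + r⁻¹ ^ 2 * (ω : ℂ) ^ 2).prod = 0 := by
        rw [Multiset.prod_eq_zero_iff, ← h]
        exact Multiset.mem_map_of_mem (fun r => 1 + r⁻¹ ^ 2 * (ω : ℂ) ^ 2) hr
      rw [h4, mul_zero, hc] at hprod
      rcases mul_eq_zero.1 hprod with h | h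
      · exact hω h
      · exact hω (star_eq_zero.1 h)
    have hlog : ∀ R : Multiset ℂ, (∀ r ∈ R, 1 + r⁻¹ ^ 2 * (ω : ℂ) ^ 2 ≠ 0) →
        (R.map fun r => Real.log ‖1 + r⁻¹ ^ 2 * (ω : ℂ) ^ 2‖).sum =
          Real.log ‖(R.map fun r => 1 + r⁻¹ ^ 2 * (ω : ℂ) ^ 2).prod‖ := by
      intro R hR
      induction R using Multiset.induction_on with
      | empty => simp
      | cons r R ih =>
        simp only [Multiset.map_cons, Multiset.sum_cons, Multiset.prod_cons, norm_mul]
        rw [ih fun r hr => hR r (by simp [hr]), Real.log_mul]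
        · exact norm_ne_zero_iff.2 (hR r (by simp))
        · rw [norm_ne_zero_iff, Ne, Multiset.prod_eq_zero_iff, Multiset.mem_map]
          rintro ⟨r', hr', h5⟩
          exact hR r' (by simp [hr']) h5
    rw [hlog _ hne, hev, hev]
    have h6 := congrArg norm hprod
    rw [hc, norm_mul, norm_star, norm_mul, norm_pow] at h6
    have h7 : ‖(p.roots.map fun r => 1 + r⁻¹ ^ 2 * (ω : ℂ) ^ 2).prod‖ =
        ‖p.eval ((ω : ℂ) * Complex.I) / p.eval 0‖ ^ 2 := by
      have : ‖p.eval 0‖ ≠ 0 := norm_ne_zero_iff.2 hpe0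
      rw [norm_div, div_pow, eq_div_iff (pow_ne_zero _ this), sq ‖p.eval ((ω : ℂ) * Complex.I)‖,
        h6, mul_comm]
    rw [h7, Real.log_pow]
    push_cast
    ring
  have hae' := ae_restrict_of_ae (s := Set.Ioi (0 : ℝ)) hae
  refine ⟨(h1.const_mul (1 / 2)).congr (hae'.mono fun ω h => h.symm), ?_⟩
  rw [integral_congr_ae hae', integral_const_mul, h2,
    ← hsp.eval_derivative_div_eval_of_ne_zero hpe0, hp, Polynomial.derivative_map, hreal, hreal,
    ← Complex.ofReal_div, Complex.ofReal_re]
  ring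

end

section

/-! ### Plancherel's theorem -/

open FourierTransform in
-- Plancherel's theorem concerns the transform on `L²` as an extension. Testing against smooth
-- functions of compact support, both this transform and the Fourier integral pair to `∫ f · 𝓕 G`,
-- hence they agree almost everywhere.
lemma lintegral_fourier_sq {f : ℝ → ℂ} (h1 : Integrable f) (h2 : MemLp f 2) :
    ∫⁻ ξ, ‖𝓕 f ξ‖ₑ ^ 2 = ∫⁻ x, ‖f x‖ₑ ^ 2 := by
  set f2 : Lp ℂ 2 (volume : Measure ℝ) := h2.toLp f with hf2
  set F2 : Lp ℂ 2 (volume : Measure ℝ) := 𝓕 f2 with hF2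
  have hcont : Continuous (𝓕 f) := VectorFourier.fourierIntegral_continuous
    Real.continuous_fourierChar (by exact continuous_inner) h1
  have hae : ∀ᵐ x, F2 x = 𝓕 f x := by
    refine ae_eq_of_integral_contDiff_smul_eq
      ((Lp.memLp F2).locallyIntegrable (by norm_num)) hcont.locallyIntegrable
      fun g g_smooth g_cpt => ?_
    have hg₁ : HasCompactSupport (Complex.ofRealCLM ∘ g) := g_cpt.comp_left rfl
    have hg₂ : ContDiff ℝ ((⊤ : ℕ∞) : WithTop ℕ∞) (Complex.ofRealCLM ∘ g) := by fun_prop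
    set G := hg₁.toSchwartzMap hg₂ with hG
    have hGe : ∀ x, G x = (g x : ℂ) := fun x => rfl
    have e1 : ∫ x, g x • F2 x = ∫ x, G x • F2 x := by
      refine integral_congr_ae (Eventually.of_forall fun x => ?_)
      simp only [hGe]
      exact (Complex.coe_smul (g x) (F2 x)).symm
    have e2 : ∫ x, g x • 𝓕 f x = ∫ x, 𝓕 f x • G x := by
      refine integral_congr_ae (Eventually.of_forall fun x => ?_)
      simp only [hGe, smul_eq_mul, Complex.real_smul]
      ring
    have e3 := congrArg (fun T => T G) (Lp.fourier_toTemperedDistribution_eq f2)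
    simp only [TemperedDistribution.fourier_apply, Lp.toTemperedDistribution_apply] at e3
    have e5 : ∫ x, G x • F2 x = ∫ x, (𝓕 G) x • f2 x := e3.symm
    rw [e1, e5, e2]
    have e4 := VectorFourier.integral_fourierIntegral_smul_eq_flip (e := Real.fourierChar)
      (μ := (volume : Measure ℝ)) (ν := (volume : Measure ℝ)) (L := innerₗ ℝ)
      (f := f) (g := (G : ℝ → ℂ)) Real.continuous_fourierChar
      (by exact continuous_inner) h1 G.integrable
    refine Eq.trans ?_ e4.symm
    refine integral_congr_ae ?_
    filter_upwards [h2.coeFn_toLp] with x hx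
    rw [hf2, hx, smul_eq_mul, smul_eq_mul, mul_comm]
    congr 1
    rw [flip_innerₗ]
    exact congrFun (SchwartzMap.fourier_coe G) x
  have hn : eLpNorm (𝓕 f) 2 volume = eLpNorm f 2 volume := by
    rw [← eLpNorm_congr_ae hae, ← eLpNorm_congr_ae h2.coeFn_toLp]
    have h3 := Lp.norm_fourier_eq f2
    rw [Lp.norm_def, Lp.norm_def] at h3
    exact (ENNReal.toReal_eq_toReal_iff' (Lp.eLpNorm_ne_top _) (Lp.eLpNorm_ne_top _)).1 h3
  have h4 : ∀ g : ℝ → ℂ, ∫⁻ x, ‖g x‖ₑ ^ 2 = eLpNorm g 2 volume ^ 2 := by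
    intro g
    rw [eLpNorm_eq_lintegral_rpow_enorm_toReal (by norm_num) (by norm_num)]
    simp only [ENNReal.toReal_ofNat, ENNReal.rpow_ofNat]
    rw [← ENNReal.rpow_natCast, ← ENNReal.rpow_mul]
    norm_num
  rw [h4, h4, hn]

/-- `G` is the Laplace transform of `h` on the open right half plane. -/
def HasLaplace (h : ℝ → ℝ) (G : ℂ → ℂ) : Prop :=
  ∀ s : ℂ, 0 < s.re →
    IntegrableOn (fun t : ℝ => Complex.exp (-s * t) * (h t : ℂ)) (Set.Ioi 0) ∧
    ∫ t in Set.Ioi (0 : ℝ), Complex.exp (-s * t) * (h t : ℂ) = G s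

lemma lintegral_comp_mul_left_real {a : ℝ} (ha : 0 < a) (g : ℝ → ENNReal) :
    ∫⁻ x, g (a * x) = ENNReal.ofReal a⁻¹ * ∫⁻ x, g x := by
  have h := Real.map_volume_mul_left ha.ne'
  refine ((Homeomorph.mulLeft₀ a ha.ne').measurableEmbedding.lintegral_map
    (μ := volume) g).symm.trans ?_
  rw [show (⇑(Homeomorph.mulLeft₀ a ha.ne')) = (a * ·) from rfl, h, lintegral_smul_measure,
    abs_of_pos (inv_pos.2 ha), smul_eq_mul]

open FourierTransform in
-- `G (a + iω)` is the Fourier integral of `exp (-a t) h(t)` on `(0, ∞)` at the frequency `ω / 2π`;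
-- the rescaling is the origin of the factor `2π`.
lemma HasLaplace.plancherel {h : ℝ → ℝ} {G : ℂ → ℂ} (hG : HasLaplace h G)
    (hm : MemLp h 2 (volume.restrict (Set.Ioi 0))) {a : ℝ} (ha : 0 < a) :
    ∫⁻ ω : ℝ, ‖G (a + ω * Complex.I)‖ₑ ^ 2 = ENNReal.ofReal (2 * Real.pi) *
      ∫⁻ t in Set.Ioi (0 : ℝ), ENNReal.ofReal (Real.exp (-2 * a * t)) * ‖h t‖ₑ ^ 2 := by
  set f : ℝ → ℂ := (Set.Ioi (0 : ℝ)).indicator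
    fun t => Complex.exp (-(a : ℂ) * t) * (h t : ℂ) with hf
  have hsm : MeasurableSet (Set.Ioi (0 : ℝ)) := measurableSet_Ioi
  have h1 : Integrable f := (integrable_indicator_iff hsm).2 (hG a (by simpa using ha)).1
  have hexp : ∀ t ∈ Set.Ioi (0 : ℝ), ‖Complex.exp (-(a : ℂ) * t)‖ ≤ 1 := by
    intro t ht
    rw [Complex.norm_exp]
    simp only [Complex.mul_re, Complex.neg_re, Complex.ofReal_re, Complex.neg_im,
      Complex.ofReal_im, mul_zero, sub_zero]
    rw [Real.exp_le_one_iff]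
    have := mul_pos ha ht
    linarith
  have h2 : MemLp f 2 := by
    rw [hf, memLp_indicator_iff_restrict hsm]
    have hm' : MemLp (fun t => (h t : ℂ)) 2 (volume.restrict (Set.Ioi (0 : ℝ))) := hm.ofReal
    refine hm'.of_le (((by fun_prop : Continuous fun t : ℝ =>
      Complex.exp (-(a : ℂ) * t)).aestronglyMeasurable).mul hm'.1) ?_
    filter_upwards [ae_restrict_mem hsm] with t ht
    rw [norm_mul]
    exact mul_le_of_le_one_left (norm_nonneg _) (hexp t ht)
  have hF : ∀ ξ : ℝ, 𝓕 f ξ = G (a + ((2 * Real.pi * ξ : ℝ) : ℂ) * Complex.I) := by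
    intro ξ
    rw [Real.fourier_real_eq_integral_exp_smul, ← (hG (a + ((2 * Real.pi * ξ : ℝ) : ℂ) *
      Complex.I) (by simpa using ha)).2, ← integral_indicator hsm]
    refine integral_congr_ae (Eventually.of_forall fun t => ?_)
    simp only [hf]
    by_cases ht : t ∈ Set.Ioi (0 : ℝ)
    · rw [Set.indicator_of_mem ht, Set.indicator_of_mem ht, smul_eq_mul, ← mul_assoc,
        ← Complex.exp_add]
      congr 2
      push_cast
      ring
    · rw [Set.indicator_of_notMem ht, Set.indicator_of_notMem ht, smul_zero]
  have h3 := lintegral_fourier_sq h1 h2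
  simp_rw [hF] at h3
  rw [lintegral_comp_mul_left_real (by positivity : 0 < 2 * Real.pi)
    (fun ω => ‖G (a + ω * Complex.I)‖ₑ ^ 2)] at h3
  have h4 : ∫⁻ x, ‖f x‖ₑ ^ 2 = ∫⁻ t in Set.Ioi (0 : ℝ),
      ENNReal.ofReal (Real.exp (-2 * a * t)) * ‖h t‖ₑ ^ 2 := by
    rw [← lintegral_indicator hsm]
    refine lintegral_congr fun t => ?_
    by_cases ht : t ∈ Set.Ioi (0 : ℝ)
    · simp only [hf]
      rw [Set.indicator_of_mem ht, Set.indicator_of_mem ht, enorm_mul, mul_pow]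
      congr 1
      · rw [← ofReal_norm, ← ENNReal.ofReal_pow (norm_nonneg _), Complex.norm_exp]
        congr 1
        rw [← Real.exp_nat_mul]
        congr 1
        simp
        ring
      · congr 1
        rw [← ofReal_norm, ← ofReal_norm, Complex.norm_real]
    · simp only [hf]
      rw [Set.indicator_of_notMem ht, Set.indicator_of_notMem ht]
      simp
  rw [← h4, ← h3, ← mul_assoc, ← ENNReal.ofReal_mul (by positivity),
    mul_inv_cancel₀ (by positivity), ENNReal.ofReal_one, one_mul]

lemma tendsto_one_div_nat_nhdsGT :
    Tendsto (fun n : ℕ => 1 / ((n : ℝ) + 1)) atTop (𝓝[>] 0) :=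
  tendsto_nhdsWithin_iff.2 ⟨tendsto_one_div_add_atTop_nhds_zero_nat,
    Eventually.of_forall fun n => by simp only [Set.mem_Ioi]; positivity⟩

/-- The boundary energy of a Laplace transform is at most the energy of the signal. -/
lemma HasLaplace.lintegral_axis_le {h : ℝ → ℝ} {G : ℂ → ℂ} (hG : HasLaplace h G)
    (hm : MemLp h 2 (volume.restrict (Set.Ioi 0))) {G₀ : ℝ → ℂ}
    (hc : ∀ᵐ ω : ℝ, Tendsto (fun a : ℝ => G (a + ω * Complex.I)) (𝓝[>] 0) (𝓝 (G₀ ω)))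
    (hmeas : ∀ a : ℝ, 0 < a → Measurable fun ω : ℝ => G (a + ω * Complex.I)) :
    ∫⁻ ω : ℝ, ‖G₀ ω‖ₑ ^ 2 ≤ ENNReal.ofReal (2 * Real.pi) *
      ∫⁻ t in Set.Ioi (0 : ℝ), ‖h t‖ₑ ^ 2 := by
  set a : ℕ → ℝ := fun n => 1 / ((n : ℝ) + 1) with ha
  have ha0 : ∀ n, 0 < a n := fun n => by simp only [ha]; positivity
  have h1 : ∀ᵐ ω : ℝ, Tendsto (fun n => ‖G (a n + ω * Complex.I)‖ₑ ^ 2) atTop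
      (𝓝 (‖G₀ ω‖ₑ ^ 2)) := by
    filter_upwards [hc] with ω hω
    exact (ENNReal.continuous_pow 2).continuousAt.tendsto.comp
      ((hω.comp tendsto_one_div_nat_nhdsGT).enorm)
  -- Fatou's lemma on the lines `Re s = a`, `a ↓ 0`: on each of them the energy is at most that of
  -- `h`, because the weight `exp (-2 a t)` is at most `1`. Only almost everywhere convergence at
  -- the boundary is needed, so `G₀` may come from a function with poles on the axis.
  calc ∫⁻ ω : ℝ, ‖G₀ ω‖ₑ ^ 2
      = ∫⁻ ω : ℝ, liminf (fun n => ‖G (a n + ω * Complex.I)‖ₑ ^ 2) atTop :=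
        lintegral_congr_ae (h1.mono fun ω hω => hω.liminf_eq.symm)
    _ ≤ liminf (fun n => ∫⁻ ω : ℝ, ‖G (a n + ω * Complex.I)‖ₑ ^ 2) atTop :=
        lintegral_liminf_le fun n => ((hmeas _ (ha0 n)).enorm.pow_const 2)
    _ ≤ liminf (fun _ : ℕ => ENNReal.ofReal (2 * Real.pi) *
        ∫⁻ t in Set.Ioi (0 : ℝ), ‖h t‖ₑ ^ 2) atTop := by
        refine liminf_le_liminf (Eventually.of_forall fun n => ?_)
        rw [hG.plancherel hm (ha0 n)]
        refine mul_le_mul' le_rfl (setLIntegral_mono' measurableSet_Ioi fun t ht => ?_)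
        refine mul_le_of_le_one_left (by positivity) ?_
        rw [ENNReal.ofReal_le_one, Real.exp_le_one_iff]
        have := mul_pos (ha0 n) ht
        linarith
    _ = _ := by simp

/-- Parseval's inequality in the other direction, for transforms in the Hardy class. -/
lemma HasLaplace.lintegral_le_axis {h : ℝ → ℝ} {G : ℂ → ℂ} (hG : HasLaplace h G)
    (hm : MemLp h 2 (volume.restrict (Set.Ioi 0))) (hh : IsH2 G) :
    ENNReal.ofReal (2 * Real.pi) * ∫⁻ t in Set.Ioi (0 : ℝ), ‖h t‖ₑ ^ 2 ≤
      ∫⁻ ω : ℝ, ‖G (ω * Complex.I)‖ₑ ^ 2 := by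
  set a : ℕ → ℝ := fun n => 1 / ((n : ℝ) + 1) with ha
  have ha0 : ∀ n, 0 < a n := fun n => by simp only [ha]; positivity
  have hat : Tendsto a atTop (𝓝 0) := tendsto_one_div_add_atTop_nhds_zero_nat
  -- On the frequency side the Hardy bound is uniform in `a` and permits dominated convergence; on
  -- the time side Fatou's lemma is enough, since the weights tend to `1`.
  have h1 : Tendsto (fun n => ∫⁻ ω : ℝ, ‖G (a n + ω * Complex.I)‖ₑ ^ 2) atTop
      (𝓝 (∫⁻ ω : ℝ, ‖G (ω * Complex.I)‖ₑ ^ 2)) := by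
    obtain ⟨C, hC0, hC⟩ := hh.exists_bound
    have hmem : ∀ n (ω : ℝ), 0 ≤ ((a n : ℂ) + ω * Complex.I).re := fun n ω => by
      simpa using (ha0 n).le
    refine tendsto_lintegral_of_dominated_convergence'
      (fun ω => ENNReal.ofReal (C ^ 2 * (1 + ω ^ 2)⁻¹)) (fun n => ?_) (fun n => ?_) ?_ ?_
    · have hcn : Continuous fun ω : ℝ => G (a n + ω * Complex.I) :=
        hh.cont.comp_continuous (by fun_prop) fun ω => hmem n ω
      exact (hcn.enorm.measurable.pow_const 2).aemeasurable
    · refine Eventually.of_forall fun ω => ?_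
      simp only
      rw [← ofReal_norm, ← ENNReal.ofReal_pow (norm_nonneg _)]
      apply ENNReal.ofReal_le_ofReal
      have h2 := hC _ (hmem n ω)
      have h3 : |ω| ≤ ‖(a n : ℂ) + ω * Complex.I‖ := by
        refine le_trans (le_of_eq ?_) (Complex.abs_im_le_norm _)
        simp
      calc ‖G (a n + ω * Complex.I)‖ ^ 2 ≤ (C / (1 + |ω|)) ^ 2 := by
            refine pow_le_pow_left₀ (norm_nonneg _) (h2.trans ?_) 2
            exact div_le_div_of_nonneg_left hC0 (by positivity) (by linarith)
        _ = C ^ 2 * (1 / (1 + |ω|) ^ 2) := by field_simp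
        _ ≤ _ := mul_le_mul_of_nonneg_left (inv_one_add_abs_sq_le ω) (by positivity)
    · exact (integrable_inv_one_add_sq.const_mul (C ^ 2)).lintegral_lt_top.ne
    · refine Eventually.of_forall fun ω => ?_
      have h2 : Tendsto (fun n => (a n : ℂ) + ω * Complex.I) atTop
          (𝓝[{s | 0 ≤ s.re}] (ω * Complex.I)) := by
        refine tendsto_nhdsWithin_iff.2 ⟨?_, Eventually.of_forall fun n => hmem n ω⟩
        simpa using ((Complex.continuous_ofReal.tendsto 0).comp hat).add_const (ω * Complex.I)
      have h3 := (hh.cont (ω * Complex.I) (by simp)).tendsto.comp h2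
      exact (ENNReal.continuous_pow 2).continuousAt.tendsto.comp h3.enorm
  have h2 : ∫⁻ t in Set.Ioi (0 : ℝ), ‖h t‖ₑ ^ 2 ≤ liminf (fun n =>
      ∫⁻ t in Set.Ioi (0 : ℝ), ENNReal.ofReal (Real.exp (-2 * a n * t)) * ‖h t‖ₑ ^ 2) atTop := by
    calc _ = ∫⁻ t in Set.Ioi (0 : ℝ), liminf (fun n =>
        ENNReal.ofReal (Real.exp (-2 * a n * t)) * ‖h t‖ₑ ^ 2) atTop := by
          refine lintegral_congr fun t => ?_
          have h3 : Tendsto (fun n => ENNReal.ofReal (Real.exp (-2 * a n * t))) atTop (𝓝 1) := by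
            rw [← ENNReal.ofReal_one, ← Real.exp_zero]
            refine (ENNReal.continuous_ofReal.tendsto _).comp
              ((Real.continuous_exp.tendsto _).comp ?_)
            simpa using (hat.const_mul (-2)).mul_const t
          have h4 := ENNReal.Tendsto.mul_const (b := ‖h t‖ₑ ^ 2) h3 (Or.inl one_ne_zero)
          rw [one_mul] at h4
          exact h4.liminf_eq.symm
      _ ≤ _ := lintegral_liminf_le' fun n => by
          refine AEMeasurable.mul (ENNReal.measurable_ofReal.comp
            (by fun_prop : Measurable fun t : ℝ => Real.exp (-2 * a n * t))).aemeasurable ?_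
          exact hm.1.enorm.pow_const 2
  calc _ ≤ ENNReal.ofReal (2 * Real.pi) * liminf (fun n =>
      ∫⁻ t in Set.Ioi (0 : ℝ), ENNReal.ofReal (Real.exp (-2 * a n * t)) * ‖h t‖ₑ ^ 2) atTop := by
        gcongr
    _ ≤ liminf (fun n => ENNReal.ofReal (2 * Real.pi) * ∫⁻ t in Set.Ioi (0 : ℝ),
        ENNReal.ofReal (Real.exp (-2 * a n * t)) * ‖h t‖ₑ ^ 2) atTop := by
        rw [ENNReal.liminf_const_mul_of_ne_zero_of_ne_top _ ENNReal.ofReal_ne_top]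
        simpa using Real.pi_pos
    _ = liminf (fun n => ∫⁻ ω : ℝ, ‖G (a n + ω * Complex.I)‖ₑ ^ 2) atTop := by
        congr 1
        ext n
        exact (hG.plancherel hm (ha0 n)).symm
    _ = _ := h1.liminf_eq

end

section

/-! ### Impulse responses of stable systems -/

/-- `h` is a continuous, exponentially decaying signal with Laplace transform `G`. -/
structure ExpSignal (h : ℝ → ℂ) (G : ℂ → ℂ) : Prop where
  cont : Continuous h
  bound : ∃ C δ : ℝ, 0 < δ ∧ ∀ t : ℝ, 0 ≤ t → ‖h t‖ ≤ C * Real.exp (-δ * t)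
  lap : ∀ s : ℂ, 0 < s.re → ∫ t in Set.Ioi (0 : ℝ), Complex.exp (-s * t) * h t = G s

namespace ExpSignal

variable {h h' : ℝ → ℂ} {G G' : ℂ → ℂ}

lemma norm_exp_le {s : ℂ} (hs : 0 ≤ s.re) {t : ℝ} (ht : 0 ≤ t) :
    ‖Complex.exp (-s * t)‖ ≤ 1 := by
  rw [Complex.norm_exp]
  simp only [Complex.mul_re, Complex.neg_re, Complex.ofReal_re, Complex.neg_im,
    Complex.ofReal_im, mul_zero, sub_zero]
  rw [Real.exp_le_one_iff]
  have := mul_nonneg hs ht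
  linarith

lemma integrableOn (hh : ExpSignal h G) {s : ℂ} (hs : 0 ≤ s.re) :
    IntegrableOn (fun t : ℝ => Complex.exp (-s * t) * h t) (Set.Ioi 0) := by
  obtain ⟨C, δ, hδ, hC⟩ := hh.bound
  have h1 : IntegrableOn (fun t : ℝ => C * Real.exp (-δ * t)) (Set.Ioi 0) :=
    (exp_neg_integrableOn_Ioi 0 hδ).const_mul C
  refine Integrable.mono' h1 (Continuous.aestronglyMeasurable (by have := hh.cont; fun_prop)) ?_
  filter_upwards [ae_restrict_mem measurableSet_Ioi] with t ht
  rw [norm_mul]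
  exact (mul_le_of_le_one_left (norm_nonneg _) (norm_exp_le hs (le_of_lt ht))).trans
    (hC t (le_of_lt ht))

lemma congr (hh : ExpSignal h G) (hG : ∀ s : ℂ, 0 < s.re → G s = G' s) : ExpSignal h G' :=
  ⟨hh.cont, hh.bound, fun s hs => (hh.lap s hs).trans (hG s hs)⟩

lemma zero : ExpSignal (fun _ => 0) fun _ => 0 :=
  ⟨continuous_const, ⟨0, 1, one_pos, fun t _ => by simp⟩, fun s _ => by simp⟩

lemma add (hh : ExpSignal h G) (hh' : ExpSignal h' G') :
    ExpSignal (fun t => h t + h' t) fun s => G s + G' s := by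
  obtain ⟨C, δ, hδ, hC⟩ := hh.bound
  obtain ⟨C', δ', hδ', hC'⟩ := hh'.bound
  refine ⟨hh.cont.add hh'.cont, ⟨C + C', min δ δ', lt_min hδ hδ', fun t ht => ?_⟩,
    fun s hs => ?_⟩
  · have hC0 : 0 ≤ C := by simpa using (norm_nonneg _).trans (hC 0 le_rfl)
    have hC0' : 0 ≤ C' := by simpa using (norm_nonneg _).trans (hC' 0 le_rfl)
    refine (norm_add_le _ _).trans ?_
    rw [add_mul]
    refine add_le_add ((hC t ht).trans ?_) ((hC' t ht).trans ?_)
    · refine mul_le_mul_of_nonneg_left (Real.exp_le_exp.2 ?_) hC0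
      have := mul_le_mul_of_nonneg_right (min_le_left δ δ') ht
      linarith
    · refine mul_le_mul_of_nonneg_left (Real.exp_le_exp.2 ?_) hC0'
      have := mul_le_mul_of_nonneg_right (min_le_right δ δ') ht
      linarith
  · simp only [mul_add]
    rw [integral_add (hh.integrableOn hs.le) (hh'.integrableOn hs.le), hh.lap s hs, hh'.lap s hs]

lemma const_mul (hh : ExpSignal h G) (c : ℂ) :
    ExpSignal (fun t => c * h t) fun s => c * G s := by
  obtain ⟨C, δ, hδ, hC⟩ := hh.bound
  refine ⟨continuous_const.mul hh.cont, ⟨‖c‖ * C, δ, hδ, fun t ht => ?_⟩, fun s hs => ?_⟩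
  · rw [norm_mul, mul_assoc]
    exact mul_le_mul_of_nonneg_left (hC t ht) (norm_nonneg _)
  · simp only [mul_left_comm _ c]
    rw [integral_const_mul, hh.lap s hs]

lemma exp {b : ℂ} (hb : b.re < 0) :
    ExpSignal (fun t : ℝ => Complex.exp (b * t)) fun s => 1 / (s - b) := by
  refine ⟨by fun_prop, ⟨1, -b.re, by linarith, fun t _ => ?_⟩, fun s hs => ?_⟩
  · rw [Complex.norm_exp]
    simp
  · simp only [← Complex.exp_add, ← add_mul]
    rw [integral_exp_mul_complex_Ioi (by simp; linarith)]
    have : s - b ≠ 0 := fun h => by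
      have := congrArg Complex.re h
      simp at this
      linarith
    simp only [Complex.ofReal_zero, mul_zero, Complex.exp_zero]
    rw [show -s + b = -(s - b) by ring, neg_div_neg_eq]

/-- Division by `s - b` is convolution with `exp (b t)`, that is, the solution of `h₁' = b h₁ + h`
with `h₁(0) = 0`. Its transform follows by integrating the derivative of `exp (-s t) h₁`. -/
lemma div_sub (hh : ExpSignal h G) {b : ℂ} (hb : b.re < 0) :
    ∃ h₁, ExpSignal h₁ fun s => G s / (s - b) := by
  set h₁ : ℝ → ℂ := fun t => Complex.exp (b * t) *
    ∫ τ in (0 : ℝ)..t, Complex.exp (-b * τ) * h τ with hh₁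
  have hcont : Continuous fun τ : ℝ => Complex.exp (-b * τ) * h τ := by
    have := hh.cont
    fun_prop
  have hd : ∀ t, HasDerivAt h₁ (b * h₁ t + h t) t := by
    intro t
    have h2 : HasDerivAt (fun t : ℝ => Complex.exp (b * t)) (Complex.exp (b * t) * b) t := by
      have h3 : HasDerivAt (fun t : ℝ => b * (t : ℂ)) b t := by
        simpa using (Complex.ofRealCLM.hasDerivAt (x := t)).const_mul b
      exact h3.cexp
    have h4 := intervalIntegral.integral_hasDerivAt_right (hcont.intervalIntegrable 0 t)
      (hcont.stronglyMeasurableAtFilter _ _) hcont.continuousAt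
    refine (h2.mul h4).congr_deriv ?_
    simp only [hh₁]
    have h5 : Complex.exp (b * t) * (Complex.exp (-b * t) * h t) = h t := by
      rw [← mul_assoc, ← Complex.exp_add]
      simp
    rw [h5]
    ring
  have hc1 : Continuous h₁ := continuous_iff_continuousAt.2 fun t => (hd t).continuousAt
  obtain ⟨C, δ, hδ, hC⟩ := hh.bound
  have hC0 : 0 ≤ C := by simpa using (norm_nonneg _).trans (hC 0 le_rfl)
  set d := min δ (-b.re) with hdd
  have hd0 : 0 < d := lt_min hδ (by linarith)
  -- The convolution is only bounded by `t exp (-d t)`; half of the rate `d` is spent on absorbing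
  -- the factor `t`.
  have hbd : ∀ t : ℝ, 0 ≤ t → ‖h₁ t‖ ≤ C / (d / 2) * Real.exp (-(d / 2) * t) := by
    intro t ht
    have h2 : ‖h₁ t‖ ≤ C * Real.exp (-d * t) * |t - 0| := by
      simp only [hh₁]
      rw [← intervalIntegral.integral_const_mul]
      refine intervalIntegral.norm_integral_le_of_norm_le_const fun τ hτ => ?_
      rw [Set.uIoc_of_le ht] at hτ
      rw [norm_mul, norm_mul, Complex.norm_exp, Complex.norm_exp]
      simp only [Complex.mul_re, Complex.neg_re, Complex.ofReal_re, Complex.ofReal_im, mul_zero,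
        sub_zero]
      have h3 := hC τ hτ.1.le
      have h4 : Real.exp (b.re * t) * (Real.exp (-b.re * τ) * ‖h τ‖) ≤
          Real.exp (b.re * t) * (Real.exp (-b.re * τ) * (C * Real.exp (-δ * τ))) := by gcongr
      refine h4.trans ?_
      rw [show Real.exp (b.re * t) * (Real.exp (-b.re * τ) * (C * Real.exp (-δ * τ))) =
        C * (Real.exp (b.re * t) * Real.exp (-b.re * τ) * Real.exp (-δ * τ)) by ring,
        ← Real.exp_add, ← Real.exp_add]
      refine mul_le_mul_of_nonneg_left (Real.exp_le_exp.2 ?_) hC0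
      have h5 := mul_le_mul_of_nonneg_right (min_le_left δ (-b.re)) hτ.1.le
      have h6 := mul_le_mul_of_nonneg_right (min_le_right δ (-b.re)) (sub_nonneg.2 hτ.2)
      rw [← hdd] at h5 h6
      linarith
    refine h2.trans ?_
    rw [sub_zero, abs_of_nonneg ht]
    have h3 : d / 2 * t ≤ Real.exp (d / 2 * t) := by
      linarith [Real.add_one_le_exp (d / 2 * t)]
    have h4 : Real.exp (-d * t) * Real.exp (d / 2 * t) = Real.exp (-(d / 2) * t) := by
      rw [← Real.exp_add]
      congr 1
      ring
    rw [← h4, div_mul_eq_mul_div, le_div_iff₀ (by positivity)]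
    have h5 : 0 ≤ C * Real.exp (-d * t) := by positivity
    nlinarith
  have key : ExpSignal h₁ fun s =>
      ∫ t in Set.Ioi (0 : ℝ), Complex.exp (-s * t) * h₁ t :=
    ⟨hc1, ⟨_, _, by positivity, hbd⟩, fun s _ => rfl⟩
  refine ⟨h₁, key.congr fun s hs => ?_⟩
  have hne : s - b ≠ 0 := fun h => by
    have := congrArg Complex.re h
    simp at this
    linarith
  have hF : ∀ t : ℝ, HasDerivAt (fun t : ℝ => Complex.exp (-s * t) * h₁ t)
      ((b - s) * (Complex.exp (-s * t) * h₁ t) + Complex.exp (-s * t) * h t) t := by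
    intro t
    have h3 : HasDerivAt (fun t : ℝ => -s * (t : ℂ)) (-s) t := by
      simpa using (Complex.ofRealCLM.hasDerivAt (x := t)).const_mul (-s)
    refine (h3.cexp.mul (hd t)).congr_deriv ?_
    ring
  have hi1 := (key.integrableOn hs.le).const_mul (b - s)
  have hi2 := hh.integrableOn hs.le
  have hlim : Tendsto (fun t : ℝ => Complex.exp (-s * t) * h₁ t) atTop (𝓝 0) := by
    have h5 : Tendsto (fun t : ℝ => C / (d / 2) * Real.exp (-(d / 2) * t)) atTop
        (𝓝 (C / (d / 2) * 0)) := by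
      refine Tendsto.const_mul _ (Real.tendsto_exp_atBot.comp ?_)
      exact tendsto_id.const_mul_atTop_of_neg (by linarith)
    rw [mul_zero] at h5
    refine squeeze_zero_norm' ?_ h5
    filter_upwards [eventually_ge_atTop (0 : ℝ)] with t ht
    rw [norm_mul]
    exact (mul_le_of_le_one_left (norm_nonneg _) (norm_exp_le hs.le ht)).trans (hbd t ht)
  have h6 := integral_Ioi_of_hasDerivAt_of_tendsto (hF 0).continuousAt.continuousWithinAt
    (fun t _ => hF t) (hi1.add hi2) hlim
  rw [integral_add hi1 hi2, integral_const_mul, hh.lap s hs] at h6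
  have h7 : h₁ 0 = 0 := by simp [hh₁]
  rw [h7, mul_zero, sub_zero] at h6
  rw [eq_div_iff hne]
  linear_combination -h6

lemma exists_inv_prod (R : Multiset ℂ) (hR : ∀ r ∈ R, r.re < 0) (h0 : R ≠ 0) :
    ∃ h, ExpSignal h fun s => 1 / (R.map fun r => s - r).prod := by
  induction R using Multiset.induction_on with
  | empty => exact absurd rfl h0
  | cons r R ih =>
    by_cases hR0 : R = 0
    · subst hR0
      exact ⟨_, (exp (hR r (by simp))).congr fun s _ => by simp⟩
    · obtain ⟨h, hh⟩ := ih (fun r hr => hR r (by simp [hr])) hR0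
      obtain ⟨h₁, hh₁⟩ := hh.div_sub (hR r (by simp))
      refine ⟨h₁, hh₁.congr fun s _ => ?_⟩
      rw [Multiset.map_cons, Multiset.prod_cons, div_div, mul_comm]

/-- Division with remainder by `X - r` replaces `p` by a quotient, to which the induction hypothesis
applies, and the constant `p(r)`, which needs only a reciprocal of linear factors. In this way
multiple roots require no separate treatment. -/
lemma exists_div_prod (R : Multiset ℂ) (hR : ∀ r ∈ R, r.re < 0) (p : Polynomial ℂ)
    (hp : p.degree < R.card) :
    ∃ h, ExpSignal h fun s => p.eval s / (R.map fun r => s - r).prod := by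
  induction R using Multiset.induction_on generalizing p with
  | empty =>
    have : p = 0 := by simpa using hp
    exact ⟨_, zero.congr fun s _ => by simp [this]⟩
  | cons r R ih =>
    have hR' : ∀ r ∈ R, r.re < 0 := fun r hr => hR r (by simp [hr])
    have hdiv := Polynomial.modByMonic_add_div p (Polynomial.X - Polynomial.C r)
    rw [Polynomial.modByMonic_X_sub_C_eq_C_eval] at hdiv
    have hdeg : (p /ₘ (Polynomial.X - Polynomial.C r)).degree < R.card := by
      by_cases hq : p /ₘ (Polynomial.X - Polynomial.C r) = 0
      · rw [hq, Polynomial.degree_zero]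
        exact WithBot.bot_lt_coe _
      · have h1 : p ≠ 0 := by rintro rfl; simp at hq
        have h2 := Polynomial.natDegree_divByMonic p (Polynomial.monic_X_sub_C r)
        rw [Polynomial.natDegree_X_sub_C] at h2
        rw [Polynomial.degree_eq_natDegree h1, Multiset.card_cons] at hp
        have hp' : p.natDegree < R.card + 1 := by exact_mod_cast hp
        have h3 : 1 ≤ p.natDegree := by
          by_contra! h4
          have h5 : p.natDegree = 0 := by omega
          apply hq
          rw [Polynomial.divByMonic_eq_zero_iff (Polynomial.monic_X_sub_C r),
            Polynomial.degree_X_sub_C, Polynomial.degree_eq_natDegree h1, h5]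
          norm_num
        rw [Polynomial.degree_eq_natDegree hq, h2]
        norm_cast
        omega
    obtain ⟨h1, hh1⟩ := ih hR' _ hdeg
    obtain ⟨h2, hh2⟩ := exists_inv_prod (r ::ₘ R) hR (by simp)
    refine ⟨_, (hh1.add (hh2.const_mul (p.eval r))).congr fun s hs => ?_⟩
    have hne : s - r ≠ 0 := fun h => by
      have h3 := congrArg Complex.re h
      have h4 := hR r (by simp)
      simp at h3
      linarith
    have hne2 : (R.map fun r => s - r).prod ≠ 0 := by
      rw [Ne, Multiset.prod_eq_zero_iff, Multiset.mem_map]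
      rintro ⟨r', hr', h⟩
      have h3 := congrArg Complex.re h
      have h4 := hR' r' hr'
      simp at h3
      linarith
    have h5 := congrArg (Polynomial.eval s) hdiv
    simp only [Polynomial.eval_add, Polynomial.eval_C, Polynomial.eval_mul, Polynomial.eval_sub,
      Polynomial.eval_X] at h5
    rw [Multiset.map_cons, Multiset.prod_cons, ← h5]
    field_simp
    ring

end ExpSignal

/-- A stable strictly proper system has a square integrable impulse response. -/
lemma exists_impulseResponse {g : RatFunc ℝ} (hg : Stable g) (hs : StrictlyProper g) :
    ∃ h : ℝ → ℝ, MemLp h 2 (volume.restrict (Set.Ioi 0)) ∧ Continuous h ∧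
      HasLaplace h (ev g) := by
  set q := g.denom.map (algebraMap ℝ ℂ) with hq
  set p := g.num.map (algebraMap ℝ ℂ) with hp
  have hq0 : q ≠ 0 := by simpa [hq, Polynomial.map_eq_zero] using g.denom_ne_zero
  have hsp := IsAlgClosed.splits q
  have hroots : ∀ r ∈ q.roots, r.re < 0 := by
    intro r hr
    have hr2 : q.eval r = 0 := (Polynomial.mem_roots hq0).1 hr
    by_contra! h
    refine hg.2 r h ?_
    rwa [hq, Polynomial.eval_map_algebraMap] at hr2
  have hdeg : p.degree < q.roots.card := by
    rw [← hsp.natDegree_eq_card_roots, ← Polynomial.degree_eq_natDegree hq0, hp, hq,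
      Polynomial.degree_map, Polynomial.degree_map]
    exact hs
  obtain ⟨h, hh⟩ := ExpSignal.exists_div_prod q.roots hroots p hdeg
  have hh2 : ExpSignal (fun t => q.leadingCoeff⁻¹ * h t) (ev g) := by
    refine (hh.const_mul q.leadingCoeff⁻¹).congr fun s hs => ?_
    rw [ev_eq_div, ← Polynomial.eval_map_algebraMap, ← Polynomial.eval_map_algebraMap, ← hp, ← hq,
      hsp.eval_eq_prod_roots s]
    field_simp
  clear_value p q
  -- The signal was built root by root and may be complex. As `g` has real coefficients, the
  -- conjugate signal has the same transform, and so has the real part.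
  set k : ℝ → ℂ := fun t => q.leadingCoeff⁻¹ * h t with hk
  refine ⟨fun t => (k t).re, ?_, Complex.continuous_re.comp hh2.cont, ?_⟩
  · obtain ⟨C, δ, hδ, hC⟩ := hh2.bound
    have hCint : IntegrableOn (fun t : ℝ => C ^ 2 * Real.exp (-(2 * δ) * t)) (Set.Ioi 0) :=
      (exp_neg_integrableOn_Ioi 0 (by positivity)).const_mul _
    have hm : AEStronglyMeasurable (fun t => (k t).re) (volume.restrict (Set.Ioi (0 : ℝ))) :=
      (Complex.continuous_re.comp hh2.cont).aestronglyMeasurable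
    rw [memLp_two_iff_integrable_sq hm]
    refine Integrable.mono' hCint (hm.pow 2) ?_
    filter_upwards [ae_restrict_mem measurableSet_Ioi] with t ht
    rw [Real.norm_of_nonneg (by positivity)]
    have h1 := (Complex.abs_re_le_norm (k t)).trans (hC t (le_of_lt ht))
    calc (k t).re ^ 2 = |(k t).re| ^ 2 := (sq_abs _).symm
      _ ≤ (C * Real.exp (-δ * t)) ^ 2 := pow_le_pow_left₀ (abs_nonneg _) h1 2
      _ = C ^ 2 * Real.exp (-(2 * δ) * t) := by
        rw [mul_pow, ← Real.exp_nat_mul]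
        congr 2
        push_cast
        ring
  · intro s hs
    have hs' : 0 < (star s).re := by simpa using hs
    have hi1 := hh2.integrableOn hs.le
    have hi2 := hh2.integrableOn hs'.le
    have hconj : ∀ t : ℝ, star (Complex.exp (-(star s) * t) * k t) =
        Complex.exp (-s * t) * star (k t) := by
      intro t
      rw [star_mul', show star (Complex.exp (-(star s) * t)) =
        (starRingEnd ℂ) (Complex.exp (-(star s) * t)) from rfl, ← Complex.exp_conj]
      simp
    have hi3 : IntegrableOn (fun t : ℝ => Complex.exp (-s * t) * star (k t)) (Set.Ioi 0) := by
      have h1 := (Complex.conjLIE.toContinuousLinearEquiv :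
        ℂ ≃L[ℝ] ℂ).toContinuousLinearMap.integrable_comp hi2
      refine h1.congr (Eventually.of_forall fun t => ?_)
      exact hconj t
    have hre : ∀ t : ℝ, Complex.exp (-s * t) * (((k t).re : ℝ) : ℂ) =
        1 / 2 * (Complex.exp (-s * t) * k t) + 1 / 2 * (Complex.exp (-s * t) * star (k t)) := by
      intro t
      have h1 : (((k t).re : ℝ) : ℂ) = (k t + star (k t)) / 2 := by
        have := Complex.add_conj (k t)
        rw [show star (k t) = (starRingEnd ℂ) (k t) from rfl, this]
        push_cast
        ring
      rw [h1]
      ring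
    simp_rw [hre]
    refine ⟨(hi1.const_mul _).add (hi3.const_mul _), ?_⟩
    rw [integral_add (hi1.const_mul _) (hi3.const_mul _), integral_const_mul, integral_const_mul,
      hh2.lap s hs]
    have h4 : ∫ t in Set.Ioi (0 : ℝ), Complex.exp (-s * t) * star (k t) = ev g s := by
      simp_rw [← hconj]
      have h5 : ∫ t in Set.Ioi (0 : ℝ), star (Complex.exp (-(star s) * t) * k t) =
          star (∫ t in Set.Ioi (0 : ℝ), Complex.exp (-(star s) * t) * k t) := integral_conj
      rw [h5, hh2.lap _ hs', ev_conj, star_star]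
    rw [h4]
    ring

lemma hasLaplace_one : HasLaplace (fun _ => 1) fun s => 1 / s := by
  intro s hs
  simp only [Complex.ofReal_one, mul_one]
  refine ⟨integrableOn_exp_mul_complex_Ioi (by simpa using hs) 0, ?_⟩
  rw [integral_exp_mul_complex_Ioi (by simpa using hs)]
  simp [neg_div_neg_eq]

lemma HasLaplace.const_mul {h : ℝ → ℝ} {G : ℂ → ℂ} (hG : HasLaplace h G) (c : ℝ) :
    HasLaplace (fun t => c * h t) fun s => c * G s := by
  intro s hs
  obtain ⟨h1, h2⟩ := hG s hs
  simp only [Complex.ofReal_mul, mul_left_comm _ (c : ℂ)]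
  exact ⟨h1.const_mul _, by rw [integral_const_mul, h2]⟩

lemma HasLaplace.add {h h' : ℝ → ℝ} {G G' : ℂ → ℂ} (hG : HasLaplace h G)
    (hG' : HasLaplace h' G') : HasLaplace (fun t => h t + h' t) fun s => G s + G' s := by
  intro s hs
  obtain ⟨h1, h2⟩ := hG s hs
  obtain ⟨h3, h4⟩ := hG' s hs
  simp only [Complex.ofReal_add, mul_add]
  exact ⟨h1.add h3, by rw [integral_add h1 h3, h2, h4]⟩

lemma HasLaplace.sub {h h' : ℝ → ℝ} {G G' : ℂ → ℂ} (hG : HasLaplace h G)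
    (hG' : HasLaplace h' G') : HasLaplace (fun t => h t - h' t) fun s => G s - G' s := by
  simpa [sub_eq_add_neg] using hG.add (hG'.const_mul (-1))

lemma HasLaplace.congr {h : ℝ → ℝ} {G G' : ℂ → ℂ} (hG : HasLaplace h G)
    (hc : ∀ s : ℂ, 0 < s.re → G s = G' s) : HasLaplace h G' :=
  fun s hs => ⟨(hG s hs).1, (hG s hs).2.trans (hc s hs)⟩

end

/-! ### White noise isometry and energies of responses -/

section

variable {l : ℕ} {Ω : Type*} [MeasurableSpace Ω] {μ : Measure Ω}

lemma integral_sq_eq_norm_sq (f : Lp ℝ 2 μ) : ∫ x, (f x) ^ 2 ∂μ = ‖f‖ ^ 2 := by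
  rw [← real_inner_self_eq_norm_sq, L2.inner_def]
  simp [sq]

lemma integrable_sq (f : Lp ℝ 2 μ) : Integrable (fun x => (f x) ^ 2) μ :=
  (Lp.memLp f).integrable_sq

lemma IsWhiteNoise.norm_sq {σ : Fin l → ℝ} {W : Noise l μ} (hW : IsWhiteNoise σ W)
    (φ : Fin l → TimeL2) : ‖∑ i, W i (φ i)‖ ^ 2 = ∑ i, σ i ^ 2 * ‖φ i‖ ^ 2 := by
  have hnn : 0 ≤ ∑ i, σ i ^ 2 * ‖φ i‖ ^ 2 := by positivity
  set A : Lp ℝ 2 μ := ∑ i, W i (φ i) with hA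
  have hm : AEMeasurable (A : Ω → ℝ) μ := (Lp.aestronglyMeasurable A).aemeasurable
  have h1 : ∫ x, (A x) ^ 2 ∂μ = ∫ y, y ^ 2 ∂(μ.map A) :=
    (integral_map (f := fun y : ℝ => y ^ 2) hm
      (continuous_pow 2).aestronglyMeasurable).symm
  rw [← integral_sq_eq_norm_sq, h1, hA, hW φ]
  have h2 := variance_id_gaussianReal (μ := 0) (v := (∑ i, σ i ^ 2 * ‖φ i‖ ^ 2).toNNReal)
  rw [variance_eq_integral (by fun_prop)] at h2
  simpa [integral_id_gaussianReal, hnn] using h2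

lemma norm_sq_add_noise {σ γ : Fin l → ℝ} {W N : Noise l μ} (hW : IsWhiteNoise σ W)
    (hN : IsWhiteNoise γ N) (hWN : Uncorrelated W N) (φ ψ : Fin l → TimeL2) :
    ‖∑ i, W i (φ i) + ∑ i, N i (ψ i)‖ ^ 2 =
      ∑ i, σ i ^ 2 * ‖φ i‖ ^ 2 + ∑ i, γ i ^ 2 * ‖ψ i‖ ^ 2 := by
  have hin : inner ℝ (∑ i, W i (φ i)) (∑ i, N i (ψ i)) = 0 := by
    rw [sum_inner]
    refine Finset.sum_eq_zero fun i _ => ?_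
    rw [inner_sum]
    refine Finset.sum_eq_zero fun j _ => ?_
    rw [L2.inner_def, ← hWN i j (φ i) (ψ j)]
    refine integral_congr_ae (Eventually.of_forall fun x => ?_)
    simp [mul_comm]
  rw [norm_add_sq_real, hin, hW.norm_sq, hN.norm_sq]
  ring

/-- Energy of a signal on `(0, ∞)`. -/
def energy (g : ℝ → ℝ) : ENNReal := ∫⁻ t in Set.Ioi (0 : ℝ), ‖g t‖ₑ ^ 2

/-- Local square integrability on `[0, ∞)`. -/
def LocL2 (g : ℝ → ℝ) : Prop := ∀ t : ℝ, MemLp g 2 (volume.restrict (Set.Icc 0 t))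

lemma Continuous.locL2 {g : ℝ → ℝ} (hg : Continuous g) : LocL2 g := fun t => by
  obtain ⟨C, hC⟩ := isCompact_Icc.exists_bound_of_continuousOn (s := Set.Icc 0 t) hg.continuousOn
  have : IsFiniteMeasure (volume.restrict (Set.Icc (0 : ℝ) t)) :=
    ⟨by simp⟩
  refine MemLp.of_bound hg.aestronglyMeasurable C ?_
  rw [ae_restrict_iff' measurableSet_Icc]
  exact Eventually.of_forall hC

/-- Reflection about `t` turns the window into the truncation of `g` to `[0, t]`, and reflection
preserves Lebesgue measure; norms of windows are therefore truncated energies. -/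
lemma window_eq_comp (g : ℝ → ℝ) (t : ℝ) :
    window g t = fun τ => (Set.Icc 0 t).indicator g (t - τ) := by
  funext τ
  by_cases h : τ ∈ Set.Icc 0 t
  · rw [window, Set.indicator_of_mem h, 
      Set.indicator_of_mem (show t - τ ∈ Set.Icc 0 t from ⟨by linarith [h.2], by linarith [h.1]⟩)]
  · rw [window, Set.indicator_of_notMem h, Set.indicator_of_notMem]
    exact fun h' => h ⟨by linarith [h'.2], by linarith [h'.1]⟩

lemma LocL2.memLp_window {g : ℝ → ℝ} (hg : LocL2 g) (t : ℝ) : MemLp (window g t) 2 volume := by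
  rw [window_eq_comp]
  exact ((memLp_indicator_iff_restrict measurableSet_Icc).2 (hg t)).comp_measurePreserving
    (Measure.measurePreserving_sub_left volume t)

lemma LocL2.toL2_window {g : ℝ → ℝ} (hg : LocL2 g) (t : ℝ) :
    toL2 (window g t) = (hg.memLp_window t).toLp := by
  rw [toL2, dif_pos (hg.memLp_window t)]

lemma LocL2.sub {g h : ℝ → ℝ} (hg : LocL2 g) (hh : LocL2 h) : LocL2 fun t => g t - h t :=
  fun t => (hg t).sub (hh t)

lemma LocL2.const_mul {g : ℝ → ℝ} (hg : LocL2 g) (c : ℝ) : LocL2 fun t => c * g t :=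
  fun t => (hg t).const_mul c

lemma toL2_window_sub {g h : ℝ → ℝ} (hg : LocL2 g) (hh : LocL2 h) (t : ℝ) :
    toL2 (window (fun τ => g τ - h τ) t) = toL2 (window g t) - toL2 (window h t) := by
  rw [hg.toL2_window, hh.toL2_window, (hg.sub hh).toL2_window, ← MemLp.toLp_sub]
  congr 1
  funext τ
  by_cases hτ : τ ∈ Set.Icc 0 t <;> simp [window, hτ]

lemma toL2_window_const_mul {g : ℝ → ℝ} (hg : LocL2 g) (c t : ℝ) :
    toL2 (window (fun τ => c * g τ) t) = c • toL2 (window g t) := by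
  rw [hg.toL2_window, (hg.const_mul c).toL2_window, ← MemLp.toLp_const_smul]
  congr 1
  funext τ
  by_cases hτ : τ ∈ Set.Icc 0 t <;> simp [window, hτ]

lemma LocL2.ofReal_norm_sq {g : ℝ → ℝ} (hg : LocL2 g) (t : ℝ) :
    ENNReal.ofReal (‖toL2 (window g t)‖ ^ 2) = ∫⁻ τ in Set.Icc 0 t, ‖g τ‖ₑ ^ 2 := by
  rw [hg.toL2_window, Lp.norm_toLp, ENNReal.ofReal_pow ENNReal.toReal_nonneg,
    ENNReal.ofReal_toReal (hg.memLp_window t).2.ne,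
    eLpNorm_eq_lintegral_rpow_enorm_toReal (by norm_num) (by norm_num)]
  simp only [ENNReal.toReal_ofNat]
  rw [← ENNReal.rpow_natCast, ← ENNReal.rpow_mul]
  norm_num
  rw [window_eq_comp, lintegral_sub_left_eq_self
    (fun τ => ‖(Set.Icc 0 t).indicator g τ‖ₑ ^ 2) t, ← lintegral_indicator measurableSet_Icc]
  refine lintegral_congr fun τ => ?_
  by_cases hτ : τ ∈ Set.Icc 0 t <;> simp [hτ]

lemma LocL2.tendsto_energy {g : ℝ → ℝ} (_ : LocL2 g) :
    Tendsto (fun t : ℝ => ∫⁻ τ in Set.Icc 0 t, ‖g τ‖ₑ ^ 2) atTop (𝓝 (energy g)) := by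
  have h : (fun t : ℝ => ∫⁻ τ in Set.Icc 0 t, ‖g τ‖ₑ ^ 2) =
      fun t => (volume.withDensity fun τ => ‖g τ‖ₑ ^ 2) (Set.Ioc 0 t) := by
    funext t
    rw [withDensity_apply _ measurableSet_Ioc, restrict_Ioc_eq_restrict_Icc]
  have h2 : energy g = (volume.withDensity fun τ => ‖g τ‖ₑ ^ 2) (⋃ t : ℝ, Set.Ioc 0 t) := by
    rw [Set.iUnion_Ioc_right, withDensity_apply _ measurableSet_Ioi, energy]
  rw [h, h2]
  exact tendsto_measure_iUnion_atTop fun s t hst => Set.Ioc_subset_Ioc_right hst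

lemma LocL2.aestronglyMeasurable {g : ℝ → ℝ} (hg : LocL2 g) :
    AEStronglyMeasurable g (volume.restrict (Set.Ioi 0)) := by
  have h : Set.Ioi (0 : ℝ) ⊆ ⋃ n : ℕ, Set.Icc 0 (n : ℝ) := fun t ht => by
    obtain ⟨n, hn⟩ := exists_nat_ge t
    exact Set.mem_iUnion.2 ⟨n, ht.le, hn⟩
  exact (aestronglyMeasurable_iUnion_iff.2 fun n : ℕ => (hg n).1).mono_measure
    (Measure.restrict_mono h le_rfl)

lemma LocL2.memLp {g : ℝ → ℝ} (hg : LocL2 g) (he : energy g ≠ ⊤) :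
    MemLp g 2 (volume.restrict (Set.Ioi 0)) := by
  refine ⟨hg.aestronglyMeasurable, ?_⟩
  rw [eLpNorm_lt_top_iff_lintegral_rpow_enorm_lt_top (by norm_num) (by norm_num)]
  simpa [energy] using he.lt_top

end

/-! ### The cost in the time domain and in the frequency domain -/

section

variable {l : ℕ} {Ω : Type*} [MeasurableSpace Ω] {μ : Measure Ω}

/-- The weighted sum of the energies of the error and input responses. -/
def timeCost (ε : ℝ) (σ γ : Fin l → ℝ) (a b a' b' : Fin l → Fin l → ℝ → ℝ) : ENNReal :=
  ∑ i, ∑ j, (ENNReal.ofReal ((1 - ε) * σ j ^ 2) *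
        energy (fun t => (1 : Matrix (Fin l) (Fin l) ℝ) i j * 1 - a i j t) +
      ENNReal.ofReal ((1 - ε) * γ j ^ 2) * energy (b i j) +
      ENNReal.ofReal (ε * σ j ^ 2) * energy (a' i j) +
      ENNReal.ofReal (ε * γ j ^ 2) * energy (b' i j))

lemma locL2_one : LocL2 fun _ => 1 := Continuous.locL2 continuous_const

/-- The reference is the noise integral of the unit step, so the error in component `i` is again a
noise integral, with kernel `δᵢⱼ - aᵢⱼ` from channel `j`. Independence and absence of correlation
leave only squared norms. -/
lemma integral_cost {ε : ℝ} {σ γ : Fin l → ℝ} {W N : Noise l μ}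
    (hW : IsWhiteNoise σ W) (hN : IsWhiteNoise γ N) (hWN : Uncorrelated W N)
    {a b a' b' : Fin l → Fin l → ℝ → ℝ} (ha : ∀ i j, LocL2 (a i j))
    {y uc : ℝ → Fin l → Lp ℝ 2 μ} {t : ℝ}
    (hy : ∀ i, y t i = ∑ j, W j (toL2 (window (a i j) t)) + ∑ j, N j (toL2 (window (b i j) t)))
    (huc : ε ≠ 0 → ∀ i, uc t i =
      ∑ j, W j (toL2 (window (a' i j) t)) + ∑ j, N j (toL2 (window (b' i j) t))) :
    ∫ x, ((1 - ε) * ∑ i, (reference W t i x - y t i x) ^ 2 + ε * ∑ i, (uc t i x) ^ 2) ∂μ =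
    ∑ i, ∑ j, ((1 - ε) * σ j ^ 2 * ‖toL2 (window
        (fun τ => (1 : Matrix (Fin l) (Fin l) ℝ) i j * 1 - a i j τ) t)‖ ^ 2 +
      (1 - ε) * γ j ^ 2 * ‖toL2 (window (b i j) t)‖ ^ 2 +
      ε * σ j ^ 2 * ‖toL2 (window (a' i j) t)‖ ^ 2 +
      ε * γ j ^ 2 * ‖toL2 (window (b' i j) t)‖ ^ 2) := by
  have hae : ∀ᵐ x ∂μ, ∀ i, reference W t i x - y t i x = (reference W t i - y t i : Lp ℝ 2 μ) x :=
    ae_all_iff.2 fun i => (Lp.coeFn_sub _ _).symm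
  have h1 : ∫ x, ((1 - ε) * ∑ i, (reference W t i x - y t i x) ^ 2 + ε * ∑ i, (uc t i x) ^ 2) ∂μ =
      (1 - ε) * ∑ i, ‖reference W t i - y t i‖ ^ 2 + ε * ∑ i, ‖uc t i‖ ^ 2 := by
    have : (fun x => (1 - ε) * ∑ i, (reference W t i x - y t i x) ^ 2 +
        ε * ∑ i, (uc t i x) ^ 2) =ᵐ[μ] fun x => (1 - ε) * ∑ i,
          ((reference W t i - y t i : Lp ℝ 2 μ) x) ^ 2 + ε * ∑ i, (uc t i x) ^ 2 := by
      filter_upwards [hae] with x hx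
      simp only [hx]
    rw [integral_congr_ae this, integral_add
      ((integrable_finsetSum _ fun i _ => integrable_sq _).const_mul _)
      ((integrable_finsetSum _ fun i _ => integrable_sq _).const_mul _),
      integral_const_mul, integral_const_mul,
      integral_finsetSum _ fun i _ => integrable_sq _,
      integral_finsetSum _ fun i _ => integrable_sq _]
    simp only [integral_sq_eq_norm_sq]
  have h2 : ∀ i, ‖reference W t i - y t i‖ ^ 2 = ∑ j, (σ j ^ 2 * ‖toL2 (window
        (fun τ => (1 : Matrix (Fin l) (Fin l) ℝ) i j * 1 - a i j τ) t)‖ ^ 2 +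
      γ j ^ 2 * ‖toL2 (window (b i j) t)‖ ^ 2) := fun i => by
    have : reference W t i - y t i = ∑ j, W j (toL2 (window
        (fun τ => (1 : Matrix (Fin l) (Fin l) ℝ) i j * 1 - a i j τ) t)) +
        ∑ j, N j (-toL2 (window (b i j) t)) := by
      simp only [toL2_window_sub (locL2_one.const_mul _) (ha i _),
        toL2_window_const_mul locL2_one, map_sub, map_smul, map_neg, Finset.sum_sub_distrib,
        Finset.sum_neg_distrib, hy i, reference]
      have h0 : ∑ j, (1 : Matrix (Fin l) (Fin l) ℝ) i j • W j (toL2 (window (fun _ => 1) t)) =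
          W i (toL2 (window (fun _ => 1) t)) := by
        simp [Matrix.one_apply]
      rw [h0]
      abel
    rw [this, norm_sq_add_noise hW hN hWN]
    simp [Finset.sum_add_distrib]
  have h3 : ε * ∑ i, ‖uc t i‖ ^ 2 = ε * ∑ i, ∑ j, (σ j ^ 2 * ‖toL2 (window (a' i j) t)‖ ^ 2 +
      γ j ^ 2 * ‖toL2 (window (b' i j) t)‖ ^ 2) := by
    -- Without a penalty on the input nothing is known about `uc`, but its term carries the factor
    -- `0`.
    by_cases hε : ε = 0
    · simp [hε]
    · congr 1
      refine Finset.sum_congr rfl fun i _ => ?_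
      rw [huc hε i, norm_sq_add_noise hW hN hWN, Finset.sum_add_distrib]
  rw [h1, h3]
  simp only [h2, Finset.mul_sum, ← Finset.sum_add_distrib]
  refine Finset.sum_congr rfl fun i _ => Finset.sum_congr rfl fun j _ => ?_
  ring

/-- Stated in `ENNReal` so that responses of infinite energy are allowed: the truncated energies
increase to the full ones in any case. -/
lemma tendsto_cost {ε : ℝ} (hε₀ : 0 ≤ ε) (hε₁ : ε ≤ 1) (σ γ : Fin l → ℝ)
    {a b a' b' : Fin l → Fin l → ℝ → ℝ} (ha : ∀ i j, LocL2 (a i j)) (hb : ∀ i j, LocL2 (b i j))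
    (ha' : ∀ i j, LocL2 (a' i j)) (hb' : ∀ i j, LocL2 (b' i j)) :
    Tendsto (fun t => ENNReal.ofReal (∑ i, ∑ j, ((1 - ε) * σ j ^ 2 * ‖toL2 (window
        (fun τ => (1 : Matrix (Fin l) (Fin l) ℝ) i j * 1 - a i j τ) t)‖ ^ 2 +
      (1 - ε) * γ j ^ 2 * ‖toL2 (window (b i j) t)‖ ^ 2 +
      ε * σ j ^ 2 * ‖toL2 (window (a' i j) t)‖ ^ 2 +
      ε * γ j ^ 2 * ‖toL2 (window (b' i j) t)‖ ^ 2))) atTop (𝓝 (timeCost ε σ γ a b a' b')) := by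
  have hε : 0 ≤ 1 - ε := by linarith
  have key : ∀ (c : ℝ) (x : ℝ), 0 ≤ c → ∀ g : ℝ → ℝ, LocL2 g →
      Tendsto (fun t => ENNReal.ofReal (c * x ^ 2 * ‖toL2 (window g t)‖ ^ 2)) atTop
        (𝓝 (ENNReal.ofReal (c * x ^ 2) * energy g)) := fun c x hc g hg => by
    simp only [ENNReal.ofReal_mul (show 0 ≤ c * x ^ 2 by positivity), hg.ofReal_norm_sq]
    exact ENNReal.Tendsto.const_mul hg.tendsto_energy (Or.inr ENNReal.ofReal_ne_top)
  have hsplit : ∀ t, ENNReal.ofReal (∑ i, ∑ j, ((1 - ε) * σ j ^ 2 * ‖toL2 (window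
        (fun τ => (1 : Matrix (Fin l) (Fin l) ℝ) i j * 1 - a i j τ) t)‖ ^ 2 +
      (1 - ε) * γ j ^ 2 * ‖toL2 (window (b i j) t)‖ ^ 2 +
      ε * σ j ^ 2 * ‖toL2 (window (a' i j) t)‖ ^ 2 +
      ε * γ j ^ 2 * ‖toL2 (window (b' i j) t)‖ ^ 2)) =
      ∑ i, ∑ j, (ENNReal.ofReal ((1 - ε) * σ j ^ 2 * ‖toL2 (window
        (fun τ => (1 : Matrix (Fin l) (Fin l) ℝ) i j * 1 - a i j τ) t)‖ ^ 2) +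
      ENNReal.ofReal ((1 - ε) * γ j ^ 2 * ‖toL2 (window (b i j) t)‖ ^ 2) +
      ENNReal.ofReal (ε * σ j ^ 2 * ‖toL2 (window (a' i j) t)‖ ^ 2) +
      ENNReal.ofReal (ε * γ j ^ 2 * ‖toL2 (window (b' i j) t)‖ ^ 2)) := fun t => by
    rw [ENNReal.ofReal_sum_of_nonneg fun i _ => Finset.sum_nonneg fun j _ => by positivity]
    refine Finset.sum_congr rfl fun i _ => ?_
    rw [ENNReal.ofReal_sum_of_nonneg fun j _ => by positivity]
    refine Finset.sum_congr rfl fun j _ => ?_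
    rw [ENNReal.ofReal_add (by positivity) (by positivity),
      ENNReal.ofReal_add (by positivity) (by positivity),
      ENNReal.ofReal_add (by positivity) (by positivity)]
  simp only [hsplit, timeCost]
  exact tendsto_finsetSum _ fun i _ => tendsto_finsetSum _ fun j _ =>
    (((key _ _ hε _ ((locL2_one.const_mul _).sub (ha i j))).add (key _ _ hε _ (hb i j))).add
      (key _ _ hε₀ _ (ha' i j))).add (key _ _ hε₀ _ (hb' i j))

/-- The closed-loop responses of the error and of the plant input, as a frequency-domain cost. -/
def freqCost (ε : ℝ) (σ γ : Fin l → ℝ) (Tr Tn Tr' Tn' : RMat (Fin l) (Fin l)) : ENNReal :=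
  ∑ i, ∑ j, (ENNReal.ofReal ((1 - ε) * σ j ^ 2) *
        (∫⁻ ω : ℝ, ‖ev ((1 - Tr) i j / RatFunc.X) (ω * Complex.I)‖ₑ ^ 2) +
      ENNReal.ofReal ((1 - ε) * γ j ^ 2) * (∫⁻ ω : ℝ, ‖ev (Tn i j) (ω * Complex.I)‖ₑ ^ 2) +
      ENNReal.ofReal (ε * σ j ^ 2) *
        (∫⁻ ω : ℝ, ‖ev (Tr' i j / RatFunc.X) (ω * Complex.I)‖ₑ ^ 2) +
      ENNReal.ofReal (ε * γ j ^ 2) * (∫⁻ ω : ℝ, ‖ev (Tn' i j) (ω * Complex.I)‖ₑ ^ 2))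

lemma measurable_ev (g : RatFunc ℝ) : Measurable (ev g) := by
  have : ev g = fun s => Polynomial.aeval s g.num / Polynomial.aeval s g.denom := by
    funext s
    rw [ev_eq_div]
  rw [this]
  exact (Polynomial.continuous_aeval _).measurable.div (Polynomial.continuous_aeval _).measurable

lemma HasLaplace.lintegral_le_energy {g : RatFunc ℝ} {h : ℝ → ℝ} (hl : LocL2 h)
    (hh : HasLaplace h (ev g)) :
    ∫⁻ ω : ℝ, ‖ev g (ω * Complex.I)‖ₑ ^ 2 ≤ ENNReal.ofReal (2 * Real.pi) * energy h := by
  by_cases he : energy h = ⊤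
  · rw [he, ENNReal.mul_top (by simp [Real.pi_pos])]
    exact le_top
  refine hh.lintegral_axis_le (hl.memLp he) ?_ fun a _ =>
    (measurable_ev g).comp (by fun_prop)
  filter_upwards [ae_of_cofinite (eventually_not_isPole g)] with ω hω
  have hc := (differentiableAt_ev hω).continuousAt
  have : Tendsto (fun a : ℝ => (a : ℂ) + ω * Complex.I) (𝓝[>] 0) (𝓝 (ω * Complex.I)) := by
    have : Continuous fun a : ℝ => (a : ℂ) + ω * Complex.I := by fun_prop
    have h := this.tendsto 0
    simp only [Complex.ofReal_zero, zero_add] at h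
    exact h.mono_left nhdsWithin_le_nhds
  exact hc.tendsto.comp this

lemma ev_div_X_of_ne {g : RatFunc ℝ} {s : ℂ} (hg : ¬ IsPole g s) (hs0 : s ≠ 0) :
    ev (g / RatFunc.X) s = ev g s / s := by
  have hX : ¬ IsPole (RatFunc.X⁻¹ : RatFunc ℝ) s := by
    have := not_isPole_div_poly (p := 1) (q := Polynomial.X) (s := s) (by simpa using hs0)
    simpa using this
  have : ev (RatFunc.X⁻¹ : RatFunc ℝ) s = s⁻¹ := by
    have := ev_div_poly (s := s) 1 (q := Polynomial.X) (by simpa using hs0)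
    simpa using this
  rw [div_eq_mul_inv, ev_mul hg hX, this, div_eq_mul_inv]

lemma ev_div_X {g : RatFunc ℝ} (hg : Stable g) {s : ℂ} (hs : 0 < s.re) :
    ev (g / RatFunc.X) s = ev g s / s :=
  ev_div_X_of_ne (hg.not_isPole hs.le) (by rintro rfl; simp at hs)

lemma freqCost_le {ε : ℝ} {σ γ : Fin l → ℝ} {Tr Tn Tr' Tn' : RMat (Fin l) (Fin l)}
    {a b a' b' : Fin l → Fin l → ℝ → ℝ} (hTr : RHinf Tr)
    (ha : ∀ i j, IsImpulseResponse (Tr i j / RatFunc.X) (a i j))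
    (hb : ∀ i j, IsImpulseResponse (Tn i j) (b i j))
    (ha' : ε ≠ 0 → ∀ i j, IsImpulseResponse (Tr' i j / RatFunc.X) (a' i j))
    (hb' : ε ≠ 0 → ∀ i j, IsImpulseResponse (Tn' i j) (b' i j)) :
    freqCost ε σ γ Tr Tn Tr' Tn' ≤ ENNReal.ofReal (2 * Real.pi) * timeCost ε σ γ a b a' b' := by
  rw [freqCost, timeCost, Finset.mul_sum]
  refine Finset.sum_le_sum fun i _ => ?_
  rw [Finset.mul_sum]
  refine Finset.sum_le_sum fun j _ => ?_
  simp only [mul_add, mul_left_comm (ENNReal.ofReal (2 * Real.pi))]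
  refine add_le_add (add_le_add (add_le_add ?_ ?_) ?_) ?_
  · refine mul_le_mul_right (HasLaplace.lintegral_le_energy
      ((locL2_one.const_mul _).sub (ha i j).1) ?_) _
    have h1 : HasLaplace (a i j) (ev (Tr i j / RatFunc.X)) := (ha i j).2
    refine ((hasLaplace_one.const_mul _).sub h1).congr fun s hs => ?_
    have h1s : Stable ((1 : RMat (Fin l) (Fin l)) i j) := rHinf_one i j
    rw [Matrix.sub_apply, ev_div_X (h1s.sub (hTr i j)) hs, ev_div_X (hTr i j) hs,
      ev_sub (h1s.not_isPole hs.le) ((hTr i j).not_isPole hs.le), sub_div]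
    congr 1
    by_cases hij : i = j <;> simp [Matrix.one_apply, hij]
  · exact mul_le_mul_right (HasLaplace.lintegral_le_energy (hb i j).1 (hb i j).2) _
  · by_cases hε : ε = 0
    · simp [hε]
    · exact mul_le_mul_right (HasLaplace.lintegral_le_energy (ha' hε i j).1 (ha' hε i j).2) _
  · by_cases hε : ε = 0
    · simp [hε]
    · exact mul_le_mul_right (HasLaplace.lintegral_le_energy (hb' hε i j).1 (hb' hε i j).2) _

/-- Lower bound of any attained cost by the frequency-domain cost. -/
lemma HasCost.freqCost_le {ε : ℝ} (hε₀ : 0 ≤ ε) (hε₁ : ε ≤ 1) {σ γ : Fin l → ℝ} {W N : Noise l μ}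
    (hW : IsWhiteNoise σ W) (hN : IsWhiteNoise γ N) (hWN : Uncorrelated W N)
    {P F H K₁ K₂ : RMat (Fin l) (Fin l)} {J : ℝ} (hJ : HasCost ε W N P F H K₁ K₂ J)
    (hTr : RHinf ((1 - P * F * K₂)⁻¹ * P * F * K₁)) :
    0 ≤ J ∧ freqCost ε σ γ ((1 - P * F * K₂)⁻¹ * P * F * K₁) ((1 - P * F * K₂)⁻¹ * P * H)
      ((1 - F * K₂ * P)⁻¹ * F * K₁) ((1 - F * K₂ * P)⁻¹ * H) ≤
      ENNReal.ofReal (2 * Real.pi * J) := by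
  obtain ⟨y, uc, ⟨a, b, ha, hb, hy⟩, huc, hlim⟩ := hJ
  -- For `ε = 0` no input response is given; zero kernels take its place, as they are multiplied by
  -- `0`.
  have hex : ∃ a' b' : Fin l → Fin l → ℝ → ℝ,
      (∀ i j, LocL2 (a' i j)) ∧ (∀ i j, LocL2 (b' i j)) ∧
      (ε ≠ 0 → ∀ i j, IsImpulseResponse (((1 - F * K₂ * P)⁻¹ * F * K₁) i j / RatFunc.X) (a' i j)) ∧
      (ε ≠ 0 → ∀ i j, IsImpulseResponse (((1 - F * K₂ * P)⁻¹ * H) i j) (b' i j)) ∧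
      (ε ≠ 0 → ∀ t, 0 ≤ t → ∀ i, uc t i =
        ∑ j, W j (toL2 (window (a' i j) t)) + ∑ j, N j (toL2 (window (b' i j) t))) := by
    by_cases hε : ε = 0
    · exact ⟨fun _ _ _ => 0, fun _ _ _ => 0, fun _ _ => Continuous.locL2 continuous_const,
        fun _ _ => Continuous.locL2 continuous_const, fun h => absurd hε h,
        fun h => absurd hε h, fun h => absurd hε h⟩
    · obtain ⟨a', b', ha', hb', h⟩ := huc hε
      exact ⟨a', b', fun i j => (ha' i j).1, fun i j => (hb' i j).1, fun _ => ha', fun _ => hb',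
        fun _ => h⟩
  obtain ⟨a', b', hla, hlb, ha', hb', huc'⟩ := hex
  have hE := fun t (ht : 0 ≤ t) => integral_cost (ε := ε) (uc := uc) hW hN hWN
    (fun i j => (ha i j).1) (hy t ht) (fun h => huc' h t ht)
  have hε : 0 ≤ 1 - ε := by linarith
  have hJ0 : 0 ≤ J := by
    refine ge_of_tendsto' hlim fun t => integral_nonneg fun x => ?_
    positivity
  have hev := (tendsto_cost hε₀ hε₁ σ γ (fun i j => (ha i j).1) (fun i j => (hb i j).1)
    hla hlb).congr' (by
      filter_upwards [eventually_ge_atTop 0] with t ht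
      rw [← hE t ht])
  -- The same function of time tends to the total weighted energy and to `J`, so finiteness of `J`
  -- makes that weighted energy finite.
  have heq := tendsto_nhds_unique hev
    ((ENNReal.continuous_ofReal.tendsto J).comp hlim)
  refine ⟨hJ0, ?_⟩
  rw [ENNReal.ofReal_mul (by positivity), ← heq]
  exact Tracking.freqCost_le hTr ha hb ha' hb'

lemma Stable.exists_response {g : RatFunc ℝ} (hg : Stable g) (hs : StrictlyProper g) :
    ∃ h, IsImpulseResponse g h ∧
      ENNReal.ofReal (2 * Real.pi) * energy h ≤ ∫⁻ ω : ℝ, ‖ev g (ω * Complex.I)‖ₑ ^ 2 := by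
  obtain ⟨h, h1, h2, h3⟩ := exists_impulseResponse hg hs
  exact ⟨h, ⟨Continuous.locL2 h2, h3⟩, h3.lintegral_le_axis h1 (IsH2.of_stable hg hs)⟩

/-- A step response: the impulse response of `g / s`, whose deviation from the constant `c` has
finite energy when `c = g(0)`. -/
lemma Stable.exists_stepResponse {g : RatFunc ℝ} (hg : Stable g) :
    ∃ h, IsImpulseResponse (g / RatFunc.X) h ∧
      ∀ c : ℝ, ev g 0 = c → ENNReal.ofReal (2 * Real.pi) * energy (fun t => c * 1 - h t) ≤
        ∫⁻ ω : ℝ, ‖ev ((RatFunc.C c - g) / RatFunc.X) (ω * Complex.I)‖ₑ ^ 2 := by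
  -- `g / s` has in general a pole at the origin. Its response is the final value `c₀ = g(0)` minus
  -- the square integrable response of `(c₀ - g) / s`.
  set c₀ : ℝ := RatFunc.eval (RingHom.id ℝ) 0 g with hc₀
  have hs : Stable (RatFunc.C c₀ - g) := (stable_C _).sub hg
  have h0 : ev (RatFunc.C c₀ - g) 0 = 0 := by
    rw [ev_sub (not_isPole_C _ _) (hg.not_isPole le_rfl), ev_C, ev_zero_eq_ofReal g, sub_self]
  obtain ⟨hs1, hs2, -⟩ := hs.div_X h0
  obtain ⟨h, h1, h2, h3⟩ := exists_impulseResponse hs1 hs2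
  refine ⟨fun t => c₀ * 1 - h t, ⟨(locL2_one.const_mul _).sub (Continuous.locL2 h2), ?_⟩, ?_⟩
  · refine ((hasLaplace_one.const_mul _).sub h3).congr fun s hs' => ?_
    rw [ev_div_X hs hs', ev_div_X hg hs', ev_sub (not_isPole_C _ _) (hg.not_isPole hs'.le), ev_C]
    ring
  · intro c hc
    have : c = c₀ := by
      rw [ev_zero_eq_ofReal g] at hc
      exact_mod_cast hc.symm
    subst this
    simpa [energy] using h3.lintegral_le_axis h1 (IsH2.of_stable hs1 hs2)

/-- Attainability of the frequency-domain cost. -/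
lemma exists_hasCost {ε : ℝ} (hε₀ : 0 ≤ ε) (hε₁ : ε ≤ 1) {σ γ : Fin l → ℝ} {W N : Noise l μ}
    (hW : IsWhiteNoise σ W) (hN : IsWhiteNoise γ N) (hWN : Uncorrelated W N)
    {P F H K₁ K₂ Tr Tn Tr' Tn' : RMat (Fin l) (Fin l)}
    (eTr : (1 - P * F * K₂)⁻¹ * P * F * K₁ = Tr) (eTn : (1 - P * F * K₂)⁻¹ * P * H = Tn)
    (eTr' : (1 - F * K₂ * P)⁻¹ * F * K₁ = Tr') (eTn' : (1 - F * K₂ * P)⁻¹ * H = Tn')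
    (hTr : RHinf Tr) (hTn : RHinf Tn) (hTr' : RHinf Tr') (hTn' : RHinf Tn')
    (hTns : ∀ i j, StrictlyProper (Tn i j)) (hTns' : ε ≠ 0 → ∀ i j, StrictlyProper (Tn' i j))
    (hTr0 : ε ≠ 1 → evM Tr 0 = 1) (hTr0' : ε ≠ 0 → evM Tr' 0 = 0)
    (hfin : freqCost ε σ γ Tr Tn Tr' Tn' ≠ ⊤) :
    ∃ J, HasCost ε W N P F H K₁ K₂ J ∧
      ENNReal.ofReal (2 * Real.pi * J) ≤ freqCost ε σ γ Tr Tn Tr' Tn' := by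
  choose a ha ha2 using fun i j => (hTr i j).exists_stepResponse
  choose b hb hb2 using fun i j => (hTn i j).exists_response (hTns i j)
  choose a' ha' ha2' using fun i j => (hTr' i j).exists_stepResponse
  have hex : ∃ b' : Fin l → Fin l → ℝ → ℝ, (∀ i j, LocL2 (b' i j)) ∧ (ε ≠ 0 → ∀ i j,
      IsImpulseResponse (Tn' i j) (b' i j) ∧ ENNReal.ofReal (2 * Real.pi) * energy (b' i j) ≤
        ∫⁻ ω : ℝ, ‖ev (Tn' i j) (ω * Complex.I)‖ₑ ^ 2) := by
    by_cases hε : ε = 0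
    · exact ⟨fun _ _ _ => 0, fun _ _ => Continuous.locL2 continuous_const, fun h => absurd hε h⟩
    · choose b' hb' hb2' using fun i j => (hTn' i j).exists_response (hTns' hε i j)
      exact ⟨b', fun i j => (hb' i j).1, fun _ i j => ⟨hb' i j, hb2' i j⟩⟩
  obtain ⟨b', hlb', hb'⟩ := hex
  -- The values `Tr(0) = I` and `Tr'(0) = 0` are the final values of the step responses; under these
  -- conditions the tracking error and the reference part of the input have finite energy.
  have hle : ENNReal.ofReal (2 * Real.pi) * timeCost ε σ γ a b a' b' ≤
      freqCost ε σ γ Tr Tn Tr' Tn' := by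
    rw [freqCost, timeCost, Finset.mul_sum]
    refine Finset.sum_le_sum fun i _ => ?_
    rw [Finset.mul_sum]
    refine Finset.sum_le_sum fun j _ => ?_
    simp only [mul_add, mul_left_comm (ENNReal.ofReal (2 * Real.pi))]
    refine add_le_add (add_le_add (add_le_add ?_ ?_) ?_) ?_
    · by_cases hε : ε = 1
      · simp [hε]
      · refine mul_le_mul_right ?_ _
        have h1 : ev (Tr i j) 0 = ((1 : Matrix (Fin l) (Fin l) ℝ) i j : ℝ) := by
          have := congrFun (congrFun (hTr0 hε) i) j
          rw [evM_apply] at this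
          rw [this]
          by_cases hij : i = j <;> simp [Matrix.one_apply, hij]
        have h2 : RatFunc.C ((1 : Matrix (Fin l) (Fin l) ℝ) i j) - Tr i j = (1 - Tr) i j := by
          by_cases hij : i = j <;> simp [Matrix.one_apply, hij]
        rw [← h2]
        exact ha2 i j _ h1
    · exact mul_le_mul_right (hb2 i j) _
    · by_cases hε : ε = 0
      · simp [hε]
      · refine mul_le_mul_right ?_ _
        have h1 : ev (Tr' i j) 0 = (0 : ℝ) := by
          have := congrFun (congrFun (hTr0' hε) i) j
          rw [evM_apply] at this
          rw [this]
          simp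
        have := ha2' i j _ h1
        rw [map_zero, zero_sub, neg_div] at this
        have hn : ∀ ω : ℝ, ev (-(Tr' i j / RatFunc.X)) (ω * Complex.I) =
            -ev (Tr' i j / RatFunc.X) (ω * Complex.I) := fun ω =>
          ev_neg (((hTr' i j).div_X (by simpa using h1)).1.not_isPole (by simp))
        simpa [hn, energy] using this
    · by_cases hε : ε = 0
      · simp [hε]
      · exact mul_le_mul_right (hb' hε i j).2 _
  have htf : timeCost ε σ γ a b a' b' ≠ ⊤ := by
    intro h
    rw [h, ENNReal.mul_top (by simp [Real.pi_pos])] at hle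
    exact hfin (top_le_iff.1 hle)
  refine ⟨(timeCost ε σ γ a b a' b').toReal, ⟨fun t i => ∑ j, W j (toL2 (window (a i j) t)) +
    ∑ j, N j (toL2 (window (b i j) t)), fun t i => ∑ j, W j (toL2 (window (a' i j) t)) +
    ∑ j, N j (toL2 (window (b' i j) t)), ⟨a, b, ?_, ?_, fun t _ i => rfl⟩,
    fun hε => ⟨a', b', ?_, ?_, fun t _ i => rfl⟩, ?_⟩, ?_⟩
  · rwa [eTr]
  · rwa [eTn]
  · rwa [eTr']
  · rw [eTn']
    exact fun i j => (hb' hε i j).1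
  · have h := (ENNReal.tendsto_toReal htf).comp (tendsto_cost hε₀ hε₁ σ γ (fun i j => (ha i j).1)
      (fun i j => (hb i j).1) (fun i j => (ha' i j).1) hlb')
    refine h.congr fun t => ?_
    have hε : 0 ≤ 1 - ε := by linarith
    have hE := integral_cost (ε := ε) (a := a) (b := b) (a' := a') (b' := b') (t := t)
      (y := fun t i => ∑ j, W j (toL2 (window (a i j) t)) + ∑ j, N j (toL2 (window (b i j) t)))
      (uc := fun t i => ∑ j, W j (toL2 (window (a' i j) t)) + ∑ j, N j (toL2 (window (b' i j) t)))
      hW hN hWN (fun i j => (ha i j).1) (fun i => rfl) (fun _ i => rfl)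
    rw [Function.comp_apply, ENNReal.toReal_ofReal (by positivity), hE]
  · rw [ENNReal.ofReal_mul (by positivity), ENNReal.ofReal_toReal htf]
    exact hle

end

/-! ### Properness, coprime factorizations and the closed loop -/

section

variable {l : ℕ}

lemma proper_iff {g : RatFunc ℝ} : Proper g ↔ g = 0 ∨ g.intDegree ≤ 0 := by
  by_cases hg : g = 0
  · simp [hg, Proper]
  · have hn : g.num ≠ 0 := RatFunc.num_ne_zero hg
    rw [Proper, Polynomial.degree_eq_natDegree hn, Polynomial.degree_eq_natDegree g.denom_ne_zero,
      RatFunc.intDegree]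
    simp only [hg, false_or]
    rw [Nat.cast_le]
    omega

lemma strictlyProper_iff {g : RatFunc ℝ} : StrictlyProper g ↔ g = 0 ∨ g.intDegree < 0 := by
  by_cases hg : g = 0
  · simp [hg, StrictlyProper]
  · have hn : g.num ≠ 0 := RatFunc.num_ne_zero hg
    rw [StrictlyProper, Polynomial.degree_eq_natDegree hn,
      Polynomial.degree_eq_natDegree g.denom_ne_zero, RatFunc.intDegree]
    simp only [hg, false_or]
    rw [Nat.cast_lt]
    omega

lemma StrictlyProper.mul_proper {g h : RatFunc ℝ} (hg : StrictlyProper g) (hh : Proper h) :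
    StrictlyProper (g * h) := by
  rw [strictlyProper_iff] at *
  rw [proper_iff] at hh
  by_cases hg0 : g = 0
  · simp [hg0]
  by_cases hh0 : h = 0
  · simp [hh0]
  right
  rw [RatFunc.intDegree_mul hg0 hh0]
  have := hg.resolve_left hg0
  have := hh.resolve_left hh0
  omega

lemma StrictlyProper.add {g h : RatFunc ℝ} (hg : StrictlyProper g) (hh : StrictlyProper h) :
    StrictlyProper (g + h) := by
  by_cases hh0 : h = 0
  · simpa [hh0] using hg
  by_cases hg0 : g = 0
  · simpa [hg0] using hh
  rw [strictlyProper_iff] at *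
  by_cases h0 : g + h = 0
  · exact Or.inl h0
  · exact Or.inr ((RatFunc.intDegree_add_le hh0 h0).trans_lt
      (max_lt (hg.resolve_left hg0) (hh.resolve_left hh0)))

lemma strictlyProper_zero : StrictlyProper 0 := strictlyProper_iff.2 (Or.inl rfl)

lemma strictlyProper_finsetSum {ι : Type*} (t : Finset ι) {g : ι → RatFunc ℝ}
    (hg : ∀ i ∈ t, StrictlyProper (g i)) : StrictlyProper (∑ i ∈ t, g i) :=
  Finset.sum_induction _ StrictlyProper (fun _ _ => StrictlyProper.add) strictlyProper_zero hg

/-- All entries are strictly proper. -/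
def StrictlyProperM {m n : Type*} (A : RMat m n) : Prop := ∀ i j, StrictlyProper (A i j)

lemma StrictlyProperM.mul_proper {m n p : Type*} [Fintype n] {A : RMat m n} {B : RMat n p}
    (hA : StrictlyProperM A) (hB : ∀ i j, Proper (B i j)) : StrictlyProperM (A * B) :=
  fun i j => strictlyProper_finsetSum _ fun k _ => (hA i k).mul_proper (hB k j)

lemma StrictlyProperM.proper_mul {m n p : Type*} [Fintype n] {A : RMat m n} {B : RMat n p}
    (hB : StrictlyProperM B) (hA : ∀ i j, Proper (A i j)) : StrictlyProperM (A * B) :=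
  fun i j => strictlyProper_finsetSum _ fun k _ => by
    rw [mul_comm]
    exact (hB k j).mul_proper (hA i k)

lemma RHinf.proper {m n : Type*} {A : RMat m n} (hA : RHinf A) : ∀ i j, Proper (A i j) :=
  fun i j => (hA i j).1

/-- Doubly coprime factorizations of a strictly proper invertible plant `P` in series with a
scalar filter `φ`, where `P⁻¹` vanishes at the origin. -/
structure CoprimeLoop (P F N N₀ M Nt Mt X Y Xt Yt : RMat (Fin l) (Fin l)) (φ : RatFunc ℝ) :
    Prop where
  F_eq : F = diagonal fun _ => φ
  stable_F : RHinf F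
  det_P : IsUnit P.det
  strictlyProper_P : StrictlyProperM P
  inv_P : ∃ (n : ℕ) (B : RMat (Fin l) (Fin l)), 1 ≤ n ∧ NoPole B 0 ∧
    P⁻¹ = (RatFunc.X ^ n : RatFunc ℝ) • B
  stable_N : RHinf N
  stable_N₀ : RHinf N₀
  stable_M : RHinf M
  stable_Nt : RHinf Nt
  stable_Mt : RHinf Mt
  stable_X : RHinf X
  stable_Y : RHinf Y
  stable_Xt : RHinf Xt
  stable_Yt : RHinf Yt
  det_M : IsUnit M.det
  det_Mt : IsUnit Mt.det
  right : P * F = N * M⁻¹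
  left : P * F = Mt⁻¹ * Nt
  right₀ : P = N₀ * M⁻¹
  bezout : fromBlocks Xt (-Yt) (-Nt) Mt * fromBlocks M Y N X = 1

namespace CoprimeLoop

variable {P F N N₀ M Nt Mt X Y Xt Yt : RMat (Fin l) (Fin l)} {φ : RatFunc ℝ}

lemma mul_F (h : CoprimeLoop P F N N₀ M Nt Mt X Y Xt Yt φ) (A : RMat (Fin l) (Fin l)) :
    F * A = A * F := by
  rw [h.F_eq, ← Matrix.smul_one_eq_diagonal]
  simp

lemma bezout_right (h : CoprimeLoop P F N N₀ M Nt Mt X Y Xt Yt φ) :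
    Xt * M - Yt * N = 1 ∧ Xt * Y - Yt * X = 0 ∧ Mt * N - Nt * M = 0 ∧ Mt * X - Nt * Y = 1 := by
  have h1 := h.bezout
  rw [fromBlocks_multiply, ← fromBlocks_one, fromBlocks_inj] at h1
  obtain ⟨h1, h2, h3, h4⟩ := h1
  refine ⟨?_, ?_, ?_, ?_⟩
  · rw [← h1]; noncomm_ring
  · rw [← h2]; noncomm_ring
  · rw [← h3]; noncomm_ring
  · rw [← h4]; noncomm_ring

/-- A one-sided inverse of a square matrix over a field is two-sided, so the reversed product yields
a second family of Bezout identities. -/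
lemma bezout_left (h : CoprimeLoop P F N N₀ M Nt Mt X Y Xt Yt φ) :
    M * Xt - Y * Nt = 1 ∧ Y * Mt - M * Yt = 0 ∧ N * Xt - X * Nt = 0 ∧ X * Mt - N * Yt = 1 := by
  have h1 := mul_eq_one_comm.1 h.bezout
  rw [fromBlocks_multiply, ← fromBlocks_one, fromBlocks_inj] at h1
  obtain ⟨h1, h2, h3, h4⟩ := h1
  refine ⟨?_, ?_, ?_, ?_⟩
  · rw [← h1]; noncomm_ring
  · rw [← h2]; noncomm_ring
  · rw [← h3]; noncomm_ring
  · rw [← h4]; noncomm_ring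

lemma right_mul (h : CoprimeLoop P F N N₀ M Nt Mt X Y Xt Yt φ) : P * F * M = N := by
  rw [h.right, Matrix.mul_assoc, Matrix.nonsing_inv_mul _ h.det_M, Matrix.mul_one]

lemma right₀_mul (h : CoprimeLoop P F N N₀ M Nt Mt X Y Xt Yt φ) : P * M = N₀ := by
  conv_lhs => rw [h.right₀, Matrix.mul_assoc, Matrix.nonsing_inv_mul _ h.det_M, Matrix.mul_one]

lemma mul_left (h : CoprimeLoop P F N N₀ M Nt Mt X Y Xt Yt φ) : Mt * (P * F) = Nt := by
  rw [h.left, ← Matrix.mul_assoc, Matrix.mul_nonsing_inv _ h.det_Mt, Matrix.one_mul]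

lemma N_eq (h : CoprimeLoop P F N N₀ M Nt Mt X Y Xt Yt φ) : N = φ • N₀ := by
  rw [← h.right_mul, ← h.right₀_mul, Matrix.mul_assoc, h.mul_F, ← Matrix.mul_assoc, h.F_eq,
    ← Matrix.smul_one_eq_diagonal]
  simp

/-- `R` drops out because `Mt N = Nt M`. The identity makes `[Xt - R Nt, Yt - R Mt]` a coprime pair
for each `R`. -/
lemma denominator_mul (h : CoprimeLoop P F N N₀ M Nt Mt X Y Xt Yt φ) (R : RMat (Fin l) (Fin l)) :
    (Xt - R * Nt) * M - (Yt - R * Mt) * N = 1 := by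
  obtain ⟨h1, -, h3, -⟩ := h.bezout_right
  calc (Xt - R * Nt) * M - (Yt - R * Mt) * N = (Xt * M - Yt * N) + R * (Mt * N - Nt * M) := by
        noncomm_ring
    _ = 1 := by rw [h1, h3]; simp

lemma sensitivity (h : CoprimeLoop P F N N₀ M Nt Mt X Y Xt Yt φ) {R K₂ : RMat (Fin l) (Fin l)}
    (hZ : IsUnit (Xt - R * Nt).det) (hK : K₂ = (Xt - R * Nt)⁻¹ * (Yt - R * Mt)) :
    (1 - K₂ * (P * F)) * (M * (Xt - R * Nt)) = 1 := by
  set Z := Xt - R * Nt with hZd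
  have h1 : (1 - K₂ * (P * F)) * M = Z⁻¹ := by
    have h2 := h.denominator_mul R
    calc (1 - K₂ * (P * F)) * M = M - K₂ * (P * F * M) := by noncomm_ring
      _ = Z⁻¹ * (Z * M - (Yt - R * Mt) * N) := by
        rw [h.right_mul, hK, Matrix.mul_sub Z⁻¹ (Z * M), Matrix.nonsing_inv_mul_cancel_left _ _ hZ,
          Matrix.mul_assoc]
      _ = Z⁻¹ := by rw [h2, Matrix.mul_one]
  rw [← Matrix.mul_assoc, h1, Matrix.nonsing_inv_mul _ hZ]

lemma inv_sensitivity (h : CoprimeLoop P F N N₀ M Nt Mt X Y Xt Yt φ)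
    {R K₂ : RMat (Fin l) (Fin l)} (hZ : IsUnit (Xt - R * Nt).det)
    (hK : K₂ = (Xt - R * Nt)⁻¹ * (Yt - R * Mt)) :
    (1 - K₂ * (P * F))⁻¹ = M * (Xt - R * Nt) :=
  Matrix.inv_eq_right_inv (h.sensitivity hZ hK)

/-- The stabilizing controllers are the ones of the parametrized family. -/
lemma stabilizes_iff (h : CoprimeLoop P F N N₀ M Nt Mt X Y Xt Yt φ) (K₁ K₂ : RMat (Fin l) (Fin l)) :
    Stabilizes (P * F) K₁ K₂ ↔ IsYoula Xt Yt Nt Mt K₁ K₂ := by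
  constructor
  · rintro ⟨hdet, h1, h2, h3, h4, h5, h6⟩
    set S := (1 - K₂ * (P * F))⁻¹ with hS
    -- `M⁻¹` need not be stable, but it equals `Xt - Yt P F`. Hence `M⁻¹ S` combines the stable maps
    -- `S` and `P F S`, and likewise after multiplication by `K₁` or `K₂`.
    have hMinv : ∀ A, M⁻¹ * A = Xt * A - Yt * (P * F * A) := fun A => by
      have h7 : M⁻¹ = Xt - Yt * (P * F) := by
        have h8 : (Xt - Yt * (P * F)) * M = 1 := by
          rw [Matrix.sub_mul, Matrix.mul_assoc, h.right_mul, h.bezout_right.1]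
        exact Matrix.inv_eq_left_inv h8
      rw [h7, Matrix.sub_mul, Matrix.mul_assoc]
    set A := M⁻¹ * S with hA
    set B := M⁻¹ * (S * K₂) with hB
    set Q := M⁻¹ * (S * K₁) with hQ
    have hAs : RHinf A := by
      rw [hA, hMinv]
      exact (h.stable_Xt.mul h1).sub (h.stable_Yt.mul h4)
    have hBs : RHinf B := by
      rw [hB, hMinv, ← Matrix.mul_assoc (P * F)]
      exact (h.stable_Xt.mul h3).sub (h.stable_Yt.mul h6)
    have hQs : RHinf Q := by
      rw [hQ, hMinv, ← Matrix.mul_assoc (P * F)]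
      exact (h.stable_Xt.mul h2).sub (h.stable_Yt.mul h5)
    have hAB : A * M - B * N = 1 := by
      have : A * M - B * N = M⁻¹ * (S * (1 - K₂ * (P * F))) * M := by
        rw [hA, hB, ← h.right_mul]
        noncomm_ring
      rw [this, hS, Matrix.nonsing_inv_mul _ hdet, Matrix.mul_one,
        Matrix.nonsing_inv_mul _ h.det_M]
    obtain ⟨l1, l2, l3, l4⟩ := h.bezout_left
    -- The parameter is forced: `R = A Y - B X` is the row `[A, -B]` applied to the second block
    -- column of the Bezout matrix. As the first column gives `A M - B N = 1`, the inverse Bezout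
    -- matrix recovers `A` and `B`.
    have eA' : A = Xt - (A * Y - B * X) * Nt := by
      calc A = A * (M * Xt - Y * Nt) - B * (N * Xt - X * Nt) := by rw [l1, l3]; simp
        _ = (A * M - B * N) * Xt - (A * Y - B * X) * Nt := by noncomm_ring
        _ = _ := by rw [hAB, Matrix.one_mul]
    have eB : B = Yt - (A * Y - B * X) * Mt := by
      have : -B = A * (Y * Mt - M * Yt) - B * (X * Mt - N * Yt) := by rw [l2, l4]; simp
      calc B = -(-B) := by simp
        _ = (A * M - B * N) * Yt - (A * Y - B * X) * Mt := by rw [this]; noncomm_ring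
        _ = _ := by rw [hAB, Matrix.one_mul]
    have hAdet : IsUnit A.det := by
      rw [hA, Matrix.det_mul, hS]
      exact (Matrix.isUnit_nonsing_inv_det _ h.det_M).mul (Matrix.isUnit_nonsing_inv_det _ hdet)
    have hcancel : ∀ K, A⁻¹ * (M⁻¹ * (S * K)) = K := fun K => by
      rw [← Matrix.mul_assoc M⁻¹, ← hA, ← Matrix.mul_assoc, Matrix.nonsing_inv_mul _ hAdet,
        Matrix.one_mul]
    refine ⟨Q, A * Y - B * X, hQs, (hAs.mul h.stable_Y).sub (hBs.mul h.stable_X), ?_, ?_, ?_⟩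
    · rwa [← eA']
    · rw [← eA']
      exact (hcancel K₁).symm
    · rw [← eA', ← eB]
      exact (hcancel K₂).symm
  · rintro ⟨Q, R, hQ, hR, hZ, hK1, hK2⟩
    have hinv := h.inv_sensitivity hZ hK2
    have hs := h.sensitivity hZ hK2
    have hZs : RHinf (Xt - R * Nt) := h.stable_Xt.sub (hR.mul h.stable_Nt)
    have hZs' : RHinf (Yt - R * Mt) := h.stable_Yt.sub (hR.mul h.stable_Mt)
    have e1 : M * (Xt - R * Nt) * K₁ = M * Q := by
      rw [hK1, Matrix.mul_assoc, Matrix.mul_nonsing_inv_cancel_left _ _ hZ]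
    have e2 : M * (Xt - R * Nt) * K₂ = M * (Yt - R * Mt) := by
      rw [hK2, Matrix.mul_assoc, Matrix.mul_nonsing_inv_cancel_left _ _ hZ]
    have e3 : ∀ A, P * F * (M * A) = N * A := fun A => by rw [← Matrix.mul_assoc, h.right_mul]
    refine ⟨Matrix.isUnit_det_of_right_inverse hs, ?_⟩
    rw [hinv]
    rw [Matrix.mul_assoc (P * F) _ K₁, Matrix.mul_assoc (P * F) _ K₂, e1, e2, e3, e3, e3]
    exact ⟨h.stable_M.mul hZs, h.stable_M.mul hQ, h.stable_M.mul hZs', h.stable_N.mul hZs,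
      h.stable_N.mul hQ, h.stable_N.mul hZs'⟩

/-- The four closed-loop transfer matrices. -/
lemma closedLoop (h : CoprimeLoop P F N N₀ M Nt Mt X Y Xt Yt φ)
    {Q R K₁ K₂ : RMat (Fin l) (Fin l)} (H : RMat (Fin l) (Fin l)) (hZ : IsUnit (Xt - R * Nt).det)
    (hK1 : K₁ = (Xt - R * Nt)⁻¹ * Q) (hK : K₂ = (Xt - R * Nt)⁻¹ * (Yt - R * Mt)) :
    (1 - P * F * K₂)⁻¹ * P * F * K₁ = N * Q ∧
    (1 - P * F * K₂)⁻¹ * P * H = N₀ * (Xt - R * Nt) * H ∧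
    (1 - F * K₂ * P)⁻¹ * F * K₁ = F * M * Q ∧
    (1 - F * K₂ * P)⁻¹ * H = M * (Xt - R * Nt) * H := by
  have hs := h.sensitivity hZ hK
  have e1 : M * (Xt - R * Nt) * K₁ = M * Q := by
    rw [hK1, Matrix.mul_assoc, Matrix.mul_nonsing_inv_cancel_left _ _ hZ]
  have hcomm : F * K₂ * P = K₂ * (P * F) := by
    rw [Matrix.mul_assoc, h.mul_F, Matrix.mul_assoc]
  have hu : IsUnit (1 - P * F * K₂).det := by
    rw [Matrix.det_one_sub_mul_comm]
    exact Matrix.isUnit_det_of_right_inverse hs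
  have hp : (1 - P * F * K₂)⁻¹ * P = P * (M * (Xt - R * Nt)) := by
    have h1 : (1 - P * F * K₂) * P = P * (1 - K₂ * (P * F)) := by
      rw [← hcomm]
      noncomm_ring
    calc (1 - P * F * K₂)⁻¹ * P = (1 - P * F * K₂)⁻¹ * (P * ((1 - K₂ * (P * F)) *
          (M * (Xt - R * Nt)))) := by rw [hs, Matrix.mul_one]
      _ = (1 - P * F * K₂)⁻¹ * ((1 - P * F * K₂) * (P * (M * (Xt - R * Nt)))) := by
          rw [← Matrix.mul_assoc P, ← h1, Matrix.mul_assoc (1 - P * F * K₂)]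
      _ = _ := Matrix.nonsing_inv_mul_cancel_left _ _ hu
  rw [hcomm, h.inv_sensitivity hZ hK, hp]
  refine ⟨?_, ?_, ?_, rfl⟩
  · rw [Matrix.mul_assoc, h.mul_F, ← Matrix.mul_assoc, Matrix.mul_assoc P, e1,
      ← Matrix.mul_assoc, h.right₀_mul, ← h.mul_F, ← Matrix.mul_assoc, h.N_eq, h.F_eq,
      ← Matrix.smul_one_eq_diagonal]
    simp
  · rw [← Matrix.mul_assoc, h.right₀_mul]
  · rw [Matrix.mul_assoc, h.mul_F, ← Matrix.mul_assoc, e1, ← h.mul_F, Matrix.mul_assoc]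

lemma strictlyProper_N₀ (h : CoprimeLoop P F N N₀ M Nt Mt X Y Xt Yt φ) : StrictlyProperM N₀ := by
  rw [← h.right₀_mul]
  exact h.strictlyProper_P.mul_proper h.stable_M.proper

lemma strictlyProper_N (h : CoprimeLoop P F N N₀ M Nt Mt X Y Xt Yt φ) : StrictlyProperM N := by
  rw [← h.right_mul, Matrix.mul_assoc]
  exact h.strictlyProper_P.mul_proper (h.stable_F.mul h.stable_M).proper

lemma strictlyProper_Nt (h : CoprimeLoop P F N N₀ M Nt Mt X Y Xt Yt φ) : StrictlyProperM Nt := by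
  rw [← h.mul_left]
  exact (h.strictlyProper_P.mul_proper h.stable_F.proper).proper_mul h.stable_Mt.proper

/-- Every parameter `R` gives an invertible controller denominator. -/
lemma isUnit_det (h : CoprimeLoop P F N N₀ M Nt Mt X Y Xt Yt φ) {R : RMat (Fin l) (Fin l)}
    (hR : RHinf R) : IsUnit (Xt - R * Nt).det := by
  rw [isUnit_iff_ne_zero]
  intro hdet
  -- The denominator times `M` is `1 + E` with `E` strictly proper, because the plant is. Its
  -- determinant tends to `1` along the positive reals and cannot vanish identically.
  set E := (Yt - R * Mt) * N with hE
  have hYs : RHinf (Yt - R * Mt) := h.stable_Yt.sub (hR.mul h.stable_Mt)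
  have hEs : RHinf E := hYs.mul h.stable_N
  have hEp : StrictlyProperM E := h.strictlyProper_N.proper_mul hYs.proper
  have h1 : (Xt - R * Nt) * M = 1 + E := by rw [← h.denominator_mul R, hE, sub_add_cancel]
  have h2 : (1 + E).det = 0 := by rw [← h1, Matrix.det_mul, hdet, zero_mul]
  have hlim : Tendsto (fun x : ℝ => (evM (1 + E) x).det) atTop (𝓝 1) := by
    have hent : Tendsto (fun x : ℝ => evM (1 + E) x) atTop (𝓝 1) := by
      refine tendsto_pi_nhds.2 fun i => tendsto_pi_nhds.2 fun j => ?_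
      obtain ⟨C, hC, hb⟩ := (hEs i j).exists_bound_of_strictlyProper (hEp i j)
      have h3 : Tendsto (fun x : ℝ => ev (E i j) x) atTop (𝓝 0) := by
        have hz : Tendsto (fun x : ℝ => C / (1 + x)) atTop (𝓝 0) :=
          tendsto_const_nhds.div_atTop (tendsto_atTop_add_const_left _ _ tendsto_id)
        refine squeeze_zero_norm' ?_ hz
        filter_upwards [eventually_ge_atTop 0] with x hx
        simpa [abs_of_nonneg hx] using hb x (by simpa using hx)
      have h4 : Tendsto (fun x : ℝ => (1 : Matrix (Fin l) (Fin l) ℂ) i j + ev (E i j) x) atTop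
          (𝓝 ((1 : Matrix (Fin l) (Fin l) ℂ) i j)) := by
        simpa using tendsto_const_nhds.add h3
      refine h4.congr' ?_
      filter_upwards [eventually_ge_atTop 0] with x hx
      rw [evM_add (rHinf_one.noPole (by simpa using hx)) (hEs.noPole (by simpa using hx)), evM_one]
      rfl
    have := ((continuous_id.matrix_det).tendsto (1 : Matrix (Fin l) (Fin l) ℂ)).comp hent
    rw [id, Matrix.det_one] at this
    exact this
  have hzero : (fun x : ℝ => (evM (1 + E) x).det) =ᶠ[atTop] fun _ => 0 := by
    filter_upwards [eventually_ge_atTop 0] with x hx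
    rw [← ev_det ((rHinf_one.add hEs).noPole (by simpa using hx)), h2, ev_zero]
  exact one_ne_zero (tendsto_nhds_unique hlim (tendsto_const_nhds.congr' hzero.symm))

/-- This is the effect of the integrators: `M = P⁻¹ N₀`, and `P⁻¹` contains a positive power of `s`.
-/
lemma M_zero (h : CoprimeLoop P F N N₀ M Nt Mt X Y Xt Yt φ) : evM M 0 = 0 := by
  obtain ⟨n, B, hn, hB, hinv⟩ := h.inv_P
  have h1 : M = (RatFunc.X ^ n : RatFunc ℝ) • (B * N₀) := by
    rw [← Matrix.smul_mul, ← hinv, ← h.right₀_mul, Matrix.nonsing_inv_mul_cancel_left _ _ h.det_P]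
  have h0 : (RatFunc.X ^ n : RatFunc ℝ) = algebraMap (Polynomial ℝ) (RatFunc ℝ)
      (Polynomial.X ^ n) := by simp
  rw [h1, evM_smul (by rw [h0]; exact not_isPole_poly _ _)
    (hB.mul (h.stable_N₀.noPole (by simp))), h0, ev_poly]
  have : n ≠ 0 := by omega
  simp [this]

/-- The Bezout identity at the origin, where `M` vanishes. It makes `N(0)` invertible, so that `N(0)
Q(0) = I` can be achieved. -/
lemma Yt_mul_N_zero (h : CoprimeLoop P F N N₀ M Nt Mt X Y Xt Yt φ) :
    (-evM Yt 0) * evM N 0 = 1 := by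
  have np : ∀ {A : RMat (Fin l) (Fin l)}, RHinf A → NoPole A 0 := fun hA => hA.noPole (by simp)
  have h1 := congrArg (evM · 0) h.bezout_right.1
  rw [evM_sub ((np h.stable_Xt).mul (np h.stable_M)) ((np h.stable_Yt).mul (np h.stable_N)),
    evM_mul (np h.stable_Xt) (np h.stable_M), evM_mul (np h.stable_Yt) (np h.stable_N), h.M_zero,
    evM_one] at h1
  simpa using h1

lemma det_N_zero (h : CoprimeLoop P F N N₀ M Nt Mt X Y Xt Yt φ) : IsUnit (evM N 0).det :=
  Matrix.isUnit_det_of_left_inverse h.Yt_mul_N_zero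

end CoprimeLoop

end

section

/-! ### Stable approximate inverses of functions without zeros in the open right half plane -/

/-- In `1 / g` the numerator of `g` is replaced by its shift by `δ`, which has no zero in the closed
half plane even if `g` vanishes on the axis. Powers of `1 + δ s`, as many as the degree of the
denominator, restore properness. -/
lemma exists_regularized_inverse {g : RatFunc ℝ} (hg : Stable g)
    (hnz : ∀ s : ℂ, 0 < s.re → ev g s ≠ 0) {δ : ℝ} (hδ : 0 < δ) :
    ∃ k, Stable k ∧ ∀ s : ℂ, 0 ≤ s.re → ev g s * ev k s =
      Polynomial.aeval s g.num / Polynomial.aeval (s + δ) g.num *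
        (1 + δ * s)⁻¹ ^ g.denom.natDegree := by
  set d := g.num with hd
  set q := g.denom with hq
  set dδ : Polynomial ℝ := d.comp (Polynomial.X + Polynomial.C δ) with hdδ
  set r : Polynomial ℝ := 1 + Polynomial.C δ * Polynomial.X with hr
  have hdnz : ∀ s : ℂ, 0 < s.re → Polynomial.aeval s d ≠ 0 := fun s hs h => by
    refine hnz s hs ?_
    rw [ev_eq_div, ← hd, h, zero_div]
  have haδ : ∀ s : ℂ, Polynomial.aeval s dδ = Polynomial.aeval (s + δ) d := fun s => by
    simp [hdδ, Polynomial.aeval_comp]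
  have har : ∀ s : ℂ, Polynomial.aeval s r = 1 + δ * s := fun s => by simp [hr]
  have hne1 : ∀ s : ℂ, 0 ≤ s.re → Polynomial.aeval (s + δ) d ≠ 0 := fun s hs =>
    hdnz _ (by simp; linarith)
  have hne2 : ∀ s : ℂ, 0 ≤ s.re → (1 + δ * s : ℂ) ≠ 0 := fun s hs h => by
    have := congrArg Complex.re h
    simp at this
    nlinarith
  have hden : ∀ s : ℂ, 0 ≤ s.re → Polynomial.aeval s (dδ * r ^ q.natDegree) ≠ 0 := fun s hs => by
    rw [map_mul, map_pow, haδ, har]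
    exact mul_ne_zero (hne1 s hs) (pow_ne_zero _ (hne2 s hs))
  have hden0 : dδ * r ^ q.natDegree ≠ 0 := fun h => by
    have := hden 0 (by simp)
    rw [h, map_zero] at this
    exact this rfl
  have hrd : r.natDegree = 1 := by
    rw [hr, add_comm]
    exact Polynomial.natDegree_linear hδ.ne'
  have hdeg : q.degree ≤ (dδ * r ^ q.natDegree).degree := by
    rw [Polynomial.degree_eq_natDegree hden0, Polynomial.degree_eq_natDegree g.denom_ne_zero,
      Polynomial.natDegree_mul (left_ne_zero_of_mul hden0) (right_ne_zero_of_mul hden0),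
      Polynomial.natDegree_pow, hrd, Nat.cast_le, ← hq]
    omega
  refine ⟨_, stable_div_poly hdeg hden, fun s hs => ?_⟩
  rw [ev_div_poly _ (hden s hs), ev_eq_div, map_mul, map_pow, haδ, har, ← hd, ← hq]
  have h1 : Polynomial.aeval s q ≠ 0 := hg.2 s hs
  have h2 := hne1 s hs
  have h3 := hne2 s hs
  rw [inv_pow]
  field_simp

lemma norm_multiset_prod_le {R : Multiset ℂ} {f h : ℂ → ℂ} (hfh : ∀ r ∈ R, ‖f r‖ ≤ ‖h r‖) :
    ‖(R.map f).prod‖ ≤ ‖(R.map h).prod‖ := by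
  induction R using Multiset.induction_on with
  | empty => simp
  | cons r R ih =>
    simp only [Multiset.map_cons, Multiset.prod_cons, norm_mul]
    exact mul_le_mul (hfh r (Multiset.mem_cons_self _ _))
      (ih fun x hx => hfh x (Multiset.mem_cons_of_mem hx)) (norm_nonneg _) (norm_nonneg _)

lemma roots_re_nonpos {d : Polynomial ℝ} (hd : ∀ s : ℂ, 0 < s.re → Polynomial.aeval s d ≠ 0)
    {r : ℂ} (hr : r ∈ (d.map (algebraMap ℝ ℂ)).roots) : r.re ≤ 0 := by
  by_contra h
  push Not at h
  have h0 : d.map (algebraMap ℝ ℂ) ≠ 0 := fun h0 => by rw [h0] at hr; simp at hr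
  have h1 : (d.map (algebraMap ℝ ℂ)).eval r = 0 := (Polynomial.mem_roots h0).1 hr
  rw [Polynomial.eval_map_algebraMap] at h1
  exact hd r h h1

/-- All roots have nonpositive real part, so a point of the closed right half plane moves away from
each of them when shifted to the right. -/
lemma norm_aeval_le_shift {d : Polynomial ℝ} (hd : ∀ s : ℂ, 0 < s.re → Polynomial.aeval s d ≠ 0)
    {δ : ℝ} (hδ : 0 ≤ δ) {s : ℂ} (hs : 0 ≤ s.re) :
    ‖Polynomial.aeval s d‖ ≤ ‖Polynomial.aeval (s + δ) d‖ := by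
  rw [← Polynomial.eval_map_algebraMap, ← Polynomial.eval_map_algebraMap,
    (IsAlgClosed.splits _).eval_eq_prod_roots, (IsAlgClosed.splits _).eval_eq_prod_roots (s + δ),
    norm_mul, norm_mul]
  refine mul_le_mul_of_nonneg_left (norm_multiset_prod_le fun r hr => ?_) (norm_nonneg _)
  have hr0 := roots_re_nonpos hd hr
  rw [← sq_le_sq₀ (norm_nonneg _) (norm_nonneg _), ← Complex.normSq_eq_norm_sq,
    ← Complex.normSq_eq_norm_sq, Complex.normSq_apply, Complex.normSq_apply]
  simp
  nlinarith

lemma norm_inv_one_add_le {δ : ℝ} (ω : ℝ) : ‖(1 + δ * (ω * Complex.I))⁻¹‖ ≤ 1 := by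
  rw [norm_inv]
  refine inv_le_one_of_one_le₀ ?_
  have := Complex.abs_re_le_norm (1 + δ * (ω * Complex.I))
  simpa using this

lemma tendsto_regularization {d : Polynomial ℝ} (e : ℕ) {s : ℂ} (h : Polynomial.aeval s d ≠ 0) :
    Tendsto (fun δ : ℝ => Polynomial.aeval s d / Polynomial.aeval (s + δ) d * (1 + δ * s)⁻¹ ^ e)
      (𝓝 0) (𝓝 1) := by
  have hc : ContinuousAt (fun δ : ℝ => Polynomial.aeval s d / Polynomial.aeval (s + δ) d *
      (1 + δ * s)⁻¹ ^ e) 0 := by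
    have h1 : Continuous fun δ : ℝ => Polynomial.aeval (s + δ) d :=
      (Polynomial.continuous_aeval d).comp (by fun_prop)
    refine (continuousAt_const.div h1.continuousAt (by simpa using h)).mul
      (ContinuousAt.pow (ContinuousAt.inv₀ (by fun_prop) (by simp)) _)
  have := hc.tendsto
  simpa [h] using this

lemma tendsto_one_div_nat : Tendsto (fun n : ℕ => 1 / ((n : ℝ) + 1)) atTop (𝓝 0) :=
  tendsto_one_div_add_atTop_nhds_zero_nat

/-- A stable function without zeros in the open right half plane has stable approximate
inverses on the imaginary axis. -/
lemma exists_approx_inverse {g : RatFunc ℝ} (hg : Stable g)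
    (hnz : ∀ s : ℂ, 0 < s.re → ev g s ≠ 0) :
    ∃ k : ℕ → RatFunc ℝ, (∀ n, Stable (k n)) ∧
      (∀ n (ω : ℝ), ‖ev g (ω * Complex.I) * ev (k n) (ω * Complex.I)‖ ≤ 1) ∧
      ∀ᵐ ω : ℝ, Tendsto (fun n => ev g (ω * Complex.I) * ev (k n) (ω * Complex.I)) atTop (𝓝 1) := by
  have hpos : ∀ n : ℕ, 0 < 1 / ((n : ℝ) + 1) := fun n => by positivity
  choose k hk hk2 using fun n : ℕ => exists_regularized_inverse hg hnz (hpos n)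
  have hdnz : ∀ s : ℂ, 0 < s.re → Polynomial.aeval s g.num ≠ 0 := fun s hs h => by
    refine hnz s hs ?_
    rw [ev_eq_div, h, zero_div]
  refine ⟨k, hk, fun n ω => ?_, ?_⟩
  · rw [hk2 n _ (by simp), norm_mul, norm_pow, norm_div]
    refine mul_le_one₀ (div_le_one_of_le₀ (norm_aeval_le_shift hdnz (hpos n).le (by simp))
      (norm_nonneg _)) (by positivity) (pow_le_one₀ (norm_nonneg _) (norm_inv_one_add_le ω))
  · have hne : g.num ≠ 0 := fun h => hdnz 1 (by simp) (by rw [h, map_zero])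
    filter_upwards [ae_of_cofinite (eventually_aeval_ne_zero hne)] with ω hω
    refine ((tendsto_regularization g.denom.natDegree hω).comp tendsto_one_div_nat).congr
      fun n => ?_
    rw [hk2 n _ (by simp), Function.comp_apply]

/-- Bound on the deviation from `1` of the normalized regularization. -/
lemma regularization_bound (R : Multiset ℂ) (hR : ∀ r ∈ R, r ≠ 0 ∧ r.re ≤ 0) :
    ∃ C : ℝ, 0 ≤ C ∧ ∀ δ : ℝ, 0 < δ → δ ≤ 1 → ∀ ω : ℝ,
      ‖(R.map fun r => (ω * Complex.I - r) * (δ - r) / ((ω * Complex.I + δ - r) * (-r))).prod‖ ≤ C ∧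
      ‖(R.map fun r => (ω * Complex.I - r) * (δ - r) / ((ω * Complex.I + δ - r) * (-r))).prod - 1‖
        ≤ C * |ω| := by
  induction R using Multiset.induction_on with
  | empty => exact ⟨1, by simp, by simp⟩
  | cons r R ih =>
    obtain ⟨C, hC, h⟩ := ih fun x hx => hR x (Multiset.mem_cons_of_mem hx)
    obtain ⟨hr0, hr⟩ := hR r (Multiset.mem_cons_self _ _)
    have hrn : 0 < ‖r‖ := norm_pos_iff.2 hr0
    refine ⟨(1 + 1 / ‖r‖) * C + 1 / ‖r‖, by positivity, fun δ hδ hδ1 ω => ?_⟩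
    obtain ⟨h1, h2⟩ := h δ hδ hδ1 ω
    simp only [Multiset.map_cons, Multiset.prod_cons]
    set A := (R.map fun r => (ω * Complex.I - r) * (δ - r) /
      ((ω * Complex.I + δ - r) * (-r))).prod with hA
    set a : ℂ := (ω * Complex.I - r) * (δ - r) / ((ω * Complex.I + δ - r) * (-r)) with ha
    have hden : δ ≤ ‖(ω * Complex.I + δ - r : ℂ)‖ := by
      have := Complex.abs_re_le_norm (ω * Complex.I + δ - r : ℂ)
      simp only [Complex.add_re, Complex.sub_re, Complex.mul_re, Complex.ofReal_re, Complex.I_re,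
        Complex.ofReal_im, Complex.I_im, mul_zero, zero_mul, sub_zero, zero_add] at this
      rw [abs_of_nonneg (by linarith)] at this
      linarith
    have hden0 : (ω * Complex.I + δ - r : ℂ) ≠ 0 := norm_pos_iff.1 (hδ.trans_le hden)
    have ha1 : ‖a‖ ≤ 1 + 1 / ‖r‖ := by
      have e1 : ‖(ω * Complex.I - r : ℂ)‖ ≤ ‖(ω * Complex.I + δ - r : ℂ)‖ := by
        rw [← sq_le_sq₀ (norm_nonneg _) (norm_nonneg _), ← Complex.normSq_eq_norm_sq,
          ← Complex.normSq_eq_norm_sq, Complex.normSq_apply, Complex.normSq_apply]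
        simp
        nlinarith
      have e2 : ‖(δ - r : ℂ)‖ ≤ 1 + ‖r‖ := by
        refine (norm_sub_le _ _).trans ?_
        simpa [abs_of_pos hδ] using hδ1
      rw [ha, norm_div, norm_mul, norm_mul, norm_neg, mul_div_mul_comm]
      calc _ ≤ 1 * ((1 + ‖r‖) / ‖r‖) := mul_le_mul (div_le_one_of_le₀ e1 (norm_nonneg _))
            (by gcongr) (by positivity) zero_le_one
        _ = 1 + 1 / ‖r‖ := by field_simp; ring
    -- The quotient `δ / (iω + δ - r)` is at most `1` in modulus because `Re r ≤ 0`. This makes the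
    -- deviation of order `|ω|` uniformly in `δ`, as needed for integration against `ω⁻²` at the
    -- origin.
    have ha2 : ‖a - 1‖ ≤ 1 / ‖r‖ * |ω| := by
      have : a - 1 = δ / (ω * Complex.I + δ - r) * (ω * Complex.I / (-r)) := by
        rw [ha]
        field_simp
        ring
      rw [this, norm_mul, norm_div, norm_div, norm_neg, norm_mul, Complex.norm_I, mul_one,
        Complex.norm_real, Complex.norm_real, Real.norm_eq_abs, Real.norm_eq_abs, abs_of_pos hδ]
      calc _ ≤ 1 * (|ω| / ‖r‖) := mul_le_mul_of_nonneg_right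
            (div_le_one_of_le₀ hden (norm_nonneg _)) (by positivity)
        _ = _ := by ring
    have hr1 : 0 ≤ 1 / ‖r‖ := by positivity
    constructor
    · rw [norm_mul]
      calc ‖a‖ * ‖A‖ ≤ (1 + 1 / ‖r‖) * C := mul_le_mul ha1 h1 (norm_nonneg _) (by positivity)
        _ ≤ _ := by linarith
    · have : a * A - 1 = a * (A - 1) + (a - 1) := by ring
      rw [this]
      refine (norm_add_le _ _).trans ?_
      rw [norm_mul, add_mul]
      refine add_le_add ?_ ha2
      rw [mul_assoc]
      exact mul_le_mul ha1 h2 (norm_nonneg _) (by positivity)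

lemma norm_inv_pow_sub_one_le {δ : ℝ} (hδ : 0 < δ) (hδ1 : δ ≤ 1) (ω : ℝ) (e : ℕ) :
    ‖(1 + δ * (ω * Complex.I))⁻¹ ^ e - 1‖ ≤ e * |ω| := by
  set b : ℂ := (1 + δ * (ω * Complex.I))⁻¹ with hb
  have h1 : ‖b‖ ≤ 1 := norm_inv_one_add_le ω
  have hne : (1 + δ * (ω * Complex.I) : ℂ) ≠ 0 := fun h => by
    have := congrArg Complex.re h
    simp at this
  have h2 : ‖b - 1‖ ≤ |ω| := by
    have : b - 1 = -(δ * (ω * Complex.I)) * b := by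
      have h3 : (1 + δ * (ω * Complex.I)) * b = 1 := mul_inv_cancel₀ hne
      linear_combination h3
    rw [this, norm_mul, norm_neg, norm_mul, norm_mul, Complex.norm_I, Complex.norm_real,
      Complex.norm_real, Real.norm_eq_abs, Real.norm_eq_abs, abs_of_pos hδ, mul_one]
    have := abs_nonneg ω
    calc δ * |ω| * ‖b‖ ≤ 1 * |ω| * 1 := by gcongr
      _ = |ω| := by ring
  induction e with
  | zero => simp
  | succ e ih =>
    have : b ^ (e + 1) - 1 = b * (b ^ e - 1) + (b - 1) := by ring
    rw [this]
    refine (norm_add_le _ _).trans ?_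
    rw [norm_mul]
    push_cast
    have h3 : ‖b‖ * ‖b ^ e - 1‖ ≤ 1 * (e * |ω|) := mul_le_mul h1 ih (norm_nonneg _) zero_le_one
    linarith

/-- Stable approximate inverses, exact at the origin, when `g` does not vanish there. -/
lemma exists_approx_inverse_of_zero {g : RatFunc ℝ} (hg : Stable g)
    (hnz : ∀ s : ℂ, 0 < s.re → ev g s ≠ 0) (h0 : ev g 0 ≠ 0) :
    ∃ k : ℕ → RatFunc ℝ, (∀ n, Stable (k n)) ∧ (∀ n, ev g 0 * ev (k n) 0 = 1) ∧
      (∃ C : ℝ, 0 ≤ C ∧ ∀ n (ω : ℝ), ‖ev g (ω * Complex.I) * ev (k n) (ω * Complex.I) - 1‖ ≤ C ∧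
        ‖ev g (ω * Complex.I) * ev (k n) (ω * Complex.I) - 1‖ ≤ C * |ω|) ∧
      ∀ᵐ ω : ℝ, Tendsto (fun n => ev g (ω * Complex.I) * ev (k n) (ω * Complex.I)) atTop (𝓝 1) := by
  have hpos : ∀ n : ℕ, 0 < 1 / ((n : ℝ) + 1) := fun n => by positivity
  have hle1 : ∀ n : ℕ, 1 / ((n : ℝ) + 1) ≤ 1 := fun n => by
    rw [div_le_one (by positivity)]
    have : (0 : ℝ) ≤ n := by positivity
    linarith
  choose k hk hk2 using fun n : ℕ => exists_regularized_inverse hg hnz (hpos n)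
  set d := g.num with hd
  have hdnz : ∀ s : ℂ, 0 < s.re → Polynomial.aeval s d ≠ 0 := fun s hs h => by
    refine hnz s hs ?_
    rw [ev_eq_div, ← hd, h, zero_div]
  have hd0 : Polynomial.aeval (0 : ℂ) d ≠ 0 := fun h => h0 (by rw [ev_eq_div, ← hd, h, zero_div])
  have hdδ : ∀ n : ℕ, Polynomial.aeval ((1 / ((n : ℝ) + 1) : ℝ) : ℂ) d ≠ 0 := fun n =>
    hdnz _ (by rw [Complex.ofReal_re]; exact hpos n)
  have hreal : ∀ x : ℝ, Polynomial.aeval (x : ℂ) d = ((d.eval x : ℝ) : ℂ) := fun x => by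
    rw [← Complex.coe_algebraMap, Polynomial.aeval_algebraMap_apply, Polynomial.coe_aeval_eq_eval]
  -- The regularization with shift `δ` takes the value `d(0) / d(δ)` at the origin; multiplication
  -- by its reciprocal makes the approximate inverse exact there.
  set c : ℕ → ℝ := fun n => d.eval (1 / ((n : ℝ) + 1)) / d.eval 0 with hc
  have hcC : ∀ n, (c n : ℂ) = Polynomial.aeval ((1 / ((n : ℝ) + 1) : ℝ) : ℂ) d /
      Polynomial.aeval (0 : ℂ) d := fun n => by
    have h00 := hreal 0
    rw [Complex.ofReal_zero] at h00
    rw [hreal, h00, hc]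
    push_cast
    rfl
  have hev : ∀ n s, 0 ≤ s.re → ev (RatFunc.C (c n) * k n) s = c n * ev (k n) s := fun n s hs => by
    rw [ev_mul (not_isPole_C _ _) ((hk n).not_isPole hs), ev_C]
  have hform : ∀ n s, 0 ≤ s.re → ev g s * ev (RatFunc.C (c n) * k n) s =
      c n * (Polynomial.aeval s d / Polynomial.aeval (s + (1 / ((n : ℝ) + 1) : ℝ)) d *
        (1 + (1 / ((n : ℝ) + 1) : ℝ) * s)⁻¹ ^ g.denom.natDegree) := fun n s hs => by
    rw [hev n s hs, mul_left_comm, hk2 n s hs]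
  have hroots : ∀ r ∈ (d.map (algebraMap ℝ ℂ)).roots, r ≠ 0 ∧ r.re ≤ 0 := fun r hr => by
    refine ⟨?_, roots_re_nonpos hdnz hr⟩
    rintro rfl
    refine hd0 ?_
    rw [← Polynomial.eval_map_algebraMap]
    exact (Polynomial.mem_roots'.1 hr).2
  obtain ⟨C, hC, hb⟩ := regularization_bound _ hroots
  have hprod : ∀ (δ : ℝ) (s : ℂ), Polynomial.aeval (δ : ℂ) d / Polynomial.aeval (0 : ℂ) d *
      (Polynomial.aeval s d / Polynomial.aeval (s + δ) d) =
      ((d.map (algebraMap ℝ ℂ)).roots.map fun r =>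
        (s - r) * (δ - r) / ((s + δ - r) * (-r))).prod := fun δ s => by
    have hlc : (d.map (algebraMap ℝ ℂ)).leadingCoeff ≠ 0 := by
      rw [Polynomial.leadingCoeff_ne_zero]
      intro h
      rw [← Polynomial.eval_map_algebraMap, h] at hd0
      simp at hd0
    have e := fun t : ℂ => (IsAlgClosed.splits (d.map (algebraMap ℝ ℂ))).eval_eq_prod_roots t
    simp only [← Polynomial.eval_map_algebraMap, e, Multiset.prod_map_div, Multiset.prod_map_mul,
      zero_sub]
    field_simp
  refine ⟨fun n => RatFunc.C (c n) * k n, fun n => (stable_C _).mul (hk n), fun n => ?_,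
    ⟨C + 1 + C * g.denom.natDegree + C, by positivity, fun n ω => ?_⟩, ?_⟩
  · rw [hform n 0 (by simp), hcC, zero_add, mul_zero, add_zero, inv_one, one_pow, mul_one]
    have := hdδ n
    field_simp
  · rw [hform n _ (by simp), ← mul_assoc, hcC, hprod]
    obtain ⟨h1, h2⟩ := hb _ (hpos n) (hle1 n) ω
    set A := ((d.map (algebraMap ℝ ℂ)).roots.map fun r => (ω * Complex.I - r) *
      (((1 / ((n : ℝ) + 1) : ℝ) : ℂ) - r) /
      ((ω * Complex.I + ((1 / ((n : ℝ) + 1) : ℝ) : ℂ) - r) * (-r))).prod with hA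
    set B : ℂ := (1 + ((1 / ((n : ℝ) + 1) : ℝ) : ℂ) * (ω * Complex.I))⁻¹ ^ g.denom.natDegree with hB
    have hB1 : ‖B‖ ≤ 1 := by
      rw [hB, norm_pow]
      exact pow_le_one₀ (norm_nonneg _) (norm_inv_one_add_le ω)
    have hB2 : ‖B - 1‖ ≤ g.denom.natDegree * |ω| := norm_inv_pow_sub_one_le (hpos n) (hle1 n) ω _
    have hp : 0 ≤ C * g.denom.natDegree := by positivity
    have hω := abs_nonneg ω
    constructor
    · refine (norm_sub_le _ _).trans ?_
      rw [norm_mul, norm_one]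
      have : ‖A‖ * ‖B‖ ≤ C * 1 := mul_le_mul h1 hB1 (norm_nonneg _) hC
      linarith
    · have : A * B - 1 = A * (B - 1) + (A - 1) := by ring
      rw [this]
      refine (norm_add_le _ _).trans ?_
      rw [norm_mul]
      have h3 : ‖A‖ * ‖B - 1‖ ≤ C * (g.denom.natDegree * |ω|) :=
        mul_le_mul h1 hB2 (norm_nonneg _) hC
      nlinarith [mul_nonneg hC hω]
  · have hne : d ≠ 0 := fun h => hd0 (by rw [h, map_zero])
    have hclim : Tendsto (fun n => (c n : ℂ)) atTop (𝓝 1) := by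
      have h1 : Tendsto (fun n : ℕ => Polynomial.aeval ((1 / ((n : ℝ) + 1) : ℝ) : ℂ) d /
          Polynomial.aeval (0 : ℂ) d) atTop (𝓝 (Polynomial.aeval ((0 : ℝ) : ℂ) d /
          Polynomial.aeval (0 : ℂ) d)) :=
        (((Polynomial.continuous_aeval d).tendsto _).comp
          ((Complex.continuous_ofReal.tendsto 0).comp tendsto_one_div_nat)).div_const _
      rw [Complex.ofReal_zero, div_self hd0] at h1
      exact h1.congr fun n => (hcC n).symm
    filter_upwards [ae_of_cofinite (eventually_aeval_ne_zero hne)] with ω hω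
    have := hclim.mul ((tendsto_regularization g.denom.natDegree hω).comp tendsto_one_div_nat)
    rw [mul_one] at this
    refine this.congr fun n => ?_
    rw [hform n _ (by simp), Function.comp_apply]

end

section

variable {l : ℕ}

/-! ### Elementary allpass factors -/

/-- The projection `η ηᴴ` onto the line of a unit vector. -/
def lineProj (η : EuclideanSpace ℂ (Fin l)) : Matrix (Fin l) (Fin l) ℂ :=
  vecMulVec (fun i => η i) (fun i => star (η i))

lemma rankOne_eq (b : ℂ) (η : EuclideanSpace ℂ (Fin l)) :
    rankOne b η = 1 + (b - 1) • lineProj η := rfl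

lemma lineProj_mulVec (η : EuclideanSpace ℂ (Fin l)) (v : Fin l → ℂ) :
    lineProj η *ᵥ v = (star (η : Fin l → ℂ) ⬝ᵥ v) • (η : Fin l → ℂ) := by
  ext i
  simp only [lineProj, Matrix.mulVec, dotProduct, vecMulVec_apply, Pi.smul_apply, smul_eq_mul,
    Finset.sum_mul, Pi.star_apply]
  exact Finset.sum_congr rfl fun j _ => by ring

lemma star_dotProduct_self {η : EuclideanSpace ℂ (Fin l)} (hη : ‖η‖ = 1) :
    star (η : Fin l → ℂ) ⬝ᵥ (η : Fin l → ℂ) = 1 := by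
  have h := EuclideanSpace.norm_sq_eq η
  rw [hη] at h
  have h2 : star (η : Fin l → ℂ) ⬝ᵥ (η : Fin l → ℂ) = ((∑ i, ‖η i‖ ^ 2 : ℝ) : ℂ) := by
    push_cast
    refine Finset.sum_congr rfl fun i _ => ?_
    rw [Pi.star_apply, Complex.star_def, Complex.conj_mul']
  rw [h2, ← h]
  simp

lemma lineProj_conjTranspose (η : EuclideanSpace ℂ (Fin l)) : (lineProj η)ᴴ = lineProj η := by
  ext i j
  simp [lineProj, vecMulVec_apply, mul_comm]

lemma lineProj_mul_self {η : EuclideanSpace ℂ (Fin l)} (hη : ‖η‖ = 1) :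
    lineProj η * lineProj η = lineProj η := by
  have h := star_dotProduct_self hη
  ext i j
  simp only [lineProj, Matrix.mul_apply, vecMulVec_apply]
  have : ∀ k, η i * star (η k) * (η k * star (η j)) =
      (star (η : Fin l → ℂ) k * η k) * (η i * star (η j)) := fun k => by
    rw [Pi.star_apply]
    ring
  simp only [this, ← Finset.sum_mul]
  have h' : ∑ k, star (η : Fin l → ℂ) k * η k = 1 := h
  rw [h', one_mul]

lemma rankOne_mul {η : EuclideanSpace ℂ (Fin l)} (hη : ‖η‖ = 1) (b c : ℂ) :
    rankOne b η * rankOne c η = rankOne (b * c) η := by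
  simp only [rankOne_eq, mul_add, add_mul, Matrix.one_mul, Matrix.mul_one, Matrix.smul_mul,
    Matrix.mul_smul, lineProj_mul_self hη]
  module

lemma rankOne_one (η : EuclideanSpace ℂ (Fin l)) : rankOne 1 η = 1 := by
  simp [rankOne_eq]

lemma rankOne_conjTranspose (b : ℂ) (η : EuclideanSpace ℂ (Fin l)) :
    (rankOne b η)ᴴ = rankOne (star b) η := by
  simp [rankOne_eq, lineProj_conjTranspose]

lemma rankOne_inv {η : EuclideanSpace ℂ (Fin l)} (hη : ‖η‖ = 1) {b : ℂ} (hb : b ≠ 0) :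
    (rankOne b η)⁻¹ = rankOne b⁻¹ η :=
  Matrix.inv_eq_right_inv (by rw [rankOne_mul hη, mul_inv_cancel₀ hb, rankOne_one])

lemma det_rankOne {η : EuclideanSpace ℂ (Fin l)} (hη : ‖η‖ = 1) (b : ℂ) :
    (rankOne b η).det = b := by
  have h : rankOne b η = 1 + vecMulVec ((b - 1) • (η : Fin l → ℂ)) (star (η : Fin l → ℂ)) := by
    rw [rankOne_eq, Matrix.smul_vecMulVec]
    rfl
  rw [h, vecMulVec_eq Unit, Matrix.det_one_add_replicateCol_mul_replicateRow, dotProduct_smul,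
    star_dotProduct_self hη]
  simp

lemma rankOne_unitary {η : EuclideanSpace ℂ (Fin l)} (hη : ‖η‖ = 1) {b : ℂ} (hb : ‖b‖ = 1) :
    (rankOne b η)ᴴ * rankOne b η = 1 := by
  rw [rankOne_conjTranspose, rankOne_mul hη, Complex.star_def, Complex.conj_mul', hb]
  simp [rankOne_one]

lemma rankOne_mulVec (b : ℂ) (η : EuclideanSpace ℂ (Fin l)) (v : Fin l → ℂ) :
    rankOne b η *ᵥ v = v + ((b - 1) * (star (η : Fin l → ℂ) ⬝ᵥ v)) • (η : Fin l → ℂ) := by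
  rw [rankOne_eq, Matrix.add_mulVec, Matrix.one_mulVec, Matrix.smul_mulVec, lineProj_mulVec,
    smul_smul]

lemma norm_blaschkeD {z : ℂ} (hz : 0 < z.re) (ω : ℝ) :
    ‖(ω * Complex.I - z) / (ω * Complex.I + star z)‖ = 1 := by
  have h1 : star (ω * Complex.I - z) = -(ω * Complex.I + star z) := by
    simp only [star_sub, star_mul', Complex.star_def, Complex.conj_I, Complex.conj_ofReal]
    ring
  have h2 : ω * Complex.I + star z ≠ 0 := fun h => by
    have := congrArg Complex.re h
    simp at this
    linarith
  rw [norm_div, ← norm_neg (_ + _), ← h1, norm_star, div_self]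
  intro h
  rw [← norm_star, h1, norm_neg, norm_eq_zero] at h
  exact h2 h

lemma norm_blaschkeL {z : ℂ} (hz : 0 < z.re) (ω : ℝ) :
    ‖star z / z * ((z - ω * Complex.I) / (star z + ω * Complex.I))‖ = 1 := by
  have hz0 : z ≠ 0 := by rintro rfl; simp at hz
  have h := norm_blaschkeD hz ω
  rw [norm_mul, norm_div, norm_star, div_self (norm_ne_zero_iff.2 hz0), one_mul, ← h, norm_div,
    norm_div, add_comm (star z), norm_sub_rev]

lemma re_pos_add_star_ne {z s : ℂ} (hz : 0 < z.re) (hs : 0 ≤ s.re) : s + star z ≠ 0 := fun h => by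
  have := congrArg Complex.re h
  simp at this
  linarith

lemma ofFn_prod_unitary {m : ℕ} (A : Fin m → Matrix (Fin l) (Fin l) ℂ)
    (hA : ∀ i, (A i)ᴴ * A i = 1) : ((List.ofFn A).prod)ᴴ * (List.ofFn A).prod = 1 := by
  induction m with
  | zero => simp
  | succ m ih =>
    rw [List.ofFn_succ, List.prod_cons, Matrix.conjTranspose_mul, Matrix.mul_assoc,
      ← Matrix.mul_assoc (A 0)ᴴ, hA 0, Matrix.one_mul]
    exact ih _ fun i => hA _

lemma prodL_unitary {m : ℕ} {z : Fin m → ℂ} (hz : ∀ i, 0 < (z i).re)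
    {η : Fin m → EuclideanSpace ℂ (Fin l)} (hη : ∀ i, ‖η i‖ = 1) (ω : ℝ) :
    (prodL z η (ω * Complex.I))ᴴ * prodL z η (ω * Complex.I) = 1 :=
  ofFn_prod_unitary _ fun i => rankOne_unitary (hη i) (norm_blaschkeL (hz i) ω)

lemma prodL_succ {m : ℕ} (z : Fin (m + 1) → ℂ) (η : Fin (m + 1) → EuclideanSpace ℂ (Fin l))
    (s : ℂ) : prodL z η s = elemL (z 0) (η 0) s * prodL (fun i => z i.succ) (fun i => η i.succ) s := by
  simp [prodL, List.ofFn_succ]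

lemma prodD_succ {m : ℕ} (z : Fin (m + 1) → ℂ) (w : Fin (m + 1) → EuclideanSpace ℂ (Fin l))
    (s : ℂ) : prodD z w s = prodD (fun i => z i.succ) (fun i => w i.succ) s * elemD (z 0) (w 0) s := by
  simp [prodD, List.ofFn_succ]

lemma prodD_unitary {m : ℕ} {z : Fin m → ℂ} (hz : ∀ i, 0 < (z i).re)
    {w : Fin m → EuclideanSpace ℂ (Fin l)} (hw : ∀ i, ‖w i‖ = 1) (ω : ℝ) :
    (prodD z w (ω * Complex.I))ᴴ * prodD z w (ω * Complex.I) = 1 := by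
  induction m with
  | zero => simp [prodD]
  | succ m ih =>
    rw [prodD_succ, Matrix.conjTranspose_mul, Matrix.mul_assoc, ← Matrix.mul_assoc (_)ᴴ (prodD _ _ _),
      ih (fun i => hz _) fun i => hw _, Matrix.one_mul]
    exact rankOne_unitary (hw 0) (norm_blaschkeD (hz 0) ω)

lemma elemL_zero {z : ℂ} (hz : 0 < z.re) (η : EuclideanSpace ℂ (Fin l)) : elemL z η 0 = 1 := by
  have hz0 : z ≠ 0 := by rintro rfl; simp at hz
  have hz1 : star z ≠ 0 := by simpa using hz0
  rw [elemL, sub_zero, add_zero]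
  rw [show star z / z * (z / star z) = 1 by field_simp, rankOne_one]

lemma prodL_zero {m : ℕ} {z : Fin m → ℂ} (hz : ∀ i, 0 < (z i).re)
    (η : Fin m → EuclideanSpace ℂ (Fin l)) : prodL z η 0 = 1 := by
  simp [prodL, elemL_zero (hz _)]

lemma star_add_self (z : ℂ) : z + star z = 2 * (z.re : ℂ) := by
  rw [Complex.star_def, Complex.add_conj]
  push_cast
  rfl

lemma self_mul_star (z : ℂ) : z * star z = (‖z‖ : ℂ) ^ 2 := by
  rw [Complex.star_def, Complex.mul_conj']

/-- First order expansion of a scalar Blaschke factor at the origin. -/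
lemma tendsto_blaschke_slope {z : ℂ} (hz : 0 < z.re) :
    Tendsto (fun s : ℂ => s⁻¹ * (star z / z * ((z - s) / (star z + s)) - 1)) (𝓝[≠] 0)
      (𝓝 (-2 * (z.re / ‖z‖ ^ 2 : ℝ))) := by
  have hz0 : z ≠ 0 := by rintro rfl; simp at hz
  have hz1 : star z ≠ 0 := by simpa using hz0
  have hc : ContinuousAt (fun s : ℂ => -(z + star z) / (z * (star z + s))) 0 :=
    ContinuousAt.div continuousAt_const (by fun_prop) (by simpa using hz0)
  have h0 : -(z + star z) / (z * (star z + 0)) = (-2 * (z.re / ‖z‖ ^ 2 : ℝ) : ℂ) := by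
    rw [add_zero, star_add_self, self_mul_star]
    push_cast
    ring
  have h1 := hc.tendsto
  rw [h0] at h1
  refine (h1.mono_left nhdsWithin_le_nhds).congr' ?_
  have hne : ∀ᶠ s in 𝓝[≠] (0 : ℂ), star z + s ≠ 0 := by
    refine eventually_nhdsWithin_of_eventually_nhds ?_
    have : ContinuousAt (fun s : ℂ => star z + s) 0 := by fun_prop
    exact this.eventually_ne (by simpa using hz0)
  filter_upwards [hne, self_mem_nhdsWithin] with s hs hs0
  have hs0' : s ≠ 0 := hs0
  field_simp
  ring

/-- First order expansion of `L` at the origin. -/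
lemma tendsto_prodL_slope {m : ℕ} {z : Fin m → ℂ} (hz : ∀ i, 0 < (z i).re)
    (η : Fin m → EuclideanSpace ℂ (Fin l)) :
    Tendsto (fun s : ℂ => s⁻¹ • (prodL z η s - 1)) (𝓝[≠] 0)
      (𝓝 (∑ i, (-2 * ((z i).re / ‖z i‖ ^ 2 : ℝ) : ℂ) • lineProj (η i))) := by
  induction m with
  | zero => simp [prodL]
  | succ m ih =>
    have h2 := ih (fun i => hz i.succ) fun i => η i.succ
    have h1 : Tendsto (fun s : ℂ => s⁻¹ • (elemL (z 0) (η 0) s - 1)) (𝓝[≠] 0)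
        (𝓝 ((-2 * ((z 0).re / ‖z 0‖ ^ 2 : ℝ) : ℂ) • lineProj (η 0))) := by
      refine ((tendsto_blaschke_slope (hz 0)).smul_const (lineProj (η 0))).congr fun s => ?_
      rw [elemL, rankOne_eq, add_sub_cancel_left, smul_smul]
    have h3 : Tendsto (fun s : ℂ => prodL (fun i => z i.succ) (fun i => η i.succ) s) (𝓝[≠] 0)
        (𝓝 1) := by
      have h4 : Tendsto (fun s : ℂ => s) (𝓝[≠] 0) (𝓝 0) := tendsto_id.mono_left nhdsWithin_le_nhds
      have h5 := (h4.smul h2).add (tendsto_const_nhds (x := (1 : Matrix (Fin l) (Fin l) ℂ)))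
      rw [zero_smul, zero_add] at h5
      refine h5.congr' ?_
      filter_upwards [self_mem_nhdsWithin] with s hs
      rw [smul_smul, mul_inv_cancel₀ hs, one_smul, sub_add_cancel]
    have h6 := (h1.mul h3).add h2
    rw [mul_one, ← Fin.sum_univ_succ (f := fun i => (-2 * ((z i).re / ‖z i‖ ^ 2 : ℝ) : ℂ) •
      lineProj (η i))] at h6
    refine h6.congr fun s => ?_
    rw [prodL_succ, Matrix.smul_mul, ← smul_add]
    congr 1
    noncomm_ring

/-- First order expansion of a scalar Blaschke product at the origin. -/
lemma tendsto_blaschkeProd_slope {n : ℕ} {z : Fin n → ℂ} (hz : ∀ i, 0 < (z i).re) :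
    Tendsto (fun s : ℂ => s⁻¹ *
      (∏ k, star (z k) * (z k - s) / (z k * (star (z k) + s)) - 1)) (𝓝[≠] 0)
      (𝓝 (-2 * (∑ k, (z k).re / ‖z k‖ ^ 2 : ℝ))) := by
  induction n with
  | zero => simp
  | succ n ih =>
    have h2 := ih fun i => hz i.succ
    have h1 : Tendsto (fun s : ℂ => s⁻¹ *
        (star (z 0) * (z 0 - s) / (z 0 * (star (z 0) + s)) - 1)) (𝓝[≠] 0)
        (𝓝 (-2 * ((z 0).re / ‖z 0‖ ^ 2 : ℝ))) := by
      refine (tendsto_blaschke_slope (hz 0)).congr fun s => ?_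
      rw [div_mul_div_comm]
    have h3 : Tendsto (fun s : ℂ => ∏ k : Fin n,
        star (z k.succ) * (z k.succ - s) / (z k.succ * (star (z k.succ) + s))) (𝓝[≠] 0)
        (𝓝 1) := by
      have h4 : Tendsto (fun s : ℂ => s) (𝓝[≠] 0) (𝓝 0) := tendsto_id.mono_left nhdsWithin_le_nhds
      have h5 := (h4.mul h2).add (tendsto_const_nhds (x := (1 : ℂ)))
      rw [zero_mul, zero_add] at h5
      refine h5.congr' ?_
      filter_upwards [self_mem_nhdsWithin] with s hs
      rw [mul_inv_cancel_left₀ hs, sub_add_cancel]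
    have h6 := (h1.mul h3).add h2
    rw [mul_one, ← mul_add, ← Complex.ofReal_add, ← Fin.sum_univ_succ
      (f := fun k => (z k).re / ‖z k‖ ^ 2)] at h6
    refine h6.congr fun s => ?_
    rw [Fin.prod_univ_succ]
    ring

end

section

variable {l : ℕ}

/-! ### Orthogonality of the directions of a repeated zero -/

lemma rankOne_zero_mulVec (w : EuclideanSpace ℂ (Fin l)) (v : Fin l → ℂ) :
    rankOne 0 w *ᵥ v = v - (star (w : Fin l → ℂ) ⬝ᵥ v) • (w : Fin l → ℂ) := by
  rw [rankOne_mulVec, zero_sub, neg_one_mul, neg_smul, sub_eq_add_neg]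

/-- If a product of elementary factors vanishes at `ζ` on a subspace of dimension at least the
number of factors with zero `ζ`, then the directions of these (consecutive) factors are
orthogonal. -/
lemma prodD_kernel {m : ℕ} {z : Fin m → ℂ} (hz : ∀ i, 0 < (z i).re)
    {w : Fin m → EuclideanSpace ℂ (Fin l)} (hw : ∀ i, ‖w i‖ = 1)
    (hrow : ∀ i j k, i ≤ j → j ≤ k → z i = z k → z j = z i) {ζ : ℂ} (hζ : 0 < ζ.re)
    (V : Submodule ℂ (Fin l → ℂ)) (hV : ∀ v ∈ V, prodD z w ζ *ᵥ v = 0)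
    (hc : (∑ i, open Classical in if z i = ζ then 1 else 0) ≤ Module.finrank ℂ V) :
    (∀ i j, i ≠ j → z i = ζ → z j = ζ → star (w i : Fin l → ℂ) ⬝ᵥ (w j : Fin l → ℂ) = 0) ∧
    Module.finrank ℂ V ≤ (∑ i, open Classical in if z i = ζ then 1 else 0) ∧
    ∀ i, z i = ζ → (∀ j ≤ i, z j = ζ) → (w i : Fin l → ℂ) ∈ V := by
  classical
  induction m generalizing V with
  | zero =>
    refine ⟨fun i => i.elim0, ?_, fun i => i.elim0⟩
    have : V = ⊥ := by
      rw [Submodule.eq_bot_iff]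
      intro v hv
      simpa [prodD] using hV v hv
    simp [this]
  | succ m ih =>
    -- Induction on the rightmost factor `A`, with `V` replaced by its image under `A`. If `A` has
    -- its zero at `ζ`, it is the orthogonal projection along `w 0`: the dimension drops by at most
    -- one and the number of factors by exactly one. Otherwise `A` is invertible at `ζ` and both
    -- stay the same.
    set A := elemD (z 0) (w 0) ζ with hA
    set f := Matrix.mulVecLin A with hf
    have hfv : ∀ v, f v = A *ᵥ v := fun v => Matrix.mulVecLin_apply _ _
    have hkill : ∀ v ∈ V.map f, prodD (fun i => z i.succ) (fun i => w i.succ) ζ *ᵥ v = 0 := by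
      rintro _ ⟨v, hv, rfl⟩
      rw [hfv, Matrix.mulVec_mulVec, ← prodD_succ]
      exact hV v hv
    have hrow' : ∀ i j k : Fin m, i ≤ j → j ≤ k → z i.succ = z k.succ → z j.succ = z i.succ :=
      fun i j k hij hjk => hrow _ _ _ (Fin.succ_le_succ_iff.2 hij) (Fin.succ_le_succ_iff.2 hjk)
    have ih' := ih (fun i => hz i.succ) (fun i => hw i.succ) hrow' (V.map f) hkill
    rw [Fin.sum_univ_succ] at hc ⊢
    by_cases h0 : z 0 = ζ
    · rw [if_pos h0] at hc ⊢
      have hAv : ∀ v, f v = v - (star (w 0 : Fin l → ℂ) ⬝ᵥ v) • (w 0 : Fin l → ℂ) := fun v => by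
        rw [hfv, hA, elemD, h0, sub_self, zero_div, rankOne_zero_mulVec]
      set g := f.domRestrict V with hg
      have hrange : LinearMap.range g = V.map f := by
        rw [hg, LinearMap.range_domRestrict]
      have hker : LinearMap.ker g ≤ (Submodule.span ℂ {(w 0 : Fin l → ℂ)}).comap V.subtype := by
        intro v hv
        have hv' : f v = 0 := hv
        rw [hAv, sub_eq_zero] at hv'
        exact Submodule.mem_span_singleton.2 ⟨_, hv'.symm⟩
      have hkd : Module.finrank ℂ (LinearMap.ker g) ≤ 1 := by
        have h1 : Module.finrank ℂ (LinearMap.ker g) =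
            Module.finrank ℂ ((LinearMap.ker g).map V.subtype) :=
          (LinearEquiv.finrank_eq (Submodule.equivMapOfInjective _ V.injective_subtype _))
        rw [h1]
        refine (Submodule.finrank_mono (Submodule.map_le_iff_le_comap.2 hker)).trans ?_
        simpa using finrank_span_le_card ({(w 0 : Fin l → ℂ)} : Set (Fin l → ℂ)) (R := ℂ)
      have hrn := LinearMap.finrank_range_add_finrank_ker g
      rw [hrange] at hrn
      obtain ⟨i1, i2, i3⟩ := ih' (by omega)
      -- By `i2` the image has dimension at most the remaining number of factors, while `V` had at
      -- least one more. So `A` has a kernel on `V`, and this kernel is the line of `w 0`.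
      have hk1 : 0 < Module.finrank ℂ (LinearMap.ker g) := by omega
      have hw0 : (w 0 : Fin l → ℂ) ∈ V := by
        have : Nontrivial (LinearMap.ker g) := Module.finrank_pos_iff.1 hk1
        obtain ⟨⟨⟨v, hvV⟩, hv⟩, hne⟩ := exists_ne (0 : LinearMap.ker g)
        have hv0 : v ≠ 0 := fun h => hne (by ext1; ext1; exact h)
        have hv' : f v = 0 := hv
        rw [hAv, sub_eq_zero] at hv'
        have hc0 : star (w 0 : Fin l → ℂ) ⬝ᵥ v ≠ 0 := fun h => hv0 (by rw [hv', h, zero_smul])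
        have : (w 0 : Fin l → ℂ) = (star (w 0 : Fin l → ℂ) ⬝ᵥ v)⁻¹ • v := by
          conv_rhs => rw [hv']
          rw [dotProduct_smul, star_dotProduct_self (hw 0), smul_smul, smul_eq_mul, mul_one,
            inv_mul_cancel₀ hc0, one_smul]
        rw [this]
        exact V.smul_mem _ hvV
      -- Equal zeros are consecutive, so every position before `j` has the zero `ζ` as well. The
      -- induction hypothesis then places `w j.succ` in the image of `A`, which is orthogonal to `w
      -- 0`.
      have hmem : ∀ j : Fin m, z j.succ = ζ → (w j.succ : Fin l → ℂ) ∈ V.map f := fun j hj =>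
        i3 j hj fun k hk => by
          rw [← h0]
          exact hrow 0 k.succ j.succ (Fin.zero_le _) (Fin.succ_le_succ_iff.2 hk) (h0.trans hj.symm)
      have horth : ∀ v ∈ V.map f, star (w 0 : Fin l → ℂ) ⬝ᵥ v = 0 := by
        rintro _ ⟨v, hv, rfl⟩
        rw [hAv, dotProduct_sub, dotProduct_smul, star_dotProduct_self (hw 0), smul_eq_mul,
          mul_one, sub_self]
      have hsub : V.map f ≤ V := by
        rintro _ ⟨v, hv, rfl⟩
        rw [hAv]
        exact V.sub_mem hv (V.smul_mem _ hw0)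
      refine ⟨fun i j => ?_, by omega, fun i => ?_⟩
      · refine Fin.cases ?_ (fun i => ?_) i <;> refine Fin.cases ?_ (fun j => ?_) j
        · intro h
          exact absurd rfl h
        · intro _ _ hj
          exact horth _ (hmem j hj)
        · intro _ hi _
          have := horth _ (hmem i hi)
          rw [← star_star (_ ⬝ᵥ _), Matrix.star_dotProduct, star_star, this, star_zero]
        · intro hij
          exact i1 i j fun h => hij (congrArg _ h)
      · refine Fin.cases ?_ (fun i => ?_) i
        · intro _ _
          exact hw0
        · intro hi _
          exact hsub (hmem i hi)
    · rw [if_neg h0, zero_add] at hc ⊢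
      have hb : (ζ - z 0) / (ζ + star (z 0)) ≠ 0 :=
        div_ne_zero (sub_ne_zero.2 (Ne.symm h0)) (re_pos_add_star_ne (hz 0) hζ.le)
      have hinj : Function.Injective f := by
        have hu : IsUnit A := by
          rw [Matrix.isUnit_iff_isUnit_det, hA, elemD, det_rankOne (hw 0)]
          exact isUnit_iff_ne_zero.2 hb
        exact Matrix.mulVec_injective_iff_isUnit.2 hu
      have hdim : Module.finrank ℂ (V.map f) = Module.finrank ℂ V :=
        (LinearEquiv.finrank_eq (Submodule.equivMapOfInjective f hinj V)).symm
      obtain ⟨i1, i2, i3⟩ := ih' (by rwa [hdim])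
      rw [hdim] at i2
      refine ⟨fun i j => ?_, i2, fun i _ hi => absurd (hi 0 (Fin.zero_le _)) h0⟩
      refine Fin.cases ?_ (fun i => ?_) i <;> refine Fin.cases ?_ (fun j => ?_) j
      · exact fun h => absurd rfl h
      · exact fun _ h => absurd h h0
      · exact fun _ _ h => absurd h h0
      · intro hij
        exact i1 i j fun h => hij (congrArg _ h)

/-! ### Partial fractions of `D⁻¹` -/

/-- The inverse of an elementary factor. -/
def invD (z : ℂ) (w : EuclideanSpace ℂ (Fin l)) (s : ℂ) : Matrix (Fin l) (Fin l) ℂ :=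
  1 + (2 * (z.re : ℂ) / (s - z)) • lineProj w

lemma elemD_inv {z s : ℂ} {w : EuclideanSpace ℂ (Fin l)} (hw : ‖w‖ = 1) (hs : s ≠ z)
    (hs' : s + star z ≠ 0) : (elemD z w s)⁻¹ = invD z w s := by
  have h : s - z ≠ 0 := sub_ne_zero.2 hs
  rw [elemD, rankOne_inv hw (div_ne_zero h hs'), invD, rankOne_eq]
  congr 2
  rw [← star_add_self]
  field_simp
  ring

lemma elemD_mul_invD {z s : ℂ} {w : EuclideanSpace ℂ (Fin l)} (hw : ‖w‖ = 1) (hs : s ≠ z)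
    (hs' : s + star z ≠ 0) : elemD z w s * invD z w s = 1 := by
  rw [← elemD_inv hw hs hs', Matrix.mul_nonsing_inv]
  rw [elemD, det_rankOne hw]
  exact isUnit_iff_ne_zero.2 (div_ne_zero (sub_ne_zero.2 hs) hs')

/-- `D⁻¹ = D₁⁻¹ ⋯ Dₘ⁻¹`. -/
def prodDinv {m : ℕ} (z : Fin m → ℂ) (w : Fin m → EuclideanSpace ℂ (Fin l)) (s : ℂ) :
    Matrix (Fin l) (Fin l) ℂ := (List.ofFn fun i => invD (z i) (w i) s).prod

lemma prodDinv_succ {m : ℕ} (z : Fin (m + 1) → ℂ) (w : Fin (m + 1) → EuclideanSpace ℂ (Fin l))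
    (s : ℂ) : prodDinv z w s =
      invD (z 0) (w 0) s * prodDinv (fun i => z i.succ) (fun i => w i.succ) s := by
  simp [prodDinv, List.ofFn_succ]

lemma prodD_mul_prodDinv {m : ℕ} {z : Fin m → ℂ} (hz : ∀ i, 0 < (z i).re)
    {w : Fin m → EuclideanSpace ℂ (Fin l)} (hw : ∀ i, ‖w i‖ = 1) {s : ℂ} (hs : 0 ≤ s.re)
    (hne : ∀ i, s ≠ z i) : prodD z w s * prodDinv z w s = 1 := by
  induction m with
  | zero => simp [prodD, prodDinv]
  | succ m ih =>
    rw [prodD_succ, prodDinv_succ, Matrix.mul_assoc, ← Matrix.mul_assoc (elemD _ _ _),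
      elemD_mul_invD (hw 0) (hne 0) (re_pos_add_star_ne (hz 0) hs), Matrix.one_mul]
    exact ih (fun i => hz _) (fun i => hw _) fun i => hne _

lemma prodDinv_unitary {m : ℕ} {z : Fin m → ℂ} (hz : ∀ i, 0 < (z i).re)
    {w : Fin m → EuclideanSpace ℂ (Fin l)} (hw : ∀ i, ‖w i‖ = 1) (ω : ℝ) :
    prodDinv z w (ω * Complex.I) * (prodDinv z w (ω * Complex.I))ᴴ = 1 := by
  have hne : ∀ i, ω * Complex.I ≠ z i := fun i h => by
    have := hz i
    rw [← h] at this
    simp at this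
  have h1 := prodD_mul_prodDinv hz hw (s := ω * Complex.I) (by simp) hne
  have h2 := prodD_unitary hz hw ω
  have h3 : prodDinv z w (ω * Complex.I) = (prodD z w (ω * Complex.I))ᴴ := by
    calc prodDinv z w (ω * Complex.I) = (prodD z w (ω * Complex.I))ᴴ *
          (prodD z w (ω * Complex.I) * prodDinv z w (ω * Complex.I)) := by
          rw [← Matrix.mul_assoc, h2, Matrix.one_mul]
      _ = _ := by rw [h1, Matrix.mul_one]
  rw [h3, Matrix.conjTranspose_conjTranspose, h2]

section PartialFractions

variable {m : ℕ}

lemma Dl_zero (z : Fin (m + 1) → ℂ) (w : Fin (m + 1) → EuclideanSpace ℂ (Fin l)) :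
    Dl z w 0 = 1 := by
  simp [Dl]

open Classical in
lemma Dl_succ (z : Fin (m + 1) → ℂ) (w : Fin (m + 1) → EuclideanSpace ℂ (Fin l)) (i : Fin m) :
    Dl z w i.succ = (if z 0 ≠ z i.succ then (elemD (z 0) (w 0) (z i.succ))⁻¹ else 1) *
      Dl (fun i => z i.succ) (fun i => w i.succ) i := by
  simp [Dl, List.ofFn_succ, Fin.succ_lt_succ_iff]

lemma Dr_succ (z : Fin (m + 1) → ℂ) (w : Fin (m + 1) → EuclideanSpace ℂ (Fin l)) (i : Fin m) :
    Dr z w i.succ = Dr (fun i => z i.succ) (fun i => w i.succ) i := by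
  simp [Dr, List.ofFn_succ, Fin.succ_lt_succ_iff]

lemma Dl_eq_one {z : Fin m → ℂ} (w : Fin m → EuclideanSpace ℂ (Fin l)) {i : Fin m}
    (h : ∀ k < i, z k = z i) : Dl z w i = 1 := by
  unfold Dl
  have : (fun k => open Classical in
      if k < i ∧ z k ≠ z i then (elemD (z k) (w k) (z i))⁻¹ else 1) =
      fun _ => (1 : Matrix (Fin l) (Fin l) ℂ) := by
    funext k
    rw [if_neg]
    rintro ⟨h1, h2⟩
    exact h2 (h k h1)
  rw [this]
  simp

/-- The product of the inverses of the factors with a zero other than `ζ`. -/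
def outerD (z : Fin m → ℂ) (w : Fin m → EuclideanSpace ℂ (Fin l)) (ζ s : ℂ) :
    Matrix (Fin l) (Fin l) ℂ :=
  open Classical in (List.ofFn fun k => if z k ≠ ζ then invD (z k) (w k) s else 1).prod

lemma outerD_succ (z : Fin (m + 1) → ℂ) (w : Fin (m + 1) → EuclideanSpace ℂ (Fin l)) (ζ s : ℂ) :
    outerD z w ζ s = (open Classical in if z 0 ≠ ζ then invD (z 0) (w 0) s else 1) *
      outerD (fun i => z i.succ) (fun i => w i.succ) ζ s := by
  simp [outerD, List.ofFn_succ]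

lemma outerD_eq_prodDinv {z : Fin m → ℂ} (w : Fin m → EuclideanSpace ℂ (Fin l)) {ζ : ℂ}
    (h : ∀ k, z k ≠ ζ) (s : ℂ) : outerD z w ζ s = prodDinv z w s := by
  simp [outerD, prodDinv, h]

lemma continuousAt_div_sub_smul (c : ℂ) {a ζ : ℂ} (h : ζ ≠ a) (A : Matrix (Fin l) (Fin l) ℂ) :
    ContinuousAt (fun s : ℂ => (c / (s - a)) • A) ζ := by
  have h1 : ContinuousAt (fun s : ℂ => c / (s - a)) ζ :=
    ContinuousAt.div continuousAt_const (by fun_prop) (sub_ne_zero.2 h)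
  exact h1.smul continuousAt_const

lemma continuousAt_outerD (z : Fin m → ℂ) (w : Fin m → EuclideanSpace ℂ (Fin l)) (ζ : ℂ) :
    ContinuousAt (outerD z w ζ) ζ := by
  induction m with
  | zero =>
    have : outerD z w ζ = fun _ => 1 := by
      funext s
      simp [outerD]
    rw [this]
    exact continuousAt_const
  | succ m ih =>
    have : outerD z w ζ = fun s => (open Classical in if z 0 ≠ ζ then invD (z 0) (w 0) s else 1) *
        outerD (fun i => z i.succ) (fun i => w i.succ) ζ s := funext fun s => outerD_succ z w ζ s
    rw [this]
    refine ContinuousAt.mul ?_ (ih _ _)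
    by_cases h : z 0 = ζ
    · simpa [h] using continuousAt_const
    · simp only [ne_eq, h, not_false_eq_true, if_true]
      unfold invD
      exact continuousAt_const.add (continuousAt_div_sub_smul _ (Ne.symm h) _)

/-- The factors with zero `ζ` stand first, so they meet `E` one after the other, and `E` annihilates
the polar part of each; they act as the identity. -/
lemma mul_prodDinv_eq_outerD {z : Fin m → ℂ} {w : Fin m → EuclideanSpace ℂ (Fin l)} {ζ s : ℂ}
    {E : Matrix (Fin l) (Fin l) ℂ} (hE : ∀ k, z k = ζ → E * lineProj (w k) = 0)
    (hblock : ∀ k, z k = ζ → ∀ j ≤ k, z j = ζ) :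
    E * prodDinv z w s = E * outerD z w ζ s := by
  induction m with
  | zero => simp [prodDinv, outerD]
  | succ m ih =>
    by_cases h : z 0 = ζ
    · rw [prodDinv_succ, outerD_succ, ← Matrix.mul_assoc, ← Matrix.mul_assoc, if_neg (by simp [h]),
        Matrix.mul_one, invD, Matrix.mul_add, Matrix.mul_one, Matrix.mul_smul, hE 0 h, smul_zero,
        add_zero]
      exact ih (fun k => hE _) fun k hk j hj => hblock _ hk _ (Fin.succ_le_succ_iff.2 hj)
    · rw [outerD_eq_prodDinv w fun k hk => h (hblock k hk 0 (Fin.zero_le _))]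

lemma lineProj_mul_eq_zero {w w' : EuclideanSpace ℂ (Fin l)}
    (h : star (w : Fin l → ℂ) ⬝ᵥ (w' : Fin l → ℂ) = 0) : lineProj w * lineProj w' = 0 := by
  have h1 : lineProj w * lineProj w' = (star (w : Fin l → ℂ) ⬝ᵥ (w' : Fin l → ℂ)) •
      vecMulVec (w : Fin l → ℂ) (star (w' : Fin l → ℂ)) := by
    rw [← Matrix.vecMulVec_smul]
    exact Matrix.vecMulVec_mul_vecMulVec _ _ _ _
  rw [h1, h, zero_smul]

lemma Dr_zero {z : Fin (m + 1) → ℂ} (hz : ∀ i, 0 < (z i).re)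
    {w : Fin (m + 1) → EuclideanSpace ℂ (Fin l)} (hw : ∀ i, ‖w i‖ = 1) :
    Dr z w 0 = outerD (fun i => z i.succ) (fun i => w i.succ) (z 0) (z 0) := by
  unfold Dr outerD
  rw [List.ofFn_succ, List.prod_cons, if_neg (by simp), one_mul]
  congr 2
  funext k
  by_cases h : z k.succ = z 0
  · simp [h]
  · rw [if_pos ⟨Fin.succ_pos k, h⟩, if_pos h,
      elemD_inv (hw _) (Ne.symm h) (re_pos_add_star_ne (hz _) (hz 0).le)]

/-- A product of two fractions with distinct poles splits into its two residues. If the poles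
coincide, then `E * X i = 0`, so that no double pole arises and the quotients by `a - z i = 0` are
multiplied by zero. -/
lemma invD_mul_partialFractions {a s : ℂ} {z : Fin m → ℂ} (ha : s ≠ a) (hs : ∀ i, s ≠ z i)
    {E : Matrix (Fin l) (Fin l) ℂ} {X : Fin m → Matrix (Fin l) (Fin l) ℂ}
    (hEX : ∀ i, z i = a → E * X i = 0) (c : ℂ) (c' : Fin m → ℂ) :
    (1 + (c / (s - a)) • E) * (1 + ∑ i, (c' i / (s - z i)) • X i) =
      1 + ((c / (s - a)) • (E + ∑ i, (c' i / (a - z i)) • (E * X i)) +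
        ∑ i, (c' i / (s - z i)) • (X i + (c / (z i - a)) • (E * X i))) := by
  have hs0 : s - a ≠ 0 := sub_ne_zero.2 ha
  have key : ∀ i, (c / (s - a)) • (c' i / (s - z i)) • (E * X i) =
      (c / (s - a)) • (c' i / (a - z i)) • (E * X i) +
        (c' i / (s - z i)) • (c / (z i - a)) • (E * X i) := fun i => by
    by_cases h : z i = a
    · simp [hEX i h]
    · have h1 : s - z i ≠ 0 := sub_ne_zero.2 (hs _)
      have h2 : a - z i ≠ 0 := sub_ne_zero.2 (Ne.symm h)
      have h3 : z i - a ≠ 0 := sub_ne_zero.2 h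
      rw [smul_smul, smul_smul, smul_smul, ← add_smul]
      congr 1
      field_simp
      ring
  have key' := Finset.sum_congr (rfl : (Finset.univ : Finset (Fin m)) = _) fun i _ => key i
  rw [Finset.sum_add_distrib] at key'
  rw [Matrix.add_mul, Matrix.one_mul, Matrix.smul_mul, Matrix.mul_add, Matrix.mul_one,
    Matrix.mul_sum, smul_add, smul_add, Finset.smul_sum, Finset.smul_sum]
  simp only [Matrix.mul_smul, smul_add, Finset.sum_add_distrib]
  rw [key']
  abel

variable {z : Fin m → ℂ} {w : Fin m → EuclideanSpace ℂ (Fin l)}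

/-- Partial fractions of `D⁻¹` when the directions of equal zeros are orthogonal. -/
lemma prodDinv_eq (hz : ∀ i, 0 < (z i).re) (hw : ∀ i, ‖w i‖ = 1)
    (hrow : ∀ i j k, i ≤ j → j ≤ k → z i = z k → z j = z i)
    (horth : ∀ i j, i ≠ j → z i = z j → star (w i : Fin l → ℂ) ⬝ᵥ (w j : Fin l → ℂ) = 0)
    {s : ℂ} (hs : ∀ i, s ≠ z i) :
    prodDinv z w s = 1 + ∑ i, (2 * ((z i).re : ℂ) / (s - z i)) •
      (Dl z w i * lineProj (w i) * Dr z w i) := by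
  induction m generalizing s with
  | zero => simp [prodDinv]
  | succ m ih =>
    set z' := fun i : Fin m => z i.succ with hz'
    set w' := fun i : Fin m => w i.succ with hw'
    have ih' : ∀ {s : ℂ}, (∀ i, s ≠ z' i) → prodDinv z' w' s = 1 + ∑ i,
        (2 * ((z' i).re : ℂ) / (s - z' i)) • (Dl z' w' i * lineProj (w' i) * Dr z' w' i) :=
      fun {s} hs => ih (fun i => hz _) (fun i => hw _)
        (fun i j k hij hjk => hrow _ _ _ (Fin.succ_le_succ_iff.2 hij) (Fin.succ_le_succ_iff.2 hjk))
        (fun i j hij => horth _ _ fun h => hij (Fin.succ_injective _ h)) hs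
    set X := fun i => Dl z' w' i * lineProj (w' i) * Dr z' w' i with hX
    set E := lineProj (w 0) with hE
    set c : ℂ := 2 * ((z 0).re : ℂ) with hc
    set c' : Fin m → ℂ := fun i => 2 * ((z' i).re : ℂ) with hc'
    have hEw : ∀ k, z' k = z 0 → E * lineProj (w' k) = 0 := fun k hk =>
      lineProj_mul_eq_zero (horth 0 k.succ (Fin.succ_ne_zero k).symm hk.symm)
    have hblock : ∀ k, z' k = z 0 → ∀ j ≤ k, z' j = z 0 := fun k hk j hj =>
      hrow 0 j.succ k.succ (Fin.zero_le _) (Fin.succ_le_succ_iff.2 hj) hk.symm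
    have hEX : ∀ k, z' k = z 0 → E * X k = 0 := fun k hk => by
      have : Dl z' w' k = 1 := Dl_eq_one w' fun j hj => (hblock k hk j hj.le).trans hk.symm
      rw [hX]
      simp only [this, Matrix.one_mul, ← Matrix.mul_assoc, hEw k hk, Matrix.zero_mul]
    -- The coefficient at the first zero contains the other inverse factors evaluated at `z 0`. It
    -- is obtained by letting `s` tend to `z 0` in the induction hypothesis multiplied by `E`, which
    -- has removed the factors singular there.
    have hDr : E * Dr z w 0 = E + ∑ i, (c' i / (z 0 - z' i)) • (E * X i) := by
      rw [Dr_zero hz hw]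
      have hlim1 : Tendsto (fun s => E * outerD z' w' (z 0) s) (𝓝[≠] (z 0))
          (𝓝 (E * outerD z' w' (z 0) (z 0))) :=
        ((continuousAt_const.mul (continuousAt_outerD z' w' (z 0))).tendsto).mono_left
          nhdsWithin_le_nhds
      have hlim2 : Tendsto (fun s => E + ∑ i, (c' i / (s - z' i)) • (E * X i)) (𝓝[≠] (z 0))
          (𝓝 (E + ∑ i, (c' i / (z 0 - z' i)) • (E * X i))) := by
        refine tendsto_const_nhds.add (tendsto_finsetSum _ fun i _ => ?_)
        by_cases h : z' i = z 0
        · simp [hEX i h]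
        · exact (continuousAt_div_sub_smul _ (Ne.symm h) _).tendsto.mono_left nhdsWithin_le_nhds
      refine tendsto_nhds_unique (hlim1.congr' ?_) hlim2
      have hne : ∀ᶠ s in 𝓝[≠] (z 0), ∀ i, s ≠ z' i := by
        rw [eventually_all]
        intro i
        by_cases h : z' i = z 0
        · rw [h]
          exact self_mem_nhdsWithin
        · exact eventually_nhdsWithin_of_eventually_nhds
            (continuousAt_id.eventually_ne (Ne.symm h))
      filter_upwards [hne] with s hs
      rw [← mul_prodDinv_eq_outerD hEw hblock, ih' hs, Matrix.mul_add, Matrix.mul_one,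
        Matrix.mul_sum]
      simp only [Matrix.mul_smul, hX, hc']
    -- At a later zero the value of the first inverse factor joins the left product `Dl`. For an
    -- equal zero that factor is omitted, and consistently its correction `E * X i` vanishes.
    have hterm : ∀ i : Fin m, Dl z w i.succ * lineProj (w i.succ) * Dr z w i.succ =
        X i + (c / (z' i - z 0)) • (E * X i) := fun i => by
      have : Dl z w i.succ * lineProj (w i.succ) * Dr z w i.succ =
          (open Classical in if z 0 ≠ z i.succ then (elemD (z 0) (w 0) (z i.succ))⁻¹ else 1) *
            X i := by
        rw [Dl_succ, Dr_succ, hX]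
        simp only [Matrix.mul_assoc]
        rfl
      rw [this]
      by_cases h : z' i = z 0
      · rw [if_neg (by simpa using h.symm), hEX i h, Matrix.one_mul, smul_zero, add_zero]
      · rw [if_pos (Ne.symm h), elemD_inv (hw 0) h
          (re_pos_add_star_ne (hz 0) (hz _).le), invD, Matrix.add_mul, Matrix.one_mul,
          Matrix.smul_mul]
    rw [prodDinv_succ, ih' fun i => hs _, Fin.sum_univ_succ, Dl_zero, Matrix.one_mul, hDr, invD]
    simp only [hterm]
    exact invD_mul_partialFractions (hs 0) (fun i => hs i.succ) hEX c c'

/-- `D(zᵢ) Dᵢˡ wᵢ = 0`. -/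
lemma prodD_mul_Dl (hz : ∀ i, 0 < (z i).re) (hw : ∀ i, ‖w i‖ = 1)
    (hrow : ∀ i j k, i ≤ j → j ≤ k → z i = z k → z j = z i)
    (horth : ∀ i j, i ≠ j → z i = z j → star (w i : Fin l → ℂ) ⬝ᵥ (w j : Fin l → ℂ) = 0)
    (i : Fin m) : prodD z w (z i) * Dl z w i * lineProj (w i) = 0 := by
  induction m with
  | zero => exact i.elim0
  | succ m ih =>
    have ih' := ih (z := fun i => z i.succ) (w := fun i => w i.succ) (fun i => hz _) (fun i => hw _)
        (fun i j k hij hjk => hrow _ _ _ (Fin.succ_le_succ_iff.2 hij) (Fin.succ_le_succ_iff.2 hjk))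
        (fun i j hij => horth _ _ fun h => hij (Fin.succ_injective _ h))
    refine Fin.cases ?_ (fun i => ?_) i
    · rw [Dl_zero, Matrix.mul_one, prodD_succ, Matrix.mul_assoc, elemD, sub_self, zero_div,
        rankOne_eq, Matrix.add_mul, Matrix.one_mul, Matrix.smul_mul, lineProj_mul_self (hw 0)]
      simp
    · rw [Dl_succ, prodD_succ]
      by_cases h : z 0 = z i.succ
      · have hD : Dl (fun i => z i.succ) (fun i => w i.succ) i = 1 := Dl_eq_one _ fun k hk =>
          (hrow 0 k.succ i.succ (Fin.zero_le _) (Fin.succ_lt_succ_iff.2 hk).le h).trans h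
        have h2 := ih' i
        rw [hD, Matrix.mul_one] at h2
        have h3 := lineProj_mul_eq_zero (horth 0 i.succ (Fin.succ_ne_zero i).symm h)
        rw [if_neg (by simpa using h), Matrix.one_mul, hD, Matrix.mul_one, Matrix.mul_assoc, elemD,
          rankOne_eq, Matrix.add_mul, Matrix.one_mul, Matrix.smul_mul, h3, smul_zero, add_zero, h2]
      · rw [if_pos h, Matrix.mul_assoc (prodD _ _ _), ← Matrix.mul_assoc (elemD _ _ _),
          elemD_inv (hw 0) (Ne.symm h) (re_pos_add_star_ne (hz 0) (hz _).le),
          elemD_mul_invD (hw 0) (Ne.symm h) (re_pos_add_star_ne (hz 0) (hz _).le), Matrix.one_mul]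
        exact ih' i

end PartialFractions

end

/-! ### Orders of vanishing and orthogonality of the directions -/

section

variable {l m : ℕ}

lemma continuousAt_evM {p q : Type*} {A : RMat p q} {s : ℂ} (hA : NoPole A s) :
    ContinuousAt (evM A) s :=
  continuousAt_pi.2 fun i => continuousAt_pi.2 fun j => (differentiableAt_ev (hA i j)).continuousAt

lemma det_prodL {z : Fin m → ℂ} {η : Fin m → EuclideanSpace ℂ (Fin l)} (hη : ∀ i, ‖η i‖ = 1)
    (s : ℂ) :
    (prodL z η s).det = ∏ i, star (z i) / z i * ((z i - s) / (star (z i) + s)) := by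
  induction m with
  | zero => simp [prodL]
  | succ m ih =>
    rw [prodL_succ, Matrix.det_mul, Fin.prod_univ_succ, elemL, det_rankOne (hη 0),
      ih fun i => hη i.succ]

/-- A simple zero of a rational function. -/
lemma tendsto_div_of_simple_zero {φ : RatFunc ℝ} {ζ : ℂ} (hp : ¬ IsPole φ ζ)
    (h1 : (φ.num.map (algebraMap ℝ ℂ)).rootMultiplicity ζ = 1) :
    ∃ a : ℂ, a ≠ 0 ∧ Tendsto (fun s => ev φ s / (s - ζ)) (𝓝[≠] ζ) (𝓝 a) := by
  have hne : φ.num.map (algebraMap ℝ ℂ) ≠ 0 := fun h => by rw [h] at h1; simp at h1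
  obtain ⟨q, hq, hq2⟩ := Polynomial.exists_eq_pow_rootMultiplicity_mul_and_not_dvd _ hne ζ
  rw [h1, pow_one] at hq
  have hqζ : q.eval ζ ≠ 0 := fun h => hq2 (Polynomial.dvd_iff_isRoot.2 h)
  refine ⟨q.eval ζ / Polynomial.aeval ζ φ.denom, div_ne_zero hqζ hp, ?_⟩
  have hc : ContinuousAt (fun s => q.eval s / Polynomial.aeval s φ.denom) ζ :=
    q.continuous.continuousAt.div (Polynomial.continuous_aeval _).continuousAt hp
  refine (hc.tendsto.mono_left nhdsWithin_le_nhds).congr' ?_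
  filter_upwards [self_mem_nhdsWithin] with s hs
  have hs' : s - ζ ≠ 0 := sub_ne_zero.2 hs
  rw [ev_eq_div, ← Polynomial.eval_map_algebraMap φ.num s, hq, Polynomial.eval_mul]
  simp only [Polynomial.eval_sub, Polynomial.eval_X, Polynomial.eval_C]
  field_simp

open Classical in
/-- The number of factors with a given zero is at most the order of vanishing. -/
lemma card_zeros_le {z : Fin m → ℂ} (hz : ∀ i, 0 < (z i).re) {ζ : ℂ} (hζ : 0 < ζ.re)
    {g h : ℂ → ℂ} (hh : ContinuousAt h ζ) {a : ℂ} (ha : a ≠ 0)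
    (hg : Tendsto (fun s => g s / (s - ζ) ^ l) (𝓝[≠] ζ) (𝓝 a))
    (hgh : ∀ s : ℂ, 0 ≤ s.re →
      g s = (∏ i, star (z i) / z i * ((z i - s) / (star (z i) + s))) * h s) :
    (∑ i, if z i = ζ then 1 else 0) ≤ l := by
  -- With `l + k + 1` factors vanishing at `ζ`, the function would still contain `(s - ζ)^(k + 1)`
  -- after division by `(s - ζ)^l`, and its limit would be `0` instead of `a`.
  by_contra hcon
  push Not at hcon
  obtain ⟨k, hk⟩ := Nat.exists_eq_add_of_lt hcon
  set c : Fin m → ℂ → ℂ := fun i s => if z i = ζ then -(star (z i) / z i) / (star (z i) + s) else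
    star (z i) / z i * ((z i - s) / (star (z i) + s)) with hc
  have hden : ∀ i, star (z i) + ζ ≠ 0 := fun i => by
    rw [add_comm]
    exact re_pos_add_star_ne (hz i) hζ.le
  have hcc : ∀ i, ContinuousAt (c i) ζ := fun i => by
    by_cases h : z i = ζ
    · simp only [hc, h, if_true]
      exact continuousAt_const.div (by fun_prop) (by simpa [h] using hden i)
    · simp only [hc, h, if_false]
      exact continuousAt_const.mul ((by fun_prop : ContinuousAt (fun s => z i - s) ζ).div
        (by fun_prop) (hden i))
  have hprod : ∀ s : ℂ, ∏ i, star (z i) / z i * ((z i - s) / (star (z i) + s)) =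
      (s - ζ) ^ (∑ i, if z i = ζ then 1 else 0) * ∏ i, c i s := fun s => by
    rw [← Finset.prod_pow_eq_pow_sum, ← Finset.prod_mul_distrib]
    refine Finset.prod_congr rfl fun i _ => ?_
    by_cases h : z i = ζ
    · simp only [hc, h, if_true, pow_one]
      ring
    · simp [hc, h]
  have hlim : Tendsto (fun s => (s - ζ) ^ (k + 1) * (∏ i, c i s) * h s) (𝓝[≠] ζ) (𝓝 0) := by
    have h1 : ContinuousAt (fun s => (s - ζ) ^ (k + 1) * (∏ i, c i s) * h s) ζ :=
      ((by fun_prop : ContinuousAt (fun s => (s - ζ) ^ (k + 1)) ζ).mul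
        (tendsto_finsetProd _ fun i _ => hcc i)).mul hh
    have h2 := h1.tendsto
    simp only [sub_self, ne_eq, Nat.add_eq_zero_iff, one_ne_zero, and_false, not_false_eq_true,
      zero_pow, zero_mul] at h2
    exact h2.mono_left nhdsWithin_le_nhds
  refine ha (tendsto_nhds_unique hg (hlim.congr' ?_))
  have hre : ∀ᶠ s in 𝓝[≠] ζ, 0 < s.re := eventually_nhdsWithin_of_eventually_nhds
    (Complex.continuous_re.continuousAt.eventually (lt_mem_nhds hζ))
  filter_upwards [hre, self_mem_nhdsWithin] with s hs hsζ
  have hs' : s - ζ ≠ 0 := sub_ne_zero.2 hsζ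
  rw [hgh s hs.le, hprod, hk]
  field_simp
  ring

namespace CoprimeLoop

variable {P F N N₀ M Nt Mt X Y Xt Yt : RMat (Fin l) (Fin l)} {φ : RatFunc ℝ}

lemma stable_φ (h : CoprimeLoop P F N N₀ M Nt Mt X Y Xt Yt φ) (i : Fin l) : Stable φ := by
  have := h.stable_F i i
  rwa [h.F_eq, Matrix.diagonal_apply_eq] at this

lemma evM_bezout (h : CoprimeLoop P F N N₀ M Nt Mt X Y Xt Yt φ) {s : ℂ} (hs : 0 ≤ s.re) :
    evM Xt s * evM M s - evM Yt s * evM N s = 1 := by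
  have h1 := congrArg (evM · s) h.bezout_right.1
  have np : ∀ {A : RMat (Fin l) (Fin l)}, RHinf A → NoPole A s := fun hA => hA.noPole hs
  rwa [evM_sub ((np h.stable_Xt).mul (np h.stable_M)) ((np h.stable_Yt).mul (np h.stable_N)),
    evM_mul (np h.stable_Xt) (np h.stable_M), evM_mul (np h.stable_Yt) (np h.stable_N),
    evM_one] at h1

lemma evM_Mt_mul_N (h : CoprimeLoop P F N N₀ M Nt Mt X Y Xt Yt φ) {s : ℂ} (hs : 0 ≤ s.re) :
    evM Mt s * evM N s = evM Nt s * evM M s := by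
  have h1 := congrArg (evM · s) (sub_eq_zero.1 h.bezout_right.2.2.1)
  have np : ∀ {A : RMat (Fin l) (Fin l)}, RHinf A → NoPole A s := fun hA => hA.noPole hs
  rwa [evM_mul (np h.stable_Mt) (np h.stable_N), evM_mul (np h.stable_Nt) (np h.stable_M)] at h1

/-- At a zero of `φ` both numerators vanish and `M` is invertible. -/
lemma zero_of_φ (h : CoprimeLoop P F N N₀ M Nt Mt X Y Xt Yt φ) (i : Fin l) {ζ : ℂ} (hζ : 0 ≤ ζ.re)
    (h0 : ev φ ζ = 0) : evM N ζ = 0 ∧ IsUnit (evM M ζ).det ∧ evM Nt ζ = 0 := by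
  have hN : evM N ζ = 0 := by
    rw [h.N_eq, evM_smul ((h.stable_φ i).not_isPole hζ) (h.stable_N₀.noPole hζ), h0, zero_smul]
  have h1 := h.evM_bezout hζ
  rw [hN, Matrix.mul_zero, sub_zero] at h1
  have hM := Matrix.isUnit_det_of_left_inverse h1
  refine ⟨hN, hM, ?_⟩
  have h2 := h.evM_Mt_mul_N hζ
  rw [hN, Matrix.mul_zero] at h2
  rw [← Matrix.mul_nonsing_inv_cancel_right _ (evM Nt ζ) hM, ← h2, Matrix.zero_mul]

/-- From `M = P⁻¹ N₀` with `P⁻¹` regular at the point, a singular `N₀` would make `M` singular. -/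
lemma isUnit_det_N₀ (h : CoprimeLoop P F N N₀ M Nt Mt X Y Xt Yt φ) {ζ : ℂ} (hζ : 0 ≤ ζ.re)
    (hM : IsUnit (evM M ζ).det) (hP : ¬ IsZeroOf P ζ) : IsUnit (evM N₀ ζ).det := by
  have hnp : NoPole P⁻¹ ζ := fun i j hij => hP ⟨i, j, hij⟩
  have h1 : M = P⁻¹ * N₀ := by
    rw [← h.right₀_mul, Matrix.nonsing_inv_mul_cancel_left _ _ h.det_P]
  rw [h1, evM_mul hnp (h.stable_N₀.noPole hζ), Matrix.det_mul] at hM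
  exact isUnit_of_mul_isUnit_right hM

/-- The directions of equal zeros are orthogonal. -/
lemma orthogonal (h : CoprimeLoop P F N N₀ M Nt Mt X Y Xt Yt φ)
    {z : Fin m → ℂ} (hz : ∀ i, 0 < (z i).re)
    (hzP : ∀ i j, i ≠ j → z i = z j → ev φ (z i) = 0)
    (hzF : ∀ s : ℂ, 0 < s.re → ev φ s = 0 →
      ((φ.num.map (algebraMap ℝ ℂ)).rootMultiplicity s = 1 ∧ ¬ IsZeroOf P s))
    (hzrow : ∀ i j k, i ≤ j → j ≤ k → z i = z k → z j = z i)
    {η : Fin m → EuclideanSpace ℂ (Fin l)} (hη : ∀ i, ‖η i‖ = 1)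
    {Nm : RMat (Fin l) (Fin l)} (hNm : MinPhase Nm)
    (hL : ∀ s : ℂ, 0 ≤ s.re → evM N s = prodL z η s * evM Nm s)
    {w : Fin m → EuclideanSpace ℂ (Fin l)} (hw : ∀ i, ‖w i‖ = 1)
    {H C : RMat (Fin l) (Fin l)} (hH : RHinf H) (hC : MinPhase C) {γ : Fin l → ℝ}
    (hD : ∀ s : ℂ, 0 ≤ s.re →
      evM (Nt * H * constM (diagonal γ)) s = evM C s * prodD z w s)
    (i j : Fin m) (hij : i ≠ j) (hzij : z i = z j) :
    star (w i : Fin l → ℂ) ⬝ᵥ (w j : Fin l → ℂ) = 0 := by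
  classical
  have hζ := hz i
  have h0 := hzP i j hij hzij
  obtain ⟨h1, hP⟩ := hzF _ hζ h0
  -- The stability of `φ` is read off a diagonal entry of `F`, so an index is needed; in dimension
  -- `0` there is no unit vector.
  have hl : ∃ _ : Fin l, True := by
    by_contra hcon
    have : IsEmpty (Fin l) := ⟨fun a => hcon ⟨a, trivial⟩⟩
    have h2 := hw i
    rw [EuclideanSpace.norm_eq] at h2
    simp at h2
  obtain ⟨a, -⟩ := hl
  have hφ := h.stable_φ a
  obtain ⟨hN, hM, hNt⟩ := h.zero_of_φ a hζ.le h0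
  have hdetC : IsUnit (evM C (z i)).det := isUnit_iff_ne_zero.2 (hC.2 _ hζ)
  have hprodD : prodD z w (z i) = 0 := by
    have h3 := hD (z i) hζ.le
    rw [evM_mul ((h.stable_Nt.noPole hζ.le).mul (hH.noPole hζ.le)) (noPole_constM _),
      evM_mul (h.stable_Nt.noPole hζ.le) (hH.noPole hζ.le), hNt, Matrix.zero_mul,
      Matrix.zero_mul] at h3
    rw [← Matrix.nonsing_inv_mul_cancel_left _ (prodD z w (z i)) hdetC, ← h3, Matrix.mul_zero]
  -- Here `det N = φ^l det N₀` vanishes to order exactly `l`: the zero of `φ` is simple and `N₀` is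
  -- invertible. Since `D` vanishes on the whole space, of dimension `l`, `prodD_kernel` applies
  -- with `V = ⊤`.
  have hcount : (∑ k, if z k = z i then 1 else 0) ≤ l := by
    obtain ⟨b, hb, hlim⟩ := tendsto_div_of_simple_zero (hφ.not_isPole hζ.le) h1
    have hN₀ : (evM N₀ (z i)).det ≠ 0 :=
      isUnit_iff_ne_zero.1 (h.isUnit_det_N₀ hζ.le hM hP)
    have hcont : ∀ {A : RMat (Fin l) (Fin l)}, RHinf A →
        ContinuousAt (fun s => (evM A s).det) (z i) := fun hA =>
      (continuous_id.matrix_det).continuousAt.comp (continuousAt_evM (hA.noPole hζ.le))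
    refine card_zeros_le hz hζ (g := fun s => (evM N s).det) (hcont hNm.1)
      (mul_ne_zero (pow_ne_zero l hb) hN₀) ?_ fun s hs => ?_
    · refine ((hlim.pow l).mul ((hcont h.stable_N₀).tendsto.mono_left nhdsWithin_le_nhds)).congr' ?_
      have hre : ∀ᶠ s in 𝓝[≠] (z i), 0 < s.re := eventually_nhdsWithin_of_eventually_nhds
        (Complex.continuous_re.continuousAt.eventually (lt_mem_nhds hζ))
      filter_upwards [hre] with s hs
      rw [h.N_eq, evM_smul (hφ.not_isPole hs.le) (h.stable_N₀.noPole hs.le), Matrix.det_smul,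
        Fintype.card_fin, div_pow]
      ring
    · rw [hL s hs, Matrix.det_mul, det_prodL hη]
  have hker := prodD_kernel hz hw hzrow hζ ⊤ (fun v _ => by rw [hprodD, Matrix.zero_mulVec])
    (by simpa using hcount)
  exact hker.1 i j hij rfl hzij.symm

end CoprimeLoop

end

section

/-! ### The scalar function `f` -/

section Scalar

variable {n : ℕ} {sz : Fin n → ℂ}

/-- `star z + s` differs from `s - z` by `2 Re z`, which is at most four times the distance assumed.
-/
lemma norm_blaschke_factor_ge {z s : ℂ} (hz : 0 < z.re) (hs0 : 0 ≤ s.re)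
    (hs : z.re / 2 ≤ ‖s - z‖) : 1 / 5 ≤ ‖star z * (z - s) / (z * (star z + s))‖ := by
  have hz0 : z ≠ 0 := by rintro rfl; simp at hz
  have h1 : ‖star z + s‖ ≤ 5 * ‖s - z‖ := by
    have : star z + s = (s - z) + 2 * (z.re : ℂ) := by rw [← star_add_self]; ring
    rw [this]
    refine (norm_add_le _ _).trans ?_
    rw [norm_mul, Complex.norm_real, Real.norm_of_nonneg hz.le]
    norm_num
    linarith
  have hne : 0 < ‖star z + s‖ := norm_pos_iff.2 (by
    rw [add_comm]
    exact re_pos_add_star_ne hz hs0)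
  rw [norm_div, norm_mul, norm_mul, norm_star, mul_div_mul_left _ _ (norm_ne_zero_iff.2 hz0),
    norm_sub_rev, le_div_iff₀ hne]
  linarith

lemma norm_blaschkeProd_axis (hsz : ∀ k, 0 < (sz k).re) (ω : ℝ) :
    ‖∏ k, star (sz k) * (sz k - ω * Complex.I) / (sz k * (star (sz k) + ω * Complex.I))‖ = 1 := by
  rw [norm_prod]
  refine Finset.prod_eq_one fun k _ => ?_
  rw [← div_mul_div_comm]
  exact norm_blaschkeL (hsz k) ω

lemma blaschkeProd_zero (hsz : ∀ k, 0 < (sz k).re) :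
    ∏ k, star (sz k) * (sz k - 0) / (sz k * (star (sz k) + 0)) = 1 := by
  refine Finset.prod_eq_one fun k _ => ?_
  have hz0 : sz k ≠ 0 := fun h => by have := hsz k; rw [h] at this; simp at this
  have hz1 : star (sz k) ≠ 0 := by simpa using hz0
  rw [sub_zero, add_zero]
  field_simp

variable {f fm : RatFunc ℝ}

/-- The factor without zeros in the open right half plane is stable. -/
lemma stable_minPhase_factor (hf : Stable f) (hsz : ∀ k, 0 < (sz k).re)
    (hnz : ∀ s : ℂ, 0 < s.re → ev fm s ≠ 0)
    (hfac : ∀ s : ℂ, 0 ≤ s.re → ev f s =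
      (∏ k, star (sz k) * (sz k - s) / (sz k * (star (sz k) + s))) * ev fm s) : Stable fm := by
  -- At a pole the value is `0` by the convention on division, so absence of zeros already excludes
  -- poles in the open half plane.
  have hnp : ∀ s : ℂ, 0 < s.re → ¬ IsPole fm s := fun s hs h => hnz s hs (by
    rw [ev_eq_div, show Polynomial.aeval s fm.denom = 0 from h, div_zero])
  obtain ⟨c, hc, hb⟩ := hf.exists_bound
  -- Division by the Blaschke product is controlled only away from its zeros. Near them `fm` is
  -- continuous, and compactness of the discs supplies the bound.
  set K : Set ℂ := ⋃ k, Metric.closedBall (sz k) ((sz k).re / 2) with hK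
  have hKc : IsCompact K := isCompact_iUnion fun k => isCompact_closedBall _ _
  have hKre : ∀ s ∈ K, 0 < s.re := fun s hs => by
    obtain ⟨k, hk⟩ := Set.mem_iUnion.1 hs
    have h1 := (Complex.abs_re_le_norm (s - sz k)).trans (by simpa [dist_eq_norm] using hk)
    rw [Complex.sub_re, abs_le] at h1
    have := hsz k
    linarith [h1.1]
  obtain ⟨c', hc'⟩ := hKc.exists_bound_of_continuousOn (f := ev fm) fun s hs =>
    (differentiableAt_ev (hnp s (hKre s hs))).continuousAt.continuousWithinAt
  refine stable_of_bound (C := max c' (5 ^ n * c)) (Eventually.of_forall fun s hs => ?_)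
  by_cases hsK : s ∈ K
  · exact (hc' s hsK).trans (le_max_left _ _)
  · refine le_trans ?_ (le_max_right _ _)
    have hge : (1 / 5 : ℝ) ^ n ≤
        ‖∏ k, star (sz k) * (sz k - s) / (sz k * (star (sz k) + s))‖ := by
      rw [norm_prod]
      calc (1 / 5 : ℝ) ^ n = ∏ _k : Fin n, (1 / 5 : ℝ) := by simp
        _ ≤ _ := Finset.prod_le_prod (fun _ _ => by norm_num) fun k _ =>
          norm_blaschke_factor_ge (hsz k) hs.le (by
            by_contra hcon
            push Not at hcon
            exact hsK (Set.mem_iUnion.2 ⟨k, by simpa [dist_eq_norm] using hcon.le⟩))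
    have h1 := hb s hs.le
    rw [hfac s hs.le, norm_mul] at h1
    have h2 : (1 / 5 : ℝ) ^ n * ‖ev fm s‖ ≤ c :=
      (mul_le_mul_of_nonneg_right hge (norm_nonneg _)).trans h1
    rw [one_div, inv_pow, inv_mul_le_iff₀ (by positivity)] at h2
    exact h2

lemma ev_minPhase_factor_zero (hsz : ∀ k, 0 < (sz k).re)
    (hfac : ∀ s : ℂ, 0 ≤ s.re → ev f s =
      (∏ k, star (sz k) * (sz k - s) / (sz k * (star (sz k) + s))) * ev fm s) :
    ev fm 0 = ev f 0 := by
  rw [hfac 0 (by simp), blaschkeProd_zero hsz, one_mul]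

lemma aeval_zero_eq (q : Polynomial ℝ) : Polynomial.aeval (0 : ℂ) q = (q.eval 0 : ℝ) := by
  have := Polynomial.aeval_algebraMap_apply (A := ℝ) ℂ (0 : ℝ) q
  simpa using this

lemma tendsto_ofReal_nhdsGT : Tendsto (fun x : ℝ => (x : ℂ)) (𝓝[>] 0) (𝓝[≠] 0) := by
  refine tendsto_nhdsWithin_iff.2 ⟨?_, ?_⟩
  · have := Complex.continuous_ofReal.tendsto 0
    exact this.mono_left nhdsWithin_le_nhds
  · filter_upwards [self_mem_nhdsWithin] with x hx
    have : (0 : ℝ) < x := hx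
    simpa using this.ne'

lemma tendsto_ev_slope {g : RatFunc ℝ} (hg : Stable g) :
    ∃ d : ℂ, Tendsto (fun x : ℝ => (x : ℂ)⁻¹ * (ev g x - ev g 0)) (𝓝[>] 0) (𝓝 d) := by
  have h := (differentiableAt_ev (hg.not_isPole (s := 0) (by simp))).hasDerivAt
  rw [hasDerivAt_iff_tendsto_slope] at h
  refine ⟨_, (h.comp tendsto_ofReal_nhdsGT).congr fun x => ?_⟩
  simp [slope_def_field, div_eq_inv_mul]

/-- Integral formula for the derivative at the origin of the minimum phase factor. -/
lemma log_integral_minPhase (hfm : Stable fm) (hnz : ∀ s : ℂ, 0 < s.re → ev fm s ≠ 0)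
    {c : ℝ} (hc : c ≠ 0) (h0 : ev fm 0 = c) :
    IntegrableOn (logIntegrand fm) (Set.Ioi 0) ∧
    Tendsto (fun x : ℝ => (x : ℂ)⁻¹ * (ev fm x - c)) (𝓝[>] 0)
      (𝓝 ((c * (2 / Real.pi) * ∫ ω in Set.Ioi (0 : ℝ), logIntegrand fm ω : ℝ))) := by
  set p := fm.num with hp
  set q := fm.denom with hq
  have hpnz : ∀ s : ℂ, 0 < s.re → Polynomial.aeval s p ≠ 0 := fun s hs h => hnz s hs (by
    rw [ev_eq_div, ← hp, h, zero_div])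
  have hqnz : ∀ s : ℂ, 0 ≤ s.re → Polynomial.aeval s q ≠ 0 := fun s hs => hfm.2 s hs
  have hq0 : q.eval 0 ≠ 0 := fun h => hqnz 0 (by simp) (by rw [aeval_zero_eq, h]; simp)
  have hp0 : p.eval 0 ≠ 0 := fun h => hc (by
    have h1 := h0
    rw [ev_eq_div, ← hp, aeval_zero_eq, h] at h1
    simpa using h1.symm)
  have hcpq : c = p.eval 0 / q.eval 0 := by
    have h1 := h0
    rw [ev_eq_div, ← hp, ← hq, aeval_zero_eq, aeval_zero_eq] at h1
    exact_mod_cast h1.symm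
  obtain ⟨ip, ep⟩ := log_integral_poly hp0 hpnz
  obtain ⟨iq, eq⟩ := log_integral_poly hq0 fun s hs => hqnz s hs.le
  have hpne : p ≠ 0 := fun h => hp0 (by rw [h]; simp)
  have hae : logIntegrand fm =ᵐ[volume.restrict (Set.Ioi 0)] fun ω : ℝ =>
      Real.log ‖Polynomial.aeval ((ω : ℂ) * Complex.I) p / Polynomial.aeval (0 : ℂ) p‖ / ω ^ 2 -
      Real.log ‖Polynomial.aeval ((ω : ℂ) * Complex.I) q / Polynomial.aeval (0 : ℂ) q‖ / ω ^ 2 := by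
    refine ae_restrict_of_ae ?_
    filter_upwards [ae_of_cofinite (eventually_aeval_ne_zero hpne)] with ω hω
    have hp0' : Polynomial.aeval (0 : ℂ) p ≠ 0 := by rw [aeval_zero_eq]; exact_mod_cast hp0
    have hq0' := hqnz 0 (by simp)
    have hqω := hqnz (ω * Complex.I) (by simp)
    rw [logIntegrand, ← sub_div, ← Real.log_div (norm_ne_zero_iff.2 (div_ne_zero hω hp0'))
      (norm_ne_zero_iff.2 (div_ne_zero hqω hq0')), ← norm_div, ev_eq_div, ev_eq_div, ← hp, ← hq]
    congr 3
    field_simp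
  refine ⟨(ip.sub iq).congr hae.symm, ?_⟩
  -- Each of the two logarithmic integrals is `π / 2` times a logarithmic derivative at `0`; their
  -- difference is `π / 2` times that of `fm`.
  rw [integral_congr_ae hae, integral_sub ip iq, ep, eq]
  have hd : HasDerivAt (ev fm) ((Polynomial.aeval (0 : ℂ) p.derivative *
      Polynomial.aeval (0 : ℂ) q - Polynomial.aeval (0 : ℂ) p *
      Polynomial.aeval (0 : ℂ) q.derivative) / Polynomial.aeval (0 : ℂ) q ^ 2) 0 :=
    (p.hasDerivAt_aeval (0 : ℂ)).div (q.hasDerivAt_aeval (0 : ℂ)) (hqnz 0 (by simp))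
  rw [hasDerivAt_iff_tendsto_slope] at hd
  have hv : (Polynomial.aeval (0 : ℂ) p.derivative *
      Polynomial.aeval (0 : ℂ) q - Polynomial.aeval (0 : ℂ) p *
      Polynomial.aeval (0 : ℂ) q.derivative) / Polynomial.aeval (0 : ℂ) q ^ 2 =
      ((c * (2 / Real.pi) * (Real.pi / 2 * (p.derivative.eval 0 / p.eval 0) -
        Real.pi / 2 * (q.derivative.eval 0 / q.eval 0)) : ℝ) : ℂ) := by
    simp only [aeval_zero_eq]
    norm_cast
    rw [hcpq]
    have := Real.pi_ne_zero
    field_simp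
  rw [hv] at hd
  refine (hd.comp tendsto_ofReal_nhdsGT).congr fun x => ?_
  simp [slope_def_field, div_eq_inv_mul, h0]

/-- The derivative at the origin of `f` through its zeros and its logarithmic integral. -/
lemma tendsto_slope_logTerm (hf : Stable f) (hsz : ∀ k, 0 < (sz k).re)
    (hnz : ∀ s : ℂ, 0 < s.re → ev fm s ≠ 0)
    (hfac : ∀ s : ℂ, 0 ≤ s.re → ev f s =
      (∏ k, star (sz k) * (sz k - s) / (sz k * (star (sz k) + s))) * ev fm s)
    {c : ℝ} (hc : c ≠ 0) (h0 : ev f 0 = c) :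
    IntegrableOn (logIntegrand f) (Set.Ioi 0) ∧
    Tendsto (fun x : ℝ => (x : ℂ)⁻¹ * (ev f x - c)) (𝓝[>] 0)
      (𝓝 ((-2 * (c * logTerm f sz) : ℝ))) := by
  have hfm := stable_minPhase_factor hf hsz hnz hfac
  have hfm0 := ev_minPhase_factor_zero hsz hfac
  obtain ⟨h1, h2⟩ := log_integral_minPhase hfm hnz hc (hfm0.trans h0)
  -- The Blaschke product has modulus one on the axis and value one at `0`, so it is invisible in
  -- the integral; it enters only through its derivative at the origin.
  have heq : logIntegrand f = logIntegrand fm := by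
    funext ω
    rw [logIntegrand, logIntegrand, hfac _ (by simp), hfm0, mul_div_assoc, norm_mul,
      norm_blaschkeProd_axis hsz, one_mul]
  refine ⟨by rwa [heq], ?_⟩
  have h3 := (tendsto_blaschkeProd_slope hsz).comp tendsto_ofReal_nhdsGT
  have h4 : Tendsto (fun x : ℝ => ev fm x) (𝓝[>] 0) (𝓝 (c : ℂ)) := by
    have := (differentiableAt_ev (hfm.not_isPole (s := 0) (by simp))).continuousAt.tendsto
    rw [hfm0, h0] at this
    exact this.comp (tendsto_ofReal_nhdsGT.mono_right nhdsWithin_le_nhds)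
  have h5 := (h3.mul h4).add h2
  have hval : (-2 * (∑ k, (sz k).re / ‖sz k‖ ^ 2 : ℝ) : ℂ) * c +
      ((c * (2 / Real.pi) * ∫ ω in Set.Ioi (0 : ℝ), logIntegrand fm ω : ℝ) : ℂ) =
      ((-2 * (c * logTerm f sz) : ℝ) : ℂ) := by
    rw [logTerm, heq]
    push_cast
    ring
  rw [hval] at h5
  refine h5.congr' ?_
  filter_upwards [self_mem_nhdsWithin] with x hx
  rw [hfac x (by simpa using (show (0 : ℝ) < x from hx).le)]
  simp only [Function.comp_apply]
  ring

end Scalar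

end

section

variable {l m : ℕ}

/-! ### Squared Frobenius norm -/

/-- The squared Frobenius norm. -/
def nsq {p q : Type*} [Fintype p] [Fintype q] (A : Matrix p q ℂ) : ℝ := ∑ i, ∑ j, ‖A i j‖ ^ 2

lemma nsq_nonneg {p q : Type*} [Fintype p] [Fintype q] (A : Matrix p q ℂ) : 0 ≤ nsq A := by
  unfold nsq
  positivity

lemma nsq_eq_trace {p q : Type*} [Fintype p] [Fintype q] (A : Matrix p q ℂ) :
    (nsq A : ℂ) = (Aᴴ * A).trace := by
  simp only [nsq, Matrix.trace, Matrix.diag, Matrix.mul_apply, Matrix.conjTranspose_apply]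
  push_cast
  rw [Finset.sum_comm]
  refine Finset.sum_congr rfl fun i _ => Finset.sum_congr rfl fun j _ => ?_
  rw [Complex.star_def, Complex.conj_mul']

lemma nsq_conjTranspose {p q : Type*} [Fintype p] [Fintype q] (A : Matrix p q ℂ) :
    nsq Aᴴ = nsq A := by
  simp only [nsq, Matrix.conjTranspose_apply, norm_star]
  rw [Finset.sum_comm]

lemma nsq_unitary_mul {p q r : Type*} [Fintype p] [Fintype q] [Fintype r] [DecidableEq q]
    {U : Matrix r q ℂ} (hU : Uᴴ * U = 1) (A : Matrix q p ℂ) : nsq (U * A) = nsq A := by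
  have h : (nsq (U * A) : ℂ) = nsq A := by
    rw [nsq_eq_trace, nsq_eq_trace, Matrix.conjTranspose_mul, Matrix.mul_assoc,
      ← Matrix.mul_assoc Uᴴ, hU, Matrix.one_mul]
  exact_mod_cast h

lemma nsq_mul_unitary {p q : Type*} [Fintype p] [Fintype q] [DecidableEq q]
    {U : Matrix q q ℂ} (hU : U * Uᴴ = 1) (A : Matrix p q ℂ) : nsq (A * U) = nsq A := by
  rw [← nsq_conjTranspose, Matrix.conjTranspose_mul,
    nsq_unitary_mul (by rwa [Matrix.conjTranspose_conjTranspose]), nsq_conjTranspose]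

/-- The complex diagonal matrix of real entries. -/
abbrev cdiag (σ : Fin l → ℝ) : Matrix (Fin l) (Fin l) ℂ := diagonal fun i => (σ i : ℂ)

lemma cdiag_conjTranspose (σ : Fin l → ℝ) : (cdiag σ)ᴴ = cdiag σ := by
  ext i j
  by_cases h : i = j
  · subst h
    simp
  · simp [h, Ne.symm h]

lemma evM_constM_diagonal (σ : Fin l → ℝ) (s : ℂ) : evM (constM (diagonal σ)) s = cdiag σ := by
  rw [evM_constM]
  ext i j
  by_cases h : i = j
  · subst h
    simp
  · simp [h]

lemma nsq_mul_cdiag (A : Matrix (Fin l) (Fin l) ℂ) (σ : Fin l → ℝ) :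
    nsq (A * cdiag σ) = ∑ i, ∑ j, σ j ^ 2 * ‖A i j‖ ^ 2 := by
  unfold nsq
  refine Finset.sum_congr rfl fun i _ => Finset.sum_congr rfl fun j _ => ?_
  rw [Matrix.mul_diagonal, norm_mul, mul_pow, Complex.norm_real, Real.norm_eq_abs, sq_abs,
    mul_comm]

/-! ### The frequency-domain cost as an integral -/

lemma lintegral_ofReal_sum {g : Fin l → Fin l → ℝ → ℝ} (hg : ∀ i j, Measurable (g i j))
    (h0 : ∀ i j ω, 0 ≤ g i j ω) :
    ∫⁻ ω, ENNReal.ofReal (∑ i, ∑ j, g i j ω) = ∑ i, ∑ j, ∫⁻ ω, ENNReal.ofReal (g i j ω) := by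
  have h : ∀ ω, ENNReal.ofReal (∑ i, ∑ j, g i j ω) = ∑ i, ∑ j, ENNReal.ofReal (g i j ω) :=
    fun ω => by
    rw [ENNReal.ofReal_sum_of_nonneg fun i _ => Finset.sum_nonneg fun j _ => h0 i j ω]
    exact Finset.sum_congr rfl fun i _ => ENNReal.ofReal_sum_of_nonneg fun j _ => h0 i j ω
  simp only [h]
  rw [lintegral_finsetSum _ fun i _ => Finset.measurable_sum _ fun j _ => (hg i j).ennreal_ofReal]
  exact Finset.sum_congr rfl fun i _ => lintegral_finsetSum _ fun j _ => (hg i j).ennreal_ofReal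

lemma measurable_ev_axis (g : RatFunc ℝ) : Measurable fun ω : ℝ => ev g (ω * Complex.I) :=
  (measurable_ev g).comp (by fun_prop)

/-- The frequency density of the tracking part of the cost. -/
def trackDensity (ε : ℝ) (σ : Fin l → ℝ) (Tr Tr' : RMat (Fin l) (Fin l)) (ω : ℝ) : ℝ :=
  ((1 - ε) * nsq ((1 - evM Tr (ω * Complex.I)) * cdiag σ) +
    ε * nsq (evM Tr' (ω * Complex.I) * cdiag σ)) / ω ^ 2

/-- The frequency density of the noise part of the cost. -/
def noiseDensity (ε : ℝ) (γ : Fin l → ℝ) (Tn Tn' : RMat (Fin l) (Fin l)) (ω : ℝ) : ℝ :=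
  (1 - ε) * nsq (evM Tn (ω * Complex.I) * cdiag γ) +
    ε * nsq (evM Tn' (ω * Complex.I) * cdiag γ)

lemma freqCost_eq {ε : ℝ} (hε₀ : 0 ≤ ε) (hε₁ : ε ≤ 1) (σ γ : Fin l → ℝ)
    {Tr Tn Tr' Tn' : RMat (Fin l) (Fin l)} (hTr : RHinf Tr) (hTr' : RHinf Tr') :
    freqCost ε σ γ Tr Tn Tr' Tn' = (∫⁻ ω, ENNReal.ofReal (trackDensity ε σ Tr Tr' ω)) +
      ∫⁻ ω, ENNReal.ofReal (noiseDensity ε γ Tn Tn' ω) := by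
  have hε : 0 ≤ 1 - ε := by linarith
  have hX : ∀ (c x : ℝ), 0 ≤ c → ∀ g : RatFunc ℝ, Stable g →
      ENNReal.ofReal (c * x ^ 2) * (∫⁻ ω : ℝ, ‖ev (g / RatFunc.X) (ω * Complex.I)‖ₑ ^ 2) =
      ∫⁻ ω : ℝ, ENNReal.ofReal (c * x ^ 2 * ‖ev g (ω * Complex.I)‖ ^ 2 / ω ^ 2) :=
    fun c x hc g hg => by
    rw [← lintegral_const_mul _ ((measurable_ev_axis _).enorm.pow_const 2)]
    refine lintegral_congr_ae ?_
    filter_upwards [Measure.ae_ne volume (0 : ℝ)] with ω hω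
    rw [ev_div_X_of_ne (hg.not_isPole (by simp)) (by simpa using hω), mul_div_assoc,
      ENNReal.ofReal_mul (p := c * x ^ 2) (by positivity), ← ofReal_norm, ← ENNReal.ofReal_pow (norm_nonneg _),
      norm_div, norm_axis, div_pow, sq_abs]
  have hY : ∀ (c x : ℝ), 0 ≤ c → ∀ g : RatFunc ℝ,
      ENNReal.ofReal (c * x ^ 2) * (∫⁻ ω : ℝ, ‖ev g (ω * Complex.I)‖ₑ ^ 2) =
      ∫⁻ ω : ℝ, ENNReal.ofReal (c * x ^ 2 * ‖ev g (ω * Complex.I)‖ ^ 2) :=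
    fun c x hc g => by
    rw [← lintegral_const_mul _ ((measurable_ev_axis _).enorm.pow_const 2)]
    refine lintegral_congr fun ω => ?_
    rw [ENNReal.ofReal_mul (p := c * x ^ 2) (by positivity), ← ofReal_norm, ← ENNReal.ofReal_pow (norm_nonneg _)]
  have hmX : ∀ (c : ℝ) (g : RatFunc ℝ), Measurable fun ω : ℝ =>
      c * ‖ev g (ω * Complex.I)‖ ^ 2 / ω ^ 2 := fun c g =>
    (((measurable_ev_axis g).norm.pow_const 2).const_mul c).div (by fun_prop)
  have hmY : ∀ (c : ℝ) (g : RatFunc ℝ), Measurable fun ω : ℝ =>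
      c * ‖ev g (ω * Complex.I)‖ ^ 2 := fun c g =>
    (((measurable_ev_axis g).norm.pow_const 2).const_mul c)
  have e1 : ∀ ω, trackDensity ε σ Tr Tr' ω = ∑ i, ∑ j,
      ((1 - ε) * σ j ^ 2 * ‖ev ((1 - Tr) i j) (ω * Complex.I)‖ ^ 2 / ω ^ 2 +
        ε * σ j ^ 2 * ‖ev (Tr' i j) (ω * Complex.I)‖ ^ 2 / ω ^ 2) := fun ω => by
    have : 1 - evM Tr (ω * Complex.I) = evM (1 - Tr) (ω * Complex.I) := by
      rw [evM_sub (rHinf_one.noPole (by simp)) (hTr.noPole (by simp)), evM_one]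
    rw [trackDensity, this, nsq_mul_cdiag, nsq_mul_cdiag]
    simp only [Finset.mul_sum, Finset.sum_div, ← Finset.sum_add_distrib, evM_apply]
    refine Finset.sum_congr rfl fun i _ => Finset.sum_congr rfl fun j _ => ?_
    ring
  have e2 : ∀ ω, noiseDensity ε γ Tn Tn' ω = ∑ i, ∑ j,
      ((1 - ε) * γ j ^ 2 * ‖ev (Tn i j) (ω * Complex.I)‖ ^ 2 +
        ε * γ j ^ 2 * ‖ev (Tn' i j) (ω * Complex.I)‖ ^ 2) := fun ω => by
    rw [noiseDensity, nsq_mul_cdiag, nsq_mul_cdiag]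
    simp only [Finset.mul_sum, ← Finset.sum_add_distrib, evM_apply]
    refine Finset.sum_congr rfl fun i _ => Finset.sum_congr rfl fun j _ => ?_
    ring
  simp only [e1, e2]
  rw [lintegral_ofReal_sum (g := fun i j ω =>
      (1 - ε) * σ j ^ 2 * ‖ev ((1 - Tr) i j) (ω * Complex.I)‖ ^ 2 / ω ^ 2 +
        ε * σ j ^ 2 * ‖ev (Tr' i j) (ω * Complex.I)‖ ^ 2 / ω ^ 2)
      (fun i j => (hmX _ _).add (hmX _ _)) (fun i j ω => by positivity),
    lintegral_ofReal_sum (g := fun i j ω =>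
      (1 - ε) * γ j ^ 2 * ‖ev (Tn i j) (ω * Complex.I)‖ ^ 2 +
        ε * γ j ^ 2 * ‖ev (Tn' i j) (ω * Complex.I)‖ ^ 2)
      (fun i j => (hmY _ _).add (hmY _ _)) (fun i j ω => by positivity), freqCost,
    ← Finset.sum_add_distrib]
  refine Finset.sum_congr rfl fun i _ => ?_
  rw [← Finset.sum_add_distrib]
  refine Finset.sum_congr rfl fun j _ => ?_
  rw [hX _ _ hε _ ((rHinf_one.sub hTr) i j), hX _ _ hε₀ _ (hTr' i j), hY _ _ hε, hY _ _ hε₀]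
  have s1 : ∀ ω : ℝ, ENNReal.ofReal
      ((1 - ε) * σ j ^ 2 * ‖ev ((1 - Tr) i j) (ω * Complex.I)‖ ^ 2 / ω ^ 2 +
        ε * σ j ^ 2 * ‖ev (Tr' i j) (ω * Complex.I)‖ ^ 2 / ω ^ 2) = ENNReal.ofReal
      ((1 - ε) * σ j ^ 2 * ‖ev ((1 - Tr) i j) (ω * Complex.I)‖ ^ 2 / ω ^ 2) + ENNReal.ofReal
        (ε * σ j ^ 2 * ‖ev (Tr' i j) (ω * Complex.I)‖ ^ 2 / ω ^ 2) := fun ω =>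
    ENNReal.ofReal_add (by positivity) (by positivity)
  have s2 : ∀ ω : ℝ, ENNReal.ofReal
      ((1 - ε) * γ j ^ 2 * ‖ev (Tn i j) (ω * Complex.I)‖ ^ 2 +
        ε * γ j ^ 2 * ‖ev (Tn' i j) (ω * Complex.I)‖ ^ 2) = ENNReal.ofReal
      ((1 - ε) * γ j ^ 2 * ‖ev (Tn i j) (ω * Complex.I)‖ ^ 2) + ENNReal.ofReal
        (ε * γ j ^ 2 * ‖ev (Tn' i j) (ω * Complex.I)‖ ^ 2) := fun ω =>
    ENNReal.ofReal_add (by positivity) (by positivity)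
  simp only [s1, s2]
  rw [lintegral_add_left (hmX _ _).ennreal_ofReal, lintegral_add_left (hmY _ _).ennreal_ofReal]
  abel

end

section

variable {l m : ℕ}

/-! ### The tracking part of the cost -/

lemma ev_trace {A : RMat (Fin l) (Fin l)} {s : ℂ} (hA : NoPole A s) :
    ev A.trace s = (evM A s).trace :=
  ev_sum _ fun i _ => hA i i

lemma RHinf.trace {A : RMat (Fin l) (Fin l)} (hA : RHinf A) : Stable A.trace :=
  stable_sum _ fun i _ => hA i i

/-- Completion of squares. -/
lemma tracking_identity {e : ℝ} {U N Q G Θ Ψ : Matrix (Fin l) (Fin l) ℂ} (hU : Uᴴ = U)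
    (hspec : ((1 - e : ℝ) : ℂ) • (Nᴴ * N) + (e : ℂ) • (Gᴴ * G) = Θᴴ * Θ)
    (hΨ : Ψ * Ψᴴ = ((1 - e : ℝ) : ℂ) • 1) :
    (1 - e) * nsq ((1 - N * Q) * U) + e * nsq (G * Q * U) =
      nsq ((Ψᴴ - Θ * Q) * U) -
        2 * ((U * ((((1 - e : ℝ) : ℂ) • N - Ψ * Θ) * Q) * U).trace).re := by
  -- The identity holds for any `Ψ` with `Ψ Ψᴴ = (1 - e) I`; it is used with a constant `Ψ`, the
  -- value at the origin, which makes the cross term the boundary value of a stable function.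
  set W := Q * U with hW
  set K := U * ((((1 - e : ℝ) : ℂ) • N - Ψ * Θ) * Q) * U with hK
  have hK' : K = ((1 - e : ℝ) : ℂ) • (U * N * W) - U * Ψ * Θ * W := by
    rw [hK, hW, Matrix.sub_mul, Matrix.mul_sub, Matrix.sub_mul]
    simp only [Matrix.smul_mul, Matrix.mul_smul, Matrix.mul_assoc]
  have hKH : Kᴴ = ((1 - e : ℝ) : ℂ) • (Wᴴ * Nᴴ * U) - Wᴴ * Θᴴ * Ψᴴ * U := by
    rw [hK']
    simp only [Matrix.conjTranspose_sub, Matrix.conjTranspose_smul, Matrix.conjTranspose_mul, hU,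
      Matrix.mul_assoc, Complex.star_def, Complex.conj_ofReal]
  have h1 : ((1 - e : ℝ) : ℂ) • (((1 - N * Q) * U)ᴴ * ((1 - N * Q) * U)) +
      (e : ℂ) • ((G * Q * U)ᴴ * (G * Q * U)) =
      ((Ψᴴ - Θ * Q) * U)ᴴ * ((Ψᴴ - Θ * Q) * U) - K - Kᴴ := by
    have a1 : (1 - N * Q) * U = U - N * W := by rw [Matrix.sub_mul, Matrix.one_mul, Matrix.mul_assoc]
    have a2 : G * Q * U = G * W := by rw [Matrix.mul_assoc]
    have a3 : (Ψᴴ - Θ * Q) * U = Ψᴴ * U - Θ * W := by rw [Matrix.sub_mul, Matrix.mul_assoc Θ]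
    have b1 : (U - N * W)ᴴ * (U - N * W) = U * U - U * N * W - Wᴴ * Nᴴ * U + Wᴴ * (Nᴴ * N) * W := by
      rw [Matrix.conjTranspose_sub, Matrix.conjTranspose_mul, hU]
      noncomm_ring
    have b2 : (G * W)ᴴ * (G * W) = Wᴴ * (Gᴴ * G) * W := by
      rw [Matrix.conjTranspose_mul]
      noncomm_ring
    have b3 : (Ψᴴ * U - Θ * W)ᴴ * (Ψᴴ * U - Θ * W) =
        U * (Ψ * Ψᴴ) * U - U * Ψ * Θ * W - Wᴴ * Θᴴ * Ψᴴ * U + Wᴴ * (Θᴴ * Θ) * W := by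
      rw [Matrix.conjTranspose_sub, Matrix.conjTranspose_mul, Matrix.conjTranspose_mul, hU,
        Matrix.conjTranspose_conjTranspose]
      noncomm_ring
    rw [a1, a2, a3, b1, b2, b3, hKH, hK', ← hspec, hΨ]
    simp only [Matrix.mul_add, Matrix.add_mul, Matrix.mul_smul, Matrix.smul_mul, Matrix.mul_one,
      smul_add, smul_sub]
    abel
  have h2 := congrArg Matrix.trace h1
  simp only [Matrix.trace_add, Matrix.trace_sub, Matrix.trace_smul, ← nsq_eq_trace,
    Matrix.trace_conjTranspose, smul_eq_mul] at h2
  have h3 := congrArg Complex.re h2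
  rw [← Complex.ofReal_mul, ← Complex.ofReal_mul] at h3
  simp only [Complex.add_re, Complex.sub_re, Complex.ofReal_re, Complex.star_def,
    Complex.conj_re] at h3
  linarith

/-- The factors that enter the tracking part of the cost: `Ψ` is the (scaled) upper block of
the inner factor and `Θ` the outer factor. -/
structure TrackingFactors (ε : ℝ) (z : Fin m → ℂ) (η : Fin m → EuclideanSpace ℂ (Fin l))
    (N G Nm Θ Ψ : RMat (Fin l) (Fin l)) : Prop where
  lt_one : ε < 1
  nonneg : 0 ≤ ε
  re_pos : ∀ i, 0 < (z i).re
  unit : ∀ i, ‖η i‖ = 1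
  stable_N : RHinf N
  stable_G : RHinf G
  stable_Nm : RHinf Nm
  stable_Ψ : RHinf Ψ
  minPhase : MinPhase Θ
  allpass : ∀ s : ℂ, 0 ≤ s.re → evM N s = prodL z η s * evM Nm s
  spectral : ∀ ω : ℝ, ((1 - ε : ℝ) : ℂ) • ((evM N (ω * Complex.I))ᴴ * evM N (ω * Complex.I)) +
    (ε : ℂ) • ((evM G (ω * Complex.I))ᴴ * evM G (ω * Complex.I)) =
    (evM Θ (ω * Complex.I))ᴴ * evM Θ (ω * Complex.I)
  factor : ∀ s : ℂ, 0 ≤ s.re → ((1 - ε : ℝ) : ℂ) • evM Nm s = evM Ψ s * evM Θ s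
  orth : evM Ψ 0 * (evM Ψ 0)ᴴ = ((1 - ε : ℝ) : ℂ) • 1
  det_zero : IsUnit (evM Θ 0).det

lemma tendsto_evM_nhdsGT {A : RMat (Fin l) (Fin l)} (hA : RHinf A) :
    Tendsto (fun x : ℝ => evM A x) (𝓝[>] 0) (𝓝 (evM A 0)) :=
  (continuousAt_evM (hA.noPole (by simp))).tendsto.comp
    (tendsto_ofReal_nhdsGT.mono_right nhdsWithin_le_nhds)

lemma tendsto_evM_slope {A : RMat (Fin l) (Fin l)} (hA : RHinf A) :
    ∃ D : Matrix (Fin l) (Fin l) ℂ,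
      Tendsto (fun x : ℝ => (x : ℂ)⁻¹ • (evM A x - evM A 0)) (𝓝[>] 0) (𝓝 D) := by
  choose D hD using fun i j => tendsto_ev_slope (hA i j)
  exact ⟨Matrix.of D, tendsto_pi_nhds.2 fun i => tendsto_pi_nhds.2 fun j => hD i j⟩

lemma cosAngle_single {η : EuclideanSpace ℂ (Fin l)} (hη : ‖η‖ = 1) (j : Fin l) :
    cosAngle η (EuclideanSpace.single j (1 : ℂ)) = ‖η j‖ := by
  simp [cosAngle, hη, EuclideanSpace.inner_single_right]

lemma trace_cdiag_lineProj {η : EuclideanSpace ℂ (Fin l)} (hη : ‖η‖ = 1) (σ : Fin l → ℝ) :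
    (cdiag σ * lineProj η * cdiag σ).trace =
      ((∑ j, σ j ^ 2 * cosAngle η (EuclideanSpace.single j (1 : ℂ)) ^ 2 : ℝ) : ℂ) := by
  simp only [Matrix.trace, Matrix.diag, Matrix.mul_diagonal, Matrix.diagonal_mul, lineProj,
    vecMulVec_apply, cosAngle_single hη]
  push_cast
  refine Finset.sum_congr rfl fun j _ => ?_
  rw [← Complex.mul_conj', ← Complex.star_def]
  ring

/-- Finite energy forces the value at the origin to vanish. -/
lemma ev_zero_of_lintegral {g : RatFunc ℝ} (hg : Stable g)
    (h : ∫⁻ ω : ℝ, ENNReal.ofReal (‖ev g (ω * Complex.I)‖ ^ 2 / ω ^ 2) ≠ ⊤) : ev g 0 = 0 := by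
  by_contra h0
  have hm : Measurable fun ω : ℝ => ‖ev g (ω * Complex.I)‖ ^ 2 / ω ^ 2 :=
    ((measurable_ev_axis g).norm.pow_const 2).div (by fun_prop)
  have hint : Integrable fun ω : ℝ => ‖ev g (ω * Complex.I)‖ ^ 2 / ω ^ 2 :=
    (lintegral_ofReal_ne_top_iff_integrable hm.aestronglyMeasurable
      (Eventually.of_forall fun ω => by positivity)).1 h
  set c := ‖ev g 0‖ ^ 2 / 2 with hc
  have hc0 : 0 < c := by
    have := norm_pos_iff.2 h0
    positivity
  have hcont : ContinuousAt (fun ω : ℝ => ‖ev g (ω * Complex.I)‖ ^ 2) 0 := by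
    have h1 : ContinuousAt (ev g) (((0 : ℝ) : ℂ) * Complex.I) :=
      (differentiableAt_ev (hg.not_isPole (by simp))).continuousAt
    have h2 : ContinuousAt (fun ω : ℝ => (ω : ℂ) * Complex.I) 0 := by fun_prop
    exact (ContinuousAt.comp (f := fun ω : ℝ => (ω : ℂ) * Complex.I) h1 h2).norm.pow 2
  have hev : ∀ᶠ ω : ℝ in 𝓝 0, c < ‖ev g (ω * Complex.I)‖ ^ 2 := by
    refine hcont.eventually (lt_mem_nhds ?_)
    simp only [Complex.ofReal_zero, zero_mul]
    rw [hc]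
    have := norm_pos_iff.2 h0
    have h3 : 0 < ‖ev g 0‖ ^ 2 := by positivity
    linarith
  obtain ⟨r, hr, hball⟩ := Metric.eventually_nhds_iff.1 hev
  set b := min (r / 2) 1 with hb
  have hb0 : 0 < b := by positivity
  -- Near the origin the integrand exceeds a constant times `ω⁻²`, which on `(0, 1]` dominates
  -- `ω⁻¹`; the latter is not integrable there.
  have hbad : IntegrableOn (fun ω : ℝ => ω⁻¹) (Set.Ioc 0 b) := by
    refine ((hint.integrableOn (s := Set.Ioc 0 b)).const_mul c⁻¹).mono'
      (by fun_prop) ?_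
    rw [ae_restrict_iff' measurableSet_Ioc]
    refine Eventually.of_forall fun ω hω => ?_
    have hω0 : 0 < ω := hω.1
    have h1 : c < ‖ev g (ω * Complex.I)‖ ^ 2 := hball (by
      rw [Real.dist_eq, sub_zero, abs_of_pos hω0]
      have := hω.2.trans (min_le_left _ _)
      linarith)
    have hω1 : ω ≤ 1 := hω.2.trans (min_le_right _ _)
    rw [Real.norm_of_nonneg (by positivity)]
    calc ω⁻¹ ≤ c⁻¹ * (c / ω ^ 2) := by
          field_simp
          exact hω1
      _ ≤ _ := by gcongr
  have := (intervalIntegrable_iff_integrableOn_Ioc_of_le hb0.le).2 hbad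
  rw [intervalIntegrable_inv_iff] at this
  rcases this with h1 | h1
  · exact hb0.ne h1
  · exact h1 (by simp)

namespace TrackingFactors

variable {ε : ℝ} {z : Fin m → ℂ} {η : Fin m → EuclideanSpace ℂ (Fin l)}
  {N G Nm Θ Ψ : RMat (Fin l) (Fin l)}

lemma N_zero (h : TrackingFactors ε z η N G Nm Θ Ψ) : evM N 0 = evM Nm 0 := by
  rw [h.allpass 0 (by simp), prodL_zero h.re_pos, Matrix.one_mul]

lemma orth' (h : TrackingFactors ε z η N G Nm Θ Ψ) :
    (evM Ψ 0)ᴴ * evM Ψ 0 = ((1 - ε : ℝ) : ℂ) • 1 := by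
  have hε : ((1 - ε : ℝ) : ℂ) ≠ 0 := by
    have := h.lt_one
    exact_mod_cast (by linarith : (1 - ε : ℝ) ≠ 0)
  have h1 : evM Ψ 0 * (((1 - ε : ℝ) : ℂ)⁻¹ • (evM Ψ 0)ᴴ) = 1 := by
    rw [Matrix.mul_smul, h.orth, smul_smul, inv_mul_cancel₀ hε, one_smul]
  have h2 := mul_eq_one_comm.1 h1
  rw [Matrix.smul_mul] at h2
  rw [← h2, smul_smul, mul_inv_cancel₀ hε, one_smul]

/-- `Ψ(0)` is a multiple of a unitary matrix and `(1 - ε) N(0) = Ψ(0) Θ(0)`. Exact tracking at zero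
frequency is thus the condition under which the completed square vanishes at the origin. -/
lemma outer_mul_zero (h : TrackingFactors ε z η N G Nm Θ Ψ) {A U : Matrix (Fin l) (Fin l) ℂ}
    (h0 : evM N 0 * A * U = U) : evM Θ 0 * A * U = (evM Ψ 0)ᴴ * U := by
  have hε : ((1 - ε : ℝ) : ℂ) ≠ 0 := by
    have := h.lt_one
    exact_mod_cast (by linarith : (1 - ε : ℝ) ≠ 0)
  have h1 := h.factor 0 (by simp)
  have h2 : ((1 - ε : ℝ) : ℂ) • (evM Θ 0 * A * U) = ((1 - ε : ℝ) : ℂ) • ((evM Ψ 0)ᴴ * U) := by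
    calc ((1 - ε : ℝ) : ℂ) • (evM Θ 0 * A * U)
        = (((1 - ε : ℝ) : ℂ) • 1) * (evM Θ 0 * A * U) := by rw [Matrix.smul_mul, Matrix.one_mul]
      _ = (evM Ψ 0)ᴴ * ((evM Ψ 0 * evM Θ 0) * A * U) := by
          rw [← h.orth']
          simp only [Matrix.mul_assoc]
      _ = ((1 - ε : ℝ) : ℂ) • ((evM Ψ 0)ᴴ * (evM N 0 * A * U)) := by
          rw [← h1, h.N_zero]
          simp only [Matrix.smul_mul, Matrix.mul_smul]
      _ = _ := by rw [h0]
  exact smul_right_injective _ hε h2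

/-- The rational function whose half residue gives the minimal tracking cost. -/
def crossTerm (ε : ℝ) (σ : Fin l → ℝ) (N Θ Ψ Q : RMat (Fin l) (Fin l)) : RatFunc ℝ :=
  (constM (diagonal σ) * ((RatFunc.C (1 - ε) • N - constM (atZero Ψ) * Θ) * Q) *
    constM (diagonal σ)).trace

lemma stable_crossTerm (h : TrackingFactors ε z η N G Nm Θ Ψ) (σ : Fin l → ℝ)
    {Q : RMat (Fin l) (Fin l)} (hQ : RHinf Q) : Stable (crossTerm ε σ N Θ Ψ Q) :=
  (((rHinf_constM _).mul (((h.stable_N.smul (stable_C _)).sub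
    ((rHinf_constM _).mul h.minPhase.1)).mul hQ)).mul (rHinf_constM _)).trace

lemma ev_crossTerm (h : TrackingFactors ε z η N G Nm Θ Ψ) (σ : Fin l → ℝ)
    {Q : RMat (Fin l) (Fin l)} (hQ : RHinf Q) {s : ℂ} (hs : 0 ≤ s.re) :
    ev (crossTerm ε σ N Θ Ψ Q) s = (cdiag σ * ((((1 - ε : ℝ) : ℂ) • evM N s -
      evM Ψ 0 * evM Θ s) * evM Q s) * cdiag σ).trace := by
  have n1 : NoPole (constM (diagonal σ)) s := noPole_constM _
  have n2 : NoPole (RatFunc.C (1 - ε) • N) s := (h.stable_N.smul (stable_C _)).noPole hs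
  have n3 : NoPole (constM (atZero Ψ) * Θ) s := ((rHinf_constM _).mul h.minPhase.1).noPole hs
  have n4 := hQ.noPole hs
  rw [crossTerm, ev_trace ((n1.mul ((n2.sub n3).mul n4)).mul n1),
    evM_mul (n1.mul ((n2.sub n3).mul n4)) n1, evM_mul n1 ((n2.sub n3).mul n4),
    evM_mul (n2.sub n3) n4, evM_sub n2 n3, evM_smul (not_isPole_C _ _) (h.stable_N.noPole hs),
    evM_mul (noPole_constM _) (h.minPhase.1.noPole hs), evM_constM_diagonal, ev_C, evM_constM,
    ← evM_at_zero]

lemma crossTerm_zero (h : TrackingFactors ε z η N G Nm Θ Ψ) (σ : Fin l → ℝ)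
    {Q : RMat (Fin l) (Fin l)} (hQ : RHinf Q) : ev (crossTerm ε σ N Θ Ψ Q) 0 = 0 := by
  rw [h.ev_crossTerm σ hQ (by simp), h.N_zero, h.factor 0 (by simp), sub_self]
  simp

/-- Value of the half residue. -/
lemma residue_eq (h : TrackingFactors ε z η N G Nm Θ Ψ) (σ : Fin l → ℝ)
    {Q : RMat (Fin l) (Fin l)} (hQ : RHinf Q)
    (h0 : evM N 0 * evM Q 0 * cdiag σ = cdiag σ) {d : ℝ}
    (hd : Tendsto (fun x : ℝ => (x : ℂ)⁻¹ * (cdiag σ * ((evM Ψ x - evM Ψ 0) * (evM Ψ 0)ᴴ) *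
      cdiag σ).trace) (𝓝[>] 0) (𝓝 (((1 - ε) * d : ℝ) : ℂ))) :
    ev (crossTerm ε σ N Θ Ψ Q / RatFunc.X) 0 =
      ((-((1 - ε) * (2 * zeroTerm σ z η - d)) : ℝ) : ℂ) := by
  set U := cdiag σ with hU
  obtain ⟨D, hD⟩ := tendsto_evM_slope h.stable_Ψ
  set Λ : Matrix (Fin l) (Fin l) ℂ :=
    ∑ i, (-2 * ((z i).re / ‖z i‖ ^ 2 : ℝ) : ℂ) • lineProj (η i) with hΛ
  have hLs : Tendsto (fun x : ℝ => (x : ℂ)⁻¹ • (prodL z η x - 1)) (𝓝[>] 0) (𝓝 Λ) :=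
    (tendsto_prodL_slope h.re_pos η).comp tendsto_ofReal_nhdsGT
  have htr : ∀ {f : ℝ → Matrix (Fin l) (Fin l) ℂ} {A : Matrix (Fin l) (Fin l) ℂ},
      Tendsto f (𝓝[>] 0) (𝓝 A) → Tendsto (fun x => (f x).trace) (𝓝[>] 0) (𝓝 A.trace) :=
    fun hf => ((continuous_id.matrix_trace).tendsto _).comp hf
  have hd' : (U * (D * (evM Ψ 0)ᴴ) * U).trace = (((1 - ε) * d : ℝ) : ℂ) := by
    refine tendsto_nhds_unique ?_ hd
    refine (htr ((tendsto_const_nhds.mul (hD.mul tendsto_const_nhds)).mul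
      (tendsto_const_nhds (x := U)))).congr fun x => ?_
    rw [Matrix.smul_mul, Matrix.mul_smul, Matrix.smul_mul, Matrix.trace_smul, smul_eq_mul]
  have hΛ' : (U * Λ * U).trace = ((-2 * zeroTerm σ z η : ℝ) : ℂ) := by
    rw [hΛ, Matrix.mul_sum, Matrix.sum_mul, Matrix.trace_sum, zeroTerm]
    simp only [Matrix.mul_smul, Matrix.smul_mul, Matrix.trace_smul, hU,
      trace_cdiag_lineProj (h.unit _), smul_eq_mul]
    push_cast
    rw [Finset.mul_sum]
    exact Finset.sum_congr rfl fun i _ => by ring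
  have hlim := htr ((((tendsto_const_nhds (x := U)).mul
    ((((hLs.mul (tendsto_evM_nhdsGT h.stable_Nm)).const_smul ((1 - ε : ℝ) : ℂ)).add
      (hD.mul (tendsto_evM_nhdsGT h.minPhase.1))).mul (tendsto_evM_nhdsGT hQ)))).mul
      (tendsto_const_nhds (x := U)))
  have hval : (U * ((((1 - ε : ℝ) : ℂ) • (Λ * evM Nm 0) + D * evM Θ 0) * evM Q 0) * U).trace =
      ((-((1 - ε) * (2 * zeroTerm σ z η - d)) : ℝ) : ℂ) := by
    have e1 : U * ((((1 - ε : ℝ) : ℂ) • (Λ * evM Nm 0) + D * evM Θ 0) * evM Q 0) * U =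
        ((1 - ε : ℝ) : ℂ) • (U * Λ * (evM N 0 * evM Q 0 * U)) +
          U * D * (evM Θ 0 * evM Q 0 * U) := by
      rw [h.N_zero]
      simp only [Matrix.add_mul, Matrix.mul_add, Matrix.smul_mul, Matrix.mul_smul,
        Matrix.mul_assoc]
    have e2 : U * D * ((evM Ψ 0)ᴴ * U) = U * (D * (evM Ψ 0)ᴴ) * U := by
      simp only [Matrix.mul_assoc]
    rw [e1, h.outer_mul_zero h0, h0, e2, Matrix.trace_add, Matrix.trace_smul, hΛ', hd',
      smul_eq_mul]
    push_cast
    ring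
  rw [hval] at hlim
  have hk := h.stable_crossTerm σ hQ
  obtain ⟨hk1, -, hk3⟩ := hk.div_X (h.crossTerm_zero σ hQ)
  have hc : Tendsto (fun x : ℝ => ev (crossTerm ε σ N Θ Ψ Q / RatFunc.X) x) (𝓝[>] 0)
      (𝓝 (ev (crossTerm ε σ N Θ Ψ Q / RatFunc.X) 0)) :=
    (differentiableAt_ev (hk1.not_isPole (by simp))).continuousAt.tendsto.comp
      (tendsto_ofReal_nhdsGT.mono_right nhdsWithin_le_nhds)
  refine tendsto_nhds_unique hc (hlim.congr' ?_)
  filter_upwards [self_mem_nhdsWithin] with x hx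
  have hx0 : (0 : ℝ) < x := hx
  have hxre : 0 ≤ ((x : ℂ)).re := by simpa using hx0.le
  have hxne : (x : ℂ) ≠ 0 := by exact_mod_cast hx0.ne'
  have h3 := hk3 x hxre
  rw [h.ev_crossTerm σ hQ hxre] at h3
  -- Since `N = L Nm` and `(1 - ε) Nm = Ψ Θ`, the difference is `(1 - ε) (L - 1) Nm + (Ψ - Ψ(0)) Θ`:
  -- one increment from the zeros of the plant, one from the inner factor.
  have e3 : ((1 - ε : ℝ) : ℂ) • evM N x - evM Ψ 0 * evM Θ x = (x : ℂ) •
      (((1 - ε : ℝ) : ℂ) • ((x : ℂ)⁻¹ • (prodL z η x - 1) * evM Nm x) +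
        (x : ℂ)⁻¹ • (evM Ψ x - evM Ψ 0) * evM Θ x) := by
    rw [smul_add, Matrix.smul_mul, Matrix.smul_mul, smul_comm (x : ℂ), smul_smul (x : ℂ),
      smul_smul (x : ℂ), mul_inv_cancel₀ hxne, one_smul, one_smul, h.allpass x hxre,
      Matrix.sub_mul, Matrix.sub_mul, ← h.factor x hxre, Matrix.one_mul, smul_sub]
    abel
  rw [e3, Matrix.smul_mul, Matrix.mul_smul, Matrix.smul_mul, Matrix.trace_smul, smul_eq_mul] at h3
  exact (mul_left_cancel₀ hxne h3).symm

/-- The tracking cost as the distance from the optimum. -/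
lemma integral_trackDensity (h : TrackingFactors ε z η N G Nm Θ Ψ) (σ : Fin l → ℝ)
    {Q : RMat (Fin l) (Fin l)} (hQ : RHinf Q)
    (h0 : evM N 0 * evM Q 0 * cdiag σ = cdiag σ) {d : ℝ}
    (hd : Tendsto (fun x : ℝ => (x : ℂ)⁻¹ * (cdiag σ * ((evM Ψ x - evM Ψ 0) * (evM Ψ 0)ᴴ) *
      cdiag σ).trace) (𝓝[>] 0) (𝓝 (((1 - ε) * d : ℝ) : ℂ))) :
    Integrable (trackDensity ε σ (N * Q) (G * Q)) ∧
    ∫ ω, trackDensity ε σ (N * Q) (G * Q) ω =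
      (∫ ω : ℝ, nsq (((evM Ψ 0)ᴴ - evM Θ (ω * Complex.I) * evM Q (ω * Complex.I)) * cdiag σ) /
        ω ^ 2) + 2 * Real.pi * ((1 - ε) * (2 * zeroTerm σ z η - d)) := by
  obtain ⟨r1, r2⟩ := half_residue (h.stable_crossTerm σ hQ) (h.crossTerm_zero σ hQ)
  rw [h.residue_eq σ hQ h0 hd, Complex.ofReal_re] at r2
  set B : RMat (Fin l) (Fin l) := (constM (atZero Ψ)ᵀ - Θ * Q) * constM (diagonal σ) with hB
  have hBs : RHinf B := ((rHinf_constM _).sub (h.minPhase.1.mul hQ)).mul (rHinf_constM _)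
  have hBev : ∀ s : ℂ, 0 ≤ s.re →
      evM B s = ((evM Ψ 0)ᴴ - evM Θ s * evM Q s) * cdiag σ := fun s hs => by
    have n1 := (h.minPhase.1.mul hQ).noPole hs
    have n2 : NoPole (constM (atZero Ψ)ᵀ) s := noPole_constM _
    rw [hB, evM_mul (n2.sub n1) (noPole_constM _), evM_sub n2 n1,
      evM_mul (h.minPhase.1.noPole hs) (hQ.noPole hs), evM_constM_diagonal, evM_constM]
    congr 2
    rw [evM_at_zero]
    ext i j
    simp
  -- The zero at the origin compensates `ω⁻²`, so the completed square is integrable separately from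
  -- the cross term.
  have hB0 : evM B 0 = 0 := by
    rw [hBev 0 (by simp), Matrix.sub_mul, h.outer_mul_zero h0, sub_self]
  have hBint : Integrable fun ω : ℝ => nsq (((evM Ψ 0)ᴴ - evM Θ (ω * Complex.I) *
      evM Q (ω * Complex.I)) * cdiag σ) / ω ^ 2 := by
    have hij : ∀ i j, Integrable fun ω : ℝ => ‖ev (B i j) (ω * Complex.I)‖ ^ 2 / ω ^ 2 :=
      fun i j => by
      obtain ⟨d1, d2, d3⟩ := (hBs i j).div_X (congrFun (congrFun hB0 i) j)
      refine (IsH2.of_stable d1 d2).integrable_norm_sq.congr ?_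
      filter_upwards [Measure.ae_ne volume (0 : ℝ)] with ω hω
      rw [ev_div_X_of_ne ((hBs i j).not_isPole (by simp)) (by simpa using hω), norm_div, norm_axis,
        div_pow, sq_abs]
    refine (integrable_finsetSum Finset.univ fun i _ =>
      integrable_finsetSum Finset.univ fun j _ => hij i j).congr (Eventually.of_forall fun ω => ?_)
    have e : nsq (((evM Ψ 0)ᴴ - evM Θ (ω * Complex.I) * evM Q (ω * Complex.I)) * cdiag σ) / ω ^ 2 =
        ∑ i, ∑ j, ‖ev (B i j) (ω * Complex.I)‖ ^ 2 / ω ^ 2 := by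
      rw [← hBev _ (by simp), nsq]
      simp only [Finset.sum_div, evM_apply]
    exact e.symm
  have hpt : ∀ ω : ℝ, trackDensity ε σ (N * Q) (G * Q) ω =
      nsq (((evM Ψ 0)ᴴ - evM Θ (ω * Complex.I) * evM Q (ω * Complex.I)) * cdiag σ) / ω ^ 2 -
      2 * ((ev (crossTerm ε σ N Θ Ψ Q) (ω * Complex.I)).re / ω ^ 2) := fun ω => by
    have hs : 0 ≤ ((ω : ℂ) * Complex.I).re := by simp
    rw [trackDensity, evM_mul (h.stable_N.noPole hs) (hQ.noPole hs),
      evM_mul (h.stable_G.noPole hs) (hQ.noPole hs),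
      tracking_identity (cdiag_conjTranspose σ) (h.spectral ω) h.orth, h.ev_crossTerm σ hQ hs]
    ring
  have hfun : trackDensity ε σ (N * Q) (G * Q) = fun ω : ℝ =>
      nsq (((evM Ψ 0)ᴴ - evM Θ (ω * Complex.I) * evM Q (ω * Complex.I)) * cdiag σ) / ω ^ 2 -
      2 * ((ev (crossTerm ε σ N Θ Ψ Q) (ω * Complex.I)).re / ω ^ 2) := funext hpt
  rw [hfun]
  refine ⟨hBint.sub (r1.const_mul 2), ?_⟩
  rw [integral_sub hBint (r1.const_mul 2), integral_const_mul, r2]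
  ring

/-- Lower bound of the tracking cost. -/
lemma le_lintegral (h : TrackingFactors ε z η N G Nm Θ Ψ) (σ : Fin l → ℝ)
    {Q : RMat (Fin l) (Fin l)} (hQ : RHinf Q) {d : ℝ}
    (hd : Tendsto (fun x : ℝ => (x : ℂ)⁻¹ * (cdiag σ * ((evM Ψ x - evM Ψ 0) * (evM Ψ 0)ᴴ) *
      cdiag σ).trace) (𝓝[>] 0) (𝓝 (((1 - ε) * d : ℝ) : ℂ))) :
    ENNReal.ofReal (2 * Real.pi * ((1 - ε) * (2 * zeroTerm σ z η - d))) ≤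
      ∫⁻ ω, ENNReal.ofReal (trackDensity ε σ (N * Q) (G * Q) ω) := by
  have hε : 0 < 1 - ε := by linarith [h.lt_one]
  have hε0 := h.nonneg
  by_cases hfin : ∫⁻ ω, ENNReal.ofReal (trackDensity ε σ (N * Q) (G * Q) ω) = ⊤
  · rw [hfin]
    exact le_top
  set B : RMat (Fin l) (Fin l) := (1 - N * Q) * constM (diagonal σ) with hB
  have hBs : RHinf B := (rHinf_one.sub (h.stable_N.mul hQ)).mul (rHinf_constM _)
  have hBev : ∀ s : ℂ, 0 ≤ s.re → evM B s = (1 - evM (N * Q) s) * cdiag σ := fun s hs => by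
    have n1 := (h.stable_N.mul hQ).noPole hs
    have n2 : NoPole (1 : RMat (Fin l) (Fin l)) s := rHinf_one.noPole hs
    rw [hB, evM_mul (n2.sub n1) (noPole_constM _), evM_sub n2 n1, evM_constM_diagonal, evM_one]
  -- Because `1 - ε > 0`, finite cost forces each entry of the error map weighted by `U` to vanish
  -- at zero frequency. With this condition the residue is the same for all competing `Q`.
  have h0 : evM N 0 * evM Q 0 * cdiag σ = cdiag σ := by
    have hB0 : evM B 0 = 0 := by
      ext i j
      refine ev_zero_of_lintegral (hBs i j) fun htop => hfin ?_
      have hle : ∀ ω : ℝ, ENNReal.ofReal (1 - ε) *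
          ENNReal.ofReal (‖ev (B i j) (ω * Complex.I)‖ ^ 2 / ω ^ 2) ≤
          ENNReal.ofReal (trackDensity ε σ (N * Q) (G * Q) ω) := fun ω => by
        rw [← ENNReal.ofReal_mul hε.le]
        refine ENNReal.ofReal_le_ofReal ?_
        rw [trackDensity, ← hBev _ (by simp), ← mul_div_assoc]
        have h1 : ‖ev (B i j) (ω * Complex.I)‖ ^ 2 ≤ nsq (evM B (ω * Complex.I)) := by
          unfold nsq
          refine le_trans ?_ (Finset.single_le_sum (f := fun i => ∑ j,
            ‖evM B (ω * Complex.I) i j‖ ^ 2) (fun i _ => by positivity) (Finset.mem_univ i))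
          exact Finset.single_le_sum (f := fun j => ‖evM B (ω * Complex.I) i j‖ ^ 2)
            (fun i _ => by positivity) (Finset.mem_univ j)
        have h2 := nsq_nonneg (evM (G * Q) (ω * Complex.I) * cdiag σ)
        refine div_le_div_of_nonneg_right ?_ (by positivity)
        have h3 := mul_le_mul_of_nonneg_left h1 hε.le
        have h4 := mul_nonneg hε0 h2
        linarith
      refine top_le_iff.1 ?_
      calc (⊤ : ENNReal) = ENNReal.ofReal (1 - ε) * ⊤ := by
            rw [ENNReal.mul_top (by simpa using h.lt_one)]
        _ = ∫⁻ ω : ℝ, ENNReal.ofReal (1 - ε) *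
            ENNReal.ofReal (‖ev (B i j) (ω * Complex.I)‖ ^ 2 / ω ^ 2) := by
            rw [lintegral_const_mul', htop]
            exact ENNReal.ofReal_ne_top
        _ ≤ _ := lintegral_mono hle
    rw [hBev 0 (by simp), evM_mul (h.stable_N.noPole (by simp)) (hQ.noPole (by simp)),
      Matrix.sub_mul, Matrix.one_mul, sub_eq_zero] at hB0
    exact hB0.symm
  obtain ⟨i1, i2⟩ := h.integral_trackDensity σ hQ h0 hd
  have hnn : ∀ ω, 0 ≤ trackDensity ε σ (N * Q) (G * Q) ω := fun ω => by
    have h1 := nsq_nonneg ((1 - evM (N * Q) (ω * Complex.I)) * cdiag σ)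
    have h2 := nsq_nonneg (evM (G * Q) (ω * Complex.I) * cdiag σ)
    unfold trackDensity
    positivity
  rw [← ofReal_integral_eq_lintegral_ofReal i1 (Eventually.of_forall hnn), i2]
  refine ENNReal.ofReal_le_ofReal ?_
  have : 0 ≤ ∫ ω : ℝ, nsq (((evM Ψ 0)ᴴ - evM Θ (ω * Complex.I) * evM Q (ω * Complex.I)) *
      cdiag σ) / ω ^ 2 := integral_nonneg fun ω => div_nonneg (nsq_nonneg _) (by positivity)
  linarith

/-- The lower bound of the tracking cost is approached. -/
lemma exists_lintegral_le (h : TrackingFactors ε z η N G Nm Θ Ψ) (σ : Fin l → ℝ) {d : ℝ}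
    (hd : Tendsto (fun x : ℝ => (x : ℂ)⁻¹ * (cdiag σ * ((evM Ψ x - evM Ψ 0) * (evM Ψ 0)ᴴ) *
      cdiag σ).trace) (𝓝[>] 0) (𝓝 (((1 - ε) * d : ℝ) : ℂ))) {δ : ℝ} (hδ : 0 < δ) :
    0 ≤ 2 * Real.pi * ((1 - ε) * (2 * zeroTerm σ z η - d)) + δ ∧
    ∃ Q, RHinf Q ∧ evM N 0 * evM Q 0 = 1 ∧
      ∫⁻ ω, ENNReal.ofReal (trackDensity ε σ (N * Q) (G * Q) ω) ≤
        ENNReal.ofReal (2 * Real.pi * ((1 - ε) * (2 * zeroTerm σ z η - d)) + δ) := by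
  have hε : 0 < 1 - ε := by linarith [h.lt_one]
  have hεC : ((1 - ε : ℝ) : ℂ) ≠ 0 := by exact_mod_cast hε.ne'
  have hε0 := h.nonneg
  have hΘs := h.minPhase.1
  have hdet : ∀ s : ℂ, 0 ≤ s.re → ev Θ.det s = (evM Θ s).det := fun s hs =>
    ev_det (hΘs.noPole hs)
  obtain ⟨k, hk, hk0, ⟨c, hc0, hc⟩, hklim⟩ := exists_approx_inverse_of_zero hΘs.det
    (fun s hs => by rw [hdet s hs.le]; exact h.minPhase.2 s hs)
    (by rw [hdet 0 (by simp)]; exact h.det_zero.ne_zero)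
  -- The ideal choice `Θ⁻¹ Ψ(0)ᴴ` need not be stable or proper. Writing `Θ⁻¹` as adjugate over
  -- determinant, only the scalar `1 / det Θ` has to be approximated.
  set Q : ℕ → RMat (Fin l) (Fin l) := fun n => k n • (Θ.adjugate * constM (atZero Ψ)ᵀ) with hQ
  have hQs : ∀ n, RHinf (Q n) := fun n => (hΘs.adjugate.mul (rHinf_constM _)).smul (hk n)
  have hΨt : ∀ s, evM (constM (atZero Ψ)ᵀ) s = (evM Ψ 0)ᴴ := fun s => by
    rw [evM_constM, evM_at_zero]
    ext i j
    simp
  have hΘQ : ∀ n (s : ℂ), 0 ≤ s.re →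
      evM Θ s * evM (Q n) s = (ev Θ.det s * ev (k n) s) • (evM Ψ 0)ᴴ := fun n s hs => by
    have n1 := hΘs.noPole hs
    have h1 : Θ * Q n = (Θ.det * k n) • constM (atZero Ψ)ᵀ := by
      rw [hQ, Matrix.mul_smul, ← Matrix.mul_assoc, Matrix.mul_adjugate, Matrix.smul_mul,
        Matrix.one_mul, smul_smul, mul_comm]
    rw [← evM_mul n1 ((hQs n).noPole hs), h1, evM_smul ((hΘs.det.mul (hk n)).not_isPole hs)
      (noPole_constM _), hΨt, ev_mul (hΘs.det.not_isPole hs) ((hk n).not_isPole hs)]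
  have hNQ : ∀ n, evM N 0 * evM (Q n) 0 = 1 := fun n => by
    have h1 : ((1 - ε : ℝ) : ℂ) • (evM N 0 * evM (Q n) 0) = ((1 - ε : ℝ) : ℂ) • 1 := by
      rw [← Matrix.smul_mul, h.N_zero, h.factor 0 (by simp), Matrix.mul_assoc,
        hΘQ n 0 (by simp), hk0 n, one_smul, h.orth]
    exact smul_right_injective _ hεC h1
  set χ : ℕ → ℝ → ℂ := fun n ω => ev Θ.det (ω * Complex.I) * ev (k n) (ω * Complex.I) with hχ
  set a := nsq ((evM Ψ 0)ᴴ * cdiag σ) with ha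
  have hpt : ∀ n (ω : ℝ), nsq (((evM Ψ 0)ᴴ - evM Θ (ω * Complex.I) * evM (Q n) (ω * Complex.I)) *
      cdiag σ) / ω ^ 2 = a * (‖χ n ω - 1‖ ^ 2 / ω ^ 2) := fun n ω => by
    have h1 : ((evM Ψ 0)ᴴ - evM Θ (ω * Complex.I) * evM (Q n) (ω * Complex.I)) * cdiag σ =
        (1 - χ n ω) • ((evM Ψ 0)ᴴ * cdiag σ) := by
      rw [hΘQ n _ (by simp), sub_smul, one_smul, Matrix.sub_mul, Matrix.smul_mul]
    have h2 : ∀ (b : ℂ) (A : Matrix (Fin l) (Fin l) ℂ), nsq (b • A) = nsq A * ‖b‖ ^ 2 :=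
      fun b A => by
      simp only [nsq, Matrix.smul_apply, smul_eq_mul, norm_mul, mul_pow, Finset.sum_mul,
        mul_comm (‖b‖ ^ 2)]
    rw [h1, h2, norm_sub_rev, mul_div_assoc]
  -- The bounds `c` and `c |ω|` for `|χ - 1|` together dominate `|χ - 1|² / ω²` by `2 c² / (1 +
  -- ω²)`.
  have hlim : Tendsto (fun n => ∫ ω : ℝ, a * (‖χ n ω - 1‖ ^ 2 / ω ^ 2)) atTop (𝓝 0) := by
    have h0 : (0 : ℝ) = ∫ _ω : ℝ, (0 : ℝ) := by simp
    rw [h0]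
    refine tendsto_integral_of_dominated_convergence
      (fun ω : ℝ => |a| * (2 * c ^ 2 * (1 + ω ^ 2)⁻¹)) (fun n => ?_)
      ((integrable_inv_one_add_sq.const_mul _).const_mul _)
      (fun n => ?_) ?_
    · have : Measurable fun ω : ℝ => a * (‖χ n ω - 1‖ ^ 2 / ω ^ 2) := by
        have h1 := measurable_ev_axis Θ.det
        have h2 := measurable_ev_axis (k n)
        have h3 : Measurable fun ω => χ n ω := h1.mul h2
        exact ((((h3.sub_const 1).norm.pow_const 2)).div (by fun_prop)).const_mul a
      exact this.aestronglyMeasurable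
    · filter_upwards [Measure.ae_ne volume (0 : ℝ)] with ω hω
      rw [norm_mul, Real.norm_eq_abs, Real.norm_of_nonneg (by positivity)]
      refine mul_le_mul_of_nonneg_left ?_ (abs_nonneg _)
      obtain ⟨c1, c2⟩ := hc n ω
      have hω2 : 0 < ω ^ 2 := by positivity
      have d1 : ‖χ n ω - 1‖ ^ 2 ≤ c ^ 2 := pow_le_pow_left₀ (norm_nonneg _) c1 2
      have d2 : ‖χ n ω - 1‖ ^ 2 ≤ c ^ 2 * ω ^ 2 := by
        have := pow_le_pow_left₀ (norm_nonneg _) c2 2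
        rwa [mul_pow, sq_abs] at this
      rw [div_le_iff₀ hω2, ← div_eq_mul_inv, div_mul_eq_mul_div, le_div_iff₀ (by positivity)]
      nlinarith
    · filter_upwards [hklim] with ω hω
      have h1 : Tendsto (fun n => a * (‖χ n ω - 1‖ ^ 2 / ω ^ 2)) atTop
          (𝓝 (a * (‖(1 : ℂ) - 1‖ ^ 2 / ω ^ 2))) :=
        (((hω.sub_const 1).norm.pow 2).div_const _).const_mul a
      simpa using h1
  obtain ⟨n, hn⟩ := (hlim.eventually (gt_mem_nhds hδ)).exists
  have h0 : evM N 0 * evM (Q n) 0 * cdiag σ = cdiag σ := by rw [hNQ, Matrix.one_mul]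
  obtain ⟨i1, i2⟩ := h.integral_trackDensity σ (hQs n) h0 hd
  have hnn : ∀ ω, 0 ≤ trackDensity ε σ (N * Q n) (G * Q n) ω := fun ω => by
    have h1 := nsq_nonneg ((1 - evM (N * Q n) (ω * Complex.I)) * cdiag σ)
    have h2 := nsq_nonneg (evM (G * Q n) (ω * Complex.I) * cdiag σ)
    unfold trackDensity
    positivity
  have hint : 0 ≤ ∫ ω, trackDensity ε σ (N * Q n) (G * Q n) ω := integral_nonneg hnn
  rw [i2] at hint
  simp only [hpt] at hint
  refine ⟨by linarith, Q n, hQs n, hNQ n, ?_⟩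
  rw [← ofReal_integral_eq_lintegral_ofReal i1 (Eventually.of_forall hnn), i2]
  simp only [hpt]
  exact ENNReal.ofReal_le_ofReal (by linarith)

end TrackingFactors

end

section

variable {l m : ℕ}

/-! ### Inner-outer factorizations on the imaginary axis -/

lemma IsMinPhasePart.gram {A₀ A : RMat (Fin l) (Fin l)} (h : IsMinPhasePart A₀ A) (ω : ℝ) :
    (evM A (ω * Complex.I))ᴴ * evM A (ω * Complex.I) =
      (evM A₀ (ω * Complex.I))ᴴ * evM A₀ (ω * Complex.I) := by
  obtain ⟨h₀, B, ⟨hB, hB1⟩, rfl⟩ := h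
  rw [evM_mul (hB.noPole (by simp)) (h₀.1.noPole (by simp)), Matrix.conjTranspose_mul,
    Matrix.mul_assoc, ← Matrix.mul_assoc (evM B _)ᴴ, hB1, Matrix.one_mul]

/-- The two square blocks of the inner factor. -/
lemma IsOuterFactor.exists_blocks {ε : ℝ} {A B G : RMat (Fin l) (Fin l)}
    (h : IsOuterFactor ε A B G) :
    ∃ G₁ G₂ : RMat (Fin l) (Fin l), RHinf G₁ ∧ RHinf G₂ ∧
      RatFunc.C (√(1 - ε)) • A = G₁ * G ∧ RatFunc.C (√ε) • B = G₂ * G ∧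
      ∀ ω : ℝ, (evM G₁ (ω * Complex.I))ᴴ * evM G₁ (ω * Complex.I) +
        (evM G₂ (ω * Complex.I))ᴴ * evM G₂ (ω * Complex.I) = 1 := by
  obtain ⟨-, Gi, ⟨hGi, hin⟩, hfac⟩ := h
  rw [← Matrix.fromRows_toRows Gi, Matrix.fromRows_mul] at hfac
  obtain ⟨h1, h2⟩ := Matrix.fromRows_inj hfac
  refine ⟨Gi.toRows₁, Gi.toRows₂, fun i j => hGi _ _, fun i j => hGi _ _, h1, h2, fun ω => ?_⟩
  rw [← hin ω]
  ext i j
  simp [Matrix.mul_apply, evM_apply, Matrix.add_apply]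

lemma sqrt_smul_gram {c : ℝ} (hc : 0 ≤ c) (A : Matrix (Fin l) (Fin l) ℂ) :
    (((√c : ℝ) : ℂ) • A)ᴴ * (((√c : ℝ) : ℂ) • A) = (c : ℂ) • (Aᴴ * A) := by
  rw [Matrix.conjTranspose_smul, Matrix.smul_mul, Matrix.mul_smul, smul_smul, Complex.star_def,
    Complex.conj_ofReal, ← Complex.ofReal_mul, Real.mul_self_sqrt hc]

lemma IsOuterFactor.gram {ε : ℝ} (hε₀ : 0 ≤ ε) (hε₁ : ε ≤ 1) {A B G : RMat (Fin l) (Fin l)}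
    (h : IsOuterFactor ε A B G) (hA : RHinf A) (hB : RHinf B) (ω : ℝ) :
    ((1 - ε : ℝ) : ℂ) • ((evM A (ω * Complex.I))ᴴ * evM A (ω * Complex.I)) +
      (ε : ℂ) • ((evM B (ω * Complex.I))ᴴ * evM B (ω * Complex.I)) =
      (evM G (ω * Complex.I))ᴴ * evM G (ω * Complex.I) := by
  obtain ⟨G₁, G₂, hG₁, hG₂, e1, e2, hin⟩ := h.exists_blocks
  have hs : 0 ≤ ((ω : ℂ) * Complex.I).re := by simp
  have f1 := congrArg (fun A => evM A (ω * Complex.I)) e1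
  have f2 := congrArg (fun A => evM A (ω * Complex.I)) e2
  rw [evM_smul (not_isPole_C _ _) (hA.noPole hs), ev_C, evM_mul (hG₁.noPole hs) (h.1.1.noPole hs)]
    at f1
  rw [evM_smul (not_isPole_C _ _) (hB.noPole hs), ev_C, evM_mul (hG₂.noPole hs) (h.1.1.noPole hs)]
    at f2
  rw [← sqrt_smul_gram (by linarith), ← sqrt_smul_gram hε₀, f1, f2, Matrix.conjTranspose_mul,
    Matrix.conjTranspose_mul]
  calc _ = (evM G (ω * Complex.I))ᴴ * ((evM G₁ (ω * Complex.I))ᴴ * evM G₁ (ω * Complex.I) +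
        (evM G₂ (ω * Complex.I))ᴴ * evM G₂ (ω * Complex.I)) * evM G (ω * Complex.I) := by
        noncomm_ring
    _ = _ := by rw [hin, Matrix.mul_one]

/-- `Ψ` is `√(1 - ε)` times the upper block of the inner factor. At the origin `F M` vanishes, hence
so does the lower block, and the upper block is unitary there. -/
lemma CoprimeLoop.exists_trackingFactors
    {P F N N₀ M Nt Mt X Y Xt Yt Nm CFM Θ : RMat (Fin l) (Fin l)} {φ : RatFunc ℝ}
    (h : CoprimeLoop P F N N₀ M Nt Mt X Y Xt Yt φ) {ε : ℝ} (hε₀ : 0 ≤ ε) (hε : ε < 1)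
    {z : Fin m → ℂ} (hz : ∀ i, 0 < (z i).re)
    {η : Fin m → EuclideanSpace ℂ (Fin l)} (hη : ∀ i, ‖η i‖ = 1) (hNm : MinPhase Nm)
    (hL : ∀ s : ℂ, 0 ≤ s.re → evM N s = prodL z η s * evM Nm s)
    (hCFM : IsMinPhasePart CFM (F * M)) (hΘ : IsOuterFactor ε Nm CFM Θ) :
    ∃ Ψ, TrackingFactors ε z η N (F * M) Nm Θ Ψ ∧ RatFunc.C (1 - ε) • Nm = Ψ * Θ := by
  obtain ⟨G₁, G₂, hG₁, hG₂, e1, e2, hin⟩ := hΘ.exists_blocks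
  have hε' : 0 < 1 - ε := by linarith
  have hsq : RatFunc.C (√(1 - ε)) * RatFunc.C (√(1 - ε)) = RatFunc.C (1 - ε) := by
    rw [← map_mul, Real.mul_self_sqrt hε'.le]
  have hfac : RatFunc.C (1 - ε) • Nm = (RatFunc.C (√(1 - ε)) • G₁) * Θ := by
    rw [Matrix.smul_mul, ← e1, smul_smul, hsq]
  have hΨ : RHinf (RatFunc.C (√(1 - ε)) • G₁) := RHinf.smul (stable_C _) hG₁
  have hevfac : ∀ s : ℂ, 0 ≤ s.re → ((1 - ε : ℝ) : ℂ) • evM Nm s =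
      evM (RatFunc.C (√(1 - ε)) • G₁) s * evM Θ s := fun s hs => by
    rw [← evM_mul (hΨ.noPole hs) (hΘ.1.1.noPole hs), ← hfac,
      evM_smul (not_isPole_C _ _) (hNm.1.noPole hs), ev_C]
  have h00 : (0 : ℂ) = ((0 : ℝ) : ℂ) * Complex.I := by simp
  have hNm0 : IsUnit (evM Nm 0).det := by
    have := hL 0 (by simp)
    rw [prodL_zero hz, Matrix.one_mul] at this
    rw [← this]
    exact h.det_N_zero
  have hdet : IsUnit (evM Θ 0).det := by
    have := congrArg Matrix.det (hevfac 0 (by simp))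
    rw [Matrix.det_smul, Matrix.det_mul] at this
    rw [isUnit_iff_ne_zero]
    intro h0
    rw [h0, mul_zero] at this
    exact mul_ne_zero (pow_ne_zero _ (by exact_mod_cast hε'.ne')) hNm0.ne_zero this
  have hM0 : evM CFM 0 = 0 := by
    have h1 : evM (F * M) 0 = 0 := by
      rw [evM_mul (h.stable_F.noPole (by simp)) (h.stable_M.noPole (by simp)), h.M_zero,
        Matrix.mul_zero]
    have h2 := hCFM.gram 0
    rw [← h00, h1, Matrix.mul_zero] at h2
    open scoped ComplexOrder in exact Matrix.conjTranspose_mul_self_eq_zero.1 h2.symm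
  have hG20 : evM G₂ 0 = 0 := by
    have f2 := congrArg (fun A => evM A 0) e2
    rw [evM_smul (not_isPole_C _ _) (hCFM.1.1.noPole (by simp)), hM0, smul_zero,
      evM_mul (hG₂.noPole (by simp)) (hΘ.1.1.noPole (by simp))] at f2
    calc evM G₂ 0 = evM G₂ 0 * evM Θ 0 * (evM Θ 0)⁻¹ := (Matrix.mul_nonsing_inv_cancel_right _ _ hdet).symm
      _ = 0 := by rw [← f2, Matrix.zero_mul]
  have hG1 : evM G₁ 0 * (evM G₁ 0)ᴴ = 1 := by
    have := hin 0
    rw [← h00, hG20, Matrix.mul_zero, add_zero] at this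
    exact mul_eq_one_comm.1 this
  refine ⟨RatFunc.C (√(1 - ε)) • G₁, ⟨hε, hε₀, hz, hη, h.stable_N, h.stable_F.mul h.stable_M,
    hNm.1, hΨ, hΘ.1, hL, fun ω => ?_, hevfac, ?_, hdet⟩, hfac⟩
  · have hLω := prodL_unitary hz hη ω
    rw [← hΘ.gram hε₀ hε.le hNm.1 hCFM.1.1, hCFM.gram, hL _ (by simp), Matrix.conjTranspose_mul,
      Matrix.mul_assoc, ← Matrix.mul_assoc (prodL z η _)ᴴ, hLω, Matrix.one_mul]
  · rw [evM_smul (not_isPole_C _ _) (hG₁.noPole (by simp)), ev_C, Matrix.conjTranspose_smul,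
      Matrix.smul_mul, Matrix.mul_smul, smul_smul, Complex.star_def, Complex.conj_ofReal,
      ← Complex.ofReal_mul, Real.mul_self_sqrt hε'.le, hG1]

/-! ### The function `f` -/

namespace TrackingFactors

variable {ε : ℝ} {z : Fin m → ℂ} {η : Fin m → EuclideanSpace ℂ (Fin l)}
  {N G Nm Θ Ψ : RMat (Fin l) (Fin l)}

/-- The outer factor cancels: `(1 - ε) Nm Θ⁻¹` is `Ψ`, and at the origin the transposed quotient is
`Ψ(0)ᵀ / (1 - ε)`. In this form `f` is stable, and its derivative at `0` is the one met in the
tracking residue. -/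
lemma fFun_eq (h : TrackingFactors ε z η N G Nm Θ Ψ)
    (hfac : RatFunc.C (1 - ε) • Nm = Ψ * Θ) (σ : Fin l → ℝ) :
    fFun ε σ Nm Θ = (constM (diagonal σ) * Ψ *
      constM ((1 - ε)⁻¹ • (atZero Ψ)ᵀ * diagonal σ)).trace := by
  have hε : 1 - ε ≠ 0 := by linarith [h.lt_one]
  have hinj : ∀ A B : Matrix (Fin l) (Fin l) ℝ, (A.map fun x => (x : ℂ)) = B.map (fun x => (x : ℂ)) →
      A = B := fun A B hAB => by
    ext i j
    exact Complex.ofReal_injective (congrFun (congrFun hAB i) j)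
  have hreal : (1 - ε) • atZero Nm = atZero Ψ * atZero Θ := by
    refine hinj _ _ ?_
    have h0 := h.factor 0 (by simp)
    rw [evM_at_zero, evM_at_zero, evM_at_zero] at h0
    have e1 : ((atZero Ψ * atZero Θ).map fun x => (x : ℂ)) =
      (atZero Ψ).map (fun x => (x : ℂ)) * (atZero Θ).map fun x => (x : ℂ) :=
        Matrix.map_mul (f := Complex.ofRealHom)
    rw [e1, ← h0]
    ext i j
    simp
  have hdet : IsUnit (atZero Θ).det := by
    have h0 := h.det_zero
    have e1 : (((atZero Θ).map fun x => (x : ℂ)).det) = (((atZero Θ).det : ℝ) : ℂ) :=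
      (RingHom.map_det Complex.ofRealHom (atZero Θ)).symm
    rw [evM_at_zero, e1] at h0
    rw [isUnit_iff_ne_zero] at h0 ⊢
    exact_mod_cast h0
  have hNm : (((atZero Θ)⁻¹)ᵀ * (atZero Nm)ᵀ) = (1 - ε)⁻¹ • (atZero Ψ)ᵀ := by
    rw [← Matrix.transpose_mul]
    have : atZero Nm = (1 - ε)⁻¹ • (atZero Ψ * atZero Θ) := by
      rw [← hreal, smul_smul, inv_mul_cancel₀ hε, one_smul]
    rw [this, Matrix.smul_mul, Matrix.mul_nonsing_inv_cancel_right _ _ hdet,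
      Matrix.transpose_smul]
  have hΘ : IsUnit Θ.det := isUnit_iff_ne_zero.2 h.minPhase.det_ne_zero
  rw [fFun, hNm, Matrix.diagonal_transpose, ← Matrix.smul_mul, ← Matrix.smul_mul,
    ← Matrix.mul_smul, hfac, ← Matrix.mul_assoc, Matrix.mul_nonsing_inv_cancel_right _ _ hΘ]

lemma stable_fFun (h : TrackingFactors ε z η N G Nm Θ Ψ)
    (hfac : RatFunc.C (1 - ε) • Nm = Ψ * Θ) (σ : Fin l → ℝ) : Stable (fFun ε σ Nm Θ) := by
  rw [h.fFun_eq hfac]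
  exact (((rHinf_constM _).mul h.stable_Ψ).mul (rHinf_constM _)).trace

lemma ev_fFun (h : TrackingFactors ε z η N G Nm Θ Ψ)
    (hfac : RatFunc.C (1 - ε) • Nm = Ψ * Θ) (σ : Fin l → ℝ) {s : ℂ} (hs : 0 ≤ s.re) :
    ev (fFun ε σ Nm Θ) s = (((1 - ε : ℝ) : ℂ))⁻¹ *
      (cdiag σ * (evM Ψ s * (evM Ψ 0)ᴴ) * cdiag σ).trace := by
  have hΨ := h.stable_Ψ.noPole hs
  have hc : ∀ A : Matrix (Fin l) (Fin l) ℝ, NoPole (constM A) s := fun A => noPole_constM A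
  have e1 : evM (constM ((1 - ε)⁻¹ • (atZero Ψ)ᵀ * diagonal σ)) s =
      (((1 - ε : ℝ) : ℂ))⁻¹ • ((evM Ψ 0)ᴴ * cdiag σ) := by
    rw [evM_constM, evM_at_zero]
    ext i j
    simp [Matrix.mul_diagonal]
  rw [h.fFun_eq hfac, ev_trace (((hc _).mul hΨ).mul (hc _)), evM_mul ((hc _).mul hΨ) (hc _),
    evM_mul (hc _) hΨ, evM_constM_diagonal, e1, Matrix.mul_smul, Matrix.trace_smul, smul_eq_mul]
  simp only [Matrix.mul_assoc]

lemma ev_fFun_zero (h : TrackingFactors ε z η N G Nm Θ Ψ)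
    (hfac : RatFunc.C (1 - ε) • Nm = Ψ * Θ) (σ : Fin l → ℝ) :
    ev (fFun ε σ Nm Θ) 0 = ((∑ i, σ i ^ 2 : ℝ) : ℂ) := by
  have hε : ((1 - ε : ℝ) : ℂ) ≠ 0 := by exact_mod_cast (by linarith [h.lt_one] : (1 - ε : ℝ) ≠ 0)
  rw [h.ev_fFun hfac σ (by simp), h.orth, Matrix.mul_smul, Matrix.smul_mul, Matrix.mul_one,
    Matrix.trace_smul, smul_eq_mul, inv_mul_cancel_left₀ hε, Matrix.diagonal_mul_diagonal,
    Matrix.trace_diagonal]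
  push_cast
  exact Finset.sum_congr rfl fun i _ => (sq _).symm

/-- The spectral density of the reference does not vanish if `f` has a minimum phase factor. -/
lemma sum_sq_ne_zero (h : TrackingFactors ε z η N G Nm Θ Ψ)
    (hfac : RatFunc.C (1 - ε) • Nm = Ψ * Θ) {σ : Fin l → ℝ} {Ns : ℕ} {sz : Fin Ns → ℂ}
    (hsz : ∀ k, 0 < (sz k).re) {fm : RatFunc ℝ} (hnz : ∀ s : ℂ, 0 < s.re → ev fm s ≠ 0)
    (hfm : ∀ s : ℂ, 0 ≤ s.re → ev (fFun ε σ Nm Θ) s =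
      (∏ k, star (sz k) * (sz k - s) / (sz k * (star (sz k) + s))) * ev fm s) :
    ∑ i, σ i ^ 2 ≠ 0 := by
  intro h0
  have hσ : ∀ i, σ i = 0 := fun i => by
    have := (Finset.sum_eq_zero_iff_of_nonneg fun i _ => sq_nonneg (σ i)).1 h0 i (Finset.mem_univ i)
    exact pow_eq_zero_iff two_ne_zero |>.1 this
  have hU : cdiag σ = 0 := by
    ext i j
    simp [Matrix.diagonal_apply, hσ]
  -- A positive real point beyond all the `sz k`: the Blaschke product is nonzero there, while `f`
  -- would vanish identically.
  set x : ℝ := 1 + ∑ k, ‖sz k‖ with hx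
  have hx0 : 0 < x := by positivity
  have hre : 0 < (x : ℂ).re := by simpa using hx0
  have h1 := hfm x hre.le
  rw [h.ev_fFun hfac σ hre.le, hU, Matrix.zero_mul, Matrix.zero_mul, Matrix.trace_zero,
    mul_zero] at h1
  refine mul_ne_zero (Finset.prod_ne_zero_iff.2 fun k _ => ?_) (hnz x hre) h1.symm
  have hk : sz k ≠ 0 := fun hk => by simpa [hk] using hsz k
  have hlt : ‖sz k‖ < x := by
    have := Finset.single_le_sum (f := fun k => ‖sz k‖) (fun k _ => norm_nonneg _)
      (Finset.mem_univ k)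
    rw [hx]
    linarith
  have hne : sz k - x ≠ 0 := fun he => by
    rw [sub_eq_zero.1 he, Complex.norm_real, Real.norm_eq_abs, abs_of_pos hx0] at hlt
    exact lt_irrefl _ hlt
  have hne' : star (sz k) + x ≠ 0 := by
    rw [add_comm]
    exact re_pos_add_star_ne (hsz k) hre.le
  exact div_ne_zero (mul_ne_zero (star_ne_zero.2 hk) hne) (mul_ne_zero hk hne')

lemma tendsto_slope (h : TrackingFactors ε z η N G Nm Θ Ψ)
    (hfac : RatFunc.C (1 - ε) • Nm = Ψ * Θ) {σ : Fin l → ℝ} {t : ℝ}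
    (ht : Tendsto (fun x : ℝ => (x : ℂ)⁻¹ * (ev (fFun ε σ Nm Θ) x - ((∑ i, σ i ^ 2 : ℝ) : ℂ)))
      (𝓝[>] 0) (𝓝 (t : ℂ))) :
    Tendsto (fun x : ℝ => (x : ℂ)⁻¹ * (cdiag σ * ((evM Ψ x - evM Ψ 0) * (evM Ψ 0)ᴴ) *
      cdiag σ).trace) (𝓝[>] 0) (𝓝 (((1 - ε) * t : ℝ) : ℂ)) := by
  have hε : ((1 - ε : ℝ) : ℂ) ≠ 0 := by exact_mod_cast (by linarith [h.lt_one] : (1 - ε : ℝ) ≠ 0)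
  rw [Complex.ofReal_mul]
  refine (ht.const_mul ((1 - ε : ℝ) : ℂ)).congr' ?_
  filter_upwards [self_mem_nhdsWithin] with x hx
  have hre : 0 ≤ (x : ℂ).re := by simpa using (Set.mem_Ioi.1 hx).le
  rw [← h.ev_fFun_zero hfac σ, h.ev_fFun hfac σ hre, h.ev_fFun hfac σ (by simp), Matrix.sub_mul,
    Matrix.mul_sub, Matrix.sub_mul, Matrix.trace_sub, ← mul_sub]
  field_simp

end TrackingFactors

end

section

variable {l m : ℕ}

/-! ### Sums of simple fractions with poles in the right half plane -/

/-- `∑ᵢ 2 Re zᵢ / (s - zᵢ) Bᵢ`. -/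
def antiSum (z : Fin m → ℂ) (B : Fin m → Matrix (Fin l) (Fin l) ℂ) (s : ℂ) :
    Matrix (Fin l) (Fin l) ℂ :=
  ∑ i, (2 * ((z i).re : ℂ) / (s - z i)) • B i

lemma antiSum_apply (z : Fin m → ℂ) (B : Fin m → Matrix (Fin l) (Fin l) ℂ) (s : ℂ) (p q : Fin l) :
    antiSum z B s p q = ∑ i, 2 * ((z i).re : ℂ) / (s - z i) * B i p q := by
  simp [antiSum, Matrix.sum_apply]

lemma axis_sub_ne {z : ℂ} (hz : 0 < z.re) (ω : ℝ) : (ω : ℂ) * Complex.I - z ≠ 0 := fun h => by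
  rw [sub_eq_zero] at h
  rw [← h] at hz
  simp at hz

lemma star_axis_coeff (z : ℂ) (ω : ℝ) :
    star (2 * (z.re : ℂ) / ((ω : ℂ) * Complex.I - z)) =
      -(2 * (z.re : ℂ)) * (1 / (star z + ω * Complex.I)) := by
  have h : star ((ω : ℂ) * Complex.I - z) = -(star z + ω * Complex.I) := by
    simp
    ring
  rw [star_div₀, h, div_neg, mul_one_div, neg_div]
  simp

/-- The conjugate of a sum of simple fractions extends from the axis to the Hardy class. -/
lemma exists_isH2_star_antiSum {z : Fin m → ℂ} (hz : ∀ i, 0 < (z i).re)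
    (B : Fin m → Matrix (Fin l) (Fin l) ℂ) (p q : Fin l) :
    ∃ g : ℂ → ℂ, IsH2 g ∧
      ∀ ω : ℝ, g (ω * Complex.I) = star (antiSum z B (ω * Complex.I) p q) := by
  refine ⟨fun s => ∑ i, (-(2 * ((z i).re : ℂ)) * star (B i p q)) * (1 / (star (z i) + s)),
    IsH2.sum _ fun i _ => (IsH2.inv_add (by simpa using hz i)).const_mul _, fun ω => ?_⟩
  rw [antiSum_apply, star_sum]
  refine Finset.sum_congr rfl fun i _ => ?_
  rw [star_mul', star_axis_coeff]
  ring

lemma integrable_nsq_antiSum {z : Fin m → ℂ} (hz : ∀ i, 0 < (z i).re)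
    (B : Fin m → Matrix (Fin l) (Fin l) ℂ) :
    Integrable fun ω : ℝ => nsq (antiSum z B (ω * Complex.I)) := by
  refine integrable_finsetSum _ fun p _ => integrable_finsetSum _ fun q _ => ?_
  obtain ⟨g, hg, hgA⟩ := exists_isH2_star_antiSum hz B p q
  refine hg.integrable_norm_sq.congr (Eventually.of_forall fun ω => ?_)
  simp only [hgA, norm_star]

/-- Functions in the Hardy class are orthogonal to the fractions with poles in the right half
plane. -/
lemma integral_nsq_add_antiSum {z : Fin m → ℂ} (hz : ∀ i, 0 < (z i).re)
    (B : Fin m → Matrix (Fin l) (Fin l) ℂ) {S : ℂ → Matrix (Fin l) (Fin l) ℂ}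
    (hS : ∀ p q, IsH2 fun s => S s p q) :
    Integrable (fun ω : ℝ => nsq (S (ω * Complex.I) + antiSum z B (ω * Complex.I))) ∧
    ∫ ω : ℝ, nsq (S (ω * Complex.I) + antiSum z B (ω * Complex.I)) =
      (∫ ω : ℝ, nsq (S (ω * Complex.I))) + ∫ ω : ℝ, nsq (antiSum z B (ω * Complex.I)) := by
  choose g hg hgA using exists_isH2_star_antiSum hz B
  -- The cross term is the product of a Hardy function with the conjugate of the fractions, which on
  -- the axis is a Hardy function too; such products integrate to zero.
  have hpt : ∀ ω : ℝ, nsq (S (ω * Complex.I) + antiSum z B (ω * Complex.I)) =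
      nsq (S (ω * Complex.I)) + nsq (antiSum z B (ω * Complex.I)) +
      2 * (∑ p, ∑ q, g p q (ω * Complex.I) * S (ω * Complex.I) p q).re := fun ω => by
    simp only [nsq, Complex.re_sum, Finset.mul_sum, ← Finset.sum_add_distrib, hgA,
      Matrix.add_apply]
    refine Finset.sum_congr rfl fun p _ => Finset.sum_congr rfl fun q _ => ?_
    rw [← Complex.normSq_eq_norm_sq, ← Complex.normSq_eq_norm_sq, ← Complex.normSq_eq_norm_sq,
      Complex.normSq_add, mul_comm (star _), Complex.star_def]
  have h1 : Integrable fun ω : ℝ => nsq (S (ω * Complex.I)) :=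
    integrable_finsetSum _ fun p _ => integrable_finsetSum _ fun q _ => (hS p q).integrable_norm_sq
  have h2 := integrable_nsq_antiSum hz B
  have h3 : Integrable fun ω : ℝ => ∑ p, ∑ q, g p q (ω * Complex.I) * S (ω * Complex.I) p q :=
    integrable_finsetSum _ fun p _ => integrable_finsetSum _ fun q _ =>
      ((hg p q).integral_mul (hS p q)).1
  have h4 : ∫ ω : ℝ, ∑ p, ∑ q, g p q (ω * Complex.I) * S (ω * Complex.I) p q = 0 := by
    rw [integral_finsetSum _ fun p _ => integrable_finsetSum _ fun q _ =>
      ((hg p q).integral_mul (hS p q)).1]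
    refine Finset.sum_eq_zero fun p _ => ?_
    rw [integral_finsetSum _ fun q _ => ((hg p q).integral_mul (hS p q)).1]
    exact Finset.sum_eq_zero fun q _ => ((hg p q).integral_mul (hS p q)).2
  have h5 : ∫ ω : ℝ, (∑ p, ∑ q, g p q (ω * Complex.I) * S (ω * Complex.I) p q).re = 0 := by
    have := integral_re h3
    simp only [RCLike.re_eq_complex_re] at this
    rw [this, h4, Complex.zero_re]
  have h6 : Integrable fun ω : ℝ =>
      2 * (∑ p, ∑ q, g p q (ω * Complex.I) * S (ω * Complex.I) p q).re := h3.re.const_mul 2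
  have h7 : Integrable fun ω : ℝ =>
      nsq (S (ω * Complex.I)) + nsq (antiSum z B (ω * Complex.I)) := h1.add h2
  simp only [hpt]
  refine ⟨h7.add h6, ?_⟩
  rw [integral_add h7 h6, integral_add h1 h2, integral_const_mul, h5]
  ring

/-- The energy of a sum of simple fractions. -/
lemma integral_nsq_antiSum {z : Fin m → ℂ} (hz : ∀ i, 0 < (z i).re)
    (B : Fin m → Matrix (Fin l) (Fin l) ℂ) :
    ((∫ ω : ℝ, nsq (antiSum z B (ω * Complex.I)) : ℝ) : ℂ) = 2 * Real.pi *
      ∑ i, ∑ j, (4 * (z i).re * (z j).re : ℂ) / (star (z i) + z j) * ((B i)ᴴ * B j).trace := by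
  have hk : ∀ i j, Integrable (fun ω : ℝ =>
      1 / ((star (z i) + ω * Complex.I) * (z j - ω * Complex.I))) ∧
      ∫ ω : ℝ, 1 / ((star (z i) + ω * Complex.I) * (z j - ω * Complex.I)) =
        2 * Real.pi / (star (z i) + z j) := fun i j =>
    integral_kernel (by simpa using hz i) (hz j)
  have hpt : ∀ ω : ℝ, (nsq (antiSum z B (ω * Complex.I)) : ℂ) = ∑ i, ∑ j,
      (4 * (z i).re * (z j).re * ((B i)ᴴ * B j).trace : ℂ) *
        (1 / ((star (z i) + ω * Complex.I) * (z j - ω * Complex.I))) := fun ω => by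
    rw [nsq_eq_trace, antiSum, Matrix.conjTranspose_sum, Matrix.sum_mul, Matrix.trace_sum]
    refine Finset.sum_congr rfl fun i _ => ?_
    rw [Matrix.mul_sum, Matrix.trace_sum]
    refine Finset.sum_congr rfl fun j _ => ?_
    rw [Matrix.conjTranspose_smul, Matrix.smul_mul, Matrix.mul_smul, Matrix.trace_smul,
      Matrix.trace_smul, star_axis_coeff, smul_eq_mul, smul_eq_mul]
    have h1 : star (z i) + ω * Complex.I ≠ 0 := by
      rw [add_comm]
      exact re_pos_add_star_ne (hz i) (by simp)
    have h2 := axis_sub_ne (hz j) ω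
    have h3 : z j - ω * Complex.I ≠ 0 := by
      rw [← neg_sub]
      exact neg_ne_zero.2 h2
    rw [show (ω : ℂ) * Complex.I - z j = -(z j - ω * Complex.I) by ring]
    field_simp
    ring
  rw [← integral_complex_ofReal]
  simp only [hpt]
  rw [integral_finsetSum _ fun i _ => integrable_finsetSum _ fun j _ => (hk i j).1.const_mul _,
    Finset.mul_sum]
  refine Finset.sum_congr rfl fun i _ => ?_
  rw [integral_finsetSum _ fun j _ => (hk i j).1.const_mul _, Finset.mul_sum]
  refine Finset.sum_congr rfl fun j _ => ?_
  rw [integral_const_mul, (hk i j).2]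
  ring

/-- Each argument contains a projection onto a line, so the trace splits into two scalars: one for
the outer products on the right, one for the weighted products on the left. These are the two forms
in the double sum. -/
lemma trace_lineProj_sandwich (u v : EuclideanSpace ℂ (Fin l))
    (A A' K K' : Matrix (Fin l) (Fin l) ℂ) :
    ((K * lineProj u * A)ᴴ * (K' * lineProj v * A')).trace =
      sesq v (A' * Aᴴ) u * sesq u (Kᴴ * K') v := by
  rw [Matrix.conjTranspose_mul, Matrix.conjTranspose_mul, lineProj_conjTranspose]
  have h1 : lineProj u * (Kᴴ * K') * lineProj v =
      sesq u (Kᴴ * K') v • vecMulVec (fun i => u i) (fun i => star (v i)) := by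
    rw [lineProj, lineProj, Matrix.mul_assoc, Matrix.mul_vecMulVec, Matrix.vecMulVec_mul_vecMulVec,
      sesq]
    ext i j
    simp [Matrix.vecMulVec_apply]
    ring
  have h2 : Aᴴ * (lineProj u * Kᴴ) * (K' * lineProj v * A') =
      Aᴴ * (lineProj u * (Kᴴ * K') * lineProj v) * A' := by
    simp only [Matrix.mul_assoc]
  rw [h2, h1, Matrix.mul_smul, Matrix.smul_mul, Matrix.trace_smul, smul_eq_mul, mul_comm,
    Matrix.mul_assoc, Matrix.trace_mul_comm, Matrix.mul_assoc, Matrix.vecMulVec_mul,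
    Matrix.trace_vecMulVec, sesq, sesq, Matrix.dotProduct_mulVec, Matrix.dotProduct_mulVec,
    dotProduct_comm (fun i => u i)]

/-- The double sum as the energy of the fractions. -/
lemma noiseTerm_eq {γ : Fin l → ℝ} {z : Fin m → ℂ} (hz : ∀ i, 0 < (z i).re)
    (w : Fin m → EuclideanSpace ℂ (Fin l)) (O : Fin m → Matrix (Fin l) (Fin l) ℂ) :
    ((∫ ω : ℝ, nsq (antiSum z (fun i => O i * cdiag γ * (Dl z w i * lineProj (w i) * Dr z w i))
      (ω * Complex.I)) : ℝ) : ℂ) = 2 * Real.pi * noiseTerm γ z w O := by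
  rw [integral_nsq_antiSum hz, noiseTerm]
  congr 1
  refine Finset.sum_congr rfl fun i _ => Finset.sum_congr rfl fun j _ => ?_
  have h : ∀ i, O i * cdiag γ * (Dl z w i * lineProj (w i) * Dr z w i) =
      (O i * cdiag γ * Dl z w i) * lineProj (w i) * Dr z w i := fun i => by
    simp only [Matrix.mul_assoc]
  rw [h i, h j, trace_lineProj_sandwich, Matrix.conjTranspose_mul, Matrix.conjTranspose_mul,
    ← mul_assoc]
  simp only [Matrix.mul_assoc]

end

/-! ### Splitting `T D⁻¹` into a Hardy part and simple fractions -/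

section

variable {l m : ℕ}

/-- Meant for the outer factor, whose size is known on the axis only. If the degrees were equal,
`|g|` would be bounded below at large imaginary points. -/
lemma Stable.strictlyProper_of_axis_bound {g : RatFunc ℝ} (hg : Stable g) {c : ℝ}
    (h : ∀ ω : ℝ, ‖ev g (ω * Complex.I)‖ ≤ c / (1 + |ω|)) : StrictlyProper g := by
  by_contra hs
  have hd : (g.denom.map (algebraMap ℝ ℂ)).degree ≤ (g.num.map (algebraMap ℝ ℂ)).degree := by
    simpa [Polynomial.degree_map] using not_lt.1 hs
  obtain ⟨d, hd0, ho⟩ := (Polynomial.isBigO_cobounded_of_degree_le hd).exists_pos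
  have ho2 := ho.bound
  simp only [Polynomial.eval_map_algebraMap] at ho2
  obtain ⟨r, -, hr⟩ := (Filter.hasBasis_cobounded_norm (E := ℂ)).eventually_iff.1 ho2
  set ω : ℝ := max r (max 0 (d * c)) with hω
  have hω0 : 0 ≤ ω := (le_max_left _ _).trans (le_max_right _ _)
  have hωc : d * c ≤ ω := (le_max_right _ _).trans (le_max_right _ _)
  have h1 := hr (show r ≤ ‖(ω : ℂ) * Complex.I‖ by
    rw [norm_axis, abs_of_nonneg hω0]
    exact le_max_left _ _)
  have hp : 0 < ‖Polynomial.aeval ((ω : ℂ) * Complex.I) g.denom‖ :=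
    norm_pos_iff.2 (hg.2 _ (by simp))
  have h2 : 1 ≤ d * ‖ev g (ω * Complex.I)‖ := by
    rw [ev_eq_div, norm_div, ← mul_div_assoc, le_div_iff₀ hp, one_mul]
    exact h1
  have h3 := h2.trans (mul_le_mul_of_nonneg_left (h ω) hd0.le)
  rw [abs_of_nonneg hω0, ← mul_div_assoc, le_div_iff₀ (by positivity)] at h3
  linarith

/-! ### Real partial fractions -/

/-- The real rational function `Re (c / (s - z))`, that is `(c / (s - z) + c̄ / (s - z̄)) / 2`. -/
def realFraction (z c : ℂ) : RatFunc ℝ :=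
  algebraMap (Polynomial ℝ) (RatFunc ℝ)
      (Polynomial.C c.re * Polynomial.X - Polynomial.C (c * star z).re) /
    algebraMap (Polynomial ℝ) (RatFunc ℝ) (Polynomial.X ^ 2 -
      Polynomial.C (2 * z.re) * Polynomial.X + Polynomial.C (‖z‖ ^ 2))

lemma aeval_realFraction_denom (z s : ℂ) : Polynomial.aeval s ((Polynomial.X ^ 2 -
    Polynomial.C (2 * z.re) * Polynomial.X + Polynomial.C (‖z‖ ^ 2) : Polynomial ℝ)) =
    (s - z) * (s - star z) := by
  simp only [map_add, map_sub, map_mul, map_pow, Polynomial.aeval_X, Polynomial.aeval_C,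
    Complex.coe_algebraMap]
  push_cast
  rw [← self_mul_star, ← star_add_self]
  ring

lemma ev_realFraction (z c : ℂ) {s : ℂ} (h : s ≠ z) (h' : s ≠ star z) :
    ev (realFraction z c) s = 1 / 2 * (c / (s - z) + star (c / (star s - z))) := by
  have h1 : s - z ≠ 0 := sub_ne_zero.2 h
  have h2 : s - star z ≠ 0 := sub_ne_zero.2 h'
  have h3 := star_add_self c
  have h4 := star_add_self (c * star z)
  rw [star_mul', star_star] at h4
  rw [realFraction, ev_div_poly _ (by rw [aeval_realFraction_denom]; exact mul_ne_zero h1 h2),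
    aeval_realFraction_denom, star_div₀, star_sub, star_star]
  simp only [map_sub, map_mul, Polynomial.aeval_X, Polynomial.aeval_C, Complex.coe_algebraMap]
  field_simp
  linear_combination (-s) * h3 + h4

/-! ### Projection onto the Hardy class -/

/-- The data of the noise part of the cost: `T` is the noise response for `R = 0` and
`T - Δ R E` the response for a free parameter `R`, where `E = C D`. -/
structure NoiseFactors (z : Fin m → ℂ) (w : Fin m → EuclideanSpace ℂ (Fin l))
    (Δ T E C : RMat (Fin l) (Fin l)) : Prop where
  re_pos : ∀ i, 0 < (z i).re
  unit : ∀ i, ‖w i‖ = 1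
  row : ∀ i j k, i ≤ j → j ≤ k → z i = z k → z j = z i
  orth : ∀ i j, i ≠ j → z i = z j → star (w i : Fin l → ℂ) ⬝ᵥ (w j : Fin l → ℂ) = 0
  minPhase_Δ : MinPhase Δ
  minPhase_C : MinPhase C
  stable_T : RHinf T
  strictlyProper_T : StrictlyProperM T
  stable_E : RHinf E
  strictlyProper_E : StrictlyProperM E
  factor : ∀ s : ℂ, 0 ≤ s.re → evM E s = evM C s * prodD z w s

/-- The residue of `T D⁻¹` at `zᵢ`, up to the factor `2 Re zᵢ`. -/
def residueD (z : Fin m → ℂ) (w : Fin m → EuclideanSpace ℂ (Fin l)) (T : RMat (Fin l) (Fin l))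
    (i : Fin m) : Matrix (Fin l) (Fin l) ℂ :=
  evM T (z i) * (Dl z w i * lineProj (w i) * Dr z w i)

/-- The part of `T D⁻¹` without poles in the right half plane. -/
def hardyPart (z : Fin m → ℂ) (w : Fin m → EuclideanSpace ℂ (Fin l)) (T : RMat (Fin l) (Fin l))
    (s : ℂ) : Matrix (Fin l) (Fin l) ℂ :=
  evM T s + ∑ i, (2 * ((z i).re : ℂ)) •
    ((Matrix.of fun p r => dslope (ev (T p r)) (z i) s) *
      (Dl z w i * lineProj (w i) * Dr z w i))

lemma isH2_hardyPart {z : Fin m → ℂ} (hz : ∀ i, 0 < (z i).re)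
    (w : Fin m → EuclideanSpace ℂ (Fin l)) {T : RMat (Fin l) (Fin l)} (hT : RHinf T)
    (hTs : StrictlyProperM T) (p q : Fin l) : IsH2 fun s => hardyPart z w T s p q := by
  have h : ∀ s, hardyPart z w T s p q = ev (T p q) s + ∑ i, (2 * ((z i).re : ℂ)) *
      ∑ r, dslope (ev (T p r)) (z i) s * (Dl z w i * lineProj (w i) * Dr z w i) r q := fun s => by
    simp only [hardyPart, Matrix.add_apply, Matrix.sum_apply, Matrix.smul_apply, Matrix.mul_apply,
      smul_eq_mul, evM_apply, Matrix.of_apply]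
  simp only [h]
  have hT2 : ∀ p r, IsH2 (ev (T p r)) := fun p r => IsH2.of_stable (hT p r) (hTs p r)
  exact (hT2 p q).add (IsH2.sum _ fun i _ => (IsH2.sum _ fun r _ =>
    ((hT2 p r).dslope (hz i)).mul_const _).const_mul _)

namespace NoiseFactors

variable {z : Fin m → ℂ} {w : Fin m → EuclideanSpace ℂ (Fin l)} {Δ T E C : RMat (Fin l) (Fin l)}

/-- In each simple fraction of `D⁻¹`, `T(s)` is written as `T(zᵢ)` plus `s - zᵢ` times a difference
quotient; the second term removes the pole and goes to the Hardy part. -/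
lemma mul_prodDinv (h : NoiseFactors z w Δ T E C) (T' : RMat (Fin l) (Fin l)) {s : ℂ}
    (hs : ∀ i, s ≠ z i) :
    evM T' s * prodDinv z w s = hardyPart z w T' s + antiSum z (residueD z w T') s := by
  have hd : ∀ i, (Matrix.of fun p r => dslope (ev (T' p r)) (z i) s) =
      (s - z i)⁻¹ • (evM T' s - evM T' (z i)) := fun i => by
    ext p r
    rw [Matrix.of_apply, dslope_of_ne _ (hs i), slope_def_field]
    simp [evM_apply, div_eq_inv_mul]
  rw [prodDinv_eq h.re_pos h.unit h.row h.orth hs, Matrix.mul_add, Matrix.mul_one, hardyPart,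
    antiSum, add_assoc, ← Finset.sum_add_distrib, Matrix.mul_sum]
  congr 1
  refine Finset.sum_congr rfl fun i _ => ?_
  rw [hd, residueD, Matrix.mul_smul, Matrix.smul_mul, Matrix.sub_mul, smul_smul, smul_sub,
    div_eq_mul_inv]
  abel

/-- The parameter enters through `E = C D`, and `D(zᵢ) Dᵢˡ ωᵢ = 0`. So no choice of `R` changes the
part with poles in the right half plane. -/
lemma residueD_eq (h : NoiseFactors z w Δ T E C) {R : RMat (Fin l) (Fin l)} (hR : RHinf R) :
    residueD z w (T - Δ * R * E) = residueD z w T := by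
  funext i
  have hs := (h.re_pos i).le
  have hk := prodD_mul_Dl h.re_pos h.unit h.row h.orth i
  rw [residueD, residueD, evM_sub (h.stable_T.noPole hs)
    (((h.minPhase_Δ.1.mul hR).mul h.stable_E).noPole hs),
    evM_mul ((h.minPhase_Δ.1.mul hR).noPole hs) (h.stable_E.noPole hs), h.factor _ hs,
    Matrix.sub_mul, sub_eq_self]
  calc _ = evM (Δ * R) (z i) * evM C (z i) * (prodD z w (z i) * Dl z w i * lineProj (w i)) *
        Dr z w i := by simp only [Matrix.mul_assoc]
    _ = 0 := by rw [hk, Matrix.mul_zero, Matrix.zero_mul]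

lemma axis_ne (h : NoiseFactors z w Δ T E C) (ω : ℝ) (i : Fin m) : (ω : ℂ) * Complex.I ≠ z i :=
  sub_ne_zero.1 (axis_sub_ne (h.re_pos i) ω)

/-- Lower bound of the noise cost. -/
lemma le_lintegral (h : NoiseFactors z w Δ T E C) {R : RMat (Fin l) (Fin l)} (hR : RHinf R) :
    ENNReal.ofReal (∫ ω : ℝ, nsq (antiSum z (residueD z w T) (ω * Complex.I))) ≤
      ∫⁻ ω : ℝ, ENNReal.ofReal (nsq (evM (T - Δ * R * E) (ω * Complex.I))) := by
  have hst : RHinf (T - Δ * R * E) :=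
    h.stable_T.sub ((h.minPhase_Δ.1.mul hR).mul h.stable_E)
  have hsp : StrictlyProperM (T - Δ * R * E) := fun p q => by
    rw [sub_eq_add_neg, ← Matrix.neg_mul]
    exact (h.strictlyProper_T p q).add
      (h.strictlyProper_E.proper_mul (h.minPhase_Δ.1.mul hR).neg.proper p q)
  -- Right multiplication by `D⁻¹` is unitary on the axis, so it does not change the density, and it
  -- separates the fractions from a Hardy function.
  have hpt : ∀ ω : ℝ, nsq (evM (T - Δ * R * E) (ω * Complex.I)) =
      nsq (hardyPart z w (T - Δ * R * E) (ω * Complex.I) +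
        antiSum z (residueD z w T) (ω * Complex.I)) := fun ω => by
    rw [← nsq_mul_unitary (prodDinv_unitary h.re_pos h.unit ω), h.mul_prodDinv _ (h.axis_ne ω),
      h.residueD_eq hR]
  obtain ⟨h1, h2⟩ := integral_nsq_add_antiSum h.re_pos (residueD z w T)
    (isH2_hardyPart h.re_pos w hst hsp)
  simp only [hpt]
  rw [← ofReal_integral_eq_lintegral_ofReal h1 (Eventually.of_forall fun ω => nsq_nonneg _), h2]
  refine ENNReal.ofReal_le_ofReal (le_add_of_nonneg_left (integral_nonneg fun ω => nsq_nonneg _))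

/-- The real rational part of `T D⁻¹` with poles in the right half plane. -/
def antiRat (z : Fin m → ℂ) (w : Fin m → EuclideanSpace ℂ (Fin l)) (T : RMat (Fin l) (Fin l)) :
    RMat (Fin l) (Fin l) :=
  Matrix.of fun p q => ∑ i, realFraction (z i) (2 * ((z i).re : ℂ) * residueD z w T i p q)

lemma not_isPole_realFraction {z s : ℂ} (c : ℂ) (h : s ≠ z) (h' : s ≠ star z) :
    ¬ IsPole (realFraction z c) s :=
  not_isPole_div_poly _ (by
    rw [aeval_realFraction_denom]
    exact mul_ne_zero (sub_ne_zero.2 h) (sub_ne_zero.2 h'))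

lemma evM_antiRat (z : Fin m → ℂ) (w : Fin m → EuclideanSpace ℂ (Fin l))
    (T : RMat (Fin l) (Fin l)) {s : ℂ} (hs : ∀ i, s ≠ z i) (hs' : ∀ i, s ≠ star (z i))
    (p q : Fin l) :
    evM (antiRat z w T) s p q = 1 / 2 * (antiSum z (residueD z w T) s p q +
      star (antiSum z (residueD z w T) (star s) p q)) := by
  rw [evM_apply, antiRat, Matrix.of_apply,
    ev_sum _ fun i _ => not_isPole_realFraction _ (hs i) (hs' i), antiSum_apply, antiSum_apply,
    star_sum, ← Finset.sum_add_distrib, Finset.mul_sum]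
  refine Finset.sum_congr rfl fun i _ => ?_
  have hd : ∀ d : ℂ, 2 * ((z i).re : ℂ) / d * residueD z w T i p q =
      2 * ((z i).re : ℂ) * residueD z w T i p q / d := fun d => by ring
  rw [ev_realFraction _ _ (hs i) (hs' i), hd, hd]

lemma noPole_antiRat (z : Fin m → ℂ) (w : Fin m → EuclideanSpace ℂ (Fin l))
    (T : RMat (Fin l) (Fin l)) {s : ℂ} (hs : ∀ i, s ≠ z i) (hs' : ∀ i, s ≠ star (z i)) :
    NoPole (antiRat z w T) s := fun p q => by
  rw [antiRat, Matrix.of_apply]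
  exact not_isPole_sum _ fun i _ => not_isPole_realFraction _ (hs i) (hs' i)

lemma eventually_ne (z : Fin m → ℂ) :
    ∀ᶠ s : ℂ in cofinite, (∀ i, s ≠ z i) ∧ ∀ i, s ≠ star (z i) :=
  (eventually_all.2 fun i => (Set.finite_singleton (z i)).eventually_cofinite_notMem).and
    (eventually_all.2 fun i => (Set.finite_singleton (star (z i))).eventually_cofinite_notMem)

lemma det_E_ne_zero (h : NoiseFactors z w Δ T E C) : E.det ≠ 0 := by
  intro h0
  have h1 : ∀ᶠ s : ℂ in cofinite, ∀ i, s ≠ z i := (eventually_ne z).mono fun s hs => hs.1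
  obtain ⟨x, hx, hx0⟩ := (((tendsto_add_real_cofinite 0).mono_left
    (nhdsGT_le_cofinite 0)).eventually h1 |>.and self_mem_nhdsWithin).exists
  have hx' : 0 < ((0 : ℂ) + (x : ℂ)).re := by simpa using hx0
  have h2 := ev_det (h.stable_E.noPole hx'.le)
  rw [h0, ev_zero, h.factor _ hx'.le, Matrix.det_mul, eq_comm, mul_eq_zero] at h2
  refine h2.elim (h.minPhase_C.2 _ hx') fun h3 => ?_
  have h4 := congrArg Matrix.det (prodD_mul_prodDinv h.re_pos h.unit hx'.le hx)
  rw [Matrix.det_mul, h3, zero_mul, Matrix.det_one] at h4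
  exact zero_ne_one h4

/-- `D` is given by complex factors, but in the right half plane `D = C⁻¹ E`. Thus `T D⁻¹` agrees
with the real rational `T E⁻¹ C`, from which a real parameter `R` can be built. -/
lemma evM_quotient (h : NoiseFactors z w Δ T E C) :
    ∀ᶠ s : ℂ in cofinite, 0 ≤ s.re → NoPole (T * E⁻¹ * C) s ∧
      evM (T * E⁻¹ * C) s = evM T s * prodDinv z w s := by
  filter_upwards [eventually_evM_inv h.det_E_ne_zero, eventually_noPole E⁻¹, eventually_ne z]
    with s h1 h2 h3 hs
  have nT := h.stable_T.noPole hs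
  have nC := h.minPhase_C.1.noPole hs
  refine ⟨(nT.mul h2).mul nC, ?_⟩
  have hD := prodD_mul_prodDinv h.re_pos h.unit hs h3.1
  have hC : IsUnit (evM C s).det := by
    have := h1.1
    rw [h.factor s hs, Matrix.det_mul] at this
    exact isUnit_iff_ne_zero.2 (left_ne_zero_of_mul this)
  rw [evM_mul (nT.mul h2) nC, evM_mul nT h2, h1.2, h.factor s hs, Matrix.mul_inv_rev,
    Matrix.inv_eq_right_inv hD, Matrix.mul_assoc, Matrix.mul_assoc _ _ (evM C s),
    Matrix.nonsing_inv_mul _ hC, Matrix.mul_one]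

lemma eventually_star {p : ℂ → Prop} (h : ∀ᶠ s in cofinite, p s) :
    ∀ᶠ s in cofinite, p (star s) :=
  (Function.Injective.tendsto_cofinite star_injective).eventually h

/-- The part of `T D⁻¹` in the Hardy class is real rational. -/
lemma stable_hardyRat (h : NoiseFactors z w Δ T E C) :
    RHinf (T * E⁻¹ * C - antiRat z w T) ∧ StrictlyProperM (T * E⁻¹ * C - antiRat z w T) := by
  -- A real rational function equals its conjugate reflection. Averaging the decomposition of `T
  -- D⁻¹` with its reflection turns the fractions into `antiRat`, and the remainder into an average
  -- of two Hardy functions.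
  have hev : ∀ p q, ∀ᶠ s : ℂ in cofinite, 0 < s.re →
      ev ((T * E⁻¹ * C - antiRat z w T) p q) s =
        1 / 2 * (hardyPart z w T s p q + star (hardyPart z w T (star s) p q)) := fun p q => by
    filter_upwards [h.evM_quotient, eventually_star h.evM_quotient, eventually_ne z] with s h1 h2 h3 hs
    have hs' : 0 ≤ (star s).re := by simpa using hs.le
    obtain ⟨a1, a2⟩ := h1 hs.le
    obtain ⟨-, b2⟩ := h2 hs'
    have hne : ∀ i, star s ≠ z i := fun i hi => h3.2 i (by rw [← hi, star_star])
    rw [h.mul_prodDinv T h3.1] at a2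
    rw [h.mul_prodDinv T hne, evM_conj] at b2
    have c1 := congrFun (congrFun a2 p) q
    have c2 := congrArg star (congrFun (congrFun b2 p) q)
    rw [Matrix.map_apply, star_star] at c2
    rw [← evM_apply, evM_sub a1 (noPole_antiRat z w T h3.1 h3.2), Matrix.sub_apply,
      evM_antiRat z w T h3.1 h3.2]
    simp only [Matrix.add_apply, star_add] at c1 c2
    linear_combination 1 / 2 * c1 + 1 / 2 * c2
  have hb : ∀ p q, ∃ c : ℝ, 0 ≤ c ∧ ∀ᶠ s : ℂ in cofinite, 0 < s.re →
      ‖ev ((T * E⁻¹ * C - antiRat z w T) p q) s‖ ≤ c / (1 + ‖s‖) := fun p q => by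
    obtain ⟨c, hc0, hc⟩ := (isH2_hardyPart h.re_pos w h.stable_T h.strictlyProper_T p q).exists_bound
    refine ⟨c, hc0, (hev p q).mono fun s h1 hs => ?_⟩
    rw [h1 hs, norm_mul]
    have h2 := hc s hs.le
    have h3 := hc (star s) (by simpa using hs.le)
    have h4 := norm_add_le (hardyPart z w T s p q) (star (hardyPart z w T (star s) p q))
    rw [norm_star] at h3 h4
    have h5 : ‖(1 / 2 : ℂ)‖ = 1 / 2 := by norm_num
    rw [h5]
    linarith
  refine ⟨fun p q => ?_, fun p q => ?_⟩
  · obtain ⟨c, hc0, hc⟩ := hb p q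
    refine stable_of_bound (C := c) (hc.mono fun s h1 hs => (h1 hs).trans ?_)
    exact div_le_self hc0 (by linarith [norm_nonneg s])
  · obtain ⟨c, hc0, hc⟩ := hb p q
    refine strictlyProper_of_bound (C := c) (hc.mono fun s h1 hs => ?_)
    rw [norm_mul]
    refine (mul_le_mul_of_nonneg_left (h1 hs) (norm_nonneg s)).trans ?_
    rw [mul_div_assoc', div_le_iff₀ (by positivity)]
    nlinarith [norm_nonneg s]

end NoiseFactors

end

/-! ### Approaching the infimum of the noise cost -/

section

variable {l m : ℕ}

lemma nsq_add_le {p q : Type*} [Fintype p] [Fintype q] (A B : Matrix p q ℂ) :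
    nsq (A + B) ≤ 2 * nsq A + 2 * nsq B := by
  simp only [nsq, Finset.mul_sum, ← Finset.sum_add_distrib, Matrix.add_apply]
  refine Finset.sum_le_sum fun i _ => Finset.sum_le_sum fun j _ => ?_
  have h := pow_le_pow_left₀ (norm_nonneg _) (norm_add_le (A i j) (B i j)) 2
  nlinarith [sq_nonneg (‖A i j‖ - ‖B i j‖)]

lemma nsq_smul {p q : Type*} [Fintype p] [Fintype q] (c : ℂ) (A : Matrix p q ℂ) :
    nsq (c • A) = ‖c‖ ^ 2 * nsq A := by
  simp only [nsq, Finset.mul_sum, Matrix.smul_apply, smul_eq_mul, norm_mul, mul_pow]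

lemma measurable_nsq_evM (A : RMat (Fin l) (Fin l)) :
    Measurable fun ω : ℝ => nsq (evM A (ω * Complex.I)) :=
  Finset.measurable_sum _ fun i _ => Finset.measurable_sum _ fun j _ =>
    (measurable_ev_axis (A i j)).norm.pow_const 2

namespace NoiseFactors

variable {z : Fin m → ℂ} {w : Fin m → EuclideanSpace ℂ (Fin l)} {Δ T E C : RMat (Fin l) (Fin l)}

/-- `antiRat` is an average of the fractions and their reflection, and averaging does not increase
the squared norm. After integration both halves are equal, so symmetrizing costs no energy and
`antiRat` need not be identified with `antiSum`. -/
lemma nsq_antiRat_le (h : NoiseFactors z w Δ T E C) (ω : ℝ) :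
    nsq (evM (antiRat z w T) (ω * Complex.I)) ≤
      1 / 2 * (nsq (antiSum z (residueD z w T) (ω * Complex.I)) +
        nsq (antiSum z (residueD z w T) (((-ω : ℝ) : ℂ) * Complex.I))) := by
  have hstar : star ((ω : ℂ) * Complex.I) = ((-ω : ℝ) : ℂ) * Complex.I := by simp
  have hs' : ∀ i, (ω : ℂ) * Complex.I ≠ star (z i) := fun i hi => by
    refine h.axis_ne (-ω) i ?_
    rw [← hstar, hi, star_star]
  simp only [nsq, Finset.mul_sum, ← Finset.sum_add_distrib]
  refine Finset.sum_le_sum fun p _ => Finset.sum_le_sum fun q _ => ?_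
  rw [evM_antiRat z w T (h.axis_ne ω) hs', hstar, norm_mul]
  set a := antiSum z (residueD z w T) (ω * Complex.I) p q
  set b := antiSum z (residueD z w T) (((-ω : ℝ) : ℂ) * Complex.I) p q
  have h1 := pow_le_pow_left₀ (norm_nonneg _) (norm_add_le a (star b)) 2
  rw [norm_star] at h1
  have h5 : ‖(1 / 2 : ℂ)‖ = 1 / 2 := by norm_num
  rw [h5]
  nlinarith [sq_nonneg (‖a‖ - ‖b‖)]

lemma integrable_half_sum (h : NoiseFactors z w Δ T E C) :
    Integrable fun ω : ℝ => 1 / 2 * (nsq (antiSum z (residueD z w T) (ω * Complex.I)) +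
        nsq (antiSum z (residueD z w T) (((-ω : ℝ) : ℂ) * Complex.I))) :=
  ((integrable_nsq_antiSum h.re_pos _).add (integrable_nsq_antiSum h.re_pos _).comp_neg).const_mul _

lemma lintegral_antiRat_le (h : NoiseFactors z w Δ T E C) :
    ∫⁻ ω : ℝ, ENNReal.ofReal (nsq (evM (antiRat z w T) (ω * Complex.I))) ≤
      ENNReal.ofReal (∫ ω : ℝ, nsq (antiSum z (residueD z w T) (ω * Complex.I))) := by
  have h1 := integrable_nsq_antiSum h.re_pos (residueD z w T)
  have h2 : ∫ ω : ℝ, nsq (antiSum z (residueD z w T) (((-ω : ℝ) : ℂ) * Complex.I)) =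
      ∫ ω : ℝ, nsq (antiSum z (residueD z w T) (ω * Complex.I)) :=
    integral_neg_eq_self (fun ω : ℝ => nsq (antiSum z (residueD z w T) (ω * Complex.I))) volume
  have h3 : ∫ ω : ℝ, 1 / 2 * (nsq (antiSum z (residueD z w T) (ω * Complex.I)) +
        nsq (antiSum z (residueD z w T) (((-ω : ℝ) : ℂ) * Complex.I))) =
      ∫ ω : ℝ, nsq (antiSum z (residueD z w T) (ω * Complex.I)) := by
    rw [integral_const_mul, integral_add h1 h1.comp_neg, h2]
    ring
  rw [← h3, ofReal_integral_eq_lintegral_ofReal h.integrable_half_sum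
    (Eventually.of_forall fun ω => mul_nonneg (by norm_num) (add_nonneg (nsq_nonneg _) (nsq_nonneg _)))]
  exact lintegral_mono fun ω => ENNReal.ofReal_le_ofReal (h.nsq_antiRat_le ω)

/-- The lower bound of the noise cost is approached. -/
lemma exists_lintegral_le (h : NoiseFactors z w Δ T E C) {δ : ℝ} (hδ : 0 < δ) :
    ∃ R, RHinf R ∧ ∫⁻ ω : ℝ, ENNReal.ofReal (nsq (evM (T - Δ * R * E) (ω * Complex.I))) ≤
      ENNReal.ofReal ((∫ ω : ℝ, nsq (antiSum z (residueD z w T) (ω * Complex.I))) + δ) := by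
  obtain ⟨hS, hSs⟩ := h.stable_hardyRat
  set S := T * E⁻¹ * C - antiRat z w T with hSdef
  set A := antiRat z w T with hA
  have hΔ := h.minPhase_Δ.1
  have hC := h.minPhase_C.1
  obtain ⟨k, hk, hk1, hk2⟩ := exists_approx_inverse (hΔ.det.mul hC.det) fun s hs => by
    rw [ev_mul (hΔ.det.not_isPole hs.le) (hC.det.not_isPole hs.le), ev_det (hΔ.noPole hs.le),
      ev_det (hC.noPole hs.le)]
    exact mul_ne_zero (h.minPhase_Δ.2 s hs) (h.minPhase_C.2 s hs)
  set θ : ℕ → ℝ → ℂ := fun n ω => ev (Δ.det * C.det) (ω * Complex.I) * ev (k n) (ω * Complex.I)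
    with hθ
  -- The ideal parameter is `Δ⁻¹ S C⁻¹`. With adjugates in place of inverses and a stable
  -- approximate inverse of `det Δ · det C`, the product `Δ R C` becomes the scalar `θ` times `S`.
  set R : ℕ → RMat (Fin l) (Fin l) := fun n => k n • (Δ.adjugate * S * C.adjugate) with hRdef
  have hR : ∀ n, RHinf (R n) := fun n =>
    RHinf.smul (hk n) ((hΔ.adjugate.mul hS).mul hC.adjugate)
  have hprod : ∀ n, Δ * R n * C = (Δ.det * C.det * k n) • S := fun n => by
    rw [hRdef]
    simp only [Matrix.mul_smul, Matrix.smul_mul]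
    calc k n • (Δ * (Δ.adjugate * S * C.adjugate) * C) =
          k n • ((Δ * Δ.adjugate) * S * (C.adjugate * C)) := by simp only [Matrix.mul_assoc]
      _ = _ := by
        rw [Matrix.mul_adjugate, Matrix.adjugate_mul, Matrix.smul_mul, Matrix.one_mul,
          Matrix.mul_smul, Matrix.mul_one, smul_smul, smul_smul]
        congr 1
        ring
  have hpt : ∀ᵐ ω : ℝ, ∀ n, nsq (evM (T - Δ * R n * E) (ω * Complex.I)) =
      nsq ((1 - θ n ω) • evM S (ω * Complex.I) + evM A (ω * Complex.I)) := by
    filter_upwards [ae_of_cofinite h.evM_quotient, ae_of_cofinite (eventually_ne z)] with ω h1 h2 n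
    have hs : 0 ≤ ((ω : ℂ) * Complex.I).re := by simp
    obtain ⟨a1, a2⟩ := h1 hs
    have nA := noPole_antiRat z w T h2.1 h2.2
    have e1 : evM T (ω * Complex.I) * prodDinv z w (ω * Complex.I) =
        evM S (ω * Complex.I) + evM A (ω * Complex.I) := by
      rw [← a2, hSdef, evM_sub a1 nA, sub_add_cancel]
    have e2 : evM (Δ * R n * E) (ω * Complex.I) * prodDinv z w (ω * Complex.I) =
        θ n ω • evM S (ω * Complex.I) := by
      have hg := (hΔ.det.mul hC.det).not_isPole hs
      have hkn := (hk n).not_isPole hs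
      rw [evM_mul ((hΔ.mul (hR n)).noPole hs) (h.stable_E.noPole hs), h.factor _ hs,
        Matrix.mul_assoc, Matrix.mul_assoc (evM C _),
        prodD_mul_prodDinv h.re_pos h.unit hs h2.1, Matrix.mul_one,
        ← evM_mul ((hΔ.mul (hR n)).noPole hs) (hC.noPole hs), hprod,
        evM_smul (not_isPole_mul hg hkn) (hS.noPole hs), ev_mul hg hkn]
    rw [← nsq_mul_unitary (prodDinv_unitary h.re_pos h.unit ω),
      evM_sub (h.stable_T.noPole hs) (((hΔ.mul (hR n)).mul h.stable_E).noPole hs),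
      Matrix.sub_mul, e1, e2, sub_smul, one_smul]
    congr 1
    abel
  have hSint : Integrable fun ω : ℝ => nsq (evM S (ω * Complex.I)) :=
    integrable_finsetSum _ fun i _ => integrable_finsetSum _ fun j _ =>
      (IsH2.of_stable (hS i j) (hSs i j)).integrable_norm_sq
  -- Dominating function: `|1 - θ| ≤ 2` gives `8 = 2 · 2²` for the Hardy part, and the fractions are
  -- bounded through their symmetrized energy.
  set g : ℝ → ℝ := fun ω => 8 * nsq (evM S (ω * Complex.I)) +
    2 * (1 / 2 * (nsq (antiSum z (residueD z w T) (ω * Complex.I)) +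
        nsq (antiSum z (residueD z w T) (((-ω : ℝ) : ℂ) * Complex.I)))) with hg
  have hgint : Integrable g := (hSint.const_mul 8).add (h.integrable_half_sum.const_mul 2)
  have hlim : Tendsto (fun n => ∫⁻ ω : ℝ,
      ENNReal.ofReal (nsq (evM (T - Δ * R n * E) (ω * Complex.I)))) atTop
      (𝓝 (∫⁻ ω : ℝ, ENNReal.ofReal (nsq (evM A (ω * Complex.I))))) := by
    refine tendsto_lintegral_of_dominated_convergence (fun ω => ENNReal.ofReal (g ω))
      (fun n => (measurable_nsq_evM _).ennreal_ofReal) (fun n => ?_) hgint.lintegral_lt_top.ne ?_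
    · filter_upwards [hpt] with ω h1
      refine ENNReal.ofReal_le_ofReal ?_
      rw [h1 n]
      refine (nsq_add_le _ _).trans ?_
      rw [nsq_smul]
      have h2 : ‖1 - θ n ω‖ ≤ 2 := by
        refine (norm_sub_le _ _).trans ?_
        have := hk1 n ω
        rw [norm_one]
        linarith
      have h3 : ‖1 - θ n ω‖ ^ 2 ≤ 4 := by nlinarith [norm_nonneg (1 - θ n ω)]
      have h4 := mul_le_mul_of_nonneg_right h3 (nsq_nonneg (evM S (ω * Complex.I)))
      have h5 := h.nsq_antiRat_le ω
      rw [hg]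
      simp only
      linarith
    · filter_upwards [hpt, hk2] with ω h1 h2
      refine (ENNReal.continuous_ofReal.tendsto _).comp ?_
      simp only [h1]
      refine tendsto_finsetSum _ fun i _ => tendsto_finsetSum _ fun j _ => ?_
      have h3 : Tendsto (fun n => (1 - θ n ω) * evM S (ω * Complex.I) i j +
          evM A (ω * Complex.I) i j) atTop (𝓝 (evM A (ω * Complex.I) i j)) := by
        have := ((h2.const_sub 1).mul_const (evM S (ω * Complex.I) i j)).add_const
          (evM A (ω * Complex.I) i j)
        simpa using this
      exact h3.norm.pow 2
  have hI : 0 ≤ ∫ ω : ℝ, nsq (antiSum z (residueD z w T) (ω * Complex.I)) :=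
    integral_nonneg fun ω => nsq_nonneg _
  obtain ⟨n, hn⟩ := (hlim.eventually_lt_const (h.lintegral_antiRat_le.trans_lt
    ((ENNReal.ofReal_lt_ofReal_iff (by linarith)).2 (lt_add_of_pos_right _ hδ)))).exists
  exact ⟨R n, hR n, hn.le⟩

end NoiseFactors

end

/-! ### The noise problem of the loop -/

section

variable {l m : ℕ}

lemma nsq_mul_gram {ε : ℝ} {A B G W : Matrix (Fin l) (Fin l) ℂ}
    (h : ((1 - ε : ℝ) : ℂ) • (Aᴴ * A) + (ε : ℂ) • (Bᴴ * B) = Gᴴ * G) :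
    (1 - ε) * nsq (A * W) + ε * nsq (B * W) = nsq (G * W) := by
  have hm : ∀ K : Matrix (Fin l) (Fin l) ℂ, (nsq (K * W) : ℂ) = (Wᴴ * (Kᴴ * K) * W).trace :=
    fun K => by rw [nsq_eq_trace, Matrix.conjTranspose_mul]; simp only [Matrix.mul_assoc]
  have : (((1 - ε) * nsq (A * W) + ε * nsq (B * W) : ℝ) : ℂ) = (nsq (G * W) : ℂ) := by
    rw [Complex.ofReal_add, Complex.ofReal_mul, Complex.ofReal_mul, hm, hm, hm, ← h,
      Matrix.mul_add, Matrix.add_mul, Matrix.trace_add, Matrix.mul_smul, Matrix.mul_smul,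
      Matrix.smul_mul, Matrix.smul_mul, Matrix.trace_smul, Matrix.trace_smul, smul_eq_mul,
      smul_eq_mul]
  exact_mod_cast this

lemma norm_sq_le_nsq {p q : Type*} [Fintype p] [Fintype q] (A : Matrix p q ℂ) (i : p) (j : q) :
    ‖A i j‖ ^ 2 ≤ nsq A :=
  (Finset.single_le_sum (f := fun j => ‖A i j‖ ^ 2) (fun j _ => by positivity)
    (Finset.mem_univ j)).trans (Finset.single_le_sum (f := fun i => ∑ j, ‖A i j‖ ^ 2)
      (fun i _ => by positivity) (Finset.mem_univ i))

lemma exists_nsq_bound {A : RMat (Fin l) (Fin l)} (hA : RHinf A) (hs : StrictlyProperM A) :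
    ∃ c : ℝ, 0 ≤ c ∧ ∀ ω : ℝ, nsq (evM A (ω * Complex.I)) ≤ c * (1 / (1 + |ω|)) ^ 2 := by
  choose c hc0 hc using fun i j => (hA i j).exists_bound_of_strictlyProper (hs i j)
  refine ⟨∑ i, ∑ j, c i j ^ 2, by positivity, fun ω => ?_⟩
  simp only [nsq, Finset.sum_mul]
  refine Finset.sum_le_sum fun i _ => Finset.sum_le_sum fun j _ => ?_
  have h := pow_le_pow_left₀ (norm_nonneg _) (hc i j (ω * Complex.I) (by simp)) 2
  rw [norm_axis] at h
  refine h.trans (le_of_eq ?_)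
  ring

lemma IsOuterFactor.gram_of_parts {N₀ M Nom Mm Δ : RMat (Fin l) (Fin l)} {ε : ℝ} (hε₀ : 0 ≤ ε)
    (hε₁ : ε ≤ 1) (hΔ : IsOuterFactor ε Nom Mm Δ)
    (hNom : IsMinPhasePart Nom N₀) (hMm : IsMinPhasePart Mm M) (ω : ℝ) :
    ((1 - ε : ℝ) : ℂ) • ((evM N₀ (ω * Complex.I))ᴴ * evM N₀ (ω * Complex.I)) +
      (ε : ℂ) • ((evM M (ω * Complex.I))ᴴ * evM M (ω * Complex.I)) =
      (evM Δ (ω * Complex.I))ᴴ * evM Δ (ω * Complex.I) := by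
  rw [hNom.gram, hMm.gram, hΔ.gram hε₀ hε₁ hNom.1.1 hMm.1.1]

namespace CoprimeLoop

variable {P F N N₀ M Nt Mt X Y Xt Yt H Nom Mm Δ C : RMat (Fin l) (Fin l)} {φ : RatFunc ℝ} {ε : ℝ}

/-- Without penalty on the plant input the outer factor is strictly proper. -/
lemma strictlyProper_outer (h : CoprimeLoop P F N N₀ M Nt Mt X Y Xt Yt φ)
    (hNom : IsMinPhasePart Nom N₀) (hMm : IsMinPhasePart Mm M) (hΔ : IsOuterFactor 0 Nom Mm Δ) :
    StrictlyProperM Δ := by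
  obtain ⟨c, hc0, hc⟩ := exists_nsq_bound h.stable_N₀ h.strictlyProper_N₀
  refine fun i j => (hΔ.1.1 i j).strictlyProper_of_axis_bound (c := √c) fun ω => ?_
  -- For `ε = 0` the outer factor has on the axis the same norm as `N₀`, which is strictly proper.
  have h1 := nsq_mul_gram (W := 1) (hΔ.gram_of_parts le_rfl zero_le_one hNom hMm ω)
  simp only [Matrix.mul_one, sub_zero, one_mul, zero_mul, add_zero] at h1
  have h2 := (norm_sq_le_nsq (evM Δ (ω * Complex.I)) i j).trans (h1.symm.le.trans (hc ω))
  rw [evM_apply] at h2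
  have h3 := Real.sqrt_le_sqrt h2
  rwa [Real.sqrt_sq (norm_nonneg _), Real.sqrt_mul hc0, Real.sqrt_sq (by positivity),
    mul_one_div] at h3

/-- The noise response for `R = 0` must be strictly proper to lie in the Hardy class. For `ε = 0`
this comes from `Δ`, otherwise from the strictly proper filter `H`. -/
lemma noiseFactors (h : CoprimeLoop P F N N₀ M Nt Mt X Y Xt Yt φ)
    (hH : RHinf H) (hHs : ε ≠ 0 → ∀ i j, StrictlyProper (H i j))
    {z : Fin m → ℂ} (hz : ∀ i, 0 < (z i).re)
    {w : Fin m → EuclideanSpace ℂ (Fin l)} (hw : ∀ i, ‖w i‖ = 1)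
    (hrow : ∀ i j k, i ≤ j → j ≤ k → z i = z k → z j = z i)
    (horth : ∀ i j, i ≠ j → z i = z j → star (w i : Fin l → ℂ) ⬝ᵥ (w j : Fin l → ℂ) = 0)
    (hC : MinPhase C) {γ : Fin l → ℝ}
    (hD : ∀ s : ℂ, 0 ≤ s.re →
      evM (Nt * H * constM (diagonal γ)) s = evM C s * prodD z w s)
    (hNom : IsMinPhasePart Nom N₀) (hMm : IsMinPhasePart Mm M) (hΔ : IsOuterFactor ε Nom Mm Δ) :
    NoiseFactors z w Δ (Δ * Xt * H * constM (diagonal γ)) (Nt * H * constM (diagonal γ)) C := by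
  have hV := rHinf_constM (diagonal γ)
  refine ⟨hz, hw, hrow, horth, hΔ.1, hC, ((hΔ.1.1.mul h.stable_Xt).mul hH).mul hV, ?_,
    (h.stable_Nt.mul hH).mul hV,
    (h.strictlyProper_Nt.mul_proper hH.proper).mul_proper hV.proper, hD⟩
  by_cases hε : ε = 0
  · subst hε
    exact (((h.strictlyProper_outer hNom hMm hΔ).mul_proper h.stable_Xt.proper).mul_proper
      hH.proper).mul_proper hV.proper
  · exact (StrictlyProperM.proper_mul (hHs hε) (hΔ.1.1.mul h.stable_Xt).proper).mul_proper
      hV.proper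

lemma noiseDensity_eq (h : CoprimeLoop P F N N₀ M Nt Mt X Y Xt Yt φ) (hε₀ : 0 ≤ ε) (hε₁ : ε ≤ 1)
    (hNom : IsMinPhasePart Nom N₀) (hMm : IsMinPhasePart Mm M) (hΔ : IsOuterFactor ε Nom Mm Δ)
    (hH : RHinf H) (γ : Fin l → ℝ) {R : RMat (Fin l) (Fin l)} (hR : RHinf R) (ω : ℝ) :
    noiseDensity ε γ (N₀ * (Xt - R * Nt) * H) (M * (Xt - R * Nt) * H) ω =
      nsq (evM (Δ * Xt * H * constM (diagonal γ) - Δ * R * (Nt * H * constM (diagonal γ)))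
        (ω * Complex.I)) := by
  have hs : 0 ≤ ((ω : ℂ) * Complex.I).re := by simp
  have hZ : RHinf (Xt - R * Nt) := h.stable_Xt.sub (hR.mul h.stable_Nt)
  have hZH := (hZ.mul hH).noPole hs
  have e : Δ * Xt * H * constM (diagonal γ) - Δ * R * (Nt * H * constM (diagonal γ)) =
      Δ * ((Xt - R * Nt) * H) * constM (diagonal γ) := by
    simp only [Matrix.mul_assoc, Matrix.sub_mul, Matrix.mul_sub]
  have e' : ∀ A : RMat (Fin l) (Fin l), RHinf A → evM (A * ((Xt - R * Nt) * H)) (ω * Complex.I) *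
      cdiag γ = evM A (ω * Complex.I) * (evM ((Xt - R * Nt) * H) (ω * Complex.I) * cdiag γ) :=
    fun A hA => by rw [evM_mul (hA.noPole hs) hZH, Matrix.mul_assoc]
  rw [e, evM_mul ((hΔ.1.1.noPole hs).mul hZH) (noPole_constM _), evM_constM_diagonal,
    e' _ hΔ.1.1, noiseDensity, Matrix.mul_assoc N₀, Matrix.mul_assoc M, e' _ h.stable_N₀,
    e' _ h.stable_M, nsq_mul_gram (hΔ.gram_of_parts hε₀ hε₁ hNom hMm ω)]

lemma residueD_eq (h : CoprimeLoop P F N N₀ M Nt Mt X Y Xt Yt φ) (hH : RHinf H) (hΔ : MinPhase Δ)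
    {z : Fin m → ℂ} (hz : ∀ i, 0 < (z i).re) (w : Fin m → EuclideanSpace ℂ (Fin l))
    (γ : Fin l → ℝ) :
    residueD z w (Δ * Xt * H * constM (diagonal γ)) = fun i =>
      evM Δ (z i) * evM Xt (z i) * evM H (z i) * cdiag γ *
        (Dl z w i * lineProj (w i) * Dr z w i) := by
  funext i
  have hs := (hz i).le
  have n1 := hΔ.1.noPole hs
  have n2 := h.stable_Xt.noPole hs
  have n3 := hH.noPole hs
  rw [residueD, evM_mul ((n1.mul n2).mul n3) (noPole_constM _), evM_mul (n1.mul n2) n3,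
    evM_mul n1 n2, evM_constM_diagonal]

/-- At the zeros `X̃` may be replaced by `M⁻¹`. -/
lemma noiseTerm_inv (h : CoprimeLoop P F N N₀ M Nt Mt X Y Xt Yt φ) (hH : RHinf H)
    {z : Fin m → ℂ} (hz : ∀ i, 0 < (z i).re)
    {w : Fin m → EuclideanSpace ℂ (Fin l)} (hw : ∀ i, ‖w i‖ = 1)
    (hrow : ∀ i j k, i ≤ j → j ≤ k → z i = z k → z j = z i)
    (horth : ∀ i j, i ≠ j → z i = z j → star (w i : Fin l → ℂ) ⬝ᵥ (w j : Fin l → ℂ) = 0)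
    {γ : Fin l → ℝ}
    (hD : ∀ s : ℂ, 0 ≤ s.re →
      evM (Nt * H * constM (diagonal γ)) s = evM C s * prodD z w s)
    (hM : ∀ i, (evM M (z i)).det ≠ 0) (A : Fin m → Matrix (Fin l) (Fin l) ℂ) :
    noiseTerm γ z w (fun i => A i * evM Xt (z i) * evM H (z i)) =
      noiseTerm γ z w fun i => A i * (evM M (z i))⁻¹ * evM H (z i) := by
  have hO : ∀ i, A i * evM Xt (z i) * evM H (z i) * cdiag γ *
        (Dl z w i * lineProj (w i) * Dr z w i) =
      A i * (evM M (z i))⁻¹ * evM H (z i) * cdiag γ *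
        (Dl z w i * lineProj (w i) * Dr z w i) := fun i => by
    have hs := (hz i).le
    have nX := h.stable_Xt.noPole hs
    have nY := h.stable_Y.noPole hs
    have nM := h.stable_M.noPole hs
    have nNt := h.stable_Nt.noPole hs
    have hu : IsUnit (evM M (z i)).det := isUnit_iff_ne_zero.2 (hM i)
    -- The vanishing of `D(zᵢ)` on `Dᵢˡ ωᵢ`, carried over to `Nt H V = C D`.
    have hE : evM Nt (z i) * evM H (z i) * cdiag γ * (Dl z w i * lineProj (w i) * Dr z w i) = 0 := by
      have h1 := hD _ hs
      rw [evM_mul ((h.stable_Nt.noPole hs).mul (hH.noPole hs)) (noPole_constM _),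
        evM_mul (h.stable_Nt.noPole hs) (hH.noPole hs), evM_constM_diagonal] at h1
      rw [h1]
      calc _ = evM C (z i) * (prodD z w (z i) * Dl z w i * lineProj (w i)) * Dr z w i := by
            simp only [Matrix.mul_assoc]
        _ = 0 := by
            rw [prodD_mul_Dl hz hw hrow horth, Matrix.mul_zero, Matrix.zero_mul]
    -- From `M Xt = I + Y Nt`; the second summand is annihilated by `hE`.
    have e1 : evM Xt (z i) = (evM M (z i))⁻¹ + (evM M (z i))⁻¹ * evM Y (z i) * evM Nt (z i) := by
      have hb := congrArg (fun B => evM B (z i)) h.bezout_left.1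
      rw [evM_sub (nM.mul nX) (nY.mul nNt), evM_mul nM nX, evM_mul nY nNt, evM_one,
        sub_eq_iff_eq_add] at hb
      rw [Matrix.mul_assoc, ← Matrix.mul_one (evM M (z i))⁻¹, Matrix.mul_assoc, Matrix.one_mul,
        ← Matrix.mul_add, ← hb, Matrix.nonsing_inv_mul_cancel_left _ _ hu]
    rw [e1, Matrix.mul_add, Matrix.add_mul, Matrix.add_mul, Matrix.add_mul, add_eq_left]
    calc _ = A i * ((evM M (z i))⁻¹ * evM Y (z i)) * (evM Nt (z i) * evM H (z i) * cdiag γ *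
          (Dl z w i * lineProj (w i) * Dr z w i)) := by simp only [Matrix.mul_assoc]
      _ = 0 := by rw [hE, Matrix.mul_zero]
  -- The double sum depends on `O` only through the coefficients of the fractions, whose energy it
  -- is; so equality of these coefficients suffices.
  have hπ : (2 * Real.pi : ℂ) ≠ 0 := by
    exact_mod_cast (by positivity : (2 * Real.pi : ℝ) ≠ 0)
  refine mul_left_cancel₀ hπ ?_
  rw [← noiseTerm_eq hz, ← noiseTerm_eq hz]
  simp only [hO]

end CoprimeLoop

end

/-! ### The infimum of the total cost -/

section

variable {l m : ℕ}

lemma strictlyProper_inv_X_pow {n : ℕ} (hn : 1 ≤ n) :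
    StrictlyProper (((RatFunc.X : RatFunc ℝ) ^ n)⁻¹) := by
  refine strictlyProper_iff.2 (Or.inr ?_)
  rw [RatFunc.intDegree_inv, ← RatFunc.algebraMap_X, ← map_pow, RatFunc.intDegree_polynomial,
    Polynomial.natDegree_X_pow]
  omega

lemma inv_of_integrators {P P₀ : RMat (Fin l) (Fin l)} {n : ℕ}
    (hP : P = ((RatFunc.X : RatFunc ℝ) ^ n)⁻¹ • P₀) (hPinv : IsUnit P.det) :
    P⁻¹ = (RatFunc.X ^ n : RatFunc ℝ) • P₀⁻¹ := by
  have hX : (RatFunc.X ^ n : RatFunc ℝ) ≠ 0 := pow_ne_zero _ RatFunc.X_ne_zero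
  have hdet : IsUnit P₀.det := by
    rw [hP, Matrix.det_smul] at hPinv
    exact isUnit_of_mul_isUnit_right hPinv
  refine Matrix.inv_eq_left_inv ?_
  rw [hP, Matrix.smul_mul, Matrix.mul_smul, smul_smul, mul_inv_cancel₀ hX, one_smul,
    Matrix.nonsing_inv_mul _ hdet]

namespace CoprimeLoop

variable {P F N N₀ M Nt Mt X Y Xt Yt H : RMat (Fin l) (Fin l)} {φ : RatFunc ℝ} {ε : ℝ}
  {Ω : Type*} [MeasurableSpace Ω] {μ : Measure Ω}

/-- The infimum of the cost from the infima of the tracking and the noise part. -/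
lemma isGLB_costSet (h : CoprimeLoop P F N N₀ M Nt Mt X Y Xt Yt φ) (hε₀ : 0 ≤ ε) (hε₁ : ε ≤ 1)
    {σ γ : Fin l → ℝ} {Wr Wn : Noise l μ} (hWr : IsWhiteNoise σ Wr) (hWn : IsWhiteNoise γ Wn)
    (hunc : Uncorrelated Wr Wn) (hH : RHinf H) (hHs : ε ≠ 0 → ∀ i j, StrictlyProper (H i j))
    {a b : ℝ} (hb : 0 ≤ b)
    (hlow₁ : ∀ Q, RHinf Q → ENNReal.ofReal (2 * Real.pi * a) ≤
      ∫⁻ ω, ENNReal.ofReal (trackDensity ε σ (N * Q) (F * M * Q) ω))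
    (hlow₂ : ∀ R, RHinf R → ENNReal.ofReal (2 * Real.pi * b) ≤ ∫⁻ ω, ENNReal.ofReal
      (noiseDensity ε γ (N₀ * (Xt - R * Nt) * H) (M * (Xt - R * Nt) * H) ω))
    (hup₁ : ∀ δ > 0, 0 ≤ 2 * Real.pi * a + δ ∧ ∃ Q, RHinf Q ∧
      (ε ≠ 1 → evM N 0 * evM Q 0 = 1) ∧
      ∫⁻ ω, ENNReal.ofReal (trackDensity ε σ (N * Q) (F * M * Q) ω) ≤
        ENNReal.ofReal (2 * Real.pi * a + δ))
    (hup₂ : ∀ δ > 0, ∃ R, RHinf R ∧ ∫⁻ ω, ENNReal.ofReal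
      (noiseDensity ε γ (N₀ * (Xt - R * Nt) * H) (M * (Xt - R * Nt) * H) ω) ≤
        ENNReal.ofReal (2 * Real.pi * b + δ)) :
    IsGLB (costSet ε Wr Wn P F H) (a + b) := by
  have hπ : 0 < 2 * Real.pi := by positivity
  constructor
  · rintro J ⟨K₁, K₂, hst, hJ⟩
    obtain ⟨Q, R, hQ, hR, hZ, hK1, hK2⟩ := (h.stabilizes_iff K₁ K₂).1 hst
    obtain ⟨e1, e2, e3, e4⟩ := h.closedLoop H hZ hK1 hK2
    have hNQ := h.stable_N.mul hQ
    obtain ⟨hJ0, hle⟩ := hJ.freqCost_le hε₀ hε₁ hWr hWn hunc (by rwa [e1])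
    rw [e1, e2, e3, e4, freqCost_eq hε₀ hε₁ σ γ hNQ ((h.stable_F.mul h.stable_M).mul hQ)] at hle
    have h1 := (add_le_add (hlow₁ Q hQ) (hlow₂ R hR)).trans hle
    have h2 := ENNReal.ofReal_add_le.trans h1
    rw [ENNReal.ofReal_le_ofReal_iff (by positivity), ← mul_add] at h2
    exact le_of_mul_le_mul_left h2 hπ
  · intro c hc
    refine le_of_forall_pos_le_add fun δ hδ => ?_
    -- An allowance of `π δ` in each of the two problems adds up to `2 π δ`, which is `δ` in the
    -- cost.
    have hδ' : 0 < Real.pi * δ := by positivity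
    obtain ⟨ha, Q, hQ, hQ0, hQle⟩ := hup₁ _ hδ'
    obtain ⟨R, hR, hRle⟩ := hup₂ _ hδ'
    have hZ := h.isUnit_det hR
    have hZs : RHinf (Xt - R * Nt) := h.stable_Xt.sub (hR.mul h.stable_Nt)
    obtain ⟨e1, e2, e3, e4⟩ := h.closedLoop H hZ (Q := Q) rfl rfl
    have hNQ := h.stable_N.mul hQ
    have hFMQ := (h.stable_F.mul h.stable_M).mul hQ
    have hle : freqCost ε σ γ (N * Q) (N₀ * (Xt - R * Nt) * H) (F * M * Q)
        (M * (Xt - R * Nt) * H) ≤ ENNReal.ofReal (2 * Real.pi * (a + b + δ)) := by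
      rw [freqCost_eq hε₀ hε₁ σ γ hNQ hFMQ]
      refine (add_le_add hQle hRle).trans (le_of_eq ?_)
      rw [← ENNReal.ofReal_add ha (by positivity)]
      congr 1
      ring
    obtain ⟨J, hJ, hJle⟩ := exists_hasCost hε₀ hε₁ hWr hWn hunc e1 e2 e3 e4 hNQ
      ((h.stable_N₀.mul hZs).mul hH) hFMQ ((h.stable_M.mul hZs).mul hH)
      ((h.strictlyProper_N₀.mul_proper hZs.proper).mul_proper hH.proper)
      (fun hε => StrictlyProperM.proper_mul (hHs hε) (h.stable_M.mul hZs).proper)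
      (fun hε => by
        rw [evM_mul (h.stable_N.noPole (by simp)) (hQ.noPole (by simp)), hQ0 hε])
      (fun _ => by
        rw [evM_mul ((h.stable_F.mul h.stable_M).noPole (by simp)) (hQ.noPole (by simp)),
          evM_mul (h.stable_F.noPole (by simp)) (h.stable_M.noPole (by simp)), h.M_zero,
          Matrix.mul_zero, Matrix.zero_mul])
      (ne_top_of_le_ne_top ENNReal.ofReal_ne_top hle)
    have hcJ := hc ⟨_, _, (h.stabilizes_iff _ _).2 ⟨Q, R, hQ, hR, hZ, rfl, rfl⟩, hJ⟩
    have h1 := hJle.trans hle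
    -- `ENNReal.ofReal` cuts off negative numbers and the sign of `a` is not known beforehand; the
    -- bound `ha` excludes this.
    have h2 : 0 ≤ 2 * Real.pi * (a + b + δ) := by
      have : 0 ≤ 2 * Real.pi * b := by positivity
      nlinarith
    rw [ENNReal.ofReal_le_ofReal_iff h2] at h1
    exact hcJ.trans (le_of_mul_le_mul_left h1 hπ)

end CoprimeLoop

end

end Tracking

end

/-! ### Assembly of the tracking and noise infima -/

theorem theorem1 {l m Ns : ℕ} {Ω : Type*} [MeasurableSpace Ω]
    (μ : Measure Ω) [IsProbabilityMeasure μ]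
    -- weight, noise intensities, and the two noises
    (ε : ℝ) (hε₀ : 0 ≤ ε) (hε₁ : ε ≤ 1) (σ γ : Fin l → ℝ)
    (Wr Wn : Noise l μ) (hWr : IsWhiteNoise σ Wr) (hWn : IsWhiteNoise γ Wn)
    (hunc : Uncorrelated Wr Wn)
    -- plant `P = P₀ / sⁿ`
    (P P₀ : RMat (Fin l) (Fin l)) (n : ℕ) (hn : 1 ≤ n)
    (hP : P = ((RatFunc.X : RatFunc ℝ) ^ n)⁻¹ • P₀) (hP₀ : ∀ i j, Proper (P₀ i j))
    (hPinv : IsUnit P.det) (hzero : ¬ IsZeroOf P₀ 0)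
    -- channel filters `F = φ I` and `H`
    (φ : RatFunc ℝ) (F H : RMat (Fin l) (Fin l)) (hF : F = diagonal fun _ => φ)
    (hFs : RHinf F) (hH : RHinf H) (hHsp : ε ≠ 0 → ∀ i j, StrictlyProper (H i j))
    -- coprime factorizations `P F = N M⁻¹ = M̃⁻¹ Ñ`, `P = N₀ M⁻¹` and double Bezout identity
    (N N₀ M Nt Mt X Y Xt Yt : RMat (Fin l) (Fin l))
    (hN : RHinf N) (hN₀ : RHinf N₀) (hM : RHinf M) (hNt : RHinf Nt) (hMt : RHinf Mt)
    (hX : RHinf X) (hY : RHinf Y) (hXt : RHinf Xt) (hYt : RHinf Yt)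
    (hMdet : IsUnit M.det) (hMtdet : IsUnit Mt.det)
    (hPFr : P * F = N * M⁻¹) (hPFl : P * F = Mt⁻¹ * Nt) (hPr : P = N₀ * M⁻¹)
    (hBezout : fromBlocks Xt (-Yt) (-Nt) Mt * fromBlocks M Y N X = 1)
    -- nonminimum phase zeros of `P F`: those of `P` once, those of `φ` `l` times in a row
    (z : Fin m → ℂ) (hz : ∀ i, 0 < (z i).re)
    (hzP : ∀ i j, i ≠ j → z i = z j → ev φ (z i) = 0)
    (hzF : ∀ s : ℂ, 0 < s.re → ev φ s = 0 →
      ((φ.num.map (algebraMap ℝ ℂ)).rootMultiplicity s = 1 ∧ ¬ IsZeroOf P s))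
    (hzrow : ∀ i j k, i ≤ j → j ≤ k → z i = z k → z j = z i)
    -- allpass factorization `N = L N_m`
    (η : Fin m → EuclideanSpace ℂ (Fin l)) (hη : ∀ i, ‖η i‖ = 1)
    (Nm : RMat (Fin l) (Fin l)) (hNm : MinPhase Nm)
    (hL : ∀ s : ℂ, 0 ≤ s.re → evM N s = prodL z η s * evM Nm s)
    -- allpass factorization `Ñ H V = C D`
    (w : Fin m → EuclideanSpace ℂ (Fin l)) (hw : ∀ i, ‖w i‖ = 1)
    (C : RMat (Fin l) (Fin l)) (hC : MinPhase C)
    (hD : ∀ s : ℂ, 0 ≤ s.re →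
      evM (Nt * H * constM (diagonal γ)) s = evM C s * prodD z w s)
    -- outer factors
    (CFM Θo Nom Mm Δo : RMat (Fin l) (Fin l))
    (hCFM : IsMinPhasePart CFM (F * M)) (hΘ : IsOuterFactor ε Nm CFM Θo)
    (hNom : IsMinPhasePart Nom N₀) (hMm : IsMinPhasePart Mm M)
    (hΔ : IsOuterFactor ε Nom Mm Δo)
    -- `f = (∏ₖ s̄ₖ (sₖ - s) / (sₖ (s̄ₖ + s))) f_m`, with `f_m` minimum phase
    (sz : Fin Ns → ℂ) (hsz : ∀ k, 0 < (sz k).re) (fm : RatFunc ℝ)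
    (hfm : ε < 1 → (∀ s : ℂ, 0 < s.re → ev fm s ≠ 0) ∧
      ∀ s : ℂ, 0 ≤ s.re → ev (fFun ε σ Nm Θo) s =
        (∏ k, star (sz k) * (sz k - s) / (sz k * (star (sz k) + s))) * ev fm s) :
    -- the stabilizing controllers
    (∀ K₁ K₂, Stabilizes (P * F) K₁ K₂ ↔ IsYoula Xt Yt Nt Mt K₁ K₂) ∧
    -- the function `f`
    (ε < 1 → Stable (fFun ε σ Nm Θo) ∧ Stable fm ∧
      ev (fFun ε σ Nm Θo) 0 = ∑ i, (σ i : ℂ) ^ 2 ∧ ev fm 0 = ∑ i, (σ i : ℂ) ^ 2 ∧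
      IntegrableOn (logIntegrand (fFun ε σ Nm Θo)) (Set.Ioi 0)) ∧
    -- the minimal cost
    (∃ Jstar : ℝ, IsGLB (costSet ε Wr Wn P F H) Jstar ∧
      (Jstar : ℂ) =
        ((2 * (1 - ε) * (zeroTerm σ z η + (∑ i, σ i ^ 2) * logTerm (fFun ε σ Nm Θo) sz) : ℝ) : ℂ)
        + noiseTerm γ z w fun i => evM Δo (z i) * evM Xt (z i) * evM H (z i)) ∧
    -- `O(zᵢ)` through `M⁻¹(zᵢ)`
    ((∀ i, (evM M (z i)).det ≠ 0) →
      noiseTerm γ z w (fun i => evM Δo (z i) * evM Xt (z i) * evM H (z i)) =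
      noiseTerm γ z w fun i => evM Δo (z i) * (evM M (z i))⁻¹ * evM H (z i)) := by
  have h : CoprimeLoop P F N N₀ M Nt Mt X Y Xt Yt φ :=
    ⟨hF, hFs, hPinv, fun i j => by
      rw [hP]
      exact (strictlyProper_inv_X_pow hn).mul_proper (hP₀ i j),
      ⟨n, P₀⁻¹, hn, fun i j hp => hzero ⟨i, j, hp⟩, inv_of_integrators hP hPinv⟩,
      hN, hN₀, hM, hNt, hMt, hX, hY, hXt, hYt, hMdet, hMtdet, hPFr, hPFl, hPr, hBezout⟩
  have horth := h.orthogonal hz hzP hzF hzrow hη hNm hL hw hH hC hD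
  have hnoise := h.noiseFactors hH hHsp hz hw hzrow horth hC hD hNom hMm hΔ
  have hf : ε < 1 → ∃ Ψ, TrackingFactors ε z η N (F * M) Nm Θo Ψ ∧
      RatFunc.C (1 - ε) • Nm = Ψ * Θo := fun hε =>
    h.exists_trackingFactors hε₀ hε hz hη hNm hL hCFM hΘ
  refine ⟨h.stabilizes_iff, fun hε => ?_, ?_, fun hMz =>
    h.noiseTerm_inv hH hz hw hzrow horth hD hMz _⟩
  · obtain ⟨Ψ, hΨ, hfac⟩ := hf hε
    obtain ⟨hnz, hfm⟩ := hfm hε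
    have hs := hΨ.stable_fFun hfac σ
    have h0 := hΨ.ev_fFun_zero hfac σ
    have h0' : ((∑ i, σ i ^ 2 : ℝ) : ℂ) = ∑ i, (σ i : ℂ) ^ 2 := by push_cast; rfl
    refine ⟨hs, stable_minPhase_factor hs hsz hnz hfm, h0.trans h0',
      ((ev_minPhase_factor_zero hsz hfm).trans h0).trans h0', ?_⟩
    exact (tendsto_slope_logTerm hs hsz hnz hfm (hΨ.sum_sq_ne_zero hfac hsz hnz hfm) h0).1
  · set I : ℝ := ∫ ω : ℝ, nsq (antiSum z (residueD z w (Δo * Xt * H * constM (diagonal γ)))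
      (ω * Complex.I)) with hI
    have hI0 : 0 ≤ I := integral_nonneg fun ω => nsq_nonneg _
    have hπ : (2 * Real.pi : ℝ) ≠ 0 := by positivity
    have hterm : ((I / (2 * Real.pi) : ℝ) : ℂ) = noiseTerm γ z w fun i =>
        evM Δo (z i) * evM Xt (z i) * evM H (z i) := by
      have h1 := noiseTerm_eq (γ := γ) hz w fun i => evM Δo (z i) * evM Xt (z i) * evM H (z i)
      rw [← h.residueD_eq hH hΔ.1 hz w γ, ← hI] at h1
      rw [Complex.ofReal_div, h1]
      push_cast
      rw [mul_div_cancel_left₀ _ (by exact_mod_cast hπ)]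
    refine ⟨2 * (1 - ε) * (zeroTerm σ z η + (∑ i, σ i ^ 2) * logTerm (fFun ε σ Nm Θo) sz) +
      I / (2 * Real.pi), ?_, by rw [Complex.ofReal_add, hterm]⟩
    have hmul : 2 * Real.pi * (I / (2 * Real.pi)) = I := mul_div_cancel₀ _ hπ
    have hdens := fun R (hR : RHinf R) ω => h.noiseDensity_eq hε₀ hε₁ hNom hMm hΔ hH γ hR ω
    have key : (∀ Q, RHinf Q → ENNReal.ofReal (2 * Real.pi * (2 * (1 - ε) * (zeroTerm σ z η +
          (∑ i, σ i ^ 2) * logTerm (fFun ε σ Nm Θo) sz))) ≤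
          ∫⁻ ω, ENNReal.ofReal (trackDensity ε σ (N * Q) (F * M * Q) ω)) ∧
        ∀ δ > 0, 0 ≤ 2 * Real.pi * (2 * (1 - ε) * (zeroTerm σ z η +
          (∑ i, σ i ^ 2) * logTerm (fFun ε σ Nm Θo) sz)) + δ ∧ ∃ Q, RHinf Q ∧
          (ε ≠ 1 → evM N 0 * evM Q 0 = 1) ∧
          ∫⁻ ω, ENNReal.ofReal (trackDensity ε σ (N * Q) (F * M * Q) ω) ≤
            ENNReal.ofReal (2 * Real.pi * (2 * (1 - ε) * (zeroTerm σ z η +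
              (∑ i, σ i ^ 2) * logTerm (fFun ε σ Nm Θo) sz)) + δ) := by
      rcases hε₁.lt_or_eq with hε | rfl
      · obtain ⟨Ψ, hΨ, hfac⟩ := hf hε
        obtain ⟨hnz, hfm⟩ := hfm hε
        have hd := hΨ.tendsto_slope hfac (tendsto_slope_logTerm (hΨ.stable_fFun hfac σ) hsz hnz hfm
          (hΨ.sum_sq_ne_zero hfac hsz hnz hfm) (hΨ.ev_fFun_zero hfac σ)).2
        -- The derivative of `f` at the origin is `d = -2 (∑ σᵢ²) logTerm`, which explains the sign
        -- in `2 zeroTerm - d`.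
        have e : 2 * (1 - ε) * (zeroTerm σ z η + (∑ i, σ i ^ 2) * logTerm (fFun ε σ Nm Θo) sz) =
            (1 - ε) * (2 * zeroTerm σ z η -
              -2 * ((∑ i, σ i ^ 2) * logTerm (fFun ε σ Nm Θo) sz)) := by ring
        rw [e]
        refine ⟨fun Q hQ => hΨ.le_lintegral σ hQ hd, fun δ hδ => ?_⟩
        obtain ⟨h1, Q, hQ, hQ0, hle⟩ := hΨ.exists_lintegral_le σ hd hδ
        exact ⟨h1, Q, hQ, fun _ => hQ0, hle⟩
      -- For `ε = 1` the error is not penalized; `Q = 0` has no tracking cost, and no condition at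
      -- the origin is imposed.
      · simp only [sub_self, mul_zero, zero_mul, ENNReal.ofReal_zero, zero_le, implies_true,
          true_and, zero_add]
        refine fun δ hδ => ⟨hδ.le, 0, rHinf_zero, fun h1 => absurd rfl h1, ?_⟩
        simp [trackDensity, nsq]
    refine h.isGLB_costSet hε₀ hε₁ hWr hWn hunc hH hHsp (by positivity) key.1 (fun R hR => ?_)
      key.2 fun δ hδ => ?_
    · rw [hmul]
      simp only [hdens R hR]
      exact hnoise.le_lintegral hR
    · obtain ⟨R, hR, hle⟩ := hnoise.exists_lintegral_le hδ
      refine ⟨R, hR, ?_⟩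
      rw [hmul]
      simp only [hdens R hR]
      exact hle
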